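/- **Proposition.** For non-zero integers $k_1,\dots,k_u$ let $P(k_1,\dots,k_u)$ be the pretzel link diagram with $u$ columns, the $j$-th column being a pair of vertical strands with $|k_j|$ half-twists (right-handed if $k_j>0$, left-handed if $k_j<0$), where the right upper (lower) end of each column is joined to the left upper (lower) end of the cyclically following column by a top (bottom) bridge. Let $n\ge 1$, $u=2n$, let $p_1,\dots,p_u$ be integers and $k_j=2p_j+1$; then the diagram represents a $2$-component link. It can be oriented so that in every column the two strands are antiparallel ($\varepsilon=\rightleftarrows$), and also so that in every column they are parallel ($\varepsilon=\,\parallel$); in both cases the orientation is fixed by letting the first top bridge run from the first to the second column. Denote the oriented diagram by $P(k_1\varepsilon,\dots,k_u\varepsilon)$. Let $\nabla_L(z)=\sum_i a_i(L)z^i\in\mathbb Z[z]$ be the Conway polynomial of an oriented link $L$, i.e. the invariant of oriented links determined by $\nabla=1$ for the unknot and $\nabla_{L_+}-\nabla_{L_-}=z\nabla_{L_0}$. Let $L$ be an oriented link with diagram $P(k_1\varepsilon,\dots,k_u\varepsilon)$. (1) If $\varepsilon=\rightleftarrows$, then $a_1(L)=-n-\sum_{j=1}^u p_j$ and $$a_3(L)=-\Bigl(\tfrac{n(n^2-1)}6+\tfrac{n(n-1)}2\sum_{i=1}^u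 p_i+(n-1)\sum_{1\le i<j\le u}p_ip_j+\sum_{1\le i<j<k\le u}p_ip_jp_k\Bigr)$$ $$=\tfrac12a_1(L)\,n(n-1)+\tfrac16n(n-1)(2n-1)-(n-1)\sum_{1\le i<j\le u}p_ip_j-\sum_{1\le i<j<k\le u}p_ip_jp_k .$$ (2) If $\varepsilon=\,\parallel$, then $a_1(L)=n+\sum_{j=1}^u p_j$ and $$a_3(L)=\tfrac12a_1(L)\sum_{j=1}^u p_j(p_j+1)-\tfrac16\sum_{j=1}^u p_j(p_j+1)(2p_j+1).$$ -/

import Mathlib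

open Polynomial

/-! ### Oriented link diagrams -/

/-- A signed Gauss diagram of an oriented link diagram.  `Pt` is a finite set of marked points on the
curves, `next` sends a marked point to the following one along the orientation (so the cycles of `next`
are the components, and the edges of the diagram are the pairs `x → next x`).  A point `x` with
`mate x ≠ x` is a passage through a crossing, `mate x` being the other passage through that crossing;
a point with `mate x = x` is an ordinary point of the curve that carries no crossing (the values of
`isOver` and `isPos` are irrelevant there).  `isOver x` says that `x` is the over-passage, `isPos x` that the
crossing is positive. -/
structure GaussDiagram where
  Pt : Type
  finite : Finite Pt
  next : Equiv.Perm Pt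
  mate : Pt → Pt
  mate_mate : ∀ x, mate (mate x) = x
  isOver : Pt → Bool
  isOver_mate : ∀ x, mate x ≠ x → isOver (mate x) = !isOver x
  isPos : Pt → Bool
  isPos_mate : ∀ x, isPos (mate x) = isPos x

namespace GaussDiagram

/-- `x` is a passage through a crossing. -/
def IsCrossing (D : GaussDiagram) (x : D.Pt) : Prop := D.mate x ≠ x

/-- At the crossing of `x`, the other strand crosses the strand of `x` from its right to its left.
(At a positive crossing the under-strand passes from the right to the left of the over-strand.) -/
def crossedToLeft (D : GaussDiagram) (x : D.Pt) : Bool := D.isOver x == D.isPos x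

open Classical in
/-- A side of an edge is a pair `(x, b)`: the edge `x → next x`, traversed forwards if `b = true` and
backwards if `b = false`; the side in question is the one on the left of the traveller.
`face` walks to the end of the edge and takes the sharpest left turn there,
so that its cycles are the boundary walks of the regions of the diagram. -/
noncomputable def face (D : GaussDiagram) : D.Pt × Bool → D.Pt × Bool
  | (x, true) =>
      let y := D.next x
      if D.mate y = y then (y, true)
      else if D.crossedToLeft y then (D.mate y, true)
      else (D.next.symm (D.mate y), false)
  | (x, false) =>
      if D.mate x = x then (D.next.symm x, false)
      else if D.crossedToLeft x then (D.next.symm (D.mate x), false)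
      else (D.mate x, true)

/-- The Gauss diagram is drawn on spheres: gluing a disc along every boundary walk gives a closed oriented
surface with vanishing first homology.  That is, every integral 1-cycle `f` (an integer on each edge,
with inflow equal to outflow at each vertex) is the boundary of a 2-chain `h`
(an integer on each region): `f` is the value on the left minus the value on the right. -/
def IsPlanar (D : GaussDiagram) : Prop :=
  ∀ f : D.Pt → ℤ,
    (∀ x, f x + f (D.mate x) = f (D.next.symm x) + f (D.next.symm (D.mate x))) →
    ∃ h : D.Pt × Bool → ℤ, (∀ d, h (D.face d) = h d) ∧ ∀ x, f x = h (x, true) - h (x, false)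

/-- `y` is one of the two passages of the crossing of `x`. -/
def SameCrossing (D : GaussDiagram) (x y : D.Pt) : Prop := y = x ∨ y = D.mate x

theorem sameCrossing_mate (D : GaussDiagram) (x y : D.Pt) :
    D.SameCrossing x (D.mate y) ↔ D.SameCrossing x y := by
  unfold SameCrossing
  constructor
  · rintro (h | h)
    · right; rw [← h, D.mate_mate]
    · left; rw [← D.mate_mate y, h, D.mate_mate]
  · rintro (h | h)
    · right; rw [h]
    · left; rw [h, D.mate_mate]

open Classical in
/-- Forget the crossing of `x`: its two passages become ordinary points, the curves are unchanged. -/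
noncomputable def erase (D : GaussDiagram) (x : D.Pt) : GaussDiagram where
  Pt := D.Pt
  finite := D.finite
  next := D.next
  mate y := if D.SameCrossing x y then y else D.mate y
  mate_mate y := by
    by_cases h : D.SameCrossing x y
    · simp [h]
    · simp [h, sameCrossing_mate, D.mate_mate]
  isOver := D.isOver
  isOver_mate y hy := by
    by_cases h : D.SameCrossing x y
    · simp [h] at hy
    · simp only [h, if_false] at hy ⊢
      exact D.isOver_mate y hy
  isPos := D.isPos
  isPos_mate y := by
    by_cases h : D.SameCrossing x y
    · simp [h]
    · simp [h, D.isPos_mate]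

open Classical in
/-- The crossing change at `x`. -/
noncomputable def switch (D : GaussDiagram) (x : D.Pt) : GaussDiagram where
  Pt := D.Pt
  finite := D.finite
  next := D.next
  mate := D.mate
  mate_mate := D.mate_mate
  isOver y := if D.SameCrossing x y then !D.isOver y else D.isOver y
  isOver_mate y hy := by
    by_cases h : D.SameCrossing x y <;> simp [h, sameCrossing_mate, D.isOver_mate y hy]
  isPos y := if D.SameCrossing x y then !D.isPos y else D.isPos y
  isPos_mate y := by
    by_cases h : D.SameCrossing x y <;> simp [h, sameCrossing_mate, D.isPos_mate]

open Classical in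
/-- The orientation-preserving smoothing of the crossing of `x`: each of the two strands that arrive at
the crossing leaves along the outgoing edge of the other one. -/
noncomputable def smooth (D : GaussDiagram) (x : D.Pt) : GaussDiagram :=
  { D.erase x with next := (D.next * Equiv.swap x (D.mate x) : Equiv.Perm D.Pt) }

open Classical in
/-- Mark one more ordinary point on the edge `a → next a`. -/
noncomputable def subdivide (D : GaussDiagram) (a : D.Pt) : GaussDiagram where
  Pt := Option D.Pt
  finite := by
    have := D.finite
    infer_instance
  next := Equiv.optionCongr D.next * Equiv.swap (some a) none
  mate := Option.map D.mate
  mate_mate y := by cases y <;> simp [D.mate_mate]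
  isOver y := y.elim true D.isOver
  isOver_mate y hy := by
    cases y with
    | none => simp at hy
    | some y => simpa using D.isOver_mate y (by simpa using hy)
  isPos y := y.elim true D.isPos
  isPos_mate y := by cases y <;> simp [D.isPos_mate]

open Classical in
/-- Exchange the two ends of each of the edges `x → next x`, `y → next y`, `z → next z` along the curves:
the order `p, x, next x, q` of marked points becomes `p, next x, x, q`, and similarly for `y`, `z`. -/
noncomputable def exchange (D : GaussDiagram) (x y z : D.Pt) : GaussDiagram :=
  let π : Equiv.Perm D.Pt :=
    Equiv.swap x (D.next x) * Equiv.swap y (D.next y) * Equiv.swap z (D.next z)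
  { D with next := π * D.next * π⁻¹ }

/-- The elementary changes of diagrams: relabelling, subdivision of an edge, Reidemeister moves. -/
inductive Move : GaussDiagram → GaussDiagram → Prop
  /-- relabelling of the marked points -/
  | iso (D D' : GaussDiagram) (e : D.Pt ≃ D'.Pt)
      (hnext : ∀ x, D'.next (e x) = e (D.next x))
      (hmate : ∀ x, D'.mate (e x) = e (D.mate x))
      (hover : ∀ x, D.IsCrossing x → D'.isOver (e x) = D.isOver x)
      (hpos : ∀ x, D.IsCrossing x → D'.isPos (e x) = D.isPos x) : Move D D'
  /-- one more ordinary point on an edge -/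
  | sub (D : GaussDiagram) (a : D.Pt) : Move D (D.subdivide a)
  /-- Reidemeister I: a curl is removed -/
  | reidI (D : GaussDiagram) (x : D.Pt) (hx : D.IsCrossing x) (h : D.next x = D.mate x) :
      Move D (D.erase x)
  /-- Reidemeister II: a bigon formed by an over-strand and an under-strand (parallel or antiparallel)
  is removed; that the signs are opposite means that the two strands bound a bigon -/
  | reidII (D : GaussDiagram) (x y : D.Pt) (hx : D.IsCrossing x) (hy : D.IsCrossing y)
      (hox : D.isOver x = true) (hoy : D.isOver y = true) (hpos : D.isPos x ≠ D.isPos y)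
      (hxy : D.next x = y)
      (hm : D.next (D.mate x) = D.mate y ∨ D.next (D.mate y) = D.mate x) :
      Move D ((D.erase x).erase y)
  /-- Reidemeister III: `x → next x`, `y → next y`, `z → next z` are the sides of a triangular region,
  lying on the top, the middle and the bottom strand respectively -/
  | reidIII (D : GaussDiagram) (x y z : D.Pt)
      (hnd : [x, D.next x, y, D.next y, z, D.next z].Nodup)
      (hcr : ∀ w ∈ [x, D.next x, y, D.next y, z, D.next z], D.IsCrossing w)
      (htop : D.isOver x = true ∧ D.isOver (D.next x) = true)
      (hbot : D.isOver z = false ∧ D.isOver (D.next z) = false)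
      (hface : ∃ a b c : Bool,
        (D.face (x, a) = (y, b) ∧ D.face (y, b) = (z, c) ∧ D.face (z, c) = (x, a)) ∨
        (D.face (x, a) = (z, c) ∧ D.face (z, c) = (y, b) ∧ D.face (y, b) = (x, a))) :
      Move D (D.exchange x y z)

/-- An elementary change between two planar diagrams. -/
def PlanarMove (D D' : GaussDiagram) : Prop := D.IsPlanar ∧ D'.IsPlanar ∧ Move D D'

/-- Equivalence of oriented links, in terms of their diagrams. -/
def LinkEquiv : GaussDiagram → GaussDiagram → Prop := Relation.EqvGen PlanarMove

/-- A closed curve without crossings. -/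
def IsCrossinglessCircle (D : GaussDiagram) : Prop :=
  Nonempty D.Pt ∧ (∀ x, D.mate x = x) ∧ ∀ x y, D.next.SameCycle x y

/-- `HasConwayPolynomial D q`: the polynomial `q` (in the variable `z = X`) is the Conway polynomial of the
oriented link with the planar diagram `D`, i.e. this follows from the invariance of the Conway polynomial
under equivalence of links, its value `1` on the unknot, and the relation
`∇(D₊) - ∇(D₋) = z ∇(D₀)`, in which any one of the three polynomials is determined by the other two.
Here `D` has a positive crossing at `x`, `D.switch x` is the result of the crossing change
and `D.smooth x` the smoothing. -/
inductive HasConwayPolynomial : GaussDiagram → ℤ[X] → Prop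
  | unknot (D : GaussDiagram) (h : D.IsCrossinglessCircle) : HasConwayPolynomial D 1
  | equiv (D D' : GaussDiagram) (h : LinkEquiv D D') (q : ℤ[X]) (hq : HasConwayPolynomial D q) :
      HasConwayPolynomial D' q
  | skeinPos (D : GaussDiagram) (hD : D.IsPlanar) (x : D.Pt) (hx : D.IsCrossing x)
      (hpos : D.isPos x = true) (qp qm qz : ℤ[X]) (hq : qp - qm = X * qz)
      (hm : HasConwayPolynomial (D.switch x) qm) (hz : HasConwayPolynomial (D.smooth x) qz) :
      HasConwayPolynomial D qp
  | skeinNeg (D : GaussDiagram) (hD : D.IsPlanar) (x : D.Pt) (hx : D.IsCrossing x)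
      (hpos : D.isPos x = true) (qp qm qz : ℤ[X]) (hq : qp - qm = X * qz)
      (hp : HasConwayPolynomial D qp) (hz : HasConwayPolynomial (D.smooth x) qz) :
      HasConwayPolynomial (D.switch x) qm
  | skeinZero (D : GaussDiagram) (hD : D.IsPlanar) (x : D.Pt) (hx : D.IsCrossing x)
      (hpos : D.isPos x = true) (qp qm qz : ℤ[X]) (hq : qp - qm = X * qz)
      (hp : HasConwayPolynomial D qp) (hm : HasConwayPolynomial (D.switch x) qm) :
      HasConwayPolynomial (D.smooth x) qz

end GaussDiagram

/-! ### Pretzel diagrams -/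

namespace Pretzel

/-- The four corners of a crossing between two strands of a vertical twist. -/
inductive Corner
  | nw | ne | sw | se

namespace Corner

/-- the other end of the strand through the crossing -/
def opp : Corner → Corner
  | nw => se
  | se => nw
  | ne => sw
  | sw => ne

/-- `true` for the strand between south-west and north-east,
`false` for the strand between north-west and south-east -/
def rising : Corner → Bool
  | nw => false
  | se => false
  | ne => true
  | sw => true

def west : Corner → Bool
  | nw => true
  | sw => true
  | ne => false
  | se => false

def south : Corner → Bool
  | sw => true
  | se => true
  | nw => false
  | ne => false

/-- the lower end of a strand -/
def low : Bool → Corner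
  | true => sw
  | false => se

end Corner

variable {u : ℕ}

/-- The crossings of `P(k_1, …, k_u)`: the column `j` has `|k_j|` crossings, numbered from top to bottom.
(Columns are numbered from `0`.) -/
abbrev Cross (k : Fin u → ℤ) : Type := (j : Fin u) × Fin (k j).natAbs

/-- the top crossing of a column -/
def top (k : Fin u → ℤ) (hk : ∀ j, k j ≠ 0) (j : Fin u) : Cross k :=
  ⟨j, ⟨0, Int.natAbs_pos.mpr (hk j)⟩⟩

/-- the bottom crossing of a column -/
def bot (k : Fin u → ℤ) (hk : ∀ j, k j ≠ 0) (j : Fin u) : Cross k :=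
  ⟨j, ⟨(k j).natAbs - 1, Nat.sub_lt (Int.natAbs_pos.mpr (hk j)) Nat.one_pos⟩⟩

/-- The arcs of the unoriented diagram `P(k_1, …, k_u)`, as the involution that exchanges the two ends of each
arc: the lower corners of a crossing are joined to the upper corners of the next crossing
of the column, and the top (bottom) bridges join the right upper (lower) corner of a column
to the left upper (lower) corner of the following column, in the cyclic order. -/
def join (k : Fin u → ℤ) (hk : ∀ j, k j ≠ 0) : Cross k × Corner → Cross k × Corner
  | (⟨j, i⟩, .nw) =>
      if i.1 = 0 then (top k hk ((finRotate u).symm j), .ne)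
      else (⟨j, ⟨i.1 - 1, (Nat.sub_le _ _).trans_lt i.2⟩⟩, .sw)
  | (⟨j, i⟩, .ne) =>
      if i.1 = 0 then (top k hk (finRotate u j), .nw)
      else (⟨j, ⟨i.1 - 1, (Nat.sub_le _ _).trans_lt i.2⟩⟩, .se)
  | (⟨j, i⟩, .sw) =>
      if h : i.1 + 1 < (k j).natAbs then (⟨j, ⟨i.1 + 1, h⟩⟩, .nw)
      else (bot k hk ((finRotate u).symm j), .se)
  | (⟨j, i⟩, .se) =>
      if h : i.1 + 1 < (k j).natAbs then (⟨j, ⟨i.1 + 1, h⟩⟩, .ne)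
      else (bot k hk (finRotate u j), .sw)

theorem join_join (k : Fin u → ℤ) (hk : ∀ j, k j ≠ 0) (d : Cross k × Corner) :
    join k hk (join k hk d) = d := by
  obtain ⟨⟨j, ⟨i, hi⟩⟩, c⟩ := d
  have hb : ∀ j, ¬ ((k j).natAbs - 1 + 1 < (k j).natAbs) := fun j => by omega
  have ht : ∀ j', j' = j → ∀ hi, top k hk j' = (⟨j, ⟨0, hi⟩⟩ : Cross k) := by
    rintro _ rfl _
    rfl
  have hbt : ∀ j', j' = j → ∀ hi, bot k hk j' = (⟨j, ⟨(k j).natAbs - 1, hi⟩⟩ : Cross k) := by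
    rintro _ rfl _
    rfl
  cases c
  · by_cases h : i = 0
    · subst h
      exact Prod.ext (ht _ (Equiv.apply_symm_apply _ _) hi) rfl
    · have h1 : i - 1 + 1 = i := by omega
      simp [join, h, h1, hi]
  · by_cases h : i = 0
    · subst h
      exact Prod.ext (ht _ (Equiv.symm_apply_apply _ _) hi) rfl
    · have h1 : i - 1 + 1 = i := by omega
      simp [join, h, h1, hi]
  · by_cases h : i + 1 < (k j).natAbs
    · simp [join, h]
    · obtain rfl : i = (k j).natAbs - 1 := by omega
      simp only [join, bot, hb, dif_neg, not_false_eq_true]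
      exact Prod.ext (hbt _ (Equiv.apply_symm_apply _ _) hi) rfl
  · by_cases h : i + 1 < (k j).natAbs
    · simp [join, h]
    · obtain rfl : i = (k j).natAbs - 1 := by omega
      simp only [join, bot, hb, dif_neg, not_false_eq_true]
      exact Prod.ext (hbt _ (Equiv.symm_apply_apply _ _) hi) rfl

/-- An orientation of `P(k_1, …, k_u)`: `inward (c, a)` says that the strand through the corner `a` of the
crossing `c` runs into the crossing there. -/
structure Orientation (k : Fin u → ℤ) (hk : ∀ j, k j ≠ 0) where
  inward : Cross k × Corner → Bool
  inward_opp : ∀ c a, inward (c, a.opp) = !inward (c, a)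
  inward_join : ∀ d, inward (join k hk d) = !inward d

namespace Orientation

variable {k : Fin u → ℤ} {hk : ∀ j, k j ≠ 0}

/-- The passage of the diagram (a crossing and one of its two strands) to which a corner belongs. -/
def strand (d : Cross k × Corner) : Cross k × Bool := (d.1, d.2.rising)

/-- The corner at which a passage begins. -/
def entry (o : Orientation k hk) (x : Cross k × Bool) : Cross k × Corner :=
  if o.inward (x.1, Corner.low x.2) then (x.1, Corner.low x.2) else (x.1, (Corner.low x.2).opp)

/-- The corner at which a passage ends. -/
def exit (o : Orientation k hk) (x : Cross k × Bool) : Cross k × Corner :=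
  if o.inward (x.1, Corner.low x.2) then (x.1, (Corner.low x.2).opp) else (x.1, Corner.low x.2)

theorem strand_entry (o : Orientation k hk) (x : Cross k × Bool) : strand (o.entry x) = x := by
  obtain ⟨c, b⟩ := x
  unfold entry strand
  cases b <;> split_ifs <;> rfl

theorem strand_exit (o : Orientation k hk) (x : Cross k × Bool) : strand (o.exit x) = x := by
  obtain ⟨c, b⟩ := x
  unfold exit strand
  cases b <;> split_ifs <;> rfl

theorem inward_entry (o : Orientation k hk) (x : Cross k × Bool) : o.inward (o.entry x) = true := by
  unfold entry
  split_ifs with h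
  · exact h
  · rw [o.inward_opp]; simpa using h

theorem inward_exit (o : Orientation k hk) (x : Cross k × Bool) : o.inward (o.exit x) = false := by
  unfold exit
  split_ifs with h
  · rw [o.inward_opp]; simpa using h
  · simpa using h

theorem entry_strand (o : Orientation k hk) (d : Cross k × Corner) (hd : o.inward d = true) :
    o.entry (strand d) = d := by
  obtain ⟨c, a⟩ := d
  have h := o.inward_opp c a
  unfold entry strand
  cases a <;> simp_all [Corner.rising, Corner.low, Corner.opp]

theorem exit_strand (o : Orientation k hk) (d : Cross k × Corner) (hd : o.inward d = false) :
    o.exit (strand d) = d := by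
  obtain ⟨c, a⟩ := d
  have h := o.inward_opp c a
  unfold exit strand
  cases a <;> simp_all [Corner.rising, Corner.low, Corner.opp]

/-- The oriented pretzel diagram.  A passage is followed by the one that begins at the other end of the arc
that starts where the given passage ends.  For `k_j > 0` the half-twists of the column `j` are
right-handed: the strand from south-west to north-east is the upper one.  Such a crossing is
positive if both of its strands run upwards or both run downwards, and negative otherwise. -/
def diagram (o : Orientation k hk) : GaussDiagram where
  Pt := Cross k × Bool
  finite := inferInstance
  next :=
    { toFun := fun x => strand (join k hk (o.exit x))
      invFun := fun x => strand (join k hk (o.entry x))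
      left_inv := fun x => by
        dsimp only
        rw [o.entry_strand _ (by rw [o.inward_join, o.inward_exit]; rfl), join_join, o.strand_exit]
      right_inv := fun x => by
        dsimp only
        rw [o.exit_strand _ (by rw [o.inward_join, o.inward_entry]; rfl), join_join,
          o.strand_entry] }
  mate x := (x.1, !x.2)
  mate_mate x := by simp
  isOver x := x.2 == decide (0 < k x.1.1)
  isOver_mate x _ := by cases x.2 <;> cases decide (0 < k x.1.1) <;> rfl
  isPos x := (o.inward (x.1, .sw) == o.inward (x.1, .se)) == decide (0 < k x.1.1)
  isPos_mate _ := rfl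

end Orientation

/-- The parameters `k_j = 2 p_j + 1` of an odd pretzel link. -/
def oddParam (p : Fin u → ℤ) (j : Fin u) : ℤ := 2 * p j + 1

theorem oddParam_ne_zero (p : Fin u → ℤ) (j : Fin u) : oddParam p j ≠ 0 := by
  unfold oddParam; omega

theorem natAbs_oddParam (p : Fin u → ℤ) (j : Fin u) : (oddParam p j).natAbs % 2 = 1 := by
  unfold oddParam; omega

/-- The orientation of an odd pretzel diagram in which the two strands of each column are antiparallel and
the first top bridge runs from the first to the second column: all bridges run
from left to right, and so do the strands at every other crossing of a column. -/
def antiparallel (p : Fin u → ℤ) : Orientation (oddParam p) (oddParam_ne_zero p) where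
  inward d := d.2.west == decide (d.1.2.1 % 2 = 0)
  inward_opp c a := by
    cases a <;> cases decide (c.2.1 % 2 = 0) <;> rfl
  inward_join d := by
    obtain ⟨⟨j, ⟨i, hi⟩⟩, c⟩ := d
    have hb : ∀ j, ((oddParam p j).natAbs - 1) % 2 = 0 := fun j => by
      have := natAbs_oddParam p j
      omega
    have hj := natAbs_oddParam p j
    have par : ∀ m m' : ℕ, m % 2 = m' % 2 → decide (m % 2 = 0) = decide (m' % 2 = 0) := by
      intro m m' h
      rw [h]
    have par_ne : ∀ m m' : ℕ, m % 2 ≠ m' % 2 → decide (m % 2 = 0) = !decide (m' % 2 = 0) := by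
      intro m m' h
      rcases Nat.mod_two_eq_zero_or_one m with h1 | h1 <;>
        rcases Nat.mod_two_eq_zero_or_one m' with h2 | h2 <;> simp_all
    cases c
    · by_cases h : i = 0
      · have e : join (oddParam p) (oddParam_ne_zero p) (⟨j, ⟨i, hi⟩⟩, .nw) = (top (oddParam p) (oddParam_ne_zero p) ((finRotate u).symm j), .ne) := if_pos h
        refine (congrArg (fun d : Cross (oddParam p) × Corner =>
          d.2.west == decide (d.1.2.1 % 2 = 0)) e).trans ?_
        have h3 := par (0) i (by omega)
        refine (congrArg (fun b => Corner.west .ne == b) h3).trans ?_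
        cases decide (i % 2 = 0) <;> rfl
      · have e : join (oddParam p) (oddParam_ne_zero p) (⟨j, ⟨i, hi⟩⟩, .nw) = (⟨j, ⟨i - 1, (Nat.sub_le _ _).trans_lt hi⟩⟩, .sw) := if_neg h
        refine (congrArg (fun d : Cross (oddParam p) × Corner =>
          d.2.west == decide (d.1.2.1 % 2 = 0)) e).trans ?_
        have h3 := par_ne (i - 1) i (by omega)
        refine (congrArg (fun b => Corner.west .sw == b) h3).trans ?_
        cases decide (i % 2 = 0) <;> rfl
    · by_cases h : i = 0
      · have e : join (oddParam p) (oddParam_ne_zero p) (⟨j, ⟨i, hi⟩⟩, .ne) = (top (oddParam p) (oddParam_ne_zero p) (finRotate u j), .nw) := if_pos h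
        refine (congrArg (fun d : Cross (oddParam p) × Corner =>
          d.2.west == decide (d.1.2.1 % 2 = 0)) e).trans ?_
        have h3 := par (0) i (by omega)
        refine (congrArg (fun b => Corner.west .nw == b) h3).trans ?_
        cases decide (i % 2 = 0) <;> rfl
      · have e : join (oddParam p) (oddParam_ne_zero p) (⟨j, ⟨i, hi⟩⟩, .ne) = (⟨j, ⟨i - 1, (Nat.sub_le _ _).trans_lt hi⟩⟩, .se) := if_neg h
        refine (congrArg (fun d : Cross (oddParam p) × Corner =>
          d.2.west == decide (d.1.2.1 % 2 = 0)) e).trans ?_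
        have h3 := par_ne (i - 1) i (by omega)
        refine (congrArg (fun b => Corner.west .se == b) h3).trans ?_
        cases decide (i % 2 = 0) <;> rfl
    · by_cases h : i + 1 < (oddParam p j).natAbs
      · have e : join (oddParam p) (oddParam_ne_zero p) (⟨j, ⟨i, hi⟩⟩, .sw) = (⟨j, ⟨i + 1, h⟩⟩, .nw) := dif_pos h
        refine (congrArg (fun d : Cross (oddParam p) × Corner =>
          d.2.west == decide (d.1.2.1 % 2 = 0)) e).trans ?_
        have h3 := par_ne (i + 1) i (by omega)
        refine (congrArg (fun b => Corner.west .nw == b) h3).trans ?_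
        cases decide (i % 2 = 0) <;> rfl
      · have e : join (oddParam p) (oddParam_ne_zero p) (⟨j, ⟨i, hi⟩⟩, .sw) = (bot (oddParam p) (oddParam_ne_zero p) ((finRotate u).symm j), .se) := dif_neg h
        refine (congrArg (fun d : Cross (oddParam p) × Corner =>
          d.2.west == decide (d.1.2.1 % 2 = 0)) e).trans ?_
        have h4 := hb ((finRotate u).symm j)
        have h3 := par ((oddParam p ((finRotate u).symm j)).natAbs - 1) i (by omega)
        refine (congrArg (fun b => Corner.west .se == b) h3).trans ?_
        cases decide (i % 2 = 0) <;> rfl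
    · by_cases h : i + 1 < (oddParam p j).natAbs
      · have e : join (oddParam p) (oddParam_ne_zero p) (⟨j, ⟨i, hi⟩⟩, .se) = (⟨j, ⟨i + 1, h⟩⟩, .ne) := dif_pos h
        refine (congrArg (fun d : Cross (oddParam p) × Corner =>
          d.2.west == decide (d.1.2.1 % 2 = 0)) e).trans ?_
        have h3 := par_ne (i + 1) i (by omega)
        refine (congrArg (fun b => Corner.west .ne == b) h3).trans ?_
        cases decide (i % 2 = 0) <;> rfl
      · have e : join (oddParam p) (oddParam_ne_zero p) (⟨j, ⟨i, hi⟩⟩, .se) = (bot (oddParam p) (oddParam_ne_zero p) (finRotate u j), .sw) := dif_neg h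
        refine (congrArg (fun d : Cross (oddParam p) × Corner =>
          d.2.west == decide (d.1.2.1 % 2 = 0)) e).trans ?_
        have h4 := hb (finRotate u j)
        have h3 := par ((oddParam p (finRotate u j)).natAbs - 1) i (by omega)
        refine (congrArg (fun b => Corner.west .sw == b) h3).trans ?_
        cases decide (i % 2 = 0) <;> rfl

theorem finRotate_parity (n : ℕ) (j : Fin (2 * n)) :
    decide ((finRotate (2 * n) j).1 % 2 = 0) = !decide (j.1 % 2 = 0) := by
  have hj := j.2
  obtain ⟨m, hm⟩ : ∃ m, 2 * n = m + 1 := ⟨2 * n - 1, by omega⟩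
  have key : ∀ (m' : ℕ) (hm : m' = m + 1) (j : Fin m'),
      (finRotate m' j).1 = if j.1 = m then 0 else j.1 + 1 := by
    rintro _ rfl j
    rw [coe_finRotate]
    simp [Fin.ext_iff]
  rw [key _ hm j]
  split_ifs with h
  · have h1 : j.1 % 2 = 1 := by omega
    simp [h1]
  · rcases Nat.mod_two_eq_zero_or_one j.1 with h2 | h2
    · have h3 : (j.1 + 1) % 2 = 1 := by omega
      simp [h2, h3]
    · have h3 : (j.1 + 1) % 2 = 0 := by omega
      simp [h2, h3]

theorem finRotate_symm_parity (n : ℕ) (j : Fin (2 * n)) :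
    decide (((finRotate (2 * n)).symm j).1 % 2 = 0) = !decide (j.1 % 2 = 0) := by
  have h := finRotate_parity n ((finRotate (2 * n)).symm j)
  rw [Equiv.apply_symm_apply] at h
  rw [h, Bool.not_not]

/-- The orientation of an odd pretzel diagram with an even number of columns in which the two strands of each
column are parallel and the first top bridge runs from the first to the second column: the strands
run upwards in the first, third, … column and downwards in the second, fourth, … one. -/
def parallel {n : ℕ} (p : Fin (2 * n) → ℤ) : Orientation (oddParam p) (oddParam_ne_zero p) where
  inward d := d.2.south == decide (d.1.1.1 % 2 = 0)
  inward_opp c a := by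
    cases a <;> cases decide (c.1.1 % 2 = 0) <;> rfl
  inward_join d := by
    obtain ⟨⟨j, ⟨i, hi⟩⟩, c⟩ := d
    cases c
    · by_cases h : i = 0
      · simp only [join, h, if_true, top, Corner.south, finRotate_symm_parity]
        cases decide (j.1 % 2 = 0) <;> rfl
      · simp only [join, h, if_false, Corner.south]
        cases decide (j.1 % 2 = 0) <;> rfl
    · by_cases h : i = 0
      · simp only [join, h, if_true, top, Corner.south, finRotate_parity]
        cases decide (j.1 % 2 = 0) <;> rfl
      · simp only [join, h, if_false, Corner.south]
        cases decide (j.1 % 2 = 0) <;> rfl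
    · by_cases h : i + 1 < (oddParam p j).natAbs
      · simp only [join, h, dif_pos, Corner.south]
        cases decide (j.1 % 2 = 0) <;> rfl
      · simp only [join, h, dif_neg, not_false_eq_true, bot, Corner.south, finRotate_symm_parity]
        cases decide (j.1 % 2 = 0) <;> rfl
    · by_cases h : i + 1 < (oddParam p j).natAbs
      · simp only [join, h, dif_pos, Corner.south]
        cases decide (j.1 % 2 = 0) <;> rfl
      · simp only [join, h, dif_neg, not_false_eq_true, bot, Corner.south, finRotate_parity]
        cases decide (j.1 % 2 = 0) <;> rfl

end Pretzel

/-!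
Two things have to be shown: that a planar diagram has at most one Conway polynomial, and that the stated polynomials
are Conway polynomials of the pretzel diagrams.

*Uniqueness.* For real `s > 0` a number is attached to every planar diagram which is the value of the Conway polynomial
at `z = s⁻¹ - s`. Its main part `walkDet` is a cofactor of `1 - W`, where `W` describes a walk along the diagram that
changes from the lower strand of a crossing to the upper one with a "probability" that depends on the sign; this is
the Alexander polynomial up to a power of `s`. The missing power is the writhe together with the rotation number of
the diagram, the number of Seifert circles that run counterclockwise minus that of the others. In a Gauss diagram this
is accessible through indices: by `isPlanar_iff` planarity means that every integral cycle `f` has an index, the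
winding number of `f` around the points to the left of the strands (`IsIndex`). A Seifert circle is a cycle, and its
index on its own left side, normalized at a base point, is `1` or `0` according to its direction (`IsRotation`).
The effect of a local move on the rotation number then follows from what it does to cycles and indices: circles are
carried along (`IsRotation.comap`), dropped (`IsRotation.comap_drop`) or joined and split by a band
(`IsRotation.band`). Row operations give the effect on `walkDet`. Together: `hasValue_reidI`, `hasValue_reidII`,
`hasValue_exchange` for the Reidemeister moves, `hasValue_skein` for the skein relation. Hence two Conway polynomials
of a diagram agree at infinitely many points (`HasConwayPolynomial.unique`).

*Values.* The skein relation is applied to a crossing of a column. A `Code` is a Gauss diagram whose passages have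
arbitrary names, and in which ordinary points on the strands are disregarded (`Thru`); so a crossing can be switched,
smoothed or erased without a renaming of the rest. Two adjacent crossings of a column form a bigon
(`Bigon`), and if one of them is switched, both can be erased; this reduces the length of the column by two. If one is
smoothed, the rest of an antiparallel column unravels, and the column disappears (`IsAntiparallel.delete`); a parallel
column only becomes shorter by one, and a parallel column without crossings leaves a linear chain of twists (`IsChain`).
When all columns consist of one crossing, two adjacent columns form a bigon, and the number of columns goes down.
In the antiparallel case a column with `2 p + 1` half-twists therefore acts linearly on the pair formed by the diagrams
with and without it. This action is the multiplication by `ω - p X` in the ring `QuadRing`, where `ω ^ 2 = 1 - X ω`,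
and the polynomial of the diagram is the coefficient of `ω` in the product over all columns (`IsAntiparallel.poly`).
In the parallel case only the polynomials of the closed twists with `k` and with `k - 1` half-twists matter for a column
with `k` half-twists. They form an element `twistFactor` of the dual numbers `DualRing`, because the polynomial is a
multiple of the product of the former, which belongs to the connected sum of the closed twists (`IsChain.poly`), plus
the sum of the products in which one of the former is replaced by the latter (`IsParallel.poly`, `parallelValue`).
The coefficients of `z` and `z ^ 3` are read off from the products by induction on the number of columns
(`antiparallel_coeff`, `twistFactor_prod_hasLow`).
-/

open Finset
open Equiv (Perm swap swap_apply_left swap_apply_right swap_apply_of_ne_of_ne)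

namespace GaussDiagram

/-! ### Planarity through indices of cycles -/

/-- An integral 1-cycle of the diagram.  Edges are labelled by the marked point at which they *end*. -/
def IsCycle (D : GaussDiagram) (f : D.Pt → ℤ) : Prop :=
  ∀ x, f (D.next x) + f (D.next (D.mate x)) = f x + f (D.mate x)

/-- `G` is an index of the cycle `f`: `G x` is the value, in the region to the left of the edge that ends
at `x`, of a 2-chain with boundary `f`; the value to the right of that edge is `G x - f x`.  Only the
relations around the marked points are recorded, those at a crossing being written for the strand that
is crossed from its right to its left. -/
structure IsIndex (D : GaussDiagram) (f G : D.Pt → ℤ) : Prop where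
  ordinary : ∀ x, D.mate x = x → G (D.next x) = G x
  left : ∀ x, D.mate x ≠ x → D.crossedToLeft x = true →
    G (D.next (D.mate x)) = G x ∧ G (D.mate x) = G x - f x ∧
      G (D.next x) = G x - f (D.next (D.mate x))

theorem crossedToLeft_mate (D : GaussDiagram) {x : D.Pt} (hx : D.mate x ≠ x) :
    D.crossedToLeft (D.mate x) = !D.crossedToLeft x := by
  unfold crossedToLeft
  rw [D.isOver_mate x hx, D.isPos_mate]
  cases D.isOver x <;> cases D.isPos x <;> rfl

theorem mate_mate_ne (D : GaussDiagram) {x : D.Pt} (hx : D.mate x ≠ x) :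
    D.mate (D.mate x) ≠ D.mate x := by
  rw [D.mate_mate]; exact hx.symm

theorem mate_injective (D : GaussDiagram) : Function.Injective D.mate :=
  Function.LeftInverse.injective D.mate_mate

variable {D : GaussDiagram}

theorem mate_eq_symm {v w : D.Pt} (h : D.mate v = w) : D.mate w = v := by rw [← h, D.mate_mate]

theorem crossedToLeft_eq_not {v w : D.Pt} (h : D.mate v = w) (hne : w ≠ v) :
    D.crossedToLeft w = !D.crossedToLeft v := by
  subst h; exact D.crossedToLeft_mate hne

theorem IsIndex.right {f G : D.Pt → ℤ} (hG : D.IsIndex f G) {x : D.Pt} (hx : D.mate x ≠ x)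
    (hl : ¬ D.crossedToLeft x = true) : G (D.next x) = G (D.mate x) ∧ G x = G (D.mate x) - f (D.mate x) ∧
      G (D.next (D.mate x)) = G (D.mate x) - f (D.next x) := by
  simpa only [D.mate_mate] using hG.left (D.mate x) (D.mate_mate_ne hx)
    (by rw [D.crossedToLeft_mate hx]; simpa using hl)

theorem IsIndex.left_of_mate {f G : D.Pt → ℤ} (hG : D.IsIndex f G) {v w : D.Pt}
    (h : D.mate v = w) (hne : w ≠ v) (hl : D.crossedToLeft v = true) :
    G (D.next w) = G v ∧ G w = G v - f v ∧ G (D.next v) = G v - f (D.next w) := by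
  subst h; exact hG.left v hne hl

theorem isPlanar_iff (D : GaussDiagram) :
    D.IsPlanar ↔ ∀ f, D.IsCycle f → ∃ G, D.IsIndex f G := by
  constructor
  · intro hD f hf
    obtain ⟨h, h1, h2⟩ := hD (fun x => f (D.next x)) (fun x => by
      simpa using hf x)
    refine ⟨fun y => h (D.next.symm y, true), ⟨fun x hx => ?_, fun x hx hl => ?_⟩⟩
    · have := h1 (D.next.symm x, true)
      simp only [face, Equiv.apply_symm_apply, hx, if_true] at this
      simpa using this
    · have hl' := D.crossedToLeft_mate hx
      rw [hl] at hl'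
      have hx' := D.mate_mate_ne hx
      have e1 := h1 (D.next.symm x, true)
      have e2 := h1 (x, false)
      have e3 := h1 (D.next.symm (D.mate x), true)
      have e4 := h1 (D.mate x, false)
      have k1 := h2 (D.next.symm x)
      have k2 := h2 (D.mate x)
      have k3 := h2 x
      have k4 := h2 (D.next.symm (D.mate x))
      simp only [face, Equiv.apply_symm_apply, hx, hx.symm, if_false, hl, hl', if_true, Bool.not_true,
        Bool.false_eq_true, D.mate_mate] at e1 e2 e3 e4 k1 k2 k3 k4
      simp only [Equiv.symm_apply_apply]
      refine ⟨by linarith, by linarith, by linarith⟩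
  · intro H f hf
    obtain ⟨G, hG⟩ := H (fun x => f (D.next.symm x)) (fun x => by simpa using hf x)
    refine ⟨fun d => if d.2 then G (D.next d.1) else G (D.next d.1) - f d.1, ?_, fun x => by simp⟩
    rintro ⟨x, _ | _⟩
    · by_cases hx : D.mate x = x
      · have := hG.ordinary x hx
        have hfx := hf x
        simp only [hx] at hfx
        simp only [face, hx, if_true, Bool.false_eq_true, if_false, Equiv.apply_symm_apply, this]
        linarith
      · have hx' := D.mate_mate_ne hx
        have hfx := hf x
        by_cases hl : D.crossedToLeft x = true
        · obtain ⟨e1, e2, e3⟩ := hG.left x hx hl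
          simp only [face, hx, hl, if_true, Bool.false_eq_true, if_false, Equiv.apply_symm_apply,
            Equiv.symm_apply_apply] at *
          linarith
        · obtain ⟨e1, e2, e3⟩ := hG.right hx hl
          simp only [face, hx, hl, if_true, Bool.false_eq_true, if_false,
            Equiv.symm_apply_apply, D.mate_mate] at *
          linarith
    · set y := D.next x with hy
      have hxy : D.next.symm y = x := by simp [hy]
      by_cases hx : D.mate y = y
      · have := hG.ordinary y hx
        simp only [face, ← hy, hx, if_true, this]
      · have hx' := D.mate_mate_ne hx
        have hfx := hf y
        by_cases hl : D.crossedToLeft y = true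
        · obtain ⟨e1, e2, e3⟩ := hG.left y hx hl
          simp only [face, ← hy, hx, hl, if_true, if_false]
          linarith
        · obtain ⟨e1, e2, e3⟩ := hG.right hx hl
          simp only [face, ← hy, hx, hl, if_true, Bool.false_eq_true, if_false, Equiv.apply_symm_apply,
            Equiv.symm_apply_apply, D.mate_mate] at *
          linarith

/-! ### Planarity under the elementary operations -/

theorem crossedToLeft_switch (D : GaussDiagram) (x y : D.Pt) :
    (D.switch x).crossedToLeft y = D.crossedToLeft y := by
  unfold crossedToLeft switch
  by_cases h : D.SameCrossing x y
  · simp only [h, if_true]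
    cases D.isOver y <;> cases D.isPos y <;> rfl
  · simp only [h, if_false]

theorem isIndex_switch (D : GaussDiagram) (x : D.Pt) {f G : D.Pt → ℤ} :
    (D.switch x).IsIndex f G ↔ D.IsIndex f G := by
  constructor
  · intro h
    exact ⟨h.ordinary, fun (y : D.Pt) hy hl => h.left y hy ((D.crossedToLeft_switch x y).trans hl)⟩
  · intro h
    exact ⟨h.ordinary, fun (y : D.Pt) hy hl => h.left y hy ((D.crossedToLeft_switch x y).symm.trans hl)⟩

theorem isPlanar_switch (hD : D.IsPlanar) (x : D.Pt) : (D.switch x).IsPlanar := by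
  rw [isPlanar_iff] at *
  intro f hf
  obtain ⟨G, hG⟩ := hD f hf
  exact ⟨G, (D.isIndex_switch x).2 hG⟩

theorem erase_mate_of_same (D : GaussDiagram) {x y : D.Pt} (h : D.SameCrossing x y) :
    (D.erase x).mate y = y := by simp [erase, h]

theorem erase_mate_of_not_same (D : GaussDiagram) {x y : D.Pt} (h : ¬ D.SameCrossing x y) :
    (D.erase x).mate y = D.mate y := by simp [erase, h]

theorem sameCrossing_self (D : GaussDiagram) (x : D.Pt) : D.SameCrossing x x := .inl rfl

theorem sameCrossing_mate_self (D : GaussDiagram) (x : D.Pt) : D.SameCrossing x (D.mate x) := .inr rfl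

theorem smooth_mate_of_same (D : GaussDiagram) {x y : D.Pt} (h : D.SameCrossing x y) :
    (D.smooth x).mate y = y := D.erase_mate_of_same h

theorem smooth_mate_of_not_same (D : GaussDiagram) {x y : D.Pt} (h : ¬ D.SameCrossing x y) :
    (D.smooth x).mate y = D.mate y := D.erase_mate_of_not_same h

theorem smooth_next_self (D : GaussDiagram) (x : D.Pt) : (D.smooth x).next x = D.next (D.mate x) := by
  classical
  exact congrArg D.next (swap_apply_left x (D.mate x))

theorem smooth_next_mate (D : GaussDiagram) (x : D.Pt) : (D.smooth x).next (D.mate x) = D.next x := by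
  classical
  exact congrArg D.next (swap_apply_right x (D.mate x))

theorem smooth_next_of_not_same (D : GaussDiagram) {x y : D.Pt} (h : ¬ D.SameCrossing x y) :
    (D.smooth x).next y = D.next y := by
  classical
  exact congrArg D.next (swap_apply_of_ne_of_ne (fun e => h (.inl e)) (fun e => h (.inr e)))

theorem isCycle_of_smooth {x : D.Pt} {f : D.Pt → ℤ}
    (hf : (D.smooth x).IsCycle f) :
    D.IsCycle f ∧ f (D.next (D.mate x)) = f x ∧ f (D.next x) = f (D.mate x) := by
  have h1 : f (D.next (D.mate x)) = f x := by
    have := hf x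
    rw [D.smooth_mate_of_same (D.sameCrossing_self x), smooth_next_self] at this
    linarith
  have h2 : f (D.next x) = f (D.mate x) := by
    have := hf (D.mate x)
    rw [D.smooth_mate_of_same (D.sameCrossing_mate_self x), smooth_next_mate] at this
    linarith
  refine ⟨fun y => ?_, h1, h2⟩
  by_cases hy : D.SameCrossing x y
  · rcases hy with rfl | rfl
    · linarith
    · rw [D.mate_mate]; linarith
  · have := hf y
    have hy' : ¬ D.SameCrossing x (D.mate y) := by rwa [D.sameCrossing_mate]
    rwa [D.smooth_mate_of_not_same hy, D.smooth_next_of_not_same hy,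
      D.smooth_next_of_not_same hy'] at this

theorem isIndex_smooth {x : D.Pt} (hx : D.mate x ≠ x) {f G : D.Pt → ℤ}
    (h1 : f (D.next (D.mate x)) = f x) (h2 : f (D.next x) = f (D.mate x))
    (hG : D.IsIndex f G) : (D.smooth x).IsIndex f G := by
  have hx' := D.mate_mate_ne hx
  refine ⟨fun (y : D.Pt) hy => ?_, fun (y : D.Pt) hy hl => ?_⟩
  · by_cases h : D.SameCrossing x y
    · rcases h with rfl | rfl
      · rw [smooth_next_self]
        by_cases hl : D.crossedToLeft y = true
        · exact (hG.left y hx hl).1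
        · obtain ⟨e1, e2, e3⟩ := hG.right hx hl
          linarith
      · rw [smooth_next_mate]
        by_cases hl : D.crossedToLeft x = true
        · obtain ⟨e1, e2, e3⟩ := hG.left x hx hl
          linarith
        · obtain ⟨e1, e2, e3⟩ := hG.right hx hl
          linarith
    · rw [D.smooth_next_of_not_same h]
      exact hG.ordinary y ((D.smooth_mate_of_not_same h).symm.trans hy)
  · by_cases h : D.SameCrossing x y
    · exact absurd (D.smooth_mate_of_same h) hy
    · have h' : ¬ D.SameCrossing x (D.mate y) := by rwa [D.sameCrossing_mate]
      rw [D.smooth_mate_of_not_same h] at hy ⊢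
      rw [D.smooth_next_of_not_same h, D.smooth_next_of_not_same h']
      exact hG.left y hy hl

theorem isPlanar_smooth (hD : D.IsPlanar) {x : D.Pt} (hx : D.mate x ≠ x) :
    (D.smooth x).IsPlanar := by
  rw [isPlanar_iff] at *
  intro f hf
  obtain ⟨h0, h1, h2⟩ := isCycle_of_smooth hf
  obtain ⟨G, hG⟩ := hD f h0
  exact ⟨G, isIndex_smooth hx h1 h2 hG⟩

/-- In a diagram without crossings the constant functions are indices. -/
theorem isPlanar_of_crossingless (h : ∀ x, D.mate x = x) : D.IsPlanar := by
  rw [isPlanar_iff]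
  exact fun f _ => ⟨fun _ => 0, fun _ _ => rfl, fun x hx => absurd (h x) hx⟩

end GaussDiagram

namespace GaussDiagram

open Classical in
/-- Forget all the crossings with a passage in `S`. -/
noncomputable def eraseAll (D : GaussDiagram) (S : Set D.Pt) (hS : ∀ y, D.mate y ∈ S ↔ y ∈ S) :
    GaussDiagram where
  Pt := D.Pt
  finite := D.finite
  next := D.next
  mate y := if y ∈ S then y else D.mate y
  mate_mate y := by
    by_cases h : y ∈ S
    · simp [h]
    · simp [h, hS, D.mate_mate]
  isOver := D.isOver
  isOver_mate y hy := by
    by_cases h : y ∈ S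
    · simp [h] at hy
    · simp only [h, if_false] at hy ⊢
      exact D.isOver_mate y hy
  isPos := D.isPos
  isPos_mate y := by
    by_cases h : y ∈ S
    · simp [h]
    · simp [h, D.isPos_mate]

section eraseAll

variable {D : GaussDiagram} {S : Set D.Pt} {hS : ∀ y, D.mate y ∈ S ↔ y ∈ S}

theorem eraseAll_mate_of_mem {y : D.Pt} (h : y ∈ S) : (D.eraseAll S hS).mate y = y := by
  simp [eraseAll, h]

theorem eraseAll_mate_of_notMem {y : D.Pt} (h : y ∉ S) : (D.eraseAll S hS).mate y = D.mate y := by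
  simp [eraseAll, h]

theorem erase_erase_mate (D : GaussDiagram) (x y : D.Pt) :
    ((D.erase x).erase y).mate = (D.eraseAll {z | D.SameCrossing x z ∨ D.SameCrossing y z}
      (fun z => by simp only [Set.mem_ofPred_eq, D.sameCrossing_mate])).mate := by
  funext (z : D.Pt)
  by_cases h1 : D.SameCrossing x z
  · rw [eraseAll_mate_of_mem (.inl h1)]
    by_cases h2 : (D.erase x).SameCrossing y z
    · exact (D.erase x).erase_mate_of_same h2
    · rw [(D.erase x).erase_mate_of_not_same h2, D.erase_mate_of_same h1]
  · by_cases h2 : D.SameCrossing y z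
    · rw [eraseAll_mate_of_mem (.inr h2)]
      refine (D.erase x).erase_mate_of_same ?_
      rcases h2 with h2 | h2
      · exact .inl h2
      · refine .inr (h2.trans ?_)
        rw [D.erase_mate_of_not_same]
        rwa [h2, D.sameCrossing_mate] at h1
    · have h3 : ¬ (D.erase x).SameCrossing y z := by
        rintro (h | h)
        · exact h2 (.inl h)
        · by_cases h4 : D.SameCrossing x y
          · rw [D.erase_mate_of_same h4] at h
            exact h2 (.inl h)
          · rw [D.erase_mate_of_not_same h4] at h
            exact h2 (.inr h)
      rw [eraseAll_mate_of_notMem (fun h => h.elim h1 h2), (D.erase x).erase_mate_of_not_same h3,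
        D.erase_mate_of_not_same h1]

theorem isIndex_erase_erase (D : GaussDiagram) (x y : D.Pt) {f G : D.Pt → ℤ}
    (h : (D.eraseAll {z | D.SameCrossing x z ∨ D.SameCrossing y z}
      (fun z => by simp only [Set.mem_ofPred_eq, D.sameCrossing_mate])).IsIndex f G) :
    ((D.erase x).erase y).IsIndex f G := by
  have e := D.erase_erase_mate x y
  refine ⟨fun (z : D.Pt) hz => h.ordinary z ((congrFun e z).symm.trans hz),
    fun (z : D.Pt) hz hl => ?_⟩
  rw [congrFun e z] at hz ⊢
  exact h.left z hz hl

theorem isCycle_erase_erase (D : GaussDiagram) (x y : D.Pt) {f : D.Pt → ℤ}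
    (h : ((D.erase x).erase y).IsCycle f) :
    (D.eraseAll {z | D.SameCrossing x z ∨ D.SameCrossing y z}
      (fun z => by simp only [Set.mem_ofPred_eq, D.sameCrossing_mate])).IsCycle f := by
  intro (z : D.Pt)
  have := h z
  rw [congrFun (D.erase_erase_mate x y) z] at this
  exact this

/-- An index is transported to a diagram with fewer crossings by a correction near the erased ones. -/
theorem IsIndex.eraseAll {f f' G G' : D.Pt → ℤ} (hG : D.IsIndex f G)
    (h0 : ∀ z, z ∉ S → f' z = f z ∧ f' (D.next z) = f (D.next z))
    (h1 : ∀ z, z ∉ S → G' z = G z ∧ G' (D.next z) = G (D.next z))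
    (h2 : ∀ z, z ∈ S → G' (D.next z) = G' z) : (D.eraseAll S hS).IsIndex f' G' := by
  refine ⟨fun (z : D.Pt) hz => ?_, fun (z : D.Pt) hz hl => ?_⟩
  · by_cases h : z ∈ S
    · exact h2 z h
    · rw [eraseAll_mate_of_notMem h] at hz
      change G' (D.next z) = G' z
      rw [(h1 z h).1, (h1 z h).2]
      exact hG.ordinary z hz
  · by_cases h : z ∈ S
    · exact absurd (eraseAll_mate_of_mem h) hz
    · rw [eraseAll_mate_of_notMem h] at hz ⊢
      have h' : D.mate z ∉ S := by rwa [hS]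
      change G' (D.next (D.mate z)) = G' z ∧ G' (D.mate z) = G' z - f' z ∧
        G' (D.next z) = G' z - f' (D.next (D.mate z))
      rw [(h0 z h).1, (h0 _ h').2, (h1 z h).1, (h1 z h).2, (h1 _ h').1, (h1 _ h').2]
      exact hG.left z hz hl

theorem isCycle_of_eraseAll {f : D.Pt → ℤ} (hf : (D.eraseAll S hS).IsCycle f) :
    D.IsCycle f ∧ ∀ z ∈ S, f (D.next z) = f z := by
  have h : ∀ z ∈ S, f (D.next z) = f z := by
    intro z hz
    have := hf z
    rw [eraseAll_mate_of_mem hz] at this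
    change f (D.next z) + f (D.next z) = f z + f z at this
    linarith
  refine ⟨fun z => ?_, h⟩
  by_cases hz : z ∈ S
  · rw [h z hz, h _ ((hS z).2 hz)]
  · have := hf z
    rwa [eraseAll_mate_of_notMem hz] at this

end eraseAll

variable {D : GaussDiagram}

open Classical in
/-- The correction of an index at a curl that is removed. -/
theorem isIndex_reidI {x : D.Pt} (hx : D.mate x ≠ x) (h : D.next x = D.mate x)
    {f G : D.Pt → ℤ} (h1 : f (D.mate x) = f x) (h2 : f (D.next (D.mate x)) = f x)
    (hG : D.IsIndex f G) :
    ∃ G' : D.Pt → ℤ, (D.erase x).IsIndex f G' := by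
  have hn : D.next (D.mate x) ≠ D.mate x := fun e => hx (D.next.injective (e.trans h.symm))
  have key : G (D.next (D.mate x)) = G x := by
    by_cases hl : D.crossedToLeft x = true
    · exact (hG.left x hx hl).1
    · obtain ⟨e1, e2, e3⟩ := hG.right hx hl
      rw [h] at *
      linarith
  refine ⟨Function.update G (D.mate x) (G x),
    hG.eraseAll (hS := fun y => D.sameCrossing_mate x y) (fun _ _ => ⟨rfl, rfl⟩) (fun z hz => ?_) (fun z hz => ?_)⟩
  · have n1 : z ≠ x := fun e => hz (.inl e)
    have n2 : z ≠ D.mate x := fun e => hz (.inr e)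
    have n3 : D.next z ≠ D.mate x := fun e => n1 (D.next.injective (e.trans h.symm))
    simp [n2, n3]
  · rcases hz with rfl | rfl
    · simp [h, hx.symm]
    · simp [hn, key]

theorem isPlanar_reidI (hD : D.IsPlanar) {x : D.Pt} (hx : D.mate x ≠ x)
    (h : D.next x = D.mate x) : (D.erase x).IsPlanar := by
  rw [isPlanar_iff] at *
  intro f hf
  change (D.eraseAll _ (fun y => D.sameCrossing_mate x y)).IsCycle f at hf
  obtain ⟨h0, h1⟩ := isCycle_of_eraseAll hf
  obtain ⟨G, hG⟩ := hD f h0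
  have e1 := h1 x (D.sameCrossing_self x)
  have e2 := h1 _ (D.sameCrossing_mate_self x)
  rw [h] at e1
  exact isIndex_reidI hx h e1 (e2.trans e1) hG

open Classical in
/-- The correction of an index at a bigon that is removed. -/
theorem isIndex_reidII {x y : D.Pt} (hx : D.mate x ≠ x) (hy : D.mate y ≠ y)
    (hox : D.isOver x = true) (hoy : D.isOver y = true) (hpos : D.isPos x ≠ D.isPos y)
    (hxy : D.next x = y)
    (hm : D.next (D.mate x) = D.mate y ∨ D.next (D.mate y) = D.mate x)
    {f G : D.Pt → ℤ} (h1 : ∀ z, D.SameCrossing x z ∨ D.SameCrossing y z → f (D.next z) = f z)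
    (hG : D.IsIndex f G) :
    ∃ G' : D.Pt → ℤ, ((D.erase x).erase y).IsIndex f G' := by
  have hyx : y ≠ x := fun e => hpos (by rw [e])
  have mx : D.mate x ≠ y := fun e => by
    have := D.isOver_mate x hx
    rw [e, hox, hoy] at this; simp at this
  have mxy : D.mate x ≠ D.mate y := fun e => hyx (D.mate_injective e).symm
  have my : D.mate y ≠ x := fun e => mx (by rw [← e, D.mate_mate])
  have hlx := D.crossedToLeft_mate hx
  have hly := D.crossedToLeft_mate hy
  have hxy' : D.crossedToLeft x = !D.crossedToLeft y := by
    unfold crossedToLeft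
    rw [hox, hoy]
    cases h1 : D.isPos x <;> cases h2 : D.isPos y <;> simp_all
  have fx := h1 x (.inl (D.sameCrossing_self x))
  have fy := h1 y (.inr (D.sameCrossing_self y))
  have fmx := h1 _ (.inl (D.sameCrossing_mate_self x))
  have fmy := h1 _ (.inr (D.sameCrossing_mate_self y))
  -- the relations at the two crossings of the bigon
  have gxy := congrArg G hxy
  have fxy := congrArg f hxy
  have key : G (D.next y) = G x ∧
      (D.next (D.mate x) = D.mate y → G (D.next (D.mate y)) = G (D.mate x)) ∧
      (D.next (D.mate y) = D.mate x → G (D.next (D.mate x)) = G (D.mate y)) := by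
    cases hl : D.crossedToLeft y
    · rw [hl] at hxy' hly
      obtain ⟨a1, a2, a3⟩ := hG.left x hx hxy'
      obtain ⟨b1, b2, b3⟩ := hG.left (D.mate y) (D.mate_mate_ne hy) hly
      rw [D.mate_mate] at b1 b2 b3
      exact ⟨by rcases hm with e | e <;> have := congrArg G e <;> have := congrArg f e <;> linarith,
        fun e => by have := congrArg G e; have := congrArg f e; linarith,
        fun e => by have := congrArg G e; have := congrArg f e; linarith⟩
    · rw [hl] at hxy'
      rw [hxy'] at hlx
      obtain ⟨a1, a2, a3⟩ := hG.left (D.mate x) (D.mate_mate_ne hx) hlx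
      obtain ⟨b1, b2, b3⟩ := hG.left y hy hl
      rw [D.mate_mate] at a1 a2 a3
      exact ⟨by rcases hm with e | e <;> have := congrArg G e <;> have := congrArg f e <;> linarith,
        fun e => by have := congrArg G e; have := congrArg f e; linarith,
        fun e => by have := congrArg G e; have := congrArg f e; linarith⟩
  obtain ⟨a, b, hab, k, hax, hay, hbx, hby, hne, hS⟩ : ∃ a b, D.next a = b ∧ G (D.next b) = G a ∧ a ≠ x ∧ a ≠ y ∧
      b ≠ x ∧ b ≠ y ∧ a ≠ b ∧
      ∀ z, D.SameCrossing x z ∨ D.SameCrossing y z ↔ z = x ∨ z = y ∨ z = a ∨ z = b := by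
    rcases hm with hm | hm
    · exact ⟨_, _, hm, key.2.1 hm, hx, mx, my, hy, mxy, fun z => by unfold SameCrossing; tauto⟩
    · exact ⟨_, _, hm, key.2.2 hm, my, hy, hx, mx, mxy.symm, fun z => by unfold SameCrossing; tauto⟩
  have ny : ∀ z, z ≠ x → D.next z ≠ y := fun z hz e => hz (D.next.injective (e.trans hxy.symm))
  have nb : ∀ z, z ≠ a → D.next z ≠ b := fun z hz e => hz (D.next.injective (e.trans hab.symm))
  refine ⟨Function.update (Function.update G y (G x)) b (G a),
    D.isIndex_erase_erase x y (hG.eraseAll (fun _ _ => ⟨rfl, rfl⟩) (fun z hz => ?_) (fun z hz => ?_))⟩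
  · have hz := mt (hS z).2 hz
    push Not at hz
    simp [hz, ny z hz.1, nb z hz.2.2.1]
  · rcases (hS z).1 hz with rfl | rfl | rfl | rfl
    · simp [hxy, hyx.symm, hbx.symm, hby.symm]
    · simp [ny z hyx, nb z hay.symm, hby.symm, key.1]
    · simp [hab, hne, hay]
    · simp [ny z hbx, nb z hne.symm, k]

theorem isPlanar_reidII (hD : D.IsPlanar) {x y : D.Pt} (hx : D.mate x ≠ x)
    (hy : D.mate y ≠ y) (hox : D.isOver x = true) (hoy : D.isOver y = true)
    (hpos : D.isPos x ≠ D.isPos y) (hxy : D.next x = y)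
    (hm : D.next (D.mate x) = D.mate y ∨ D.next (D.mate y) = D.mate x) :
    ((D.erase x).erase y).IsPlanar := by
  have hD' := D.isPlanar_iff.1 hD
  rw [isPlanar_iff]
  intro f hf
  obtain ⟨h0, h1⟩ := isCycle_of_eraseAll (D.isCycle_erase_erase x y hf)
  obtain ⟨G, hG⟩ := hD' f h0
  exact isIndex_reidII hx hy hox hoy hpos hxy hm h1 hG

end GaussDiagram

/-! ### Determinants of row-modified matrices -/

namespace Matrix

variable {P : Type*} [Fintype P] [DecidableEq P]

theorem det_updateRow_sub {R : Type*} [CommRing R] (A : Matrix P P R) (i : P) (a b : P → R) :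
    (A.updateRow i (a - b)).det = (A.updateRow i a).det - (A.updateRow i b).det := by
  have := A.det_updateRow_add i (a - b) b
  rw [sub_add_cancel] at this
  rw [this]; ring

theorem det_updateRow_updateRow_self {R : Type*} [CommRing R] (A : Matrix P P R) {i j : P} (h : i ≠ j)
    (a : P → R) : ((A.updateRow i a).updateRow j a).det = 0 := by
  apply det_zero_of_row_eq h
  rw [updateRow_self, updateRow_ne h, updateRow_self]

theorem det_updateRow_updateRow_swap {R : Type*} [CommRing R] (A : Matrix P P R) {i j : P} (h : i ≠ j)
    (a b : P → R) :
    ((A.updateRow i a).updateRow j b).det = -((A.updateRow i b).updateRow j a).det := by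
  have h1 := A.det_updateRow_updateRow_self h (a + b)
  rw [det_updateRow_add, updateRow_comm _ h, det_updateRow_add, updateRow_comm A h,
    det_updateRow_add, updateRow_comm _ h.symm, updateRow_comm _ h.symm, updateRow_comm _ h.symm,
    updateRow_comm _ h.symm] at h1
  rw [det_updateRow_updateRow_self A h, det_updateRow_updateRow_self A h] at h1
  linear_combination h1

/-- The skein relation for determinants: the two rows of a crossing are those of a positive crossing,
of a negative crossing, and of the smoothed crossing. -/
theorem det_skein (A : Matrix P P ℝ) {i j : P} (h : i ≠ j) (u v p q : P → ℝ) {s : ℝ} (hs : s ≠ 0) :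
    s⁻¹ * ((A.updateRow i (u - p)).updateRow j (v - (1 - s ^ 2) • p - s ^ 2 • q)).det
      - s * ((A.updateRow i (u - (1 - s⁻¹ ^ 2) • q - s⁻¹ ^ 2 • p)).updateRow j (v - q)).det
      = (s⁻¹ - s) * ((A.updateRow i (u - q)).updateRow j (v - p)).det := by
  have e1 : ∀ (a b c : P → ℝ), ((A.updateRow i (a - b)).updateRow j c).det =
      ((A.updateRow i a).updateRow j c).det - ((A.updateRow i b).updateRow j c).det := by
    intro a b c
    rw [updateRow_comm _ h, det_updateRow_sub, updateRow_comm _ h.symm, updateRow_comm _ h.symm]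
  have e2 : ∀ (r : ℝ) (b c : P → ℝ), ((A.updateRow i (r • b)).updateRow j c).det =
      r * ((A.updateRow i b).updateRow j c).det := by
    intro r b c
    rw [updateRow_comm _ h, det_updateRow_smul, updateRow_comm _ h.symm]
  simp only [det_updateRow_sub, e1, e2, det_updateRow_smul, det_updateRow_updateRow_self A h,
    A.det_updateRow_updateRow_swap h q p]
  field_simp
  ring

/-- Two matrices that vanish on `pᶜ × p`, agree in the rows of `pᶜ` and on `p × p` have the same
determinant. -/
theorem det_eq_of_agree {R : Type*} [CommRing R] (A B : Matrix P P R) (p : P → Prop) [DecidablePred p]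
    (h0 : ∀ i, ¬ p i → ∀ j, p j → A i j = 0) (h1 : ∀ i, ¬ p i → ∀ j, A i j = B i j)
    (h2 : ∀ i, p i → ∀ j, p j → A i j = B i j) : A.det = B.det := by
  rw [twoBlockTriangular_det A p h0,
    twoBlockTriangular_det B p (fun i hi j hj => by rw [← h1 i hi, h0 i hi j hj])]
  congr 2
  · ext ⟨i, hi⟩ ⟨j, hj⟩
    exact h2 i hi j hj
  · ext ⟨i, hi⟩ ⟨j, hj⟩
    exact h1 i hi j

/-- Adding multiples of the row `k` to the other rows. -/
def addRow {R : Type*} [CommRing R] (A : Matrix P P R) (k : P) (c : P → R) : Matrix P P R :=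
  of fun i => A i + c i • A k

theorem addRow_row {R : Type*} [CommRing R] (A : Matrix P P R) (k : P) (c : P → R) (i : P) :
    A.addRow k c i = A i + c i • A k := rfl

theorem det_addRow {R : Type*} [CommRing R] (A : Matrix P P R) (k : P) (c : P → R) (hc : c k = 0) :
    (A.addRow k c).det = A.det :=
  det_eq_of_forall_row_eq_smul_add_const c k hc fun i j => by simp [addRow]

/-- The determinant of a matrix with vanishing row sums and with a left kernel vector `π`, after the
diagonal entry at `e` has been raised by one: its dependence on `e` is that of `π e`. -/
theorem mul_det_add_single (A : Matrix P P ℝ) (h1 : ∀ i, ∑ j, A i j = 0) (w : P → ℝ)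
    (h2 : ∀ j, ∑ i, w i * A i j = 0) (a b : P) :
    w b * (A + single a a 1).det = w a * (A + single b b 1).det := by
  have hA : A.det = 0 := by
    apply exists_mulVec_eq_zero_iff.1
    refine ⟨fun _ => 1, fun h => ?_, ?_⟩
    · have := congrFun h a; simp at this
    · ext i; simpa [mulVec, dotProduct] using h1 i
  -- the matrix with the row `b` replaced by a unit vector
  have hr : ∀ c d : P, (A.updateRow b (Pi.single c 1)).det = (A.updateRow b (Pi.single d 1)).det := by
    intro c d
    have : (A.updateRow b (Pi.single c 1 - Pi.single d 1)).det = 0 := by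
      apply exists_mulVec_eq_zero_iff.1
      refine ⟨fun _ => 1, fun h => ?_, ?_⟩
      · have := congrFun h a; simp at this
      · ext i
        by_cases hi : i = b
        · subst hi
          simp [mulVec, dotProduct, sum_sub_distrib]
        · simpa [mulVec, dotProduct, hi] using h1 i
    rw [det_updateRow_sub] at this
    linarith
  have hs : ∀ c : P, A + single c c 1 = A.updateRow c (A c + Pi.single c 1) := by
    intro c
    ext i j
    by_cases hi : i = c
    · subst hi
      by_cases hj : j = i
      · subst hj; simp
      · simp [hj, Ne.symm hj]
    · simp [hi, Ne.symm hi]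
  have hb : (A + single b b 1).det = (A.updateRow b (Pi.single b 1)).det := by
    rw [hs, det_updateRow_add, updateRow_eq_self, hA, zero_add]
  -- replace the row `b` of `A + single a a 1` by the combination of all rows with coefficients `w`
  have hN : w b * (A + single a a 1).det =
      ((A + single a a 1).updateRow b (∑ i, w i • (A + single a a 1 : Matrix P P ℝ) i)).det := by
    rw [det_updateRow_sum, smul_eq_mul]
  have hw : ∑ i, w i • (A + single a a 1 : Matrix P P ℝ) i = w a • Pi.single a 1 := by
    ext j
    simp only [Finset.sum_apply, Pi.smul_apply, smul_eq_mul, add_apply, mul_add,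
      sum_add_distrib, h2, zero_add]
    rw [sum_eq_single a]
    · by_cases hj : j = a
      · subst hj; simp
      · simp [hj, Ne.symm hj]
    · intro i _ hi
      simp [Ne.symm hi]
    · simp
  rw [hN, hw, det_updateRow_smul, hb]
  congr 1
  rw [hr b a]
  by_cases hab : a = b
  · subst hab
    congr 1
    ext i j
    by_cases hi : i = a
    · subst hi; simp
    · simp [hi, Ne.symm hi]
  · have : (A + single a a 1).updateRow b (Pi.single a 1) =
        (A.updateRow b (Pi.single a 1)).addRow b (fun i => if i = a then 1 else 0) := by
      ext i j
      by_cases hi : i = b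
      · subst hi; simp [addRow, Ne.symm hab]
      · by_cases hia : i = a
        · subst hia
          by_cases hj : j = i
          · subst hj; simp [addRow, hi]
          · simp [addRow, hi, hj, Ne.symm hj]
        · simp [addRow, hi, hia, Ne.symm hia]
    rw [this, det_addRow _ _ _ (by simp [Ne.symm hab])]

/-- Elimination of the columns `y1` and `z1` by means of the rows `x1`, `y1`, `z1`: two matrices that agree
after the elimination have the same determinant. -/
theorem det_eq_of_eliminate {R : Type*} [CommRing R] (A B : Matrix P P R) {x1 y1 z1 y z : P}
    (hxy : x1 ≠ y1) (hxz : x1 ≠ z1) (hyz : y1 ≠ z1) (hyx : y ≠ x1) (hyy : y ≠ y1) (hyz1 : y ≠ z1)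
    (hzx : z ≠ x1) (hzy1 : z ≠ y1) (hzz : z ≠ z1) (hzy : y ≠ z)
    (h : ∀ i, i ≠ y → i ≠ z → i ≠ y1 → i ≠ z1 → A i = B i ∧ A i y1 = 0 ∧ A i z1 = 0)
    (a a' a'' b b' b'' d d' d'' e e' e'' c : R)
    (hy : A y + a • A x1 + a' • A y1 + a'' • A z1 = B y + b • B x1 + b' • B y1 + b'' • B z1)
    (hz : A z + d • A x1 + d' • A y1 + d'' • A z1 = B z + e • B x1 + e' • B y1 + e'' • B z1)
    (hy1 : (A y + a • A x1 + a' • A y1 + a'' • A z1) y1 = 0)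
    (hy2 : (A y + a • A x1 + a' • A y1 + a'' • A z1) z1 = 0)
    (hz1 : (A z + d • A x1 + d' • A y1 + d'' • A z1) y1 = 0)
    (hz2 : (A z + d • A x1 + d' • A y1 + d'' • A z1) z1 = 0)
    (k1 : A y1 y1 = B y1 y1) (k2 : A y1 z1 = B y1 z1) (k3 : A z1 y1 = B z1 y1 + c * B y1 y1)
    (k4 : A z1 z1 = B z1 z1 + c * B y1 z1) : A.det = B.det := by
  have key : ∀ (M : Matrix P P R) (a a' a'' d d' d'' c : R), ∃ N : Matrix P P R, N.det = M.det ∧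
      N y = M y + a • M x1 + a' • M y1 + a'' • M z1 ∧ N z = M z + d • M x1 + d' • M y1 + d'' • M z1 ∧
      N z1 = M z1 + c • M y1 ∧ ∀ i, i ≠ y → i ≠ z → i ≠ z1 → N i = M i := by
    intro M a a' a'' d d' d'' c
    refine ⟨((M.addRow z1 fun i => if i = y then a'' else if i = z then d'' else 0).addRow y1
      fun i => if i = y then a' else if i = z then d' else if i = z1 then c else 0).addRow x1
      fun i => if i = y then a else if i = z then d else 0, ?_, ?_, ?_, ?_, ?_⟩
    · rw [det_addRow _ _ _ (by simp [hyx.symm, hzx.symm]),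
        det_addRow _ _ _ (by simp [hyy.symm, hzy1.symm, hyz]),
        det_addRow _ _ _ (by simp [hyz1.symm, hzz.symm])]
    · simp only [addRow_row, if_true, hyx.symm, hzx.symm, hyy.symm, hzy1.symm, hxz, if_false]
      module
    · simp only [addRow_row, if_true, hyx.symm, hzx.symm, hyy.symm, hzy1.symm, hxz, hzy.symm, if_false]
      module
    · simp only [addRow_row, if_true, hyx.symm, hzx.symm, hyy.symm, hzy1.symm, hxz, hyz1.symm, hzz.symm,
        if_false]
      module
    · intro i h1 h2 h3
      simp only [addRow_row, if_false, h1, h2, h3]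
      module
  obtain ⟨N, hN, Ny, Nz, Nz1, No⟩ := key A a a' a'' d d' d'' 0
  obtain ⟨N', hN', Ny', Nz', Nz1', No'⟩ := key B b b' b'' e e' e'' c
  rw [← hN, ← hN']
  apply det_eq_of_agree _ _ (fun i => i = y1 ∨ i = z1)
  · intro i hi j hj
    push Not at hi
    by_cases h1 : i = y
    · rw [h1, Ny]; rcases hj with rfl | rfl <;> assumption
    by_cases h2 : i = z
    · rw [h2, Nz]; rcases hj with rfl | rfl <;> assumption
    rw [No i h1 h2 hi.2]
    rcases hj with rfl | rfl
    · exact (h i h1 h2 hi.1 hi.2).2.1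
    · exact (h i h1 h2 hi.1 hi.2).2.2
  · intro i hi j
    push Not at hi
    by_cases h1 : i = y
    · rw [h1, Ny, Ny', hy]
    by_cases h2 : i = z
    · rw [h2, Nz, Nz', hz]
    rw [No i h1 h2 hi.2, No' i h1 h2 hi.2, (h i h1 h2 hi.1 hi.2).1]
  · rintro i (rfl | rfl) j hj
    · rw [No _ hyy.symm hzy1.symm hyz, No' _ hyy.symm hzy1.symm hyz]
      rcases hj with rfl | rfl <;> assumption
    · rw [Nz1, Nz1']
      rcases hj with rfl | rfl
      · simpa using k3
      · simpa using k4

end Matrix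

/-! ### The walk matrix -/

section WalkMatrix

open Matrix

variable {P : Type*} [Fintype P] [DecidableEq P]

/-- The unit vectors. -/
local notation:max "δ" k:max => Pi.single k 1

/-- `1 - W` for the random walk `W` along a diagram: a walker that arrives at the marked point `y` continues
to `n y` with "probability" `τ y`, and jumps to the other strand, to go on to `n (m y)`, with "probability"
`1 - τ y`. -/
def walkMatrix (n m : P → P) (τ : P → ℝ) : Matrix P P ℝ :=
  of fun y => δ y - τ y • δ (n y) - (1 - τ y) • δ (n (m y))

/-- The principal cofactor of the walk matrix at `e`. -/
def walkDet (n m : P → P) (τ : P → ℝ) (e : P) : ℝ := (walkMatrix n m τ + single e e 1).det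

theorem walkMatrix_row (n m : P → P) (τ : P → ℝ) (e y : P) :
    (walkMatrix n m τ + single e e 1 : Matrix P P ℝ) y = δ y - τ y • δ (n y)
      - (1 - τ y) • δ (n (m y)) + if y = e then δ e else 0 := by
  ext j
  by_cases hy : y = e
  · subst hy
    by_cases hj : j = y
    · subst hj; simp [walkMatrix]
    · simp [walkMatrix, hj, Ne.symm hj]
  · simp [walkMatrix, hy, Ne.symm hy]

theorem walkDet_base (n m : P → P) (τ : P → ℝ) (hn : Function.Bijective n) (hm : ∀ y, m (m y) = y)
    (w : P → ℝ) (hw : ∀ k, w (n k) = w k * τ k + w (m k) * (1 - τ (m k))) (a b : P) :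
    w b * walkDet n m τ a = w a * walkDet n m τ b := by
  apply mul_det_add_single
  · intro i
    simp [walkMatrix, sum_sub_distrib, ← mul_sum]
  · intro j
    obtain ⟨k, rfl⟩ := hn.2 j
    have hk : ∀ i, n k = n (m i) ↔ i = m k := fun i =>
      ⟨fun h => by rw [hn.1 h, hm], fun h => by rw [h, hm]⟩
    have hk' : ∀ i, n k = n i ↔ i = k := fun i => ⟨fun h => (hn.1 h).symm, fun h => by rw [h]⟩
    simp only [walkMatrix, of_apply, Pi.sub_apply, Pi.smul_apply, Pi.single_apply, smul_eq_mul,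
      mul_sub, sum_sub_distrib, hk, hk']
    simp [hw, eq_comm]

/-- The cofactor vanishes if some part of the diagram is not connected with `e`. -/
theorem walkDet_eq_zero (n m : P → P) (τ : P → ℝ) (e : P) (S : P → Prop) [DecidablePred S] (he : ¬ S e)
    (hn : ∀ y, S (n y) ↔ S y) (hm : ∀ y, S (m y) ↔ S y) (a : P) (ha : S a) : walkDet n m τ e = 0 := by
  apply exists_mulVec_eq_zero_iff.1
  refine ⟨fun y => if S y then 1 else 0, fun h => ?_, ?_⟩
  · have := congrFun h a; simp [ha] at this
  · ext i
    have : ∀ k : P, (δ k : P → ℝ) ⬝ᵥ (fun y => if S y then (1 : ℝ) else 0) =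
        if S k then 1 else 0 := by
      intro k; rw [single_dotProduct, one_mul]
    rw [mulVec, walkMatrix_row, add_dotProduct, sub_dotProduct, sub_dotProduct,
      smul_dotProduct, smul_dotProduct, this, this, this]
    simp only [hn, hm]
    split_ifs with h1 h2
    · exact absurd (h2 ▸ h1) he
    · simp
    · rw [this]; simp [he]
    · simp

/-- A curl contributes the weight of its second passage. -/
theorem walkDet_curl {n m m' : P → P} {τ τ' : P → ℝ} {x : P} (hx : m x ≠ x) (hmm : m (m x) = x)
    (hn : n x = m x)
    (h1 : τ' x = 1) (h2 : τ' (m x) = 1) (h3 : ∀ y, y ≠ x → y ≠ m x → m' y = m y ∧ τ' y = τ y) :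
    walkDet n m τ x = τ (m x) * walkDet n m' τ' x := by
  set N : Matrix P P ℝ := walkMatrix n m' τ' + single x x 1 with hN
  have e1 : N x = (2 : ℝ) • δ x - δ (m x) := by
    rw [hN, walkMatrix_row, h1, hn]
    simp only [if_true]; module
  have e2 : N (m x) = δ (m x) - δ (n (m x)) := by
    rw [hN, walkMatrix_row, h2, if_neg hx]
    module
  have e3 : walkMatrix n m τ + single x x 1 =
      (N.addRow (m x) (fun y => if y = x then 1 - τ x else 0)).updateRow (m x) (τ (m x) • N (m x)) := by
    refine funext fun y => ?_
    rw [walkMatrix_row]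
    by_cases hy : y = m x
    · subst hy
      rw [updateRow_self, e2, hmm, hn, if_neg hx]
      module
    · rw [updateRow_ne hy]
      rw [addRow_row]
      by_cases hyx : y = x
      · subst hyx
        rw [if_pos rfl, if_pos rfl, e1, e2, hn]
        module
      · rw [if_neg hyx, if_neg hyx, hN, walkMatrix_row, (h3 y hyx hy).1, (h3 y hyx hy).2,
          if_neg hyx]
        module
  have e4 : (N.addRow (m x) (fun y => if y = x then 1 - τ x else 0)).updateRow (m x) (N (m x)) =
      N.addRow (m x) (fun y => if y = x then 1 - τ x else 0) := by
    conv_rhs => rw [← updateRow_eq_self (N.addRow (m x) (fun y => if y = x then 1 - τ x else 0)) (m x)]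
    congr 1
    rw [addRow_row, if_neg hx, zero_smul, add_zero]
  rw [walkDet, e3, det_updateRow_smul, e4, det_addRow _ _ _ (by simp [hx])]
  rfl

/-- The removal of a bigon.  The points `a → b` are the under-passages, `x → y` the over-passages. -/
theorem walkDet_bigon {n m m' : P → P} {τ τ' : P → ℝ} {x y a b : P} (hn : Function.Injective n)
    (hm : ∀ z, m (m z) = z)
    (hxy : n x = y) (hab : n a = b) (hax : a ≠ x) (hay : a ≠ y) (hbx : b ≠ x) (hby : b ≠ y)
    (hxy' : x ≠ y) (hab' : a ≠ b)
    (hm' : (m a = x ∧ m b = y) ∨ (m a = y ∧ m b = x))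
    (hτx : τ x = 1) (hτy : τ y = 1) (hτ : τ b * τ a = 1)
    (h1 : ∀ z, z = x ∨ z = y ∨ z = a ∨ z = b → τ' z = 1)
    (h2 : ∀ z, z ≠ x → z ≠ y → z ≠ a → z ≠ b → m' z = m z ∧ τ' z = τ z) :
    walkDet n m τ x = walkDet n m' τ' x := by
  set M : Matrix P P ℝ := walkMatrix n m τ + single x x 1 with hM
  set N : Matrix P P ℝ := walkMatrix n m' τ' + single x x 1 with hN
  have rM : ∀ w, M w = _ := walkMatrix_row n m τ x
  have rN : ∀ w, N w = _ := walkMatrix_row n m' τ' x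
  have My : M y = δ y - δ (n y) := by
    rw [rM, hτy, if_neg hxy'.symm]; module
  have Ma : M a = δ a - τ a • δ b - (1 - τ a) • δ (n (m a)) := by
    rw [rM, hab, if_neg hax]; module
  have Mb : M b = δ b - τ b • δ (n b) - (1 - τ b) • δ (n (m b)) := by
    rw [rM, if_neg hbx]; module
  have Na : N a = δ a - δ b := by
    rw [rN, h1 a (by simp), hab, if_neg hax]; module
  have Nb : N b = δ b - δ (n b) := by
    rw [rN, h1 b (by simp), if_neg hbx]; module
  have Mo : ∀ z, z ≠ a → z ≠ b → M z = N z := by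
    intro z za zb
    rw [rM, rN]
    by_cases zx : z = x
    · subst zx; rw [hτx, h1 z (by simp)]; simp
    by_cases zy : z = y
    · subst zy; rw [hτy, h1 z (by simp)]; simp
    rw [(h2 z zx zy za zb).1, (h2 z zx zy za zb).2]
  obtain ⟨ε, hε⟩ : ∃ ε : ℝ, (δ (n (m a)) - δ (n (m b)) : P → ℝ) = ε • M y := by
    rcases hm' with ⟨h, h'⟩ | ⟨h, h'⟩
    · exact ⟨1, by rw [h, h', hxy, My, one_smul]⟩
    · exact ⟨-1, by rw [h, h', hxy, My]; module⟩
  -- eliminate the entry of the row `a` in the column `b`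
  set M1 := (M.addRow b (fun z => if z = a then τ a else 0)).addRow y
    (fun z => if z = a then (1 - τ a) * ε else 0) with hM1
  set N1 := N.addRow b (fun z => if z = a then 1 else 0) with hN1
  have dM : M1.det = M.det := by
    rw [hM1, det_addRow _ _ _ (by simp [hay.symm]), det_addRow _ _ _ (by simp [hab'.symm])]
  have dN : N1.det = N.det := by
    rw [hN1, det_addRow _ _ _ (by simp [hab'.symm])]
  have M1o : ∀ z, z ≠ a → M1 z = M z := by
    intro z hz
    rw [hM1, addRow_row, addRow_row, addRow_row, if_neg hz, if_neg hz]; module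
  have N1o : ∀ z, z ≠ a → N1 z = N z := by
    intro z hz
    rw [hN1, addRow_row, if_neg hz]; module
  have M1a : M1 a = δ a - δ (n b) := by
    rw [hM1, addRow_row, addRow_row, addRow_row, if_pos rfl, if_pos rfl, if_neg hay.symm, zero_smul, add_zero, mul_smul, ← hε, Ma, Mb]
    have hτ' : τ a * τ b = 1 := by rw [mul_comm]; exact hτ
    have e1 : τ a • (δ b - τ b • δ (n b) - (1 - τ b) • δ (n (m b)) : P → ℝ)
        = τ a • δ b - (1 : ℝ) • δ (n b) - (τ a - 1) • δ (n (m b)) := by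
      rw [smul_sub, smul_sub, smul_smul, smul_smul, hτ', mul_sub, hτ', mul_one]
    rw [e1]; module
  have N1a : N1 a = δ a - δ (n b) := by
    rw [hN1, addRow_row, if_pos rfl, Na, Nb]; module
  have hnb : n b ≠ b := fun h => hab' (hn (hab.trans h.symm))
  have hny : n y ≠ b := fun h => hay (hn (hab.trans h.symm))
  have hmb : n (m b) ≠ b := fun h => by
    have := hn (hab.trans h.symm)
    rcases hm' with ⟨_, h'⟩ | ⟨_, h'⟩
    · exact hay (this.trans h')
    · exact hax (this.trans h')
  rw [walkDet, walkDet, ← hM, ← hN, ← dM, ← dN]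
  apply det_eq_of_agree _ _ (fun z => z = b)
  · rintro i hi j rfl
    by_cases hia : i = a
    · rw [hia, M1a]
      simp [hnb.symm, hab'.symm]
    · have h3 : n i ≠ j := fun h => hia (hn (h.trans hab.symm))
      rw [M1o i hia, rM]
      have h4 : (1 - τ i) * (δ (n (m i)) : P → ℝ) j = 0 := by
        by_cases h : n (m i) = j
        · have h5 : m i = a := hn (h.trans hab.symm)
          have h6 : i = m a := by rw [← h5, hm]
          have : τ i = 1 := by
            rcases hm' with ⟨h7, _⟩ | ⟨h7, _⟩
            · rw [h6, h7, hτx]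
            · rw [h6, h7, hτy]
          rw [this]; simp
        · simp [Ne.symm h]
      have h5 : (if i = x then (δ x : P → ℝ) else 0) j = 0 := by
        split_ifs <;> simp [hbx]
      simp only [Pi.add_apply, Pi.sub_apply, Pi.smul_apply, smul_eq_mul, h4, h5]
      simp [Ne.symm hi, h3.symm]
  · intro i hi j
    by_cases hia : i = a
    · rw [hia, M1a, N1a]
    · rw [M1o i hia, N1o i hia, Mo i hia hi]
  · rintro i rfl j rfl
    rw [M1o _ (Ne.symm hab'), N1o _ (Ne.symm hab'), Mb, Nb]
    simp [hnb.symm, hmb.symm]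

/-- The six points of the list are different. -/
theorem ne_of_nodup_six {α : Type*} {a b c d e f : α} (h : [a, b, c, d, e, f].Nodup) :
    (a ≠ b ∧ a ≠ c ∧ a ≠ d ∧ a ≠ e ∧ a ≠ f) ∧ (b ≠ c ∧ b ≠ d ∧ b ≠ e ∧ b ≠ f) ∧ (c ≠ d ∧ c ≠ e ∧ c ≠ f) ∧
      (d ≠ e ∧ d ≠ f) ∧ e ≠ f := by
  simpa using h

/-- The third Reidemeister move: the points `x → x1` lie on the top strand, `y → y1` on the middle one and
`z → z1` on the bottom one.  Here the middle strand meets the top strand first and the bottom strand afterwards;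
after the move all this is reversed.  The alternative in the hypothesis `h` is whether the bottom strand meets the top
strand or the middle strand first. -/
theorem walkDet_triangle {n m m' : P → P} {τ τ' : P → ℝ} {x x1 y y1 z z1 : P}
    (hn : Function.Injective n) (hnd : [x, x1, y, y1, z, z1].Nodup)
    (hnx : n x = x1) (hny : n y = y1) (hnz : n z = z1)
    (hx : τ x = 1) (hx1 : τ x1 = 1) (hx' : τ' x = 1) (hx1' : τ' x1 = 1) (hy1 : τ y1 = 1) (hy' : τ' y = 1)
    (hmy : m y = x ∨ m y = x1) (hmy1' : m' y1 = x ∨ m' y1 = x1)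
    (h : ((m z = x ∨ m z = x1) ∧ m z1 = y1 ∧ (m' z1 = x ∨ m' z1 = x1) ∧ m' z = y ∧ τ y = τ z) ∨
      ((m z1 = x ∨ m z1 = x1) ∧ m z = y1 ∧ (m' z = x ∨ m' z = x1) ∧ m' z1 = y ∧ τ y * τ z1 = 1))
    (h1 : τ' y1 = τ y) (h2 : τ' z1 = τ z) (h3 : τ' z = τ z1)
    (ho : ∀ i, i ∉ [x, x1, y, y1, z, z1] → m' i = m i ∧ τ' i = τ i ∧ m i ∉ [x, x1, y, y1, z, z1]) :
    walkDet n m τ x = walkDet n m' τ' x := by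
  set A : Matrix P P ℝ := walkMatrix n m τ + single x x 1
  set B : Matrix P P ℝ := walkMatrix n m' τ' + single x x 1
  have rA : ∀ w, A w = _ := walkMatrix_row n m τ x
  have rB : ∀ w, B w = _ := walkMatrix_row n m' τ' x
  obtain ⟨⟨a1, a2, a3, a4, a5⟩, ⟨b2, b3, b4, b5⟩, ⟨c3, c4, c5⟩, ⟨d4, d5⟩, e5⟩ := ne_of_nodup_six hnd
  have hAx1 : A x1 = δ x1 - δ (n x1) := by
    rw [rA, hx1, if_neg a1.symm]; module
  have hBx1 : B x1 = A x1 := by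
    rw [hAx1, rB, hx1', if_neg a1.symm]; module
  have land : ∀ p, p = x ∨ p = x1 → ∃ κ : ℝ, (δ (n p) : P → ℝ) =
      δ (n x1) + κ • A x1 := by
    rintro p (rfl | rfl)
    · exact ⟨1, by rw [hAx1, hnx]; module⟩
    · exact ⟨0, by module⟩
  obtain ⟨κ1, hκ1⟩ := land _ hmy
  obtain ⟨κ3, hκ3⟩ := land _ hmy1'
  have Ay : A y = δ y - τ y • δ y1 - (1 - τ y) • (δ (n x1) + κ1 • A x1) := by
    rw [rA y, hny, if_neg a2.symm, hκ1]; module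
  have Ay1 : A y1 = δ y1 - δ (n y1) := by
    rw [rA, hy1, if_neg a3.symm]; module
  have By : B y = δ y - δ y1 := by
    rw [rB, hy', hny, if_neg a2.symm]; module
  have By1 : B y1 = δ y1 - τ y • δ (n y1)
      - (1 - τ y) • (δ (n x1) + κ3 • A x1) := by
    rw [rB, h1, if_neg a3.symm, hκ3]; module
  have nj : ∀ {p q}, p ≠ q → n p ≠ n q := fun h h' => h (hn h')
  have f1 := (hny ▸ nj b2).symm
  have f2 := (hnz ▸ nj b4).symm
  have f3 : y1 ≠ n y1 := fun h => c3 (hn (hny.trans h))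
  have f4 := (hnz ▸ nj d4).symm
  have f5 := (hny ▸ nj c5.symm).symm
  have f6 : z1 ≠ n z1 := fun h => e5 (hn (hnz.trans h))
  have out : ∀ i, i ≠ y → i ≠ z → i ≠ y1 → i ≠ z1 → A i = B i ∧ A i y1 = 0 ∧ A i z1 = 0 := by
    intro i iy iz iy1 iz1
    by_cases ix : i = x
    · subst ix
      have e1 : A i = (2 : ℝ) • δ i - δ x1 := by
        rw [rA, hx, hnx, if_pos rfl]; module
      have e2 : B i = A i := by
        rw [e1, rB, hx', hnx, if_pos rfl]; module
      refine ⟨e2.symm, ?_, ?_⟩ <;> rw [e1] <;> simp [a3.symm, a5.symm, b3.symm, b5.symm]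
    by_cases ix1 : i = x1
    · subst ix1
      refine ⟨hBx1.symm, ?_, ?_⟩ <;> rw [hAx1] <;> simp [f1, f2, b3.symm, b5.symm]
    obtain ⟨o1, o2, o3⟩ := ho i (by simp [*])
    simp only [List.mem_cons, List.not_mem_nil, or_false, not_or] at o3
    have g1 := nj o3.2.2.1
    have g2 := nj o3.2.2.2.2.1
    have g3 := nj iy
    have g4 := nj iz
    rw [hny] at g1 g3
    rw [hnz] at g2 g4
    refine ⟨by rw [rA, rB, o1, o2], ?_, ?_⟩ <;> rw [rA] <;>
      simp [iy1.symm, iz1.symm, g1.symm, g2.symm, g3.symm, g4.symm, ix]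
  rcases h with ⟨hmz, hmz1, hmz1', hmz', h12⟩ | ⟨hmz1, hmz, hmz', hmz1', h12⟩
  · obtain ⟨κ2, hκ2⟩ := land _ hmz
    obtain ⟨κ4, hκ4⟩ := land _ hmz1'
    have Az : A z = δ z - τ z • δ z1 - (1 - τ z) • (δ (n x1) + κ2 • A x1) := by
      rw [rA z, hnz, if_neg a4.symm, hκ2]; module
    have Az1 : A z1 = δ z1 - τ z1 • δ (n z1) - (1 - τ z1) • δ (n y1) := by
      rw [rA, hmz1, if_neg a5.symm]; module
    have Bz : B z = δ z - τ z1 • δ z1 - (1 - τ z1) • δ y1 := by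
      rw [rB, h3, hnz, if_neg a4.symm, hmz', hny]; module
    have Bz1 : B z1 = δ z1 - τ z • δ (n z1)
        - (1 - τ z) • (δ (n x1) + κ4 • A x1) := by
      rw [rB, h2, if_neg a5.symm, hκ4]; module
    refine det_eq_of_eliminate A B b3 b5 d5 b2.symm c3 c5 b4.symm d4.symm e5 c4 out
      ((1 - τ y) * κ1) (τ y) 0 ((1 - τ y) * κ3) 1 0
      ((1 - τ z) * κ2) 0 (τ z) (τ z1 * (1 - τ z) * κ4 + (1 - τ z1) * (1 - τ y) * κ3) (1 - τ z1) (τ z1) 0 ?_ ?_ ?_ ?_ ?_ ?_ ?_ ?_ ?_ ?_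
    · simp only [By, By1, Bz1, hBx1, Ay, Ay1, Az1]; module
    · simp only [By1, Bz, Bz1, hBx1, Az, Ay1, Az1, ← h12]; module
    all_goals
      simp [Ay, Ay1, Az, Az1, By1, Bz1, hAx1, f1, f2, f3, f4, f5, f6, c3.symm, c5.symm, d4, d5, d5.symm,
        e5.symm, b3.symm, b5.symm]
  · obtain ⟨κ2, hκ2⟩ := land _ hmz1
    obtain ⟨κ4, hκ4⟩ := land _ hmz'
    have Az1 : A z1 = δ z1 - τ z1 • δ (n z1)
        - (1 - τ z1) • (δ (n x1) + κ2 • A x1) := by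
      rw [rA z1, if_neg a5.symm, hκ2]; module
    have Az : A z = δ z - τ z • δ z1 - (1 - τ z) • δ (n y1) := by
      rw [rA, hmz, hnz, if_neg a4.symm]; module
    have Bz1 : B z1 = δ z1 - τ z • δ (n z1) - (1 - τ z) • δ y1 := by
      rw [rB, h2, if_neg a5.symm, hmz1', hny]; module
    have Bz : B z = δ z - τ z1 • δ z1
        - (1 - τ z1) • (δ (n x1) + κ4 • A x1) := by
      rw [rB, h3, hnz, if_neg a4.symm, hκ4]; module
    refine det_eq_of_eliminate A B b3 b5 d5 b2.symm c3 c5 b4.symm d4.symm e5 c4 out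
      ((1 - τ y) * κ1) (τ y) 0 ((1 - τ y) * κ3) 1 0 (τ z * (1 - τ z1) * κ2) 0 (τ z)
      ((1 - τ z1) * κ4 + τ z1 * (1 - τ z) * (1 - τ y) * κ3) (τ z1 * (1 - τ z)) (τ z1) (1 - τ z)
      ?_ ?_ ?_ ?_ ?_ ?_ ?_ ?_ ?_ ?_
    · simp only [By, By1, Bz1, hBx1, Ay, Ay1, Az1]; module
    · simp only [By1, Bz, Bz1, hBx1, Az, Ay1, Az1]
      have e1 : (1 - τ z : ℝ) • (δ (n y1) - δ (n x1) : P → ℝ) =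
          ((1 - τ z) * (τ y * τ z1)) • (δ (n y1) - δ (n x1) : P → ℝ) := by
        rw [h12, mul_one]
      linear_combination (norm := module) -e1
    all_goals
      simp [Ay, Ay1, Az, Az1, By1, Bz1, hAx1, f1, f2, f3, f4, f5, f6, c3.symm, c5.symm, d4, d5, d5.symm,
        e5.symm, b3.symm, b5.symm]

theorem walkDet_skein {n n' m m' : P → P} {τp τm τ0 : P → ℝ} {e i j : P} (hij : i ≠ j) (hmi : m i = j)
    (hmj : m j = i) {s : ℝ} (hs : s ≠ 0) (hpi : τp i = 1) (hpj : τp j = s ^ 2) (hmi' : τm i = s⁻¹ ^ 2)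
    (hmj' : τm j = 1) (h0i : τ0 i = 1) (h0j : τ0 j = 1) (hni : n' i = n j) (hnj : n' j = n i)
    (ho : ∀ k, k ≠ i → k ≠ j →
      τm k = τp k ∧ τ0 k = τp k ∧ n' k = n k ∧ m' k = m k ∧ n' (m k) = n (m k)) :
    s⁻¹ * walkDet n m τp e - s * walkDet n m τm e = (s⁻¹ - s) * walkDet n' m' τ0 e := by
  set A : Matrix P P ℝ := walkMatrix n m τp + single e e 1 with hA
  let d : P → P → ℝ := fun k => δ k + if k = e then δ e else 0
  have hdet := det_skein A hij (d i) (d j) (δ (n i)) (δ (n j)) hs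
  have key : ∀ (B : Matrix P P ℝ) (a b : P → ℝ), B i = a → B j = b → (∀ k, k ≠ i → k ≠ j → B k = A k) →
      B = (A.updateRow i a).updateRow j b := by
    intro B a b h1 h2 h3
    refine funext fun k => ?_
    by_cases hk : k = j
    · subst hk; rw [updateRow_self, h2]
    rw [updateRow_ne hk]
    by_cases hk' : k = i
    · subst hk'; rw [updateRow_self, h1]
    rw [updateRow_ne hk', h3 k hk' hk]
  rw [← key A, ← key (walkMatrix n m τm + single e e 1), ← key (walkMatrix n' m' τ0 + single e e 1)] at hdet
  · exact hdet
  · rw [walkMatrix_row, h0i, hni]; module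
  · rw [walkMatrix_row, h0j, hnj]; module
  · intro k h1 h2
    obtain ⟨a1, a2, a3, a4, a5⟩ := ho k h1 h2
    rw [walkMatrix_row, hA, walkMatrix_row, a2, a3, a4, a5]
  · rw [walkMatrix_row, hmi', hmi]; module
  · rw [walkMatrix_row, hmj']; module
  · intro k h1 h2
    rw [walkMatrix_row, hA, walkMatrix_row, (ho k h1 h2).1]
  · rw [hA, walkMatrix_row, hpi]; module
  · rw [hA, walkMatrix_row, hpj, hmj]; module
  · intro k _ _; rfl

theorem walkDet_congr {Q : Type*} [Fintype Q] [DecidableEq Q] {n m : P → P} {τ : P → ℝ} {n' m' : Q → Q}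
    {τ' : Q → ℝ} (f : P ≃ Q) (hn : ∀ x, n' (f x) = f (n x)) (hm : ∀ x, τ x ≠ 1 → m' (f x) = f (m x))
    (hτ : ∀ x, τ' (f x) = τ x) (e : P) : walkDet n' m' τ' (f e) = walkDet n m τ e := by
  unfold walkDet
  rw [← det_submatrix_equiv_self f]
  congr 1
  refine funext fun i => ?_
  have : ∀ k : P, (δ (f k) : Q → ℝ) ∘ f = δ k := by
    intro k
    ext l
    simp [Pi.single_apply]
  change (walkMatrix n' m' τ' + single (f e) (f e) 1 : Matrix Q Q ℝ) (f i) ∘ f = _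
  rw [walkMatrix_row, walkMatrix_row, hn, hτ]
  have h2 : (1 - τ i) • (Pi.single (n' (m' (f i))) 1 : Q → ℝ) ∘ f = (1 - τ i) • δ (n (m i)) := by
    by_cases h : τ i = 1
    · rw [h]; simp
    · rw [hm i h, hn, this]
  have h3 : (if f i = f e then (δ (f e) : Q → ℝ) else 0) ∘ f = if i = e then δ e else 0 := by
    by_cases h : i = e
    · subst h; rw [if_pos rfl, if_pos rfl, this]
    · rw [if_neg h, if_neg (fun h' => h (f.injective h'))]; rfl
  rw [← h2, ← h3, ← this, ← this]
  rfl

/-- A marked point without a crossing may be inserted in the edge that starts at `a`. -/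
theorem walkDet_option {n m : P → P} {τ : P → ℝ} {n' m' : Option P → Option P} {τ' : Option P → ℝ} {a : P}
    (h1 : n' (some a) = none) (h2 : n' none = some (n a)) (h3 : ∀ y, y ≠ a → n' (some y) = some (n y))
    (hm : ∀ y, m' (some y) = some (m y)) (hτ : ∀ y, τ' (some y) = τ y) (hτ' : τ' none = 1) (e : P) :
    walkDet n' m' τ' (some e) = walkDet n m τ e := by
  set A : Matrix (Option P) (Option P) ℝ := walkMatrix n' m' τ' + single (some e) (some e) 1 with hA
  let c : Option P → ℝ := fun o => o.elim 0 fun y =>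
    (τ y * if y = a then 1 else 0) + (1 - τ y) * if m y = a then 1 else 0
  have An : A none = δ none - δ (some (n a)) := by
    rw [hA, walkMatrix_row, hτ', h2]
    simp
  have hs : ∀ y, (δ (n' (some y)) : Option P → ℝ) =
      δ (some (n y)) + (if y = a then (1 : ℝ) else 0) • A none := by
    intro y
    rw [An]
    by_cases h : y = a
    · subst h; rw [h1, if_pos rfl]; module
    · rw [h3 y h, if_neg h]; module
  have As : ∀ y, A.addRow none c (some y) = δ (some y) - τ y • δ (some (n y))
      - (1 - τ y) • Pi.single (some (n (m y))) 1 + if y = e then δ (some e) else 0 := by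
    intro y
    rw [addRow_row]
    conv_lhs => rw [hA, walkMatrix_row, ← hA]
    rw [hm, hs, hs, hτ]
    simp only [c, Option.elim_some, Option.some.injEq]
    module
  have hdet : A.det = (A.addRow none c).det := (det_addRow A none c rfl).symm
  change A.det = _
  let f : P ⊕ PUnit.{1} ≃ Option P := (Equiv.optionEquivSumPUnit P).symm
  rw [hdet, ← det_submatrix_equiv_self f]
  have : (A.addRow none c).submatrix f f =
      fromBlocks (walkMatrix n m τ + single e e 1) 0 (of fun _ j => A none (some j)) 1 := by
    ext i j
    rcases i with i | i
    · have hi : (walkMatrix n m τ + single e e 1 : Matrix P P ℝ) i = fun j => A.addRow none c (some i) (some j) := by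
        rw [As, walkMatrix_row]
        ext j
        by_cases h : i = e <;> simp [Pi.single_apply, h]
      rcases j with j | j
      · exact (congrFun hi j).symm
      · simp [f, As]
        by_cases h : i = e <;> simp [h]
    · rcases j with j | j
      · simp [f, addRow, c]
      · simp [f, addRow, c, An]
  rw [this, det_fromBlocks_zero₁₂, det_one, mul_one]
  rfl

end WalkMatrix

/-! ### Rotation numbers of systems of circles -/

section Rotation

open Equiv

/-- The function that is `1` on the part of `P` labelled `k`. -/
noncomputable def labelIndicator {P K : Type} (κ : P → K) (k : K) (y : P) : ℤ :=
  open Classical in if κ y = k then 1 else 0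

/-- `r` is the rotation number of the disjoint circles in the plane that are the cycles of `σ`: the number of
the circles that run counterclockwise minus the number of those that run clockwise.
`I f G` says that `G` is the index of the cycle `f`, normalized to vanish at infinity, so that
the index of a circle, on its left side, is `1` if the circle runs counterclockwise and `0` otherwise.
The circles are labelled by the elements of `K`. -/
def IsRotation {P : Type} (σ : Perm P) (I : (P → ℤ) → (P → ℤ) → Prop) (r : ℤ) : Prop :=
  ∃ (K : Type) (_ : Fintype K) (κ : P → K) (G : K → P → ℤ) (g : K → ℤ), Function.Surjective κ ∧
    (∀ y z, κ y = κ z ↔ σ.SameCycle y z) ∧ (∀ k, I (labelIndicator κ k) (G k)) ∧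
    (∀ y, G (κ y) y = g (κ y)) ∧ r = ∑ k, (2 * g k - 1)

variable {P Q : Type} {σ : Perm P} {I : (P → ℤ) → (P → ℤ) → Prop}

theorem eq_of_sameCycle {A : Type} {f : P → A} (hf : ∀ y, f (σ y) = f y) {y z : P} (h : σ.SameCycle y z) :
    f y = f z := by
  obtain ⟨n, rfl⟩ := h
  refine zpow_induction_left (P := fun τ : Perm _ => f y = f (τ y)) rfl (fun τ h => h.trans (hf _).symm) (fun τ h => ?_) n
  rw [h, ← hf ((σ⁻¹ * τ) y), ← Perm.mul_apply, mul_inv_cancel_left]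

theorem labelIndicator_apply_self {K : Type} (κ : P → K) (y : P) : labelIndicator κ (κ y) y = 1 := by
  simp [labelIndicator]

theorem labelIndicator_of_ne {K : Type} {κ : P → K} {k : K} {y : P} (h : κ y ≠ k) :
    labelIndicator κ k y = 0 := by
  simp [labelIndicator, h]

theorem labelIndicator_inv {K : Type} {κ : P → K} (hκ : ∀ y z, κ y = κ z ↔ σ.SameCycle y z) (k : K) (y : P) :
    labelIndicator κ k (σ y) = labelIndicator κ k y := by
  have : κ (σ y) = κ y := (hκ _ _).2 (Perm.SameCycle.refl σ y).apply_left
  rw [labelIndicator, labelIndicator, this]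

theorem IsRotation.unique (hI : ∀ f G G', I f G → I f G' → G = G') {r r' : ℤ} (h : IsRotation σ I r)
    (h' : IsRotation σ I r') : r = r' := by
  obtain ⟨K, _, κ, G, g, hs, hκ, hG, hg, rfl⟩ := h
  obtain ⟨K', _, κ', G', g', hs', hκ', hG', hg', rfl⟩ := h'
  choose y hy using hs
  choose y' hy' using hs'
  have e1 : ∀ z, κ' (y (κ z)) = κ' z := fun z => by rw [hκ', ← hκ, hy]
  have e2 : ∀ z, κ (y' (κ' z)) = κ z := fun z => by rw [hκ, ← hκ', hy']
  let e : K ≃ K' := ⟨fun k => κ' (y k), fun k => κ (y' k), fun k => by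
    change κ (y' (κ' (y k))) = k
    rw [e2, hy], fun k => by
    change κ' (y (κ (y' k))) = k
    rw [e1, hy']⟩
  have he : ∀ z, e (κ z) = κ' z := e1
  refine Fintype.sum_equiv e _ _ fun k => ?_
  obtain ⟨z, rfl⟩ : ∃ z, κ z = k := ⟨_, hy k⟩
  have h1 : labelIndicator κ (κ z) = labelIndicator κ' (κ' z) := by
    funext w
    have : κ w = κ z ↔ κ' w = κ' z := by rw [hκ, hκ']
    by_cases h : κ w = κ z
    · simp [labelIndicator, h, this.1 h]
    · simp [labelIndicator, h, mt this.2 h]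
  have h2 : G (κ z) = G' (κ' z) := hI _ _ _ (hG _) (h1 ▸ hG' _)
  rw [he, ← hg, ← hg', h2]

theorem IsRotation.exists [Finite P] (h1 : ∀ f, (∀ y, f (σ y) = f y) → ∃ G, I f G)
    (h2 : ∀ f G, (∀ y, f (σ y) = f y) → I f G → ∀ y, G (σ y) = G y) : ∃ r, IsRotation σ I r := by
  classical
  let S := Perm.SameCycle.setoid σ
  have : Fintype (Quotient S) := Fintype.ofFinite _
  have hκ : ∀ y z, (Quotient.mk S y = Quotient.mk S z ↔ σ.SameCycle y z) := fun y z => Quotient.eq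
  choose G hG using fun k : Quotient S => h1 (labelIndicator (Quotient.mk S) k) (labelIndicator_inv hκ k)
  refine ⟨_, Quotient S, this, Quotient.mk S, G, fun k => G k k.out, Quotient.mk_surjective, hκ, hG, fun y => ?_,
    rfl⟩
  exact eq_of_sameCycle (h2 _ _ (labelIndicator_inv hκ _) (hG _))
    ((hκ _ _).1 (Quotient.out_eq (Quotient.mk S y)).symm)

theorem sameCycle_comap {ρ : Perm Q} (ι : Q → P)
    (h1 : ∀ f : P → ℤ, (∀ y, f (σ y) = f y) → ∀ y, f (ι (ρ y)) = f (ι y))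
    (h2 : ∀ f : Q → ℤ, (∀ y, f (ρ y) = f y) → ∃ f' : P → ℤ, (∀ y, f' (σ y) = f' y) ∧ ∀ y, f' (ι y) = f y) (y z : Q) :
    σ.SameCycle (ι y) (ι z) ↔ ρ.SameCycle y z := by
  classical
  refine ⟨fun h => ?_, fun h => ?_⟩ <;> by_contra hc
  · obtain ⟨f, hf, hf'⟩ := h2 (fun z => if ρ.SameCycle y z then 1 else 0) fun z => by
      simp only [Perm.sameCycle_apply_right]
    have := eq_of_sameCycle hf h
    rw [hf', hf', if_pos (Perm.SameCycle.refl _ _), if_neg hc] at this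
    exact one_ne_zero this
  · have := eq_of_sameCycle (f := fun z => if σ.SameCycle (ι y) (ι z) then (1 : ℤ) else 0)
      (h1 (fun w => if σ.SameCycle (ι y) w then 1 else 0) fun w => by simp only [Perm.sameCycle_apply_right]) h
    rw [if_pos (Perm.SameCycle.refl _ _), if_neg hc] at this
    exact one_ne_zero this

/-- Transport of rotation numbers along a map that induces a bijection of circles. -/
theorem IsRotation.comap {r : ℤ} (h : IsRotation σ I r) {ρ : Perm Q} {J : (Q → ℤ) → (Q → ℤ) → Prop} (ι : Q → P)
    (h1 : ∀ f : P → ℤ, (∀ y, f (σ y) = f y) → ∀ y, f (ι (ρ y)) = f (ι y))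
    (h2 : ∀ f : Q → ℤ, (∀ y, f (ρ y) = f y) → ∃ f' : P → ℤ, (∀ y, f' (σ y) = f' y) ∧ ∀ y, f' (ι y) = f y)
    (h3 : ∀ p, ∃ q, σ.SameCycle p (ι q))
    (h4 : ∀ f G, (∀ y, f (σ y) = f y) → I f G → J (f ∘ ι) (G ∘ ι)) : IsRotation ρ J r := by
  obtain ⟨K, _, κ, G, g, hs, hκ, hG, hg, rfl⟩ := h
  refine ⟨K, inferInstance, κ ∘ ι, fun k => G k ∘ ι, g, fun k => ?_, fun y z => ?_,
    fun k => h4 _ _ (labelIndicator_inv hκ k) (hG k), fun y => hg (ι y), rfl⟩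
  · obtain ⟨p, rfl⟩ := hs k
    obtain ⟨q, hq⟩ := h3 p
    exact ⟨q, ((hκ _ _).2 hq).symm⟩
  · exact (hκ _ _).trans (sameCycle_comap ι h1 h2 y z)

/-- The circle through `t` is dropped. -/
theorem IsRotation.comap_drop {r : ℤ} (h : IsRotation σ I r) {ρ : Perm Q} {J : (Q → ℤ) → (Q → ℤ) → Prop}
    (ι : Q → P) (t : P) (γ : ℤ)
    (h1 : ∀ f : P → ℤ, (∀ y, f (σ y) = f y) → ∀ y, f (ι (ρ y)) = f (ι y))
    (h2 : ∀ f : Q → ℤ, (∀ y, f (ρ y) = f y) →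
      ∃ f' : P → ℤ, (∀ y, f' (σ y) = f' y) ∧ (∀ y, f' (ι y) = f y) ∧ f' t = 0)
    (h3 : ∀ p, σ.SameCycle p t ∨ ∃ q, σ.SameCycle p (ι q))
    (h4 : ∀ f G, (∀ y, f (σ y) = f y) → I f G → J (f ∘ ι) (G ∘ ι))
    (h5 : ∀ f G, (∀ y, f (σ y) = f y) → I f G → f t = 1 → (∀ q, f (ι q) = 0) → G t = γ) :
    IsRotation ρ J (r - (2 * γ - 1)) := by
  classical
  obtain ⟨K, _, κ, G, g, hs, hκ, hG, hg, rfl⟩ := h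
  have ht : ∀ q, κ (ι q) ≠ κ t := by
    intro q e
    obtain ⟨f, hf, hf', ht⟩ := h2 (fun _ => 1) (fun _ => rfl)
    have := eq_of_sameCycle hf ((hκ _ _).1 e)
    rw [hf', ht] at this
    simp at this
  have hlab : ∀ (k : {k // k ≠ κ t}), labelIndicator (fun q => (⟨κ (ι q), ht q⟩ : {k // k ≠ κ t})) k =
      labelIndicator κ k.1 ∘ ι := by
    intro k
    funext q
    simp only [labelIndicator, Function.comp, Subtype.ext_iff]
  refine ⟨{k // k ≠ κ t}, inferInstance, fun q => ⟨κ (ι q), ht q⟩, fun k => G k.1 ∘ ι, fun k => g k.1, ?_, ?_, ?_,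
    fun y => hg (ι y), ?_⟩
  · rintro ⟨k, hk⟩
    obtain ⟨p, rfl⟩ := hs k
    rcases h3 p with hq | ⟨q, hq⟩
    · exact absurd ((hκ _ _).2 hq) hk
    · exact ⟨q, Subtype.ext ((hκ _ _).2 hq).symm⟩
  · intro y z
    rw [Subtype.mk.injEq]
    exact (hκ _ _).trans (sameCycle_comap ι h1 (fun f hf => (h2 f hf).imp fun _ h => ⟨h.1, h.2.1⟩) y z)
  · intro k
    rw [hlab]
    exact h4 _ _ (labelIndicator_inv hκ k.1) (hG k.1)
  · have hgt : g (κ t) = γ := by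
      rw [← hg]
      exact h5 _ _ (labelIndicator_inv hκ _) (hG _) (labelIndicator_apply_self κ t)
        (fun q => labelIndicator_of_ne (ht q))
    rw [← hgt, ← add_sum_erase _ _ (mem_univ (κ t)), add_sub_cancel_left]
    exact sum_subtype _ (by simp) _

/-- A function that is invariant under `σ * swap a b` is also invariant under `σ`, if `a` and `b` lie on
different cycles of `σ`. -/
theorem inv_of_mul_swap [DecidableEq P] [Finite P] {A : Type} {a b : P} (hab : ¬ σ.SameCycle a b) {f : P → A}
    (hf : ∀ y, f ((σ * swap a b) y) = f y) : (∀ y, f (σ y) = f y) ∧ f a = f b := by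
  have fa : f (σ b) = f a := by have := hf a; rwa [Perm.mul_apply, swap_apply_left] at this
  have fb : f (σ a) = f b := by have := hf b; rwa [Perm.mul_apply, swap_apply_right] at this
  have fo : ∀ y, y ≠ a → y ≠ b → f (σ y) = f y := by
    intro y h1 h2
    have := hf y
    rwa [Perm.mul_apply, swap_apply_of_ne_of_ne h1 h2] at this
  have hba : f b = f a := by
    by_contra hne
    let S : Set P := {y | σ.SameCycle b y ∧ f y = f a}
    have hS : Set.MapsTo σ S S := by
      rintro y ⟨h1, h2⟩
      refine ⟨Perm.sameCycle_apply_right.2 h1, ?_⟩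
      rw [fo y, h2]
      · rintro rfl; exact hab h1.symm
      · rintro rfl; exact hne h2
    have h1 : σ b ∈ S := ⟨Perm.sameCycle_apply_right.2 (Perm.SameCycle.refl _ _), fa⟩
    obtain ⟨y, hy, e⟩ := ((S.toFinite.injOn_iff_bijOn_of_mapsTo hS).1 σ.injective.injOn).surjOn h1
    rw [σ.injective e] at hy
    exact hne hy.2
  refine ⟨fun y => ?_, hba.symm⟩
  by_cases h1 : y = a
  · rw [h1, fb, hba]
  by_cases h2 : y = b
  · rw [h2, fa, hba]
  exact fo y h1 h2

/-- The band move that joins the circles of `a` and `b`. -/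
theorem IsRotation.merge [DecidableEq P] [Finite P] {r : ℤ} (h : IsRotation σ I r) {a b : P} (hab : ¬ σ.SameCycle a b) (δ : ℤ)
    (h2 : ∀ f G, (∀ y, f (σ y) = f y) → I f G → ∀ y, G (σ y) = G y)
    (hadd : ∀ f G f' G', I f G → I f' G' → I (f + f') (G + G'))
    (hδ : ∀ f G, (∀ y, f (σ y) = f y) → I f G → G a - δ * f a = G b - δ * f b) :
    IsRotation (σ * swap a b) I (r + 1 - 2 * δ) := by
  classical
  obtain ⟨K, _, κ, G, g, hs, hκ, hG, hg, rfl⟩ := h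
  have hne : κ a ≠ κ b := fun e => hab ((hκ _ _).1 e)
  let κ' : P → {k // k ≠ κ b} := fun y => if h : κ y = κ b then ⟨κ a, hne⟩ else ⟨κ y, h⟩
  have v1 : ∀ y, κ y = κ b → κ' y = ⟨κ a, hne⟩ := fun y h => dif_pos h
  have v2 : ∀ y (h : κ y ≠ κ b), κ' y = ⟨κ y, h⟩ := fun y h => dif_neg h
  have hσ : ∀ y, κ (σ y) = κ y := fun y => (hκ _ _).2 (Perm.SameCycle.refl σ y).apply_left
  have hκσ : ∀ y, κ' ((σ * swap a b) y) = κ' y := by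
    intro y
    rw [Perm.mul_apply]
    by_cases ya : y = a
    · rw [ya, swap_apply_left, v1 _ (hσ b), v2 _ hne]
    by_cases yb : y = b
    · rw [yb, swap_apply_right, v1 b rfl, v2 _ ((hσ a).trans_ne hne)]
      exact Subtype.ext (hσ a)
    rw [swap_apply_of_ne_of_ne ya yb]
    by_cases h : κ y = κ b
    · rw [v1 _ h, v1 _ ((hσ y).trans h)]
    · rw [v2 _ h, v2 _ ((hσ y).trans_ne h)]
      exact Subtype.ext (hσ y)
  have hlab : ∀ k : {k // k ≠ κ b}, k.1 ≠ κ a → labelIndicator κ' k = labelIndicator κ k.1 := by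
    intro k hk
    funext y
    by_cases h : κ y = κ b
    · rw [labelIndicator_of_ne (k := k.1) (h.trans_ne k.2.symm), labelIndicator_of_ne]
      rw [v1 y h]; exact fun e => hk (congrArg Subtype.val e).symm
    · have : κ' y = k ↔ κ y = k.1 := by rw [v2 y h, Subtype.ext_iff]
      by_cases h' : κ y = k.1
      · simp [labelIndicator, h', this.2 h']
      · simp [labelIndicator, h', mt this.1 h']
  have hlab' : labelIndicator κ' ⟨κ a, hne⟩ = labelIndicator κ (κ a) + labelIndicator κ (κ b) := by
    funext y
    rw [Pi.add_apply]
    by_cases h : κ y = κ b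
    · have e1 : labelIndicator κ (κ b) y = 1 := by simp [labelIndicator, h]
      rw [labelIndicator_of_ne (h.trans_ne hne.symm), e1, ← v1 y h, labelIndicator_apply_self, zero_add]
    · rw [labelIndicator_of_ne (k := κ b) h, add_zero]
      by_cases h' : κ y = κ a
      · simp [labelIndicator, v2 y h, h']
      · simp [labelIndicator, v2 y h, h']
  have hinv : ∀ k y z, κ y = κ z → G k y = G k z := fun k y z e =>
    eq_of_sameCycle (h2 _ _ (labelIndicator_inv hκ k) (hG k)) ((hκ _ _).1 e)
  have d1 := hδ _ _ (labelIndicator_inv hκ (κ a)) (hG (κ a))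
  have d2 := hδ _ _ (labelIndicator_inv hκ (κ b)) (hG (κ b))
  rw [labelIndicator_apply_self, labelIndicator_of_ne hne.symm] at d1
  rw [labelIndicator_apply_self, labelIndicator_of_ne hne] at d2
  have ga := hg a
  have gb := hg b
  refine ⟨{k // k ≠ κ b}, inferInstance, κ', fun k => if k.1 = κ a then G (κ a) + G (κ b) else G k.1,
    fun k => if k.1 = κ a then g (κ a) + g (κ b) - δ else g k.1, ?_, ?_, ?_, ?_, ?_⟩
  · rintro ⟨k, hk⟩
    obtain ⟨y, rfl⟩ := hs k
    exact ⟨y, v2 y hk⟩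
  · intro y z
    constructor
    · intro h
      obtain ⟨i1, i2⟩ := inv_of_mul_swap hab (f := fun z => (σ * swap a b).SameCycle y z)
        (fun z => propext Perm.sameCycle_apply_right)
      have i3 : ∀ w w', κ w = κ w' → (σ * swap a b).SameCycle y w → (σ * swap a b).SameCycle y w' :=
        fun w w' e h => (eq_of_sameCycle (f := fun z => (σ * swap a b).SameCycle y z) i1 ((hκ _ _).1 e)) ▸ h
      have y0 : (σ * swap a b).SameCycle y y := Perm.SameCycle.refl _ _
      by_cases hy : κ y = κ b
      · by_cases hz : κ z = κ b
        · exact i3 _ _ (hy.trans hz.symm) y0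
        · rw [v1 y hy, v2 z hz, Subtype.mk.injEq] at h
          exact i3 _ _ h (i2 ▸ i3 _ _ hy y0)
      · by_cases hz : κ z = κ b
        · rw [v2 y hy, v1 z hz, Subtype.mk.injEq] at h
          exact i3 _ _ hz.symm (i2 ▸ i3 _ _ h y0)
        · rw [v2 y hy, v2 z hz, Subtype.mk.injEq] at h
          exact i3 _ _ h y0
    · exact eq_of_sameCycle hκσ
  · intro k
    by_cases hk : k.1 = κ a
    · obtain rfl : k = ⟨κ a, hne⟩ := Subtype.ext hk
      simp only [if_true, hlab']
      exact hadd _ _ _ _ (hG _) (hG _)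
    · simp only [hk, if_false, hlab k hk]
      exact hG _
  · intro y
    by_cases h : κ y = κ b
    · have e1 := hinv (κ a) y b h
      have e2 := hinv (κ b) y b h
      rw [v1 y h]
      simp only [if_true, Pi.add_apply]
      linarith
    · rw [v2 y h]
      by_cases h' : κ y = κ a
      · have e1 := hinv (κ a) y a h'
        have e2 := hinv (κ b) y a h'
        simp only [h', if_true, Pi.add_apply]
        linarith
      · simp only [h', if_false]
        exact hg y
  · rw [← add_sum_erase _ _ (mem_univ (κ b)),
      ← add_sum_erase _ _ (mem_erase.2 ⟨hne, mem_univ (κ a)⟩),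
      ← add_sum_erase (univ : Finset {k // k ≠ κ b}) _ (mem_univ ⟨κ a, hne⟩)]
    have : ∑ k ∈ (univ.erase (κ b)).erase (κ a), (2 * g k - 1) =
        ∑ k ∈ (univ : Finset {k // k ≠ κ b}).erase ⟨κ a, hne⟩,
          (2 * (if k.1 = κ a then g (κ a) + g (κ b) - δ else g k.1) - 1) := by
      symm
      refine sum_bij (fun k _ => k.1) ?_ ?_ ?_ ?_
      · rintro ⟨k, hk⟩ hk'
        simp only [mem_erase, mem_univ, ne_eq, Subtype.mk.injEq, and_true] at hk' ⊢
        exact ⟨hk', hk⟩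
      · rintro k _ l _ e
        exact Subtype.ext e
      · intro k hk
        simp only [mem_erase, mem_univ, and_true] at hk
        exact ⟨⟨k, hk.2⟩, by simp [hk.1], rfl⟩
      · rintro k hk
        have : k.1 ≠ κ a := fun e => (mem_erase.1 hk).1 (Subtype.ext e)
        simp only [this, if_false]
    rw [this]
    simp only [if_true]
    ring

/-- Two points of a cycle of `σ` lie on different cycles of `σ * swap a b`. -/
theorem not_sameCycle_mul_swap [DecidableEq P] [Finite P] {a b : P} (hne : a ≠ b) (hab : σ.SameCycle a b) :
    ¬ (σ * swap a b).SameCycle a b := by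
  classical
  cases nonempty_fintype P
  have hex : ∃ k : ℕ, 0 < k ∧ (σ ^ k) b = a := by
    obtain ⟨k, hk, -, h⟩ := hab.symm.exists_pow_eq
    exact ⟨k, hk, h⟩
  set k := Nat.find hex with hk
  obtain ⟨k0, hka⟩ := Nat.find_spec hex
  rw [← hk] at k0 hka
  -- the points from `σ b` to `a`
  let S : Set P := {y | ∃ i, 0 < i ∧ i ≤ k ∧ (σ ^ i) b = y}
  have hb : b ∉ S := by
    rintro ⟨i, i0, ik, hi⟩
    rcases Nat.lt_or_eq_of_le ik with h | h
    · refine Nat.find_min hex (m := k - i) (by omega) ⟨by omega, ?_⟩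
      have : (σ ^ (k - i + i)) b = a := by rw [Nat.sub_add_cancel ik, hka]
      rwa [pow_add, Perm.mul_apply, hi] at this
    · exact hne (by rw [← hka, ← h, hi])
  have hS : ∀ y ∈ S, (σ * swap a b) y ∈ S := by
    rintro y ⟨i, i0, ik, rfl⟩
    rw [Perm.mul_apply]
    by_cases h : (σ ^ i) b = a
    · rw [h, swap_apply_left]
      exact ⟨1, one_pos, k0, by simp⟩
    · have h2 : (σ ^ i) b ≠ b := fun e => hb ⟨i, i0, ik, e⟩
      rw [swap_apply_of_ne_of_ne h h2]
      refine ⟨i + 1, by omega, Nat.succ_le_of_lt (lt_of_le_of_ne ik ?_), by rw [pow_succ', Perm.mul_apply]⟩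
      rintro rfl
      exact h hka
  intro hc
  obtain ⟨i, -, hi⟩ := hc.exists_pow_eq'
  refine hb (hi ▸ ?_)
  clear hi
  induction i with
  | zero => exact ⟨k, k0, le_rfl, hka⟩
  | succ i ih => rw [pow_succ', Perm.mul_apply]; exact hS _ ih

/-- A band move between the circles (or the circle) of `a` and `b` changes the rotation number by `±1`, according to
the side on which the band is attached. -/
theorem IsRotation.band [DecidableEq P] [Finite P] {r : ℤ} (h : IsRotation σ I r) {a b : P} (hne : a ≠ b) (δ : ℤ)
    (hu : ∀ f G G', I f G → I f G' → G = G') (hadd : ∀ f G f' G', I f G → I f' G' → I (f + f') (G + G'))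
    (h1 : ∀ f, (∀ y, f ((σ * swap a b) y) = f y) → ∃ G, I f G)
    (h2 : ∀ f G, (∀ y, f (σ y) = f y) → I f G → (∀ y, G (σ y) = G y) ∧ G a - δ * f a = G b - δ * f b)
    (h2' : ∀ f G, (∀ y, f ((σ * swap a b) y) = f y) → I f G →
      (∀ y, G ((σ * swap a b) y) = G y) ∧ G a - (1 - δ) * f a = G b - (1 - δ) * f b) :
    IsRotation (σ * swap a b) I (r + 1 - 2 * δ) := by
  by_cases hab : σ.SameCycle a b
  · obtain ⟨r', hr'⟩ := IsRotation.exists h1 fun f G hf hG => (h2' f G hf hG).1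
    have := hr'.merge (not_sameCycle_mul_swap hne hab) (1 - δ) (fun f G hf hG => (h2' f G hf hG).1) hadd
      fun f G hf hG => (h2' f G hf hG).2
    rw [mul_assoc, swap_mul_self, mul_one] at this
    have e := this.unique hu h
    have : r + 1 - 2 * δ = r' := by linarith
    rwa [this]
  · exact h.merge hab δ (fun f G hf hG => (h2 f G hf hG).1) hadd fun f G hf hG => (h2 f G hf hG).2

end Rotation

/-! ### The state of a diagram at a point of the parameter line -/

namespace GaussDiagram

noncomputable instance (D : GaussDiagram) : Fintype D.Pt := @Fintype.ofFinite _ D.finite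

noncomputable instance (D : GaussDiagram) : DecidableEq D.Pt := Classical.decEq _

instance (D : GaussDiagram) : Finite D.Pt := D.finite

/-- The cycles of this permutation are the Seifert circles of the diagram: each strand that arrives at a crossing
leaves along the other strand. -/
def seifert (D : GaussDiagram) : Perm D.Pt := (Function.Involutive.toPerm D.mate D.mate_mate).trans D.next

theorem seifert_apply (D : GaussDiagram) (x : D.Pt) : D.seifert x = D.next (D.mate x) := rfl

/-- An index that vanishes on the left of the edge that ends at `e`. -/
def NormIndex (D : GaussDiagram) (e : D.Pt) (f G : D.Pt → ℤ) : Prop := D.IsIndex f G ∧ G e = 0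

/-- The transition weight of the random walk at `y`: a walker on an under-passage stays on its strand with
weight `s²` (at a positive crossing) or `s⁻²` (at a negative one). -/
noncomputable def weight (D : GaussDiagram) (s : ℝ) (y : D.Pt) : ℝ :=
  if D.mate y = y ∨ D.isOver y = true then 1 else if D.isPos y = true then s ^ 2 else s⁻¹ ^ 2

/-- The contribution of `y` to the writhe. -/
noncomputable def sign (D : GaussDiagram) (y : D.Pt) : ℤ :=
  if D.mate y ≠ y ∧ D.isOver y = true then if D.isPos y = true then 1 else -1 else 0

noncomputable def writhe (D : GaussDiagram) : ℤ := ∑ y, D.sign y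

/-- `v` is the Conway polynomial of the planar diagram `D` at `z = s⁻¹ - s`, as computed from the walk matrix
(this is the Alexander polynomial up to a unit) normalized by the rotation number of the
Seifert circles and by the writhe. -/
def HasValue (s : ℝ) (D : GaussDiagram) (v : ℝ) : Prop :=
  D.IsPlanar ∧ ∃ e r, IsRotation D.seifert (D.NormIndex e) r ∧
    v = s ^ (r + 1 - D.writhe) * walkDet D.next D.mate (D.weight s) e

variable {D D' : GaussDiagram}

theorem weight_congr (s : ℝ) {y : D.Pt} {y' : D'.Pt} (h1 : D'.mate y' = y' ↔ D.mate y = y)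
    (h2 : D.mate y ≠ y → D'.isOver y' = D.isOver y ∧ D'.isPos y' = D.isPos y) :
    D'.weight s y' = D.weight s y := by
  by_cases h : D.mate y = y
  · simp [weight, h, h1.2 h]
  · simp [weight, h1, h2 h]

theorem sign_congr {y : D.Pt} {y' : D'.Pt} (h1 : D'.mate y' = y' ↔ D.mate y = y)
    (h2 : D.mate y ≠ y → D'.isOver y' = D.isOver y ∧ D'.isPos y' = D.isPos y) : D'.sign y' = D.sign y := by
  by_cases h : D.mate y = y
  · simp [sign, h, h1.2 h]
  · simp [sign, h1, h2 h]

theorem weight_of_mate_eq {y : D.Pt} (s : ℝ) (h : D.mate y = y) : D.weight s y = 1 :=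
  if_pos (.inl h)

theorem weight_of_isOver {y : D.Pt} (s : ℝ) (h : D.isOver y = true) : D.weight s y = 1 :=
  if_pos (.inr h)

theorem weight_of_under {y : D.Pt} (s : ℝ) (h : D.mate y ≠ y) (h' : D.isOver y = false) :
    D.weight s y = if D.isPos y = true then s ^ 2 else s⁻¹ ^ 2 :=
  if_neg (by rintro (e | e); exacts [h e, by rw [h'] at e; simp at e])

theorem sign_of_mate_eq {y : D.Pt} (h : D.mate y = y) : D.sign y = 0 :=
  if_neg fun h' => h'.1 h

theorem sign_of_under {y : D.Pt} (h : D.isOver y = false) : D.sign y = 0 :=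
  if_neg fun h' => by rw [h] at h'; simp at h'

theorem sign_of_isOver {y : D.Pt} (h : D.mate y ≠ y) (h' : D.isOver y = true) :
    D.sign y = if D.isPos y = true then 1 else -1 := if_pos ⟨h, h'⟩

theorem isCycle_of_seifert {f : D.Pt → ℤ} (h : ∀ y, f (D.seifert y) = f y) : D.IsCycle f := by
  intro x
  have h1 := h x
  have h2 := h (D.mate x)
  rw [seifert_apply] at h1 h2
  rw [D.mate_mate] at h2
  rw [h1, h2, add_comm]

theorem IsIndex.seifert_at {f G : D.Pt → ℤ} (hG : D.IsIndex f G) {z : D.Pt}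
    (h2 : f (D.seifert (D.mate z)) = f (D.mate z)) : G (D.seifert z) = G z := by
  rw [seifert_apply] at h2 ⊢
  rw [D.mate_mate] at h2
  by_cases hy : D.mate z = z
  · rw [hy]; exact hG.ordinary z hy
  by_cases hl : D.crossedToLeft z = true
  · exact (hG.left z hy hl).1
  · obtain ⟨e1, e2, e3⟩ := hG.right hy hl
    linarith

theorem IsIndex.seifert {f G : D.Pt → ℤ} (h : ∀ y, f (D.seifert y) = f y) (hG : D.IsIndex f G)
    (y : D.Pt) : G (D.seifert y) = G y := hG.seifert_at (h _)

theorem IsIndex.add {f G f' G' : D.Pt → ℤ} (h : D.IsIndex f G) (h' : D.IsIndex f' G') :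
    D.IsIndex (f + f') (G + G') := by
  refine ⟨fun x hx => ?_, fun x hx hl => ?_⟩
  · simp only [Pi.add_apply, h.ordinary x hx, h'.ordinary x hx]
  · obtain ⟨a1, a2, a3⟩ := h.left x hx hl
    obtain ⟨b1, b2, b3⟩ := h'.left x hx hl
    refine ⟨?_, ?_, ?_⟩ <;> simp only [Pi.add_apply] <;> linarith

theorem IsIndex.sub {f G f' G' : D.Pt → ℤ} (h : D.IsIndex f G) (h' : D.IsIndex f' G') :
    D.IsIndex (f - f') (G - G') := by
  refine ⟨fun x hx => ?_, fun x hx hl => ?_⟩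
  · simp only [Pi.sub_apply, h.ordinary x hx, h'.ordinary x hx]
  · obtain ⟨a1, a2, a3⟩ := h.left x hx hl
    obtain ⟨b1, b2, b3⟩ := h'.left x hx hl
    refine ⟨?_, ?_, ?_⟩ <;> simp only [Pi.sub_apply] <;> linarith

theorem isIndex_const (D : GaussDiagram) (c : ℤ) : D.IsIndex 0 (fun _ => c) :=
  ⟨fun _ _ => rfl, fun _ _ _ => by simp⟩

theorem isIndex_sum {K : Type} (S : Finset K) {f G : K → D.Pt → ℤ}
    (h : ∀ k, D.IsIndex (f k) (G k)) : D.IsIndex (∑ k ∈ S, f k) (∑ k ∈ S, G k) := by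
  classical
  induction S using Finset.induction_on with
  | empty => exact D.isIndex_const 0
  | insert a S ha ih => rw [sum_insert ha, sum_insert ha]; exact (h a).add ih

theorem NormIndex.add {e : D.Pt} {f G f' G' : D.Pt → ℤ} (h : D.NormIndex e f G)
    (h' : D.NormIndex e f' G') : D.NormIndex e (f + f') (G + G') :=
  ⟨h.1.add h'.1, by rw [Pi.add_apply, h.2, h'.2, add_zero]⟩

theorem exists_normIndex (hD : D.IsPlanar) (e : D.Pt) {f : D.Pt → ℤ} (hf : D.IsCycle f) :
    ∃ G, D.NormIndex e f G := by
  obtain ⟨G, hG⟩ := D.isPlanar_iff.1 hD f hf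
  refine ⟨G - fun _ => G e, ?_, by simp⟩
  have := hG.sub (D.isIndex_const (G e))
  rwa [sub_zero] at this

theorem exists_isRotation (hD : D.IsPlanar) (e : D.Pt) :
    ∃ r, IsRotation D.seifert (D.NormIndex e) r :=
  IsRotation.exists (fun _ hf => exists_normIndex hD e (isCycle_of_seifert hf))
    fun _ _ hf hG => hG.1.seifert hf

/-- Every two edges of the diagram are connected. -/
def IsConnected (D : GaussDiagram) : Prop :=
  ∀ S : D.Pt → Prop, (∀ y, S (D.next y) ↔ S y) → (∀ y, S (D.mate y) ↔ S y) → ∀ a b, S a → S b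

theorem isConnected_of_walkDet_ne_zero {τ : D.Pt → ℝ} {e : D.Pt}
    (h : walkDet D.next D.mate τ e ≠ 0) : D.IsConnected := by
  classical
  intro S h1 h2 a b ha
  by_contra hb
  by_cases he : S e
  · exact h (walkDet_eq_zero _ _ τ e (fun y => ¬ S y) (by simpa using he) (fun y => not_congr (h1 y))
      (fun y => not_congr (h2 y)) b hb)
  · exact h (walkDet_eq_zero _ _ τ e S he h1 h2 a ha)

theorem NormIndex.unique (hD : D.IsConnected) {e : D.Pt} {f G G' : D.Pt → ℤ}
    (h : D.NormIndex e f G) (h' : D.NormIndex e f G') : G = G' := by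
  have hs : D.IsIndex (f - f) (G - G') := h.1.sub h'.1
  rw [sub_self] at hs
  have key : ∀ y, (G - G') (D.next y) = (G - G') y ∧ (G - G') (D.mate y) = (G - G') y := by
    intro y
    by_cases hy : D.mate y = y
    · exact ⟨hs.ordinary y hy, by rw [hy]⟩
    by_cases hl : D.crossedToLeft y = true
    · obtain ⟨e1, e2, e3⟩ := hs.left y hy hl
      exact ⟨by simpa using e3, by simpa using e2⟩
    · obtain ⟨e1, e2, e3⟩ := hs.right hy hl
      exact ⟨by simpa [e2] using e1, by simpa using e2.symm⟩
  funext y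
  have := hD (fun y => (G - G') y = 0) (fun y => by rw [(key y).1]) (fun y => by rw [(key y).2]) e y
    (by rw [Pi.sub_apply, h.2, h'.2, sub_zero])
  exact sub_eq_zero.1 this

/-- The weights `s ^ (2 * G)`, for the index `G` of the cycle that is `1` everywhere, are stationary. -/
theorem weight_stationary {s : ℝ} (hs : 0 < s) {f G : D.Pt → ℤ} (hG : D.IsIndex f G)
    (hf : ∀ y, f y = 1) (k : D.Pt) :
    s ^ (2 * G (D.next k)) = s ^ (2 * G k) * D.weight s k +
      s ^ (2 * G (D.mate k)) * (1 - D.weight s (D.mate k)) := by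
  by_cases hk : D.mate k = k
  · have : D.weight s k = 1 := by simp [weight, hk]
    rw [hk, this, hG.ordinary k hk]; ring
  have hk' := D.mate_mate_ne hk
  have ho' := D.isOver_mate k hk
  have hp' := D.isPos_mate k
  have s0 := hs.ne'
  have e2 : ∀ a b : ℤ, a = b - 1 → s ^ (2 * a) = s ^ (2 * b) * s⁻¹ ^ 2 := by
    rintro a b rfl
    rw [mul_sub, zpow_sub₀ s0]; norm_cast; rw [inv_pow]; rfl
  by_cases hl : D.crossedToLeft k = true
  · obtain ⟨a1, a2, a3⟩ := hG.left k hk hl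
    rw [hf] at a2 a3
    rw [e2 _ _ a3, e2 _ _ a2]
    cases ho : D.isOver k
    · have hp : D.isPos k = false := by rw [crossedToLeft, ho] at hl; simpa using hl
      simp [weight, ho', ho, hp, hk]
    · have hp : D.isPos k = true := by rw [crossedToLeft, ho] at hl; simpa using hl
      simp [weight, ho', ho, hp, hp', hk, hk']
      field_simp
      ring
  · obtain ⟨a1, a2, a3⟩ := hG.right hk hl
    rw [hf] at a2 a3
    rw [a1, e2 _ _ a2]
    cases ho : D.isOver k
    · have hp : D.isPos k = true := by rw [crossedToLeft, ho] at hl; simpa using hl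
      simp [weight, ho', ho, hp, hk]
      field_simp
    · have hp : D.isPos k = false := by rw [crossedToLeft, ho] at hl; simpa using hl
      simp [weight, ho', ho, hp, hp', hk, hk']
      ring

/-- The value may be computed at an arbitrary base point. -/
theorem HasValue.eq_at {s : ℝ} (hs : 0 < s) {v : ℝ} (h : HasValue s D v) {e : D.Pt} {r : ℤ}
    (hr : IsRotation D.seifert (D.NormIndex e) r) :
    v = s ^ (r + 1 - D.writhe) * walkDet D.next D.mate (D.weight s) e := by
  obtain ⟨hD, e0, r0, hr0, rfl⟩ := h
  obtain ⟨K, _, κ, G, g, hsj, hκ, hG, hg, hr0'⟩ := id hr0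
  have hsum : (∑ k, labelIndicator κ k) = fun _ => 1 := by
    classical
    funext y
    rw [Finset.sum_apply, sum_eq_single (κ y)]
    · exact labelIndicator_apply_self κ y
    · intro k _ hk; exact labelIndicator_of_ne hk.symm
    · simp
  have hG1 : D.IsIndex (∑ k, labelIndicator κ k) (∑ k, G k) := isIndex_sum _ fun k => (hG k).1
  have hbase := walkDet_base D.next D.mate (D.weight s) D.next.bijective D.mate_mate
    (fun y => s ^ (2 * (∑ k, G k) y)) (weight_stationary hs hG1 (fun y => by rw [hsum])) e0 e
  have h0 : (∑ k, G k) e0 = 0 := by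
    rw [Finset.sum_apply]; exact sum_eq_zero fun k _ => (hG k).2
  simp only [h0, mul_zero, zpow_zero, one_mul] at hbase
  by_cases hdet : walkDet D.next D.mate (D.weight s) e0 = 0
  · rw [hdet, mul_zero] at hbase
    rw [hdet, ← hbase, mul_zero, mul_zero]
  have hc := isConnected_of_walkDet_ne_zero hdet
  have : IsRotation D.seifert (D.NormIndex e) (r0 - 2 * (∑ k, G k) e) := by
    refine ⟨K, inferInstance, κ, fun k => G k - fun _ => G k e, fun k => g k - G k e, hsj, hκ, fun k => ⟨?_, ?_⟩,
      fun y => ?_, ?_⟩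
    · have := (hG k).1.sub (D.isIndex_const (G k e))
      rwa [sub_zero] at this
    · simp
    · simp [hg]
    · rw [hr0', Finset.sum_apply, mul_sum, ← sum_sub_distrib]
      exact sum_congr rfl fun k _ => by ring
  have hr' := this.unique (fun f G G' h h' => h.unique hc h') hr
  rw [← hbase, ← mul_assoc, ← zpow_add₀ hs.ne', ← hr']
  congr 2
  ring

theorem exists_hasValue (s : ℝ) (hD : D.IsPlanar) (hne : Nonempty D.Pt) : ∃ v, HasValue s D v := by
  obtain ⟨e⟩ := hne
  obtain ⟨r, hr⟩ := exists_isRotation hD e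
  exact ⟨_, hD, e, r, hr, rfl⟩

theorem HasValue.unique {s : ℝ} (hs : 0 < s) {v v' : ℝ} (h : HasValue s D v)
    (h' : HasValue s D v') : v = v' := by
  obtain ⟨_, e, r, hr, rfl⟩ := h'
  exact h.eq_at hs hr

theorem hasValue_iff {s : ℝ} (hs : 0 < s) (hD : D.IsPlanar) (hD' : D'.IsPlanar) (e : D.Pt)
    (e' : D'.Pt) (c : ℤ)
    (h0 : walkDet D.next D.mate (D.weight s) e = s ^ c * walkDet D'.next D'.mate (D'.weight s) e')
    (h1 : D.IsConnected → D'.IsConnected → ∀ r, IsRotation D.seifert (D.NormIndex e) r →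
      IsRotation D'.seifert (D'.NormIndex e') (r - D.writhe + c + D'.writhe)) (v : ℝ) :
    HasValue s D v ↔ HasValue s D' v := by
  obtain ⟨r, hr⟩ := exists_isRotation hD e
  obtain ⟨r', hr'⟩ := exists_isRotation hD' e'
  have key : s ^ (r + 1 - D.writhe) * walkDet D.next D.mate (D.weight s) e =
      s ^ (r' + 1 - D'.writhe) * walkDet D'.next D'.mate (D'.weight s) e' := by
    by_cases hz : walkDet D'.next D'.mate (D'.weight s) e' = 0
    · rw [h0, hz]; simp
    have hz' : walkDet D.next D.mate (D.weight s) e ≠ 0 := by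
      rw [h0]; exact mul_ne_zero (zpow_ne_zero _ hs.ne') hz
    have hc' := isConnected_of_walkDet_ne_zero hz
    have := (h1 (isConnected_of_walkDet_ne_zero hz') hc' r hr).unique (fun f G G' h h' => h.unique hc' h') hr'
    rw [h0, ← mul_assoc, ← zpow_add₀ hs.ne', ← this]
    congr 2
    ring
  constructor
  · intro h
    exact ⟨hD', e', r', hr', (h.eq_at hs hr).trans key⟩
  · intro h
    exact ⟨hD, e, r, hr, (h.eq_at hs hr').trans key.symm⟩

end GaussDiagram

/-! ### The skein relation and the unknot -/

theorem sum_eq_add_of_pair {ι : Type*} [Fintype ι] [DecidableEq ι] {i j : ι} (hij : i ≠ j) (f g : ι → ℤ)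
    (h : ∀ k, k ≠ i → k ≠ j → f k = g k) : ∑ k, f k = ∑ k, g k + (f i - g i) + (f j - g j) := by
  have : ∑ k, (f k - g k) = (f i - g i) + (f j - g j) :=
    Fintype.sum_eq_add i j hij fun k hk => by rw [h k hk.1 hk.2, sub_self]
  rw [sum_sub_distrib] at this
  linarith

namespace GaussDiagram

theorem seifert_smooth (D : GaussDiagram) {x : D.Pt} : (D.smooth x).seifert = D.seifert := by
  refine Equiv.ext fun (y : D.Pt) => ?_
  by_cases h : D.SameCrossing x y
  · rcases h with rfl | rfl
    · exact (congrArg (D.smooth y).next (D.smooth_mate_of_same (D.sameCrossing_self y))).trans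
        (D.smooth_next_self y)
    · refine (congrArg (D.smooth x).next (D.smooth_mate_of_same (D.sameCrossing_mate_self x))).trans
        ((D.smooth_next_mate x).trans (congrArg D.next (D.mate_mate x).symm))
  · exact (congrArg (D.smooth x).next (D.smooth_mate_of_not_same h)).trans
      (D.smooth_next_of_not_same (by rwa [D.sameCrossing_mate]))

theorem hasValue_skein {s : ℝ} (hs : 0 < s) {D : GaussDiagram} (hD : D.IsPlanar) {x : D.Pt} (hx : D.IsCrossing x)
    (hpos : D.isPos x = true) {vp vm vz : ℝ} (hp : HasValue s D vp) (hm : HasValue s (D.switch x) vm)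
    (hz : HasValue s (D.smooth x) vz) : vp - vm = (s⁻¹ - s) * vz := by
  -- `i` is the over-passage and `j` the under-passage
  obtain ⟨i, j, hij, hmi, hmj, si, sj, oi, oj, pi, pj, hsame⟩ : ∃ i j : D.Pt, i ≠ j ∧ D.mate i = j ∧ D.mate j = i ∧
      D.SameCrossing x i ∧ D.SameCrossing x j ∧ D.isOver i = true ∧ D.isOver j = false ∧ D.isPos i = true ∧
      D.isPos j = true ∧ ∀ k, D.SameCrossing x k → k = i ∨ k = j := by
    have ho := D.isOver_mate x hx
    cases hox : D.isOver x
    · exact ⟨D.mate x, x, hx, D.mate_mate x, rfl, D.sameCrossing_mate_self x, D.sameCrossing_self x, by simp [ho, hox],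
        hox, by rw [D.isPos_mate, hpos], hpos, fun k hk => hk.symm⟩
    · exact ⟨x, D.mate x, Ne.symm hx, rfl, D.mate_mate x, D.sameCrossing_self x, D.sameCrossing_mate_self x, hox,
        by simp [ho, hox], hpos, by rw [D.isPos_mate, hpos], fun k hk => hk⟩
  have nsame : ∀ k, k ≠ i → k ≠ j → ¬ D.SameCrossing x k := fun k h1 h2 h => (hsame k h).elim h1 h2
  have mi : D.mate i ≠ i := by rw [hmi]; exact hij.symm
  have mj : D.mate j ≠ j := by rw [hmj]; exact hij
  have ovi : (D.switch x).isOver i = false := (if_pos si).trans (by rw [oi]; rfl)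
  have ovj : (D.switch x).isOver j = true := (if_pos sj).trans (by rw [oj]; rfl)
  have psi : (D.switch x).isPos i = false := (if_pos si).trans (by rw [pi]; rfl)
  have psj : (D.switch x).isPos j = false := (if_pos sj).trans (by rw [pj]; rfl)
  have ovk : ∀ k, k ≠ i → k ≠ j → (D.switch x).isOver k = D.isOver k := fun k h1 h2 => if_neg (nsame k h1 h2)
  have psk : ∀ k, k ≠ i → k ≠ j → (D.switch x).isPos k = D.isPos k := fun k h1 h2 => if_neg (nsame k h1 h2)
  have zmi : (D.smooth x).mate i = i := D.smooth_mate_of_same si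
  have zmj : (D.smooth x).mate j = j := D.smooth_mate_of_same sj
  have zmk : ∀ k, k ≠ i → k ≠ j → (D.smooth x).mate k = D.mate k :=
    fun k h1 h2 => D.smooth_mate_of_not_same (nsame k h1 h2)
  have znk : ∀ k, k ≠ i → k ≠ j → (D.smooth x).next k = D.next k :=
    fun k h1 h2 => D.smooth_next_of_not_same (nsame k h1 h2)
  have hsw := congrFun (congrArg DFunLike.coe (D.seifert_smooth (x := x)))
  have zni : (D.smooth x).next i = D.next j :=
    ((congrArg (D.smooth x).next zmi).symm.trans (hsw i)).trans (congrArg D.next hmi)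
  have znj : (D.smooth x).next j = D.next i :=
    ((congrArg (D.smooth x).next zmj).symm.trans (hsw j)).trans (congrArg D.next hmj)
  have wm : (D.switch x).writhe = D.writhe - 2 := by
    change ∑ y : D.Pt, (D.switch x).sign y = ∑ y, D.sign y - 2
    rw [sum_eq_add_of_pair hij (fun y : D.Pt => (D.switch x).sign y) D.sign]
    · have e1 : (D.switch x).sign i = 0 := sign_of_under ovi
      have e2 : (D.switch x).sign j = -1 := (sign_of_isOver (D := D.switch x) mj ovj).trans (if_neg (by rw [psj]; simp))
      have e3 : D.sign i = 1 := by simp [sign, mi, oi, pi]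
      have e4 : D.sign j = 0 := by simp [sign, oj]
      rw [e3, e4]
      change _ + ((D.switch x).sign i - 1) + ((D.switch x).sign j - 0) = _
      rw [e1, e2]; ring
    · intro k h1 h2
      exact sign_congr (D' := D.switch x) Iff.rfl fun _ => ⟨ovk k h1 h2, psk k h1 h2⟩
  have wz : (D.smooth x).writhe = D.writhe - 1 := by
    change ∑ y : D.Pt, (D.smooth x).sign y = ∑ y, D.sign y - 1
    rw [sum_eq_add_of_pair hij (fun y : D.Pt => (D.smooth x).sign y) D.sign]
    · have e1 : (D.smooth x).sign i = 0 := sign_of_mate_eq zmi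
      have e2 : (D.smooth x).sign j = 0 := sign_of_mate_eq zmj
      have e3 : D.sign i = 1 := by simp [sign, mi, oi, pi]
      have e4 : D.sign j = 0 := by simp [sign, oj]
      rw [e3, e4]
      change _ + ((D.smooth x).sign i - 1) + ((D.smooth x).sign j - 0) = _
      rw [e1, e2]; ring
    · intro k h1 h2
      exact sign_congr (D' := D.smooth x) (by rw [← zmk k h1 h2]; rfl) fun _ => ⟨rfl, rfl⟩
  obtain ⟨r, hr⟩ := exists_isRotation hD i
  have hrm : IsRotation (D.switch x).seifert ((D.switch x).NormIndex i) r :=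
    hr.comap (fun y => y) (fun f hf => hf) (fun f hf => ⟨f, hf, fun _ => rfl⟩)
      (fun p => ⟨p, .refl _ _⟩)
      (fun f G _ h => ⟨(D.isIndex_switch x).2 h.1, h.2⟩)
  have hrz : IsRotation (D.smooth x).seifert ((D.smooth x).NormIndex i) r := by
    refine hr.comap (fun (y : D.Pt) => y) (fun f hf y => ?_) (fun f hf => ⟨f, fun y => ?_, fun _ => rfl⟩)
      (fun p => ⟨p, .refl _ _⟩) (fun f G hf h => ⟨?_, h.2⟩)
    · exact (congrArg f (hsw y)).trans (hf y)
    · exact (congrArg f (hsw y)).symm.trans (hf y)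
    · refine isIndex_smooth hx (hf x) ?_ h.1
      have := hf (D.mate x)
      rwa [seifert_apply, D.mate_mate] at this
  rw [hp.eq_at hs hr, hm.eq_at hs hrm, hz.eq_at hs hrz, wm, wz]
  have hdet := walkDet_skein (P := D.Pt) (n := D.next) (n' := (D.smooth x).next) (m := D.mate)
    (m' := (D.smooth x).mate) (τp := D.weight s) (τm := (D.switch x).weight s) (τ0 := (D.smooth x).weight s)
    (e := i) hij hmi hmj hs.ne' (by simp [weight, oi]) (by simp [weight, mj, oj, pj])
    ((weight_of_under (D := D.switch x) s mi ovi).trans (if_neg (by rw [psi]; simp)))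
    (weight_of_isOver (D := D.switch x) s ovj)
    (weight_of_mate_eq (D := D.smooth x) s zmi) (weight_of_mate_eq (D := D.smooth x) s zmj) zni znj
    (fun k h1 h2 => by
      have m1 : D.mate k ≠ i := fun e => h2 ((mate_eq_symm e).symm.trans hmi)
      have m2 : D.mate k ≠ j := fun e => h1 ((mate_eq_symm e).symm.trans hmj)
      exact ⟨weight_congr (D' := D.switch x) s Iff.rfl fun _ => ⟨ovk k h1 h2, psk k h1 h2⟩,
        weight_congr (D' := D.smooth x) s (by rw [← zmk k h1 h2]; rfl) fun _ => ⟨rfl, rfl⟩,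
        znk k h1 h2, zmk k h1 h2, znk _ m1 m2⟩)
  have hdet' : s⁻¹ * walkDet D.next D.mate (D.weight s) i -
      s * walkDet (D.switch x).next (D.switch x).mate ((D.switch x).weight s) i =
      (s⁻¹ - s) * walkDet (D.smooth x).next (D.smooth x).mate ((D.smooth x).weight s) i := hdet
  have e1 : s ^ (r + 1 - D.writhe) = s ^ (r + 1 - D.writhe + 1) * s⁻¹ := by
    rw [zpow_add_one₀ hs.ne', mul_assoc, mul_inv_cancel₀ hs.ne', mul_one]
  have e2 : s ^ (r + 1 - (D.writhe - 2)) = s ^ (r + 1 - D.writhe + 1) * s := by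
    rw [← zpow_add_one₀ hs.ne']; congr 1; ring
  have e3 : s ^ (r + 1 - (D.writhe - 1)) = s ^ (r + 1 - D.writhe + 1) := by
    congr 1; ring
  rw [e1, e2, e3]
  linear_combination s ^ (r + 1 - D.writhe + 1) * hdet'

theorem walkDet_subsingleton {P : Type*} {F F' : Fintype P} {d d' : DecidableEq P} (n m : P → P) (τ : P → ℝ) (e : P) :
    @walkDet P F d n m τ e = @walkDet P F' d' n m τ e := by
  obtain rfl : F = F' := Subsingleton.elim _ _
  obtain rfl : d = d' := Subsingleton.elim _ _
  rfl

theorem walkDet_circle {P : Type*} [Fintype P] [inst : DecidableEq P] (n : Perm P) (m : P → P) (τ : P → ℝ)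
    (hτ : ∀ y, τ y = 1) (hn : ∀ y z, n.SameCycle y z) (e : P) : walkDet n m τ e = 1 := by
  let W : Matrix P P ℝ := walkMatrix n m τ + Matrix.single e e 1
  have row : ∀ y, W y = Pi.single y 1 - Pi.single (n y) 1 + if y = e then Pi.single e 1 else 0 := by
    intro y
    dsimp only [W]
    rw [walkMatrix_row, hτ]; module
  -- the rows add up to the unit vector of `e`
  have hsum : ∑ y, (1 : ℝ) • W y = Pi.single e 1 := by
    simp only [one_smul, row, sum_add_distrib, sum_sub_distrib]
    rw [Equiv.sum_comp n (fun y => (Pi.single y 1 : P → ℝ)), sub_self, zero_add]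
    simp
  have hdet := Matrix.det_updateRow_sum W e (fun _ => 1)
  rw [hsum, one_smul] at hdet
  change Matrix.det W = 1
  rw [← hdet]
  -- the points in the order `n e, n (n e), …, e`
  have hex : ∀ y, ∃ i : ℕ, (n ^ i) (n e) = y := fun y => by
    obtain ⟨i, -, hi⟩ := (hn (n e) y).exists_pow_eq'
    exact ⟨i, hi⟩
  let b : P → ℕ := fun y => Nat.find (hex y)
  have hb : ∀ y, (n ^ b y) (n e) = y := fun y => Nat.find_spec (hex y)
  have hbi : Function.Injective b := fun y z h => by rw [← hb y, ← hb z, h]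
  have hlt : ∀ y, y ≠ e → b y < b (n y) := by
    intro y hy
    have := hb (n y)
    rcases h : b (n y) with _ | j
    · rw [h, pow_zero, Perm.one_apply] at this
      exact absurd (n.injective this).symm hy
    · rw [h, pow_succ', Perm.mul_apply] at this
      exact Nat.lt_succ_of_le (Nat.find_min' (hex y) (n.injective this))
  let _ : LinearOrder P := LinearOrder.lift' b hbi
  have htri : (W.updateRow e (Pi.single e 1)).BlockTriangular id := by
    intro i j hij
    have hij' : b j < b i := hij
    by_cases hi : i = e
    · subst hi
      rw [Matrix.updateRow_self, Pi.single_apply, if_neg]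
      rintro rfl; exact lt_irrefl _ hij'
    · rw [Matrix.updateRow_ne hi, row, if_neg hi]
      have h1 : j ≠ i := by rintro rfl; exact lt_irrefl _ hij'
      have h2 : j ≠ n i := by rintro rfl; exact absurd hij' (hlt i hi).not_gt
      simp [h1, h2]
  have := Matrix.det_of_isUpperTriangular htri
  have hd : (fun a b => instDecidableEqOfLawfulBEq a b : DecidableEq P) = inst := Subsingleton.elim _ _
  convert this
  symm
  refine Finset.prod_eq_one fun y _ => ?_
  by_cases hy : y = e
  · subst hy; rw [Matrix.updateRow_self]; simp
  · rw [Matrix.updateRow_ne hy, row, if_neg hy]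
    have : y ≠ n y := fun h => absurd (hlt y hy) (by rw [← h]; exact lt_irrefl _)
    simp [this]

theorem hasValue_circle (s : ℝ) {D : GaussDiagram} (h : D.IsCrossinglessCircle) : HasValue s D 1 := by
  obtain ⟨⟨e⟩, hm, hc⟩ := h
  have hD := isPlanar_of_crossingless hm
  refine ⟨hD, e, -1, ⟨Unit, inferInstance, fun _ => (), fun _ _ => 0, fun _ => 0, fun _ => ⟨e, rfl⟩, fun y z => ?_,
    fun _ => ⟨⟨fun _ _ => rfl, fun x hx => absurd (hm x) hx⟩, rfl⟩, fun _ => rfl, by simp⟩, ?_⟩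
  · have : D.seifert = D.next := Equiv.ext fun x => by rw [seifert_apply, hm]
    simp [this, hc]
  · have : D.writhe = 0 := sum_eq_zero fun y _ => sign_of_mate_eq (hm y)
    rw [this, walkDet_circle _ _ _ (fun y => weight_of_mate_eq s (hm y)) hc]
    simp

/-! ### Invariance under relabelling and subdivision -/

theorem HasValue.nonempty {s v : ℝ} {D : GaussDiagram} (h : HasValue s D v) : Nonempty D.Pt := by
  obtain ⟨_, e, _⟩ := h
  exact ⟨e⟩

section Iso

variable {D D' : GaussDiagram} (e : D.Pt ≃ D'.Pt) (hnext : ∀ x, D'.next (e x) = e (D.next x))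
  (hmate : ∀ x, D'.mate (e x) = e (D.mate x))
  (hover : ∀ x, D.IsCrossing x → D'.isOver (e x) = D.isOver x)
  (hpos : ∀ x, D.IsCrossing x → D'.isPos (e x) = D.isPos x)

include hnext hmate hover hpos

theorem isIndex_iso {f G : D.Pt → ℤ} (h : D.IsIndex f G) : D'.IsIndex (f ∘ e.symm) (G ∘ e.symm) := by
  refine ⟨fun y hy => ?_, fun y hy hl => ?_⟩ <;> obtain ⟨x, rfl⟩ := e.surjective y
  · rw [hmate] at hy
    simpa [hnext] using h.ordinary x (e.injective hy)
  · rw [hmate] at hy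
    have hx : D.mate x ≠ x := fun h => hy (by rw [h])
    have := h.left x hx (by rw [crossedToLeft, hover x hx, hpos x hx] at hl; exact hl)
    simpa [hnext, hmate] using this

theorem isPlanar_iso (h : D.IsPlanar) : D'.IsPlanar := by
  rw [isPlanar_iff] at *
  intro f hf
  obtain ⟨G, hG⟩ := h (f ∘ e) fun x => by
    have := hf (e x)
    simpa [hnext, hmate] using this
  have := isIndex_iso e hnext hmate hover hpos hG
  exact ⟨_, by simpa [Function.comp_assoc] using this⟩

theorem hasValue_iso {s : ℝ} (hs : 0 < s) (hD : D.IsPlanar) (v : ℝ) : HasValue s D v ↔ HasValue s D' v := by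
  have hD' : D'.IsPlanar := isPlanar_iso e hnext hmate hover hpos hD
  rcases isEmpty_or_nonempty D.Pt with hE | ⟨⟨a⟩⟩
  · constructor
    · intro h; obtain ⟨a⟩ := h.nonempty; exact hE.elim a
    · intro h; obtain ⟨a⟩ := h.nonempty; exact hE.elim (e.symm a)
  have hm : ∀ x, D'.mate (e x) = e x ↔ D.mate x = x := fun x => by rw [hmate, e.injective.eq_iff]
  refine hasValue_iff hs hD hD' a (e a) 0 ?_ ?_ v
  · rw [zpow_zero, one_mul]
    exact (walkDet_congr e hnext (fun x _ => hmate x)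
      (fun x => weight_congr s (hm x) fun h => ⟨hover x h, hpos x h⟩) a).symm
  · intro _ _ r hr
    have hw : D.writhe = D'.writhe :=
      Fintype.sum_equiv e _ _ fun x => (sign_congr (hm x) fun h => ⟨hover x h, hpos x h⟩).symm
    rw [hw, add_zero, sub_add_cancel]
    have hσ : ∀ x, D'.seifert (e x) = e (D.seifert x) := fun x => by
      rw [seifert_apply, seifert_apply, hmate, hnext]
    refine hr.comap e.symm (fun f hf y => ?_) (fun f hf => ⟨f ∘ e, fun y => ?_, fun y => ?_⟩)
      (fun p => ⟨e p, ?_⟩) fun f G _ h => ⟨isIndex_iso e hnext hmate hover hpos h.1, by simp [h.2]⟩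
    · obtain ⟨x, rfl⟩ := e.surjective y
      rw [hσ, e.symm_apply_apply, e.symm_apply_apply, hf]
    · rw [Function.comp_apply, ← hσ, hf]; rfl
    · simp
    · rw [e.symm_apply_apply]

end Iso

section Subdivide

variable (D : GaussDiagram) (a : D.Pt)

theorem subdivide_next_none : (D.subdivide a).next none = some (D.next a) := by
  classical
  exact congrArg (Equiv.optionCongr D.next) (swap_apply_right (some a) none)

theorem subdivide_next_some_self : (D.subdivide a).next (some a) = none := by
  classical
  exact congrArg (Equiv.optionCongr D.next) (swap_apply_left (some a) none)

theorem subdivide_next_some {y : D.Pt} (h : y ≠ a) : (D.subdivide a).next (some y) = some (D.next y) := by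
  classical
  exact congrArg (Equiv.optionCongr D.next)
    (swap_apply_of_ne_of_ne (fun e => h (Option.some.inj e)) (Option.some_ne_none y))

theorem subdivide_mate_some (y : D.Pt) : (D.subdivide a).mate (some y) = some (D.mate y) := rfl

theorem subdivide_mate_none : (D.subdivide a).mate none = none := rfl

/-- The edge of `D` on which the edge of the subdivided diagram that ends at a given point lies. -/
def subdivideEdge (y : Option D.Pt) : D.Pt := y.elim (D.next a) id

theorem subdivideEdge_next_some (y : D.Pt) :
    D.subdivideEdge a ((D.subdivide a).next (some y)) = D.next y := by
  by_cases h : y = a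
  · subst h; rw [subdivide_next_some_self]; rfl
  · rw [subdivide_next_some _ _ h]; rfl

theorem isIndex_subdivide {f G : D.Pt → ℤ} (h : D.IsIndex f G) :
    (D.subdivide a).IsIndex (f ∘ D.subdivideEdge a) (G ∘ D.subdivideEdge a) := by
  refine ⟨fun (y : Option D.Pt) hy => ?_, fun (y : Option D.Pt) hy hl => ?_⟩ <;> rcases y with _ | y
  · exact (congrArg (G ∘ D.subdivideEdge a) (D.subdivide_next_none a) :)
  · have := h.ordinary y (Option.some.inj hy)
    exact (congrArg G (D.subdivideEdge_next_some a y)).trans this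
  · exact absurd rfl hy
  · obtain ⟨e1, e2, e3⟩ := h.left y (fun e => hy (congrArg some e)) hl
    have k1 := D.subdivideEdge_next_some a y
    have k2 := D.subdivideEdge_next_some a (D.mate y)
    refine ⟨(congrArg G k2).trans e1, e2, (congrArg G k1).trans (e3.trans ?_)⟩
    exact congrArg (fun z => G y - f z) k2.symm

theorem isPlanar_subdivide {D : GaussDiagram} (hD : D.IsPlanar) (a : D.Pt) : (D.subdivide a).IsPlanar := by
  rw [isPlanar_iff] at *
  intro f hf
  have hn : f (some (D.next a)) = f none := by
    have := hf none
    rw [subdivide_mate_none, subdivide_next_none] at this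
    linarith
  have hf' : f = (fun y => f (some y)) ∘ D.subdivideEdge a := by
    funext (y : Option D.Pt)
    rcases y with _ | y
    · exact hn.symm
    · rfl
  have hsn : ∀ y, f ((D.subdivide a).next (some y)) = f (some (D.next y)) := by
    intro y
    rw [hf']
    exact congrArg (fun y => f (some y)) (D.subdivideEdge_next_some a y)
  obtain ⟨G, hG⟩ := hD (fun y => f (some y)) fun x => by
    have := hf (some x)
    rwa [subdivide_mate_some, hsn, hsn] at this
  rw [hf']
  exact ⟨_, D.isIndex_subdivide a hG⟩

theorem hasValue_subdivide {D : GaussDiagram} {s : ℝ} (hs : 0 < s) (hD : D.IsPlanar) (a : D.Pt) (v : ℝ) :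
    HasValue s D v ↔ HasValue s (D.subdivide a) v := by
  refine hasValue_iff hs hD (isPlanar_subdivide hD a) a (some a : Option D.Pt) 0 ?_ ?_ v
  · rw [zpow_zero, one_mul]
    refine (walkDet_option (n := D.next) (a := a) (τ := D.weight s) (m := D.mate) (n' := (D.subdivide a).next)
      (m' := (D.subdivide a).mate) (τ' := (D.subdivide a).weight s) (D.subdivide_next_some_self a)
      (D.subdivide_next_none a) (fun y hy => D.subdivide_next_some a hy) (fun y => rfl) (fun y => ?_)
      (weight_of_mate_eq (D := D.subdivide a) s rfl) a).symm.trans (walkDet_subsingleton _ _ _ _)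
    exact weight_congr (D' := D.subdivide a) s (Option.some_inj (a := D.mate y)) fun _ => ⟨rfl, rfl⟩
  · intro _ _ r hr
    have hw : (D.subdivide a).writhe = D.writhe := by
      have h0 : (D.subdivide a).writhe = ∑ y : Option D.Pt, (D.subdivide a).sign y :=
        Fintype.sum_equiv (ι := (D.subdivide a).Pt) (κ := Option D.Pt) (Equiv.refl (Option D.Pt)) _ _ fun _ => rfl
      refine h0.trans ((Fintype.sum_option _).trans ?_)
      rw [sign_of_mate_eq (D := D.subdivide a) (y := (none : Option D.Pt)) rfl, zero_add]
      exact sum_congr rfl fun y _ =>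
        sign_congr (D' := D.subdivide a) (Option.some_inj (a := D.mate y)) fun _ => ⟨rfl, rfl⟩
    rw [hw, add_zero, sub_add_cancel]
    have hσ : ∀ y, D.subdivideEdge a ((D.subdivide a).seifert (some y)) = D.seifert y := fun y =>
      D.subdivideEdge_next_some a (D.mate y)
    refine hr.comap (D.subdivideEdge a) (fun f hf (y : Option D.Pt) => ?_)
      (fun f hf => ⟨fun y => f (some y), fun y => ?_, fun (y : Option D.Pt) => ?_⟩)
      (fun p => ⟨(some p : Option D.Pt), .refl _ _⟩) fun f G _ h => ⟨D.isIndex_subdivide a h.1, h.2⟩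
    · rcases y with _ | y
      · exact (congrArg (fun z => f (D.subdivideEdge a z)) (D.subdivide_next_none a) :)
      · exact (congrArg f (hσ y)).trans (hf y)
    · have h1 := hf (some y)
      have h2 := hf none
      have e2 : (D.subdivide a).seifert none = some (D.next a) := D.subdivide_next_none a
      rw [e2] at h2
      by_cases hy : D.mate y = a
      · have e1 : (D.subdivide a).seifert (some y) = none :=
          (congrArg (fun z => (D.subdivide a).next (some z)) hy).trans (D.subdivide_next_some_self a)
        rw [e1] at h1
        refine (congrArg (fun z => f (some (D.next z))) hy).trans (h2.trans h1)
      · have e1 : (D.subdivide a).seifert (some y) = some (D.next (D.mate y)) := D.subdivide_next_some a hy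
        rw [e1] at h1
        exact h1
    · rcases y with _ | y
      · have h2 := hf none
        have e2 : (D.subdivide a).seifert none = some (D.next a) := D.subdivide_next_none a
        rw [e2] at h2
        exact h2
      · rfl

end Subdivide

end GaussDiagram

/-! ### Invariance under the first two Reidemeister moves -/

namespace GaussDiagram

theorem next_ne {D : GaussDiagram} {w w1 z : D.Pt} (hw : D.next w = w1) (hz : z ≠ w) : D.next z ≠ w1 := fun e =>
  hz (D.next.injective (e.trans hw.symm))

theorem sameCycle_seifert {D : GaussDiagram} (z : D.Pt) : D.seifert.SameCycle (D.seifert z) z :=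
  Perm.sameCycle_apply_left.2 (.refl _ _)

theorem isRotation_reidI {D : GaussDiagram} {x : D.Pt} (hx : D.mate x ≠ x) (h : D.next x = D.mate x) {r : ℤ}
    (hr : IsRotation D.seifert (D.NormIndex x) r) :
    IsRotation (D.erase x).seifert ((D.erase x).NormIndex x) (r + if D.crossedToLeft x then 1 else -1) := by
  have hn : ∀ z, z ≠ x → D.next z ≠ D.mate x := fun z => next_ne h
  have sx : D.seifert x = D.next (D.mate x) := rfl
  have smx : D.seifert (D.mate x) = D.mate x := by rw [seifert_apply, D.mate_mate, h]
  have m1 : (D.erase x).mate x = x := D.erase_mate_of_same (D.sameCrossing_self x)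
  have m2 : (D.erase x).mate (D.mate x) = D.mate x := D.erase_mate_of_same (D.sameCrossing_mate_self x)
  obtain ⟨ρ, hρ⟩ : ∃ ρ : Perm D.Pt, ρ = (D.erase x).seifert := ⟨_, rfl⟩
  have e1 : ρ x = D.mate x := by rw [hρ]; exact (congrArg D.next m1).trans h
  have e2 : ρ (D.mate x) = D.next (D.mate x) := by rw [hρ]; exact congrArg D.next m2
  have e3 : ∀ z, z ≠ x → z ≠ D.mate x → ρ z = D.seifert z ∧ D.seifert z ≠ D.mate x := by
    intro z z1 z2
    have hz : ¬ D.SameCrossing x z := fun h => h.elim z1 z2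
    rw [hρ]
    refine ⟨congrArg D.next (D.erase_mate_of_not_same hz), hn _ fun (e : D.mate z = x) => ?_⟩
    exact z2 (mate_eq_symm e).symm
  let ι : D.Pt → D.Pt := fun y => if y = D.mate x then x else y
  have ι1 : ι (D.mate x) = x := if_pos rfl
  have ι2 : ∀ z, z ≠ D.mate x → ι z = z := fun z hz => if_neg hz
  have inv : ∀ f : D.Pt → ℤ, (∀ y, f (D.seifert y) = f y) → ∀ y, f (ι (ρ y)) = f (ι y) := by
    intro f hf y
    by_cases y1 : y = x
    · rw [y1, e1, ι1, ι2 x hx.symm]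
    by_cases y2 : y = D.mate x
    · rw [y2, e2, ι1, ι2 _ (hn _ hx), ← sx, hf]
    · rw [(e3 y y1 y2).1, ι2 _ (e3 y y1 y2).2, ι2 _ y2, hf]
  obtain ⟨J, hJ⟩ : ∃ J : (D.Pt → ℤ) → (D.Pt → ℤ) → Prop, J = (D.erase x).NormIndex x := ⟨_, rfl⟩
  suffices IsRotation ρ J (r + if D.crossedToLeft x then 1 else -1) by
    subst hρ hJ; exact this
  have key := hr.comap_drop (ρ := ρ) (J := J) ι (D.mate x)
    (if D.crossedToLeft x then 0 else 1) inv ?_ ?_ ?_ ?_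
  · convert key using 1
    split_ifs <;> ring
  · intro f hf
    have f1 : f (D.mate x) = f x := e1 ▸ hf x
    have f2 : f (D.next (D.mate x)) = f (D.mate x) := e2 ▸ hf (D.mate x)
    refine ⟨Function.update f (D.mate x) 0, fun y => ?_, fun y => ?_, Function.update_self _ _ _⟩
    · by_cases y1 : y = x
      · rw [y1, Function.update_of_ne hx.symm, sx, Function.update_of_ne (hn _ hx), f2, f1]
      by_cases y2 : y = D.mate x
      · rw [y2, smx]
      · rw [Function.update_of_ne y2, Function.update_of_ne (e3 y y1 y2).2, ← (e3 y y1 y2).1, hf]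
    · by_cases y2 : y = D.mate x
      · rw [y2, ι1, Function.update_of_ne hx.symm, f1]
      · rw [ι2 y y2, Function.update_of_ne y2]
  · intro p
    by_cases hp : p = D.mate x
    · left; rw [hp]
    · right; exact ⟨p, by rw [ι2 p hp]⟩
  · intro f G hf hG
    have inv' := inv G (hG.1.seifert hf)
    subst hρ hJ
    refine ⟨hG.1.eraseAll (hS := fun y => D.sameCrossing_mate x y) (fun z hz => ?_) (fun z hz => ?_) (fun z hz => ?_),
      (congrArg G (ι2 x hx.symm)).trans hG.2⟩
    iterate 2
      have z1 : z ≠ x := fun e => hz (.inl e)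
      have z2 : z ≠ D.mate x := fun e => hz (.inr e)
      simp only [Function.comp, ι2 z z2, ι2 _ (hn z z1), and_self]
    · exact (congrArg (fun w => G (ι (D.next w))) (D.erase_mate_of_same hz)).symm.trans (inv' z)
  · intro f G hf hG ft f0
    have fx : f x = 0 := by have := f0 x; rwa [ι2 x hx.symm] at this
    have gx := hG.2
    by_cases hl : D.crossedToLeft x = true
    · obtain ⟨a1, a2, a3⟩ := hG.1.left x hx hl
      rw [if_pos hl]; linarith
    · obtain ⟨a1, a2, a3⟩ := hG.1.right hx hl
      rw [if_neg hl]; linarith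

theorem hasValue_reidI {D : GaussDiagram} {s : ℝ} (hs : 0 < s) (hD : D.IsPlanar) {x : D.Pt} (hx : D.mate x ≠ x)
    (h : D.next x = D.mate x) (v : ℝ) : HasValue s D v ↔ HasValue s (D.erase x) v := by
  have m1 : (D.erase x).mate x = x := D.erase_mate_of_same (D.sameCrossing_self x)
  have m2 : (D.erase x).mate (D.mate x) = D.mate x := D.erase_mate_of_same (D.sameCrossing_mate_self x)
  have m3 : ∀ k, k ≠ x → k ≠ D.mate x → (D.erase x).mate k = D.mate k :=
    fun k h1 h2 => D.erase_mate_of_not_same fun h => h.elim h1 h2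
  have hx' := D.mate_mate_ne hx
  have hw : (D.erase x).writhe = D.writhe - D.sign x - D.sign (D.mate x) := by
    change ∑ y : D.Pt, (D.erase x).sign y = ∑ y, D.sign y - _ - _
    rw [sum_eq_add_of_pair hx.symm (fun y : D.Pt => (D.erase x).sign y) D.sign]
    · have e1 : (D.erase x).sign x = 0 := sign_of_mate_eq (D := D.erase x) m1
      have e2 : (D.erase x).sign (D.mate x) = 0 := sign_of_mate_eq (D := D.erase x) m2
      linarith
    · intro k h1 h2
      exact sign_congr (D' := D.erase x) (by rw [← m3 k h1 h2]; rfl) fun _ => ⟨rfl, rfl⟩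
  have hdet := walkDet_curl (n := D.next) (m := D.mate) (m' := (D.erase x).mate) (τ := D.weight s)
    (τ' := (D.erase x).weight s) hx (D.mate_mate x) h (weight_of_mate_eq (D := D.erase x) s m1)
    (weight_of_mate_eq (D := D.erase x) s m2) fun k h1 h2 => ⟨m3 k h1 h2,
      weight_congr (D' := D.erase x) s (by rw [← m3 k h1 h2]; rfl) fun _ => ⟨rfl, rfl⟩⟩
  have ho' := D.isOver_mate x hx
  have hp' := D.isPos_mate x
  have key : ∃ c : ℤ, D.weight s (D.mate x) = s ^ c ∧
      -D.sign x - D.sign (D.mate x) + c = if D.crossedToLeft x then 1 else -1 := by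
    cases ho : D.isOver x
    · rw [ho] at ho'
      refine ⟨0, by rw [weight_of_isOver s ho', zpow_zero], ?_⟩
      rw [sign_of_under ho, sign_of_isOver hx' ho', hp', crossedToLeft, ho]
      cases D.isPos x <;> simp
    · rw [ho] at ho'
      rw [weight_of_under s hx' ho', sign_of_under ho', sign_of_isOver hx ho, hp', crossedToLeft, ho]
      cases D.isPos x
      · exact ⟨-2, by simp, by simp⟩
      · exact ⟨2, by simp, by simp⟩
  obtain ⟨c, hc, hc'⟩ := key
  refine hasValue_iff hs hD (isPlanar_reidI hD hx h) x x c (by rw [← hc]; exact hdet) (fun _ _ r hr => ?_) v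
  have := isRotation_reidI hx h hr
  rw [← hc'] at this
  convert this using 1
  rw [hw]; ring

section Bigon

variable {D : GaussDiagram} {x y : D.Pt}

local notation "𝓔" => erase (erase D x) y

/-- The successor in the diagram from which a bigon has been removed. -/
theorem seifert_erase_erase_of_same {z : D.Pt} (hz : D.SameCrossing x z ∨ D.SameCrossing y z) :
    (𝓔).seifert z = D.next z :=
  congrArg D.next ((congrFun (D.erase_erase_mate x y) z).trans (eraseAll_mate_of_mem hz))

theorem seifert_erase_erase_of_not_same {z : D.Pt} (hz : ¬ (D.SameCrossing x z ∨ D.SameCrossing y z)) :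
    (𝓔).seifert z = D.seifert z :=
  congrArg D.next ((congrFun (D.erase_erase_mate x y) z).trans (eraseAll_mate_of_notMem hz))

theorem isRotation_reidII_parallel (hx : D.mate x ≠ x) (hy : D.mate y ≠ y) (hxy' : y ≠ x) (hmx : D.mate x ≠ y)
    (hxy : D.next x = y) (hm : D.next (D.mate x) = D.mate y) {r : ℤ}
    (hr : IsRotation D.seifert (D.NormIndex x) r) :
    IsRotation (𝓔).seifert ((𝓔).NormIndex x) r := by
  obtain ⟨a, ha⟩ : ∃ a, D.mate x = a := ⟨_, rfl⟩
  obtain ⟨b, hb⟩ : ∃ b, D.mate y = b := ⟨_, rfl⟩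
  have ha' : D.mate a = x := mate_eq_symm ha
  have hb' : D.mate b = y := mate_eq_symm hb
  rw [ha, hb] at hm
  rw [ha] at hx hmx
  rw [hb] at hy
  have hbx : b ≠ x := fun e => hmx (by rw [← ha, ← e, hb'])
  have hab : a ≠ b := fun e => hxy' (by rw [← ha', ← hb', e])
  have hS : ∀ z, (D.SameCrossing x z ∨ D.SameCrossing y z) ↔ z = x ∨ z = a ∨ z = y ∨ z = b := by
    intro z; simp only [SameCrossing, ha, hb, or_assoc]
  have ny : ∀ z, z ≠ x → D.next z ≠ y := fun z => next_ne hxy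
  have nb : ∀ z, z ≠ a → D.next z ≠ b := fun z => next_ne hm
  obtain ⟨ρ, hρ⟩ : ∃ ρ : Perm D.Pt, ρ = (𝓔).seifert := ⟨_, rfl⟩
  have ρ1 : ∀ z, z = x ∨ z = a ∨ z = y ∨ z = b → ρ z = D.next z := fun z hz =>
    hρ ▸ seifert_erase_erase_of_same ((hS z).2 hz)
  have ρ2 : ∀ z, ¬ (z = x ∨ z = a ∨ z = y ∨ z = b) → ρ z = D.seifert z := fun z hz =>
    hρ ▸ seifert_erase_erase_of_not_same (mt (hS z).1 hz)
  have ρx : ρ x = y := (ρ1 x (by simp)).trans hxy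
  have ρa : ρ a = b := (ρ1 a (by simp)).trans hm
  have ρy : ρ y = D.next y := ρ1 y (by simp)
  have ρb : ρ b = D.next b := ρ1 b (by simp)
  have σx : D.seifert x = b := by rw [seifert_apply, ha, hm]
  have σa : D.seifert a = y := by rw [seifert_apply, ha', hxy]
  have σy : D.seifert y = D.next b := by rw [seifert_apply, hb]
  have σb : D.seifert b = D.next y := by rw [seifert_apply, hb']
  have σo : ∀ z, ¬ (z = x ∨ z = a ∨ z = y ∨ z = b) → D.seifert z ≠ y ∧ D.seifert z ≠ b := by
    intro z hz
    push Not at hz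
    exact ⟨ny _ fun e => hz.2.1 ((mate_eq_symm e).symm.trans ha), nb _ fun e => hz.1 ((mate_eq_symm e).symm.trans ha')⟩
  let π : D.Pt → D.Pt := fun z => if z = y then x else if z = b then a else z
  have πy : π y = x := if_pos rfl
  have πb : π b = a := (if_neg hy).trans (if_pos rfl)
  have πo : ∀ z, z ≠ y → z ≠ b → π z = z := fun z h1 h2 => (if_neg h1).trans (if_neg h2)
  have inv : ∀ f : D.Pt → ℤ, (∀ y, f (D.seifert y) = f y) → ∀ y, f (π (ρ y)) = f (π y) := by
    intro f hf z
    by_cases hz : z = x ∨ z = a ∨ z = y ∨ z = b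
    · rcases hz with rfl | rfl | rfl | rfl
      · rw [ρx, πy, πo z hxy'.symm hbx.symm]
      · rw [ρa, πb, πo z hmx hab]
      · rw [ρy, πy, πo _ (ny _ hxy') (nb _ hmx.symm), ← σb, hf, ← σx, hf]
      · rw [ρb, πb, πo _ (ny _ hbx) (nb _ hab.symm), ← σy, hf, ← σa, hf]
    · rw [ρ2 z hz, πo _ (σo z hz).1 (σo z hz).2, hf]
      push Not at hz
      rw [πo z hz.2.2.1 hz.2.2.2]
  obtain ⟨J, hJ⟩ : ∃ J : (D.Pt → ℤ) → (D.Pt → ℤ) → Prop, J = (𝓔).NormIndex x := ⟨_, rfl⟩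
  suffices IsRotation ρ J r by subst hρ hJ; exact this
  refine hr.comap π inv (fun f hf => ?_) (fun p => ?_) (fun f G hf hG => ?_)
  · have fx : f y = f x := ρx ▸ hf x
    have fa : f b = f a := ρa ▸ hf a
    have fy : f (D.next y) = f y := ρy ▸ hf y
    have fb : f (D.next b) = f b := ρb ▸ hf b
    obtain ⟨f', f1, f2, f3⟩ : ∃ f' : D.Pt → ℤ, f' y = f a ∧ f' b = f x ∧ ∀ z, z ≠ y → z ≠ b → f' z = f z :=
      ⟨fun z => if z = y then f a else if z = b then f x else f z, if_pos rfl, (if_neg hy).trans (if_pos rfl),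
        fun z h1 h2 => (if_neg h1).trans (if_neg h2)⟩
    refine ⟨f', fun z => ?_, fun z => ?_⟩
    · by_cases hz : z = x ∨ z = a ∨ z = y ∨ z = b
      · rcases hz with rfl | rfl | rfl | rfl
        · rw [σx, f2, f3 z hxy'.symm hbx.symm]
        · rw [σa, f1, f3 z hmx hab]
        · rw [σy, f3 _ (ny _ hbx) (nb _ hab.symm), f1, fb, fa]
        · rw [σb, f3 _ (ny _ hxy') (nb _ hmx.symm), f2, fy, fx]
      · have := hf z
        rw [ρ2 z hz] at this
        rw [f3 _ (σo z hz).1 (σo z hz).2, this]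
        push Not at hz
        rw [f3 z hz.2.2.1 hz.2.2.2]
    · by_cases h1 : z = y
      · rw [h1, πy, f3 x hxy'.symm hbx.symm, fx]
      by_cases h2 : z = b
      · rw [h2, πb, f3 a hmx hab, fa]
      · rw [πo z h1 h2, f3 z h1 h2]
  · by_cases h1 : p = y
    · exact ⟨a, by rw [πo a hmx hab, h1, ← σa]; exact sameCycle_seifert _⟩
    by_cases h2 : p = b
    · exact ⟨x, by
        rw [πo x hxy'.symm hbx.symm, h2, ← σx]; exact sameCycle_seifert _⟩
    · exact ⟨p, by rw [πo p h1 h2]⟩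
  · have inv' := inv G (hG.1.seifert hf)
    have inv'' : ∀ z, z = x ∨ z = a ∨ z = y ∨ z = b → G (π (D.next z)) = G (π z) := fun z hz => by
      rw [← ρ1 z hz]; exact inv' z
    subst hJ
    have ho : ∀ (F : D.Pt → ℤ) z, ¬ (D.SameCrossing x z ∨ D.SameCrossing y z) →
        (F ∘ π) z = F z ∧ (F ∘ π) (D.next z) = F (D.next z) := by
      intro F z hz
      rw [hS] at hz
      push Not at hz
      simp only [Function.comp, πo z hz.2.2.1 hz.2.2.2, πo _ (ny z hz.1) (nb z hz.2.1), and_self]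
    exact ⟨D.isIndex_erase_erase x y (hG.1.eraseAll (fun z hz => ho f z hz) (fun z hz => ho G z hz)
      fun z hz => inv'' z ((hS z).1 hz)), (congrArg G (πo x hxy'.symm hbx.symm)).trans hG.2⟩

/-- The indices of a cycle around an antiparallel bigon. -/
theorem IsIndex.bigon {a b : D.Pt} (hax : D.mate y = a) (hbx : D.mate x = b) (hx : b ≠ x) (hy : a ≠ y)
    (hxy : D.next x = y) (hab : D.next a = b) (hl : D.crossedToLeft y = !D.crossedToLeft x) {f G : D.Pt → ℤ}
    (hf : D.IsCycle f) (hG : D.IsIndex f G) :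
    f (D.next b) + f (D.next y) = f x + f a ∧
    ((D.crossedToLeft x = true ∧ G (D.next b) = G x ∧ G (D.next y) = G a ∧ G x - f x = G a - f (D.next y) ∧
        G y = G x - f (D.next b)) ∨
      (D.crossedToLeft x = false ∧ G (D.next y) = G x ∧ G (D.next b) = G a ∧ G x - f x = G a - f (D.next b) ∧
        G x = G y - f b)) := by
  have c1 := hf x
  have c2 := hf y
  have ha' : D.mate a = y := mate_eq_symm hax
  have hb' : D.mate b = x := mate_eq_symm hbx
  rw [hbx, hxy] at c1
  rw [hax, hab] at c2
  refine ⟨by linarith, ?_⟩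
  have lb := crossedToLeft_eq_not hbx hx
  have la := crossedToLeft_eq_not hax hy
  cases h : D.crossedToLeft x
  · rw [h] at lb hl
    obtain ⟨a1, a2, a3⟩ := hG.left_of_mate hax hy hl
    obtain ⟨b1, b2, b3⟩ := hG.left_of_mate hb' hx.symm lb
    rw [hab] at *
    rw [hxy] at *
    refine .inr ⟨rfl, ?_, ?_, ?_, ?_⟩ <;> linarith
  · rw [hl, h] at la
    obtain ⟨a1, a2, a3⟩ := hG.left_of_mate ha' hy.symm la
    obtain ⟨b1, b2, b3⟩ := hG.left_of_mate hbx hx h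
    rw [hab] at *
    rw [hxy] at *
    refine .inl ⟨rfl, ?_, ?_, ?_, ?_⟩ <;> linarith

theorem isRotation_reidII_antiparallel (hD : D.IsPlanar) (hD' : (𝓔).IsConnected)
    (hx : D.mate x ≠ x) (hy : D.mate y ≠ y) (hxy' : y ≠ x) (hmx : D.mate x ≠ y)
    (hxy : D.next x = y) (hm : D.next (D.mate y) = D.mate x) (hl : D.crossedToLeft y = !D.crossedToLeft x) {r : ℤ}
    (hr : IsRotation D.seifert (D.NormIndex x) r) :
    IsRotation (𝓔).seifert ((𝓔).NormIndex x) r := by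
  obtain ⟨b, hb⟩ : ∃ b, D.mate x = b := ⟨_, rfl⟩
  obtain ⟨a, ha⟩ : ∃ a, D.mate y = a := ⟨_, rfl⟩
  have ha' : D.mate a = y := mate_eq_symm ha
  have hb' : D.mate b = x := mate_eq_symm hb
  rw [ha, hb] at hm
  rw [ha] at hy
  rw [hb] at hx hmx
  have hax : a ≠ x := fun e => hmx (by rw [← hb, ← e, ha'])
  have hab : a ≠ b := fun e => hxy' (by rw [← ha', ← hb', e])
  have hS : ∀ z, (D.SameCrossing x z ∨ D.SameCrossing y z) ↔ z = x ∨ z = b ∨ z = y ∨ z = a := by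
    intro z; simp only [SameCrossing, ha, hb, or_assoc]
  have ny : ∀ z, z ≠ x → D.next z ≠ y := fun z => next_ne hxy
  have nb : ∀ z, z ≠ a → D.next z ≠ b := fun z => next_ne hm
  obtain ⟨σ', hσ'⟩ : ∃ σ' : Perm D.Pt, σ' = (𝓔).seifert := ⟨_, rfl⟩
  have s1 : ∀ z, z = x ∨ z = b ∨ z = y ∨ z = a → σ' z = D.next z := fun z hz =>
    hσ' ▸ seifert_erase_erase_of_same ((hS z).2 hz)
  have s2 : ∀ z, ¬ (z = x ∨ z = b ∨ z = y ∨ z = a) → σ' z = D.seifert z := fun z hz =>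
    hσ' ▸ seifert_erase_erase_of_not_same (mt (hS z).1 hz)
  have sx : σ' x = y := (s1 x (by simp)).trans hxy
  have sa : σ' a = b := (s1 a (by simp)).trans hm
  have sy : σ' y = D.next y := s1 y (by simp)
  have sb : σ' b = D.next b := s1 b (by simp)
  have σx : D.seifert x = D.next b := by rw [seifert_apply, hb]
  have σa : D.seifert a = D.next y := by rw [seifert_apply, ha']
  have σy : D.seifert y = b := by rw [seifert_apply, ha, hm]
  have σb : D.seifert b = y := by rw [seifert_apply, hb', hxy]
  have σo : ∀ z, ¬ (z = x ∨ z = b ∨ z = y ∨ z = a) →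
      (D.seifert z ≠ y ∧ D.seifert z ≠ b) ∧ ¬ (D.mate z = x ∨ D.mate z = b ∨ D.mate z = y ∨ D.mate z = a) := by
    intro z hz
    have hz' : ¬ (D.mate z = x ∨ D.mate z = b ∨ D.mate z = y ∨ D.mate z = a) := by
      rintro (e | e | e | e) <;> have e := mate_eq_symm e
      exacts [hz (.inr (.inl (e.symm.trans hb))), hz (.inl (e.symm.trans hb')),
        hz (.inr (.inr (.inr (e.symm.trans ha)))), hz (.inr (.inr (.inl (e.symm.trans ha'))))]
    push Not at hz'
    exact ⟨⟨ny _ hz'.1, nb _ hz'.2.2.2⟩, by push Not; exact hz'⟩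
  let π : D.Pt → D.Pt := fun z => if z = y then x else if z = b then a else z
  have πy : π y = x := if_pos rfl
  have πb : π b = a := (if_neg hmx).trans (if_pos rfl)
  have πo : ∀ z, z ≠ y → z ≠ b → π z = z := fun z h1 h2 => (if_neg h1).trans (if_neg h2)
  have πx := πo x hxy'.symm hx.symm
  have πa := πo a hy hab
  have πny := πo _ (ny y hxy') (nb y hy.symm)
  have πnb := πo _ (ny b hx) (nb b hab.symm)
  have πO : ∀ z, ¬ (z = x ∨ z = b ∨ z = y ∨ z = a) → π z = z ∧ π (D.next z) = D.next z := by
    intro z hz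
    push Not at hz
    exact ⟨πo z hz.2.2.1 hz.2.1, πo _ (ny z hz.1) (nb z hz.2.2.2)⟩
  have loc : ∀ f G, D.IsCycle f → D.IsIndex f G → _ := fun f G hf hG =>
    IsIndex.bigon ha hb hx hy hxy hm hl hf hG
  -- the circle through `y` and `b` is dropped, and the points `y`, `b` are moved to the circles of `x` and `a`
  let ρ : Perm D.Pt := σ' * swap y b
  have ρs : ρ * swap y b = σ' := by rw [mul_assoc, Equiv.swap_mul_self, mul_one]
  have ρy : ρ y = D.next b := by rw [Perm.mul_apply, swap_apply_left, sb]
  have ρb : ρ b = D.next y := by rw [Perm.mul_apply, swap_apply_right, sy]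
  have ρx : ρ x = y := by rw [Perm.mul_apply, swap_apply_of_ne_of_ne hxy'.symm hx.symm, sx]
  have ρa : ρ a = b := by rw [Perm.mul_apply, swap_apply_of_ne_of_ne hy hab, sa]
  have ρo : ∀ z, ¬ (z = x ∨ z = b ∨ z = y ∨ z = a) → ρ z = D.seifert z := by
    intro z hz
    rw [← s2 z hz]
    push Not at hz
    rw [Perm.mul_apply, swap_apply_of_ne_of_ne hz.2.2.1 hz.2.1]
  let J : (D.Pt → ℤ) → (D.Pt → ℤ) → Prop := fun f G =>
    ∃ f' G', D.NormIndex x f' G' ∧ D.IsCycle f' ∧ f = f' ∘ π ∧ G = G' ∘ π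
  have toD' : ∀ f f' G' : D.Pt → ℤ, D.IsIndex f' G' → (∀ z, ¬ (z = x ∨ z = b ∨ z = y ∨ z = a) → f z = f' z ∧
      f (D.next z) = f' (D.next z)) → G' (D.next y) = G' x → G' (D.next b) = G' a →
      (𝓔).IsIndex f (G' ∘ π) := by
    intro f f' G' hG h0 h1 h2
    refine D.isIndex_erase_erase x y (hG.eraseAll (fun z hz => h0 z (mt (hS z).2 hz)) (fun z hz => ?_) (fun z hz => ?_))
    · simp only [Function.comp, πO z (mt (hS z).2 hz), and_self]
    · simp only [Function.comp]
      rcases (hS z).1 hz with rfl | rfl | rfl | rfl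
      · rw [hxy, πy, πx]
      · rw [πnb, πb, h2]
      · rw [πny, πy, h1]
      · rw [hm, πb, πa]
  have drop : IsRotation ρ J (r - (2 * (if D.crossedToLeft x then 0 else 1) - 1)) := by
    refine hr.comap_drop π y _ (fun f hf z => ?_) (fun f hf => ?_) (fun p => ?_) (fun f G hf hG => ?_)
      (fun f G hf hG hy1 hf0 => ?_)
    · by_cases hz : z = x ∨ z = b ∨ z = y ∨ z = a
      · rcases hz with rfl | rfl | rfl | rfl
        · rw [ρx, πy, πx]
        · rw [ρb, πb, πny, ← σa, hf]
        · rw [ρy, πy, πnb, ← σx, hf]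
        · rw [ρa, πb, πa]
      · rw [ρo z hz, πo _ (σo z hz).1.1 (σo z hz).1.2, (πO z hz).1, hf]
    · have fx := ρx ▸ hf x
      have fy := ρy ▸ hf y
      have fa := ρa ▸ hf a
      have fb := ρb ▸ hf b
      obtain ⟨f', f1, f2, f3⟩ : ∃ f' : D.Pt → ℤ, f' y = 0 ∧ f' b = 0 ∧ ∀ z, z ≠ y → z ≠ b → f' z = f z :=
        ⟨fun z => if z = y then 0 else if z = b then 0 else f z, if_pos rfl, (if_neg hmx).trans (if_pos rfl),
          fun z h1 h2 => (if_neg h1).trans (if_neg h2)⟩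
      refine ⟨f', fun z => ?_, fun z => ?_, f1⟩
      · by_cases hz : z = x ∨ z = b ∨ z = y ∨ z = a
        · rcases hz with rfl | rfl | rfl | rfl
          · rw [σx, f3 _ (ny _ hx) (nb _ hab.symm), f3 z hxy'.symm hx.symm, fy, fx]
          · rw [σb, f1, f2]
          · rw [σy, f1, f2]
          · rw [σa, f3 _ (ny _ hxy') (nb _ hy.symm), f3 _ hy hab, fb, fa]
        · have h1 := σo z hz
          have h2 := hf z
          rw [ρo z hz] at h2
          rw [f3 _ h1.1.1 h1.1.2, h2]
          push Not at hz
          rw [f3 z hz.2.2.1 hz.2.1]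
      · by_cases h1 : z = y
        · rw [h1, πy, f3 x hxy'.symm hx.symm, fx]
        by_cases h2 : z = b
        · rw [h2, πb, f3 a hy hab, fa]
        · rw [πo z h1 h2, f3 z h1 h2]
    · by_cases h1 : p = y
      · left; rw [h1]
      by_cases h2 : p = b
      · left; rw [h2, ← σy]; exact sameCycle_seifert _
      · right; exact ⟨p, by rw [πo p h1 h2]⟩
    · exact ⟨f, G, hG, isCycle_of_seifert hf, rfl, rfl⟩
    · have h0 := hG.2
      obtain ⟨-, (⟨h, e1, e2, e3, e4⟩ | ⟨h, e1, e2, e3, e4⟩)⟩ := loc f G (isCycle_of_seifert hf) hG.1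
      · rw [if_pos h]
        have := hf0 (D.next b)
        rw [πnb] at this
        linarith
      · rw [if_neg (by rw [h]; decide)]
        have := hf b
        rw [σb] at this
        linarith
  have fin : ∀ (κ : Perm D.Pt) (f G : D.Pt → ℤ), (κ y = D.next b ∧ κ b = D.next y ∨ κ y = D.next y ∧ κ b = D.next b) →
      κ x = y → κ a = b → (∀ z, ¬ (z = x ∨ z = b ∨ z = y ∨ z = a) → κ z = D.seifert z) → D.IsIndex f G → D.IsCycle f →
      (∀ z, (f ∘ π) (κ z) = (f ∘ π) z) → (∀ z, (G ∘ π) (κ z) = (G ∘ π) z) ∧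
        (κ y = D.next b → (G ∘ π) y - (if D.crossedToLeft x then 1 else 0) * (f ∘ π) y =
          (G ∘ π) b - (if D.crossedToLeft x then 1 else 0) * (f ∘ π) b) ∧
        (κ y = D.next y → (G ∘ π) y - (1 - if D.crossedToLeft x then 1 else 0) * (f ∘ π) y =
          (G ∘ π) b - (1 - if D.crossedToLeft x then 1 else 0) * (f ∘ π) b) := by
    intro κ f G hκ κx κa κo hG hc hf
    have fy := hf y
    have fb := hf b
    obtain ⟨hs, hh⟩ := loc f G hc hG
    refine ⟨fun z => ?_, fun e => ?_, fun e => ?_⟩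
    · by_cases hz : z = x ∨ z = b ∨ z = y ∨ z = a
      · rcases hz with rfl | rfl | rfl | rfl
        · simp only [Function.comp, κx, πy, πx]
        iterate 2
          rcases hκ with ⟨e1, e2⟩ | ⟨e1, e2⟩ <;>
            simp only [Function.comp, e1, e2, πy, πb, πny, πnb] at fy fb ⊢ <;>
            rcases hh with ⟨h, e1, e2, e3, e4⟩ | ⟨h, e1, e2, e3, e4⟩ <;> linarith
        · simp only [Function.comp, κa, πb, πa]
      · have h2 := hf _ |>.symm.trans (congrArg (f ∘ π) (κo _ (σo z hz).2))
        simp only [Function.comp] at h2 ⊢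
        rw [κo z hz, πo _ (σo z hz).1.1 (σo z hz).1.2, (πO z hz).1]
        rw [seifert_apply, D.mate_mate, (πO z hz).2, (πO _ (σo z hz).2).1] at h2
        exact hG.seifert_at (by rw [seifert_apply, D.mate_mate]; exact h2.symm)
    all_goals
      rw [e] at fy
      simp only [Function.comp, πy, πb, πny, πnb] at fy ⊢
      rcases hh with ⟨h, e1, e2, e3, e4⟩ | ⟨h, e1, e2, e3, e4⟩ <;> simp only [h] <;> simp <;> linarith
  have key := drop.band (a := y) (b := b) hmx.symm (if D.crossedToLeft x then 1 else 0) ?_ ?_ ?_ ?_ ?_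
  · rw [ρs] at key
    have e : r - (2 * (if D.crossedToLeft x then 0 else 1) - 1) + 1 -
        2 * (if D.crossedToLeft x then 1 else 0) = r := by split_ifs <;> ring
    rw [e] at key
    obtain ⟨J', hJ'⟩ : ∃ J' : (D.Pt → ℤ) → (D.Pt → ℤ) → Prop, J' = (𝓔).NormIndex x := ⟨_, rfl⟩
    suffices IsRotation σ' J' r by subst hσ' hJ'; exact this
    refine key.comap id (fun f hf => hf) (fun f hf => ⟨f, hf, fun _ => rfl⟩)
      (fun p => ⟨p, .refl _ _⟩) ?_
    rintro f G hf ⟨f', G', hG, hc, rfl, rfl⟩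
    subst hJ'
    refine ⟨toD' (f' ∘ π) f' G' hG.1 (fun z hz => by simp only [Function.comp, πO z hz, and_self]) ?_ ?_,
      (congrArg G' πx).trans hG.2⟩
    all_goals
      have fy := hf y
      have fb := hf b
      simp only [Function.comp, sy, sb, πy, πb, πny, πnb] at fy fb
      obtain ⟨-, (⟨h, e1, e2, e3, e4⟩ | ⟨h, e1, e2, e3, e4⟩)⟩ := loc f' G' hc hG.1 <;> linarith
  · rintro f G G1 ⟨f', G', hG, hc, e, rfl⟩ ⟨f1, G1, hG1, hc1, e1, rfl⟩
    have hd : ∀ z, (f' - f1) (π z) = 0 := by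
      intro z
      have := congrFun (e.symm.trans e1) z
      simp only [Function.comp] at this
      rw [Pi.sub_apply, this, sub_self]
    have dy := πny ▸ hd (D.next y)
    have db := πnb ▸ hd (D.next b)
    have dx := πx ▸ hd x
    have da := πa ▸ hd a
    have hs := hG.1.sub hG1.1
    have hc2 : D.IsCycle (f' - f1) := fun z => by
      have := hc z
      have := hc1 z
      simp only [Pi.sub_apply]
      linarith
    obtain ⟨-, hh⟩ := loc _ _ hc2 hs
    have i0 : (𝓔).NormIndex x 0 ((G' - G1) ∘ π) := by
      refine ⟨toD' 0 _ _ hs (fun z hz => ?_) ?_ ?_, ?_⟩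
      · have h1 := hd z
        have h2 := hd (D.next z)
        rw [(πO z hz).1] at h1
        rw [(πO z hz).2] at h2
        rw [h1, h2]
        exact ⟨rfl, rfl⟩
      iterate 2 rcases hh with ⟨h, e1, e2, e3, e4⟩ | ⟨h, e1, e2, e3, e4⟩ <;> linarith
      · change (G' - G1) (π x) = 0
        rw [πx, Pi.sub_apply, hG.2, hG1.2, sub_zero]
    have i1 := i0.unique hD' (G' := fun _ => 0) ⟨isIndex_const _ 0, rfl⟩
    funext z
    exact sub_eq_zero.1 (congrFun i1 z)
  · rintro f G f1 G1 ⟨f', G', hG, hc, rfl, rfl⟩ ⟨f1', G1', hG1, hc1, rfl, rfl⟩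
    refine ⟨f' + f1', G' + G1', hG.add hG1, fun z => ?_, rfl, rfl⟩
    have := hc z
    have := hc1 z
    simp only [Pi.add_apply]
    linarith
  · intro f hf
    rw [ρs] at hf
    have fx := sx ▸ hf x
    have fa := sa ▸ hf a
    have hc : D.IsCycle f := by
      subst hσ'
      have hc : (𝓔).IsCycle f := isCycle_of_seifert (D := 𝓔) hf
      exact (isCycle_of_eraseAll (D.isCycle_erase_erase x y hc)).1
    obtain ⟨G, hG⟩ := exists_normIndex hD x hc
    refine ⟨G ∘ π, f, G, hG, hc, ?_, rfl⟩
    funext z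
    by_cases h1 : z = y
    · rw [h1, Function.comp, πy, fx]
    by_cases h2 : z = b
    · rw [h2, Function.comp, πb, fa]
    · rw [Function.comp, πo z h1 h2]
  · rintro f G hf ⟨f', G', hG, hc, rfl, rfl⟩
    have := fin ρ f' G' (.inl ⟨ρy, ρb⟩) ρx ρa ρo hG.1 hc hf
    exact ⟨this.1, this.2.1 ρy⟩
  · rw [ρs]
    rintro f G hf ⟨f', G', hG, hc, rfl, rfl⟩
    have := fin σ' f' G' (.inr ⟨sy, sb⟩) sx sa s2 hG.1 hc hf
    exact ⟨this.1, this.2.2 sy⟩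

theorem hasValue_reidII {s : ℝ} (hs : 0 < s) (hD : D.IsPlanar) (hx : D.mate x ≠ x) (hy : D.mate y ≠ y)
    (hox : D.isOver x = true) (hoy : D.isOver y = true) (hpos : D.isPos x ≠ D.isPos y) (hxy : D.next x = y)
    (hm : D.next (D.mate x) = D.mate y ∨ D.next (D.mate y) = D.mate x) (v : ℝ) :
    HasValue s D v ↔ HasValue s 𝓔 v := by
  have hyx : y ≠ x := fun e => hpos (by rw [e])
  have ux : D.isOver (D.mate x) = false := by rw [D.isOver_mate x hx, hox]; rfl
  have uy : D.isOver (D.mate y) = false := by rw [D.isOver_mate y hy, hoy]; rfl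
  have mx : D.mate x ≠ y := fun e => by rw [e, hoy] at ux; simp at ux
  have my : D.mate y ≠ x := fun e => by rw [e, hox] at uy; simp at uy
  have mxy : D.mate x ≠ D.mate y := fun e => hyx (D.mate_injective e).symm
  have hl : D.crossedToLeft y = !D.crossedToLeft x := by
    unfold crossedToLeft
    rw [hox, hoy]
    cases h1 : D.isPos x <;> cases h2 : D.isPos y <;> simp_all
  have m1 : ∀ z, z = x ∨ z = y ∨ z = D.mate x ∨ z = D.mate y → (𝓔).mate z = z := by
    intro z hz
    refine (congrFun (D.erase_erase_mate x y) z).trans (eraseAll_mate_of_mem ?_)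
    rcases hz with h | h | h | h
    exacts [.inl (.inl h), .inr (.inl h), .inl (.inr h), .inr (.inr h)]
  have m2 : ∀ z, z ≠ x → z ≠ y → z ≠ D.mate x → z ≠ D.mate y → (𝓔).mate z = D.mate z := by
    intro z h1 h2 h3 h4
    refine (congrFun (D.erase_erase_mate x y) z).trans (eraseAll_mate_of_notMem ?_)
    rintro ((h | h) | (h | h))
    exacts [h1 h, h3 h, h2 h, h4 h]
  have hw : (𝓔).writhe = D.writhe := by
    change ∑ z : D.Pt, (𝓔).sign z = ∑ z, D.sign z
    have hs : D.sign x + D.sign y = 0 := by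
      rw [sign_of_isOver hx hox, sign_of_isOver hy hoy]
      cases h1 : D.isPos x <;> cases h2 : D.isPos y <;> simp_all
    rw [sum_eq_add_of_pair hyx.symm (fun z : D.Pt => (𝓔).sign z) D.sign]
    · have e1 : (𝓔).sign x = 0 := sign_of_mate_eq (D := 𝓔) (m1 x (by simp))
      have e2 : (𝓔).sign y = 0 := sign_of_mate_eq (D := 𝓔) (m1 y (by simp))
      linarith
    · intro z h1 h2
      by_cases h3 : z = D.mate x
      · exact (sign_of_mate_eq (D := 𝓔) (m1 _ (by simp [h3]))).trans (sign_of_under (h3 ▸ ux)).symm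
      by_cases h4 : z = D.mate y
      · exact (sign_of_mate_eq (D := 𝓔) (m1 _ (by simp [h4]))).trans (sign_of_under (h4 ▸ uy)).symm
      exact sign_congr (D' := 𝓔) (by rw [← m2 z h1 h2 h3 h4]; rfl) fun _ => ⟨rfl, rfl⟩
  have hτ : D.weight s (D.mate x) * D.weight s (D.mate y) = 1 := by
    rw [weight_of_under s (D.mate_mate_ne hx) ux, weight_of_under s (D.mate_mate_ne hy) uy, D.isPos_mate,
      D.isPos_mate]
    have := hs.ne'
    cases h1 : D.isPos x <;> cases h2 : D.isPos y <;> simp_all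
  have w1 : ∀ z, z = x ∨ z = y ∨ z = D.mate x ∨ z = D.mate y → (𝓔).weight s z = 1 :=
    fun z hz => weight_of_mate_eq (D := 𝓔) s (m1 z hz)
  have w2 : ∀ z, z ≠ x → z ≠ y → z ≠ D.mate x → z ≠ D.mate y →
      (𝓔).mate z = D.mate z ∧ (𝓔).weight s z = D.weight s z :=
    fun z h1 h2 h3 h4 => ⟨m2 z h1 h2 h3 h4,
      weight_congr (D' := 𝓔) s (by rw [← m2 z h1 h2 h3 h4]; rfl) fun _ => ⟨rfl, rfl⟩⟩
  refine hasValue_iff hs hD (isPlanar_reidII hD hx hy hox hoy hpos hxy hm) x x 0 ?_ (fun _ hc r hr => ?_) v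
  · rw [zpow_zero, one_mul]
    rcases hm with hm | hm
    · exact walkDet_bigon (m' := (𝓔).mate) (τ' := (𝓔).weight s) D.next.injective
        D.mate_mate hxy hm hx mx my hy hyx.symm mxy (.inl ⟨D.mate_mate x, D.mate_mate y⟩) (weight_of_isOver s hox)
        (weight_of_isOver s hoy) (by rw [mul_comm, hτ]) w1 w2
    · exact walkDet_bigon (m' := (𝓔).mate) (τ' := (𝓔).weight s) D.next.injective
        D.mate_mate hxy hm my hy hx mx hyx.symm mxy.symm (.inr ⟨D.mate_mate y, D.mate_mate x⟩)
        (weight_of_isOver s hox) (weight_of_isOver s hoy) hτ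
        (fun z hz => w1 z (by rcases hz with h | h | h | h <;> simp [h])) fun z h1 h2 h3 h4 => w2 z h1 h2 h4 h3
  · have : r - D.writhe + 0 + (𝓔).writhe = r := by rw [hw]; ring
    rw [this]
    rcases hm with hm | hm
    · exact isRotation_reidII_parallel hx hy hyx mx hxy hm hr
    · exact isRotation_reidII_antiparallel hD hc hx hy hyx mx hxy hm hl hr

end Bigon

end GaussDiagram

/-! ### Invariance under the third Reidemeister move -/

namespace GaussDiagram

/-- The curves are unchanged, and the crossings are moved along them by the involution `π`.  With `π` exchanging the
ends of three edges this is, up to relabelling, the effect of a third Reidemeister move. -/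
def slide (D : GaussDiagram) (π : D.Pt → D.Pt) (hπ : ∀ z, π (π z) = z) : GaussDiagram where
  Pt := D.Pt
  finite := D.finite
  next := D.next
  mate z := π (D.mate (π z))
  mate_mate z := by rw [hπ, D.mate_mate, hπ]
  isOver z := D.isOver (π z)
  isOver_mate z hz := by
    rw [hπ, D.isOver_mate _ fun e => hz (by rw [e, hπ])]
  isPos z := D.isPos (π z)
  isPos_mate z := by rw [hπ, D.isPos_mate]

/-- The edges `p → p1`, `q → q1`, `r → r1` form a triangle, and following them one meets the vertex of `p`, `q`
first, then that of `p`, `r` and then that of `q`, `r`; all regions around the triangle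
lie on the same side, given by `β`. -/
structure LinearTriangle (D : GaussDiagram) (p q r p1 q1 r1 : D.Pt) (β : Bool) : Prop where
  nodup : [p, q, r, p1, q1, r1].Nodup
  next_p : D.next p = p1
  next_q : D.next q = q1
  next_r : D.next r = r1
  mate_p : D.mate p = q
  mate_p1 : D.mate p1 = r
  mate_q1 : D.mate q1 = r1
  left_p : D.crossedToLeft p = β
  left_p1 : D.crossedToLeft p1 = β
  left_q1 : D.crossedToLeft q1 = β

/-- The edges `p → p1`, `q → q1`, `r → r1` form a triangle with coherently oriented boundary, which they follow in the
order `p`, `r`, `q`; the triangle lies on the left if `β` holds, and on the right otherwise. -/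
structure CyclicTriangle (D : GaussDiagram) (p q r p1 q1 r1 : D.Pt) (β : Bool) : Prop where
  nodup : [p, q, r, p1, q1, r1].Nodup
  next_p : D.next p = p1
  next_q : D.next q = q1
  next_r : D.next r = r1
  mate_p : D.mate p = q1
  mate_q : D.mate q = r1
  mate_r : D.mate r = p1
  left_p1 : D.crossedToLeft p1 = β
  left_q1 : D.crossedToLeft q1 = β
  left_r1 : D.crossedToLeft r1 = β

section Triangle

variable {D : GaussDiagram} {p q r p1 q1 r1 : D.Pt} {β : Bool}

local notation "Δ" => [p, q, r, p1, q1, r1]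

theorem forall_of_six {α : Type*} {motive : α → Prop} (p q r p1 q1 r1 : α) (hp : motive p) (hq : motive q)
    (hr : motive r) (hp1 : motive p1) (hq1 : motive q1) (hr1 : motive r1)
    (h : ∀ z, z ∉ [p, q, r, p1, q1, r1] → motive z) (z : α) : motive z := by
  by_cases hz : z ∈ [p, q, r, p1, q1, r1]
  · simp only [List.mem_cons, List.not_mem_nil, or_false] at hz
    rcases hz with rfl | rfl | rfl | rfl | rfl | rfl <;> assumption
  · exact h z hz

theorem forall_of_three {α : Type*} {motive : α → Prop} (p1 q1 r1 : α) (hp1 : motive p1) (hq1 : motive q1)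
    (hr1 : motive r1) (h : ∀ z, z ≠ p1 → z ≠ q1 → z ≠ r1 → motive z) (z : α) : motive z := by
  by_cases h1 : z = p1
  · rwa [h1]
  by_cases h2 : z = q1
  · rwa [h2]
  by_cases h3 : z = r1
  · rwa [h3]
  exact h z h1 h2 h3

theorem exists_eq_on_three {α X : Type*} {p q r p1 q1 r1 : α} (hnd : [p, q, r, p1, q1, r1].Nodup) (f : α → X)
    (a b c : X) : ∃ f' : α → X, f' p1 = a ∧ f' q1 = b ∧ f' r1 = c ∧ ∀ z, z ≠ p1 → z ≠ q1 → z ≠ r1 → f' z = f z := by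
  classical
  obtain ⟨-, -, -, ⟨d4, d5⟩, e5⟩ := ne_of_nodup_six hnd
  exact ⟨fun z => if z = p1 then a else if z = q1 then b else if z = r1 then c else f z, by simp, by simp [d4.symm],
    by simp [d5.symm, e5.symm], fun z h1 h2 h3 => by simp [h1, h2, h3]⟩

theorem eq_off_three (hnd : (Δ).Nodup) (np : D.next p = p1) (nq : D.next q = q1)
    (nr : D.next r = r1) {X : Type*} {g f : D.Pt → X} (h : ∀ z, z ≠ p1 → z ≠ q1 → z ≠ r1 → g z = f z) :
    (g p = f p ∧ g q = f q ∧ g r = f r) ∧ (g (D.next p1) = f (D.next p1) ∧ g (D.next q1) = f (D.next q1) ∧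
      g (D.next r1) = f (D.next r1)) ∧
      ∀ z, z ∉ Δ → g z = f z ∧ g (D.next z) = f (D.next z) := by
  obtain ⟨⟨a1, a2, a3, a4, a5⟩, ⟨b2, b3, b4, b5⟩, ⟨c3, c4, c5⟩, ⟨d4, d5⟩, e5⟩ := ne_of_nodup_six hnd
  have N : ∀ z, z ≠ p → z ≠ q → z ≠ r → g (D.next z) = f (D.next z) := fun z h1 h2 h3 =>
    h _ (next_ne np h1) (next_ne nq h2) (next_ne nr h3)
  refine ⟨⟨h p a3 a4 a5, h q b3 b4 b5, h r c3 c4 c5⟩, ⟨N p1 a3.symm b3.symm c3.symm, N q1 a4.symm b4.symm c4.symm,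
    N r1 a5.symm b5.symm c5.symm⟩, fun z hz => ?_⟩
  simp only [List.mem_cons, List.not_mem_nil, or_false, not_or] at hz
  exact ⟨h z hz.2.2.2.1 hz.2.2.2.2.1 hz.2.2.2.2.2, N z hz.1 hz.2.1 hz.2.2.1⟩

theorem LinearTriangle.mates (h : D.LinearTriangle p q r p1 q1 r1 β) :
    D.mate q = p ∧ D.mate r = p1 ∧ D.mate r1 = q1 :=
  ⟨mate_eq_symm h.mate_p, mate_eq_symm h.mate_p1, mate_eq_symm h.mate_q1⟩

theorem CyclicTriangle.mates (h : D.CyclicTriangle p q r p1 q1 r1 β) :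
    D.mate p1 = r ∧ D.mate q1 = p ∧ D.mate r1 = q :=
  ⟨mate_eq_symm h.mate_r, mate_eq_symm h.mate_p, mate_eq_symm h.mate_q⟩

theorem mate_notMem_of_forall {l : List D.Pt} (h : ∀ w ∈ l, D.mate w ∈ l) {w : D.Pt} (hw : w ∉ l) : D.mate w ∉ l :=
  fun hw' => hw (D.mate_mate w ▸ h _ hw')

theorem LinearTriangle.mate_notMem (h : D.LinearTriangle p q r p1 q1 r1 β)
    {w : D.Pt} : w ∉ Δ → D.mate w ∉ Δ :=
  mate_notMem_of_forall (by simp [h.mate_p, h.mate_p1, h.mate_q1, h.mates])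

theorem CyclicTriangle.mate_notMem (h : D.CyclicTriangle p q r p1 q1 r1 β)
    {w : D.Pt} : w ∉ Δ → D.mate w ∉ Δ :=
  mate_notMem_of_forall (by simp [h.mate_p, h.mate_q, h.mate_r, h.mates])

theorem isIndex_slide_of_forall {π : D.Pt → D.Pt} (hπ : ∀ z, π (π z) = z) {f G : D.Pt → ℤ}
    (h1 : ∀ z, π (D.mate (π z)) = z → G (D.next z) = G z)
    (h2 : ∀ z, π (D.mate (π z)) ≠ z → D.crossedToLeft (π z) = true → G (D.next (π (D.mate (π z)))) = G z ∧
      G (π (D.mate (π z))) = G z - f z ∧ G (D.next z) = G z - f (D.next (π (D.mate (π z))))) :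
    (D.slide π hπ).IsIndex f G := ⟨h1, h2⟩

theorem LinearTriangle.isIndex_slide (h : D.LinearTriangle p q r p1 q1 r1 β) {π : D.Pt → D.Pt}
    (hπ : ∀ z, π (π z) = z) (πp : π p = p1) (πq : π q = q1) (πr : π r = r1)
    (πo : ∀ z, z ∉ Δ → π z = z) {ι : D.Pt → D.Pt} (ιp : ι p1 = q) (ιq : ι q1 = r) (ιr : ι r1 = q)
    (ιo : ∀ z, z ≠ p1 → z ≠ q1 → z ≠ r1 → ι z = z) {f G : D.Pt → ℤ} (hf : ∀ z, f (D.seifert z) = f z)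
    (hG : D.IsIndex f G) : (D.slide π hπ).IsIndex (f ∘ ι) (G ∘ ι) := by
  obtain ⟨mq, mr, mr1⟩ := h.mates
  have mo := fun z => h.mate_notMem (w := z)
  obtain ⟨hnd, np, nq, nr, mp, mp1, mq1, lp, lp1, lq1⟩ := h
  obtain ⟨⟨ιp', ιq', ιr'⟩, ⟨ιP, ιQ, ιR⟩, ιO⟩ := eq_off_three hnd np nq nr (f := fun z => z) ιo
  obtain ⟨⟨a1, a2, a3, a4, a5⟩, ⟨b2, b3, b4, b5⟩, ⟨c3, c4, c5⟩, ⟨d4, d5⟩, e5⟩ := ne_of_nodup_six hnd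
  have πp1 : π p1 = p := by rw [← πp, hπ]
  have πq1 : π q1 = q := by rw [← πq, hπ]
  have πr1 : π r1 = r := by rw [← πr, hπ]
  have lq := crossedToLeft_eq_not mp a1.symm
  have lr := crossedToLeft_eq_not mp1 c3
  have lr1 := crossedToLeft_eq_not mq1 e5.symm
  rw [lp] at lq
  rw [lp1] at lr
  rw [lq1] at lr1
  have fp := hf p
  have fq := hf q
  have fr := hf r
  have fp1 := hf p1
  have fq1 := hf q1
  have fr1 := hf r1
  simp only [seifert_apply, mp, mq, mr, mp1, mq1, mr1, np, nq, nr] at fp fq fr fp1 fq1 fr1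
  obtain ⟨g1, g2, g3, g4, g5, g6, g7, g8⟩ : (β = true → G q = G p - f p ∧ G r = G q - f q) ∧
      (β = false → G q = G p + f q ∧ G r = G q + f r) ∧ G q1 = G p ∧ G p1 = G q ∧ G r1 = G q ∧
      G (D.next p1) = G r ∧ G (D.next q1) = G q ∧ G (D.next r1) = G p := by
    cases β
    · have h1 := hG.left_of_mate mq a1 lq
      have h2 := hG.left_of_mate mr c3.symm lr
      have h3 := hG.left_of_mate mr1 e5 lr1
      simp only [np, nq, nr] at h1 h2 h3
      refine ⟨fun e => by simp at e, fun _ => ⟨?_, ?_⟩, ?_, ?_, ?_, ?_, ?_, ?_⟩ <;> linarith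
    · have h1 := hG.left_of_mate mp a1.symm lp
      have h2 := hG.left_of_mate mp1 c3 lp1
      have h3 := hG.left_of_mate mq1 e5.symm lq1
      simp only [np, nq, nr] at h1 h2 h3
      refine ⟨fun _ => ⟨?_, ?_⟩, fun e => by simp at e, ?_, ?_, ?_, ?_, ?_, ?_⟩ <;> linarith
  refine isIndex_slide_of_forall hπ (forall_of_six p q r p1 q1 r1 ?_ ?_ ?_ ?_ ?_ ?_ fun z hm => ?_)
    (forall_of_six p q r p1 q1 r1 ?_ ?_ ?_ ?_ ?_ ?_ fun z hm => ?_)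
  iterate 6 simp [πp, πq, πr, πp1, πq1, πr1, mp, mq, mr, mp1, mq1, mr1, a5, a5.symm, b2, b2.symm, d4, d4.symm]
  · simp only [Function.comp, πo z hm, πo _ (mo z hm), ιO z hm]
    exact hG.ordinary z
  iterate 6
    · simp only [Function.comp, πp, πq, πr, πp1, πq1, πr1, mp, mq, mr, mp1, mq1, mr1, np, nq, nr, ιp, ιq, ιr, ιp', ιq',
        ιr', ιP, ιQ, ιR, lp, lp1, lq1, lq, lr, lr1, Bool.not_eq_true']
      intro _ hl
      first
        | obtain ⟨k1, k2⟩ := g1 hl; refine ⟨?_, ?_, ?_⟩ <;> first | trivial | linarith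
        | obtain ⟨k1, k2⟩ := g2 hl; refine ⟨?_, ?_, ?_⟩ <;> first | trivial | linarith
  · have hm' := mo z hm
    simp only [Function.comp, πo z hm, πo _ hm', ιO z hm, ιO _ hm']
    exact hG.left z

theorem LinearTriangle.isRotation_slide (h : D.LinearTriangle p q r p1 q1 r1 β) {π : D.Pt → D.Pt}
    (hπ : ∀ z, π (π z) = z) (πp : π p = p1) (πq : π q = q1) (πr : π r = r1)
    (πo : ∀ z, z ∉ Δ → π z = z) {e : D.Pt} (he : e = p ∨ e = q ∨ e = r) {ω : ℤ}
    (hr : IsRotation D.seifert (D.NormIndex e) ω) :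
    IsRotation (D.slide π hπ).seifert ((D.slide π hπ).NormIndex e) ω := by
  have h' := h
  obtain ⟨mq, mr, mr1⟩ := h.mates
  have mo := fun z => h.mate_notMem (w := z)
  obtain ⟨hnd, np, nq, nr, mp, mp1, mq1, -, -, -⟩ := h
  have πp1 : π p1 = p := by rw [← πp, hπ]
  have πq1 : π q1 = q := by rw [← πq, hπ]
  have πr1 : π r1 = r := by rw [← πr, hπ]
  obtain ⟨σ', hσ'⟩ : ∃ σ' : Perm D.Pt, σ' = (D.slide π hπ).seifert := ⟨_, rfl⟩
  obtain ⟨J, hJ⟩ : ∃ J : (D.Pt → ℤ) → (D.Pt → ℤ) → Prop, J = (D.slide π hπ).NormIndex e := ⟨_, rfl⟩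
  have sv : ∀ z, σ' z = D.next (π (D.mate (π z))) := fun z => by rw [hσ']; rfl
  have so : ∀ z, z ∉ Δ → σ' z = D.seifert z := fun z hz => by
    rw [sv, πo z hz, πo _ (mo z hz)]; rfl
  -- the points in the interior of the triangle are moved to the Seifert circles on which they lie afterwards
  obtain ⟨ι, ιp, ιq, ιr, ιo⟩ := exists_eq_on_three hnd (fun z => z) q r q
  obtain ⟨⟨ιp', ιq', ιr'⟩, ⟨ιP, ιQ, ιR⟩, ιO⟩ := eq_off_three hnd np nq nr ιo
  have sp : σ' p = D.next r1 := by rw [sv, πp, mp1, πr]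
  have sq : σ' q = r1 := by rw [sv, πq, mq1, πr1, nr]
  have sr : σ' r = q1 := by rw [sv, πr, mr1, πq1, nq]
  have sp1 : σ' p1 = D.next q1 := by rw [sv, πp1, mp, πq]
  have sq1 : σ' q1 = D.next p1 := by rw [sv, πq1, mq, πp]
  have sr1 : σ' r1 = p1 := by rw [sv, πr1, mr, πp1, np]
  have σp : D.seifert p = q1 := by rw [seifert_apply, mp, nq]
  have σq : D.seifert q = p1 := by rw [seifert_apply, mq, np]
  have σr : D.seifert r = D.next p1 := by rw [seifert_apply, mr]
  have σp1 : D.seifert p1 = r1 := by rw [seifert_apply, mp1, nr]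
  have σq1 : D.seifert q1 = D.next r1 := by rw [seifert_apply, mq1]
  have σr1 : D.seifert r1 = D.next q1 := by rw [seifert_apply, mr1]
  suffices IsRotation σ' J ω by subst hσ' hJ; exact this
  refine hr.comap ι (fun f hf => forall_of_six p q r p1 q1 r1 ?_ ?_ ?_ ?_ ?_ ?_ fun z hm => ?_) (fun f hf => ?_)
    (forall_of_three p1 q1 r1 ⟨q, ?_⟩ ⟨p, ?_⟩ ⟨q, ?_⟩ fun z h1 h2 h3 => ⟨z, by rw [ιo z h1 h2 h3]⟩)
    (fun f G hf hG => ?_)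
  · rw [sp, ιR, ιp', ← σq1, hf, ← σp, hf]
  · rw [sq, ιr, ιq']
  · rw [sr, ιq, ιr']
  · rw [sp1, ιQ, ιp, ← σr1, hf, ← σp1, hf, ← σq, hf]
  · rw [sq1, ιP, ιq, ← σr, hf]
  · rw [sr1, ιp, ιr]
  · rw [so z hm, seifert_apply, (ιO z hm).1, (ιO _ (mo z hm)).2, ← seifert_apply, hf]
  · have fp := hf p
    have fq := hf q
    have fr := hf r
    have fp1 := hf p1
    have fq1 := hf q1
    have fr1 := hf r1
    rw [sp] at fp
    rw [sq] at fq
    rw [sr] at fr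
    rw [sp1] at fp1
    rw [sq1] at fq1
    rw [sr1] at fr1
    obtain ⟨f', f1, f2, f3, f4⟩ := exists_eq_on_three hnd f (f q) (f p) (f q)
    obtain ⟨⟨gp', gq', gr'⟩, ⟨gP, gQ, gR⟩, gO⟩ := eq_off_three hnd np nq nr f4
    refine ⟨f', forall_of_six p q r p1 q1 r1 ?_ ?_ ?_ ?_ ?_ ?_ fun z hm => ?_,
      forall_of_three p1 q1 r1 ?_ ?_ ?_ fun z h1 h2 h3 => ?_⟩
    · rw [σp, f2, gp']
    · rw [σq, f1, gq']
    · rw [σr, gP, gr', fq1, fr]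
    · rw [σp1, f3, f1]
    · rw [σq1, gR, f2, fp]
    · rw [σr1, gQ, f3, fp1, fr1, fq]
    · have h1 := hf z
      rw [so z hm] at h1
      rw [seifert_apply] at h1 ⊢
      rw [(gO z hm).1, (gO _ (mo z hm)).2, h1]
    · rw [ιp, gq', fr1, fq]
    · rw [ιq, gr', ← fr]
    · rw [ιr, gq', ← fq]
    · rw [ιo z h1 h2 h3, f4 z h1 h2 h3]
  · rw [ιq', ← σq]; exact sameCycle_seifert q
  · rw [ιp', ← σp]; exact sameCycle_seifert p
  · rw [ιq', ← σp1, ← σq]; exact (sameCycle_seifert _).trans (sameCycle_seifert q)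
  · subst hJ
    refine ⟨h'.isIndex_slide hπ πp πq πr πo ιp ιq ιr ιo hf hG.1, ?_⟩
    have : ι e = e := by rcases he with rfl | rfl | rfl <;> assumption
    exact (congrArg G this).trans hG.2

end Triangle

end GaussDiagram

namespace GaussDiagram

/-- The values of an index on the six regions around a coherently oriented triangle. -/
def TriangleBoundary {P : Type} (n : P → P) (β : Bool) (p q r p1 q1 r1 : P) (f G : P → ℤ) : Prop :=
  (β = true ∧ G (n p1) = G q ∧ G (n q1) = G r ∧ G (n r1) = G p ∧ G p - f p = G r - f (n q1) ∧
      G q - f q = G p - f (n r1) ∧ G r - f r = G q - f (n p1)) ∨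
    (β = false ∧ G (n p1) = G r ∧ G (n q1) = G p ∧ G (n r1) = G q ∧ G p - f p = G q - f (n r1) ∧
      G q - f q = G r - f (n p1) ∧ G r - f r = G p - f (n q1))

/-- An index of a cycle outside a triangle with coherently oriented boundary; its value at an interior point is
that at the beginning of the edge of the triangle. -/
structure OuterIndex (D : GaussDiagram) (β : Bool) (p q r p1 q1 r1 e : D.Pt) (f G : D.Pt → ℤ) : Prop where
  ordinary : ∀ z, z ∉ [p, q, r, p1, q1, r1] → D.mate z = z → G (D.next z) = G z
  left : ∀ z, z ∉ [p, q, r, p1, q1, r1] → D.mate z ≠ z → D.crossedToLeft z = true →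
    G (D.next (D.mate z)) = G z ∧ G (D.mate z) = G z - f z ∧ G (D.next z) = G z - f (D.next (D.mate z))
  boundary : TriangleBoundary D.next β p q r p1 q1 r1 f G
  norm : G e = 0
  inner_p : G p1 = G p
  inner_q : G q1 = G q
  inner_r : G r1 = G r

section Cyclic

variable {D : GaussDiagram} {p q r p1 q1 r1 e : D.Pt} {β : Bool}

local notation "Δ" => [p, q, r, p1, q1, r1]

local notation "𝒪" => OuterIndex D β p q r p1 q1 r1 e

theorem OuterIndex.add {f G f' G' : D.Pt → ℤ} (h : 𝒪 f G)
    (h' : 𝒪 f' G') : 𝒪 (f + f') (G + G') := by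
  constructor
  · intro z h1 h2; simp only [Pi.add_apply, h.ordinary z h1 h2, h'.ordinary z h1 h2]
  · intro z h1 h2 h3
    obtain ⟨a1, a2, a3⟩ := h.left z h1 h2 h3
    obtain ⟨b1, b2, b3⟩ := h'.left z h1 h2 h3
    refine ⟨?_, ?_, ?_⟩ <;> simp only [Pi.add_apply] <;> linarith
  · simp only [TriangleBoundary, Pi.add_apply]
    rcases h.boundary with ⟨b, h⟩ | ⟨b, h⟩ <;> rcases h'.boundary with ⟨b', h'⟩ | ⟨b', h'⟩
    · left; refine ⟨b, ?_, ?_, ?_, ?_, ?_, ?_⟩ <;> linarith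
    · rw [b] at b'; simp at b'
    · rw [b] at b'; simp at b'
    · right; refine ⟨b, ?_, ?_, ?_, ?_, ?_, ?_⟩ <;> linarith
  · rw [Pi.add_apply, h.norm, h'.norm, add_zero]
  · rw [Pi.add_apply, Pi.add_apply, h.inner_p, h'.inner_p]
  · rw [Pi.add_apply, Pi.add_apply, h.inner_q, h'.inner_q]
  · rw [Pi.add_apply, Pi.add_apply, h.inner_r, h'.inner_r]

theorem OuterIndex.sub {f G f' G' : D.Pt → ℤ} (h : 𝒪 f G)
    (h' : 𝒪 f' G') : 𝒪 (f - f') (G - G') := by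
  have := h.add (f' := -f') (G' := -G') ?_
  · simpa only [sub_eq_add_neg] using this
  constructor
  · intro z h1 h2; simp only [Pi.neg_apply, h'.ordinary z h1 h2]
  · intro z h1 h2 h3
    obtain ⟨b1, b2, b3⟩ := h'.left z h1 h2 h3
    simp only [Pi.neg_apply]
    refine ⟨by linarith, by linarith, by linarith⟩
  · simp only [TriangleBoundary, Pi.neg_apply]
    rcases h'.boundary with ⟨b', h'⟩ | ⟨b', h'⟩
    · left; refine ⟨b', ?_, ?_, ?_, ?_, ?_, ?_⟩ <;> linarith
    · right; refine ⟨b', ?_, ?_, ?_, ?_, ?_, ?_⟩ <;> linarith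
  · rw [Pi.neg_apply, h'.norm, neg_zero]
  · rw [Pi.neg_apply, Pi.neg_apply, h'.inner_p]
  · rw [Pi.neg_apply, Pi.neg_apply, h'.inner_q]
  · rw [Pi.neg_apply, Pi.neg_apply, h'.inner_r]

theorem CyclicTriangle.lefts (h : D.CyclicTriangle p q r p1 q1 r1 β) :
    D.crossedToLeft p = !β ∧ D.crossedToLeft q = !β ∧ D.crossedToLeft r = !β := by
  obtain ⟨⟨-, -, -, a4, -⟩, ⟨-, -, -, b5⟩, ⟨c3, -⟩, -⟩ := ne_of_nodup_six h.nodup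
  obtain ⟨mp1, mq1, mr1⟩ := h.mates
  exact ⟨h.left_q1 ▸ crossedToLeft_eq_not mq1 a4, h.left_r1 ▸ crossedToLeft_eq_not mr1 b5,
    h.left_p1 ▸ crossedToLeft_eq_not mp1 c3⟩

/-- The relations between the values of an index around and inside a coherently oriented triangle. -/
theorem CyclicTriangle.boundary (h : D.CyclicTriangle p q r p1 q1 r1 β) {f G : D.Pt → ℤ} (hf : D.IsCycle f)
    (hG : D.IsIndex f G) : TriangleBoundary D.next β p q r p1 q1 r1 f G ∧
      f p1 + f (D.next q1) = f p + f q1 ∧ f r1 + f (D.next p1) = f r + f p1 ∧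
      (β = true → G p = G p1 - f q1) ∧ (β = false → G p1 = G r - f r) := by
  obtain ⟨lp, lq, lr⟩ := h.lefts
  obtain ⟨mp1, mq1, mr1⟩ := h.mates
  obtain ⟨hnd, np, nq, nr, mp, mq, mr, lp1, lq1, lr1⟩ := h
  obtain ⟨⟨-, -, -, a4, -⟩, ⟨-, -, -, b5⟩, ⟨c3, -⟩, -⟩ := ne_of_nodup_six hnd
  have cp := hf p
  have cq := hf q
  have cr := hf r
  rw [mp, np] at cp
  rw [mq, nq] at cq
  rw [mr, nr] at cr
  cases β
  · have h1 := hG.left_of_mate mp a4.symm lp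
    have h2 := hG.left_of_mate mq b5.symm lq
    have h3 := hG.left_of_mate mr c3.symm lr
    simp only [np, nq, nr] at h1 h2 h3
    refine ⟨.inr ⟨rfl, ?_, ?_, ?_, ?_, ?_, ?_⟩, cp, cr, fun e => by simp at e, fun _ => ?_⟩ <;> linarith
  · have h1 := hG.left_of_mate mp1 c3 lp1
    have h2 := hG.left_of_mate mq1 a4 lq1
    have h3 := hG.left_of_mate mr1 b5 lr1
    simp only [np, nq, nr] at h1 h2 h3
    refine ⟨.inl ⟨rfl, ?_, ?_, ?_, ?_, ?_, ?_⟩, cp, cr, fun _ => ?_, fun e => by simp at e⟩ <;> linarith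

/-- An edge of the triangle is contracted to its beginning. -/
def contract [DecidableEq D.Pt] (p q r p1 q1 r1 : D.Pt) (z : D.Pt) : D.Pt :=
  if z = p1 then p else if z = q1 then q else if z = r1 then r else z

theorem CyclicTriangle.contract_eq [DecidableEq D.Pt] (h : D.CyclicTriangle p q r p1 q1 r1 β) {c : D.Pt → D.Pt}
    (hc : contract p q r p1 q1 r1 = c) : (c p1 = p ∧ c q1 = q ∧ c r1 = r) ∧
      (∀ z, z ≠ p1 → z ≠ q1 → z ≠ r1 → c z = z) ∧ (c p = p ∧ c q = q ∧ c r = r) ∧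
      (c (D.next p1) = D.next p1 ∧ c (D.next q1) = D.next q1 ∧ c (D.next r1) = D.next r1) ∧
      ∀ z, z ∉ Δ → c z = z ∧ c (D.next z) = D.next z := by
  subst hc
  have co : ∀ z, z ≠ p1 → z ≠ q1 → z ≠ r1 → contract p q r p1 q1 r1 z = z := fun z h1 h2 h3 => by
    simp [contract, h1, h2, h3]
  obtain ⟨-, -, -, ⟨d4, d5⟩, e5⟩ := ne_of_nodup_six h.nodup
  exact ⟨by simp [contract, d4.symm, d5.symm, e5.symm], co, eq_off_three h.nodup h.next_p h.next_q h.next_r co⟩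

theorem CyclicTriangle.outerIndex (h : D.CyclicTriangle p q r p1 q1 r1 β) (he : e = p ∨ e = q ∨ e = r)
    {f G : D.Pt → ℤ} (hf : D.IsCycle f) (hG : D.NormIndex e f G) :
    𝒪 (f ∘ contract p q r p1 q1 r1) (G ∘ contract p q r p1 q1 r1) := by
  obtain ⟨c, hc⟩ : ∃ c, contract p q r p1 q1 r1 = c := ⟨_, rfl⟩
  obtain ⟨⟨c1, c2, c3⟩, -, ⟨c4, c5, c6⟩, ⟨c7, c8, c9⟩, co⟩ := h.contract_eq hc
  rw [hc]
  constructor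
  · intro z hz hm
    rw [Function.comp, Function.comp, (co z hz).1, (co z hz).2, hG.1.ordinary z hm]
  · intro z hz hm hl
    simp only [Function.comp, co z hz, co _ (h.mate_notMem hz)]
    exact hG.1.left z hm hl
  · have := (h.boundary hf hG.1).1
    simpa only [TriangleBoundary, Function.comp, c4, c5, c6, c7, c8, c9] using this
  · have : c e = e := by rcases he with rfl | rfl | rfl <;> assumption
    exact (congrArg G this).trans hG.2
  · simp only [Function.comp, c1, c4]
  · simp only [Function.comp, c2, c5]
  · simp only [Function.comp, c3, c6]

theorem CyclicTriangle.outerIndex_unique (h : D.CyclicTriangle p q r p1 q1 r1 β) (hD : D.IsConnected)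
    {f G G' : D.Pt → ℤ} (hG : 𝒪 f G) (hG' : 𝒪 f G') :
    G = G' := by
  have hs := hG.sub hG'
  rw [sub_self] at hs
  have hb : ∀ z ∈ Δ, (G - G') (D.next z) = (G - G') p ∧ (G - G') z = (G - G') p := by
    have i1 := hs.inner_p
    have i2 := hs.inner_q
    have i3 := hs.inner_r
    have hb := hs.boundary
    simp only [TriangleBoundary, Pi.zero_apply] at hb
    have e2 : (G - G') q = (G - G') p := by rcases hb with hb | hb <;> linarith
    have e3 : (G - G') r = (G - G') p := by rcases hb with hb | hb <;> linarith
    simp only [List.forall_mem_cons, h.next_p, h.next_q, h.next_r, i1, i2, i3, e2, e3, true_and, and_true]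
    rcases hb with hb | hb <;> simp [hb, e2, e3]
  have hm : ∀ z, z ∈ Δ → D.mate z ∈ Δ := fun z hz => by
    by_contra hc
    exact h.mate_notMem hc (by rwa [D.mate_mate])
  have : D.NormIndex e 0 (G - G') := by
    refine ⟨⟨fun z hz => ?_, fun z hz hl => ?_⟩, hs.norm⟩
    · by_cases hm' : z ∈ Δ
      · rw [(hb z hm').1, (hb z hm').2]
      · exact hs.ordinary z hm' hz
    · by_cases hm' : z ∈ Δ
      · rw [(hb z hm').1, (hb z hm').2, (hb _ (hm z hm')).1, (hb _ (hm z hm')).2]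
        simp
      · exact hs.left z hm' hz hl
  have := this.unique hD (G' := fun _ => 0) ⟨isIndex_const _ 0, rfl⟩
  funext z
  exact sub_eq_zero.1 (congrFun this z)

/-- A function with the flow of a cycle outside the triangle extends to a cycle. -/
theorem CyclicTriangle.exists_isCycle (h : D.CyclicTriangle p q r p1 q1 r1 β) {f : D.Pt → ℤ}
    (h1 : ∀ z, z ∉ Δ → f (D.next z) + f (D.next (D.mate z)) = f z + f (D.mate z))
    (h2 : f (D.next p1) + f (D.next q1) + f (D.next r1) = f p + f q + f r)
    (h3 : f p1 = f p) (h4 : f q1 = f q) (h5 : f r1 = f r) :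
    ∃ f', D.IsCycle f' ∧ f = f' ∘ contract p q r p1 q1 r1 := by
  obtain ⟨c, hc⟩ : ∃ c, contract p q r p1 q1 r1 = c := ⟨_, rfl⟩
  obtain ⟨⟨c1, c2, c3⟩, c0, -⟩ := h.contract_eq hc
  obtain ⟨mp1, mq1, mr1⟩ := h.mates
  have mo := fun z => h.mate_notMem (w := z)
  obtain ⟨hnd, np, nq, nr, mp, mq, mr, -, -, -⟩ := h
  obtain ⟨f', g1, g2, g3, g4⟩ := exists_eq_on_three hnd f 0 (f (D.next q1) - f p) (f r - f (D.next p1))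
  obtain ⟨⟨gp, gq, gr⟩, ⟨gP, gQ, gR⟩, gO⟩ := eq_off_three hnd np nq nr g4
  rw [hc]
  refine ⟨f', forall_of_six p q r p1 q1 r1 ?_ ?_ ?_ ?_ ?_ ?_ fun z hm => ?_, funext <|
    forall_of_three p1 q1 r1 ?_ ?_ ?_ fun z e1 e2 e3 => ?_⟩
  iterate 6 simp only [mp, mq, mr, mp1, mq1, mr1, np, nq, nr]; linarith
  · rw [(gO z hm).1, (gO z hm).2, (gO _ (mo z hm)).1, (gO _ (mo z hm)).2, h1 z hm]
  · rw [Function.comp, c1, gp, h3]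
  · rw [Function.comp, c2, gq, h4]
  · rw [Function.comp, c3, gr, h5]
  · rw [Function.comp, c0 z e1 e2 e3, g4 z e1 e2 e3]

end Cyclic

end GaussDiagram

namespace GaussDiagram

section Cyclic

variable {D : GaussDiagram} {p q r p1 q1 r1 e : D.Pt} {β : Bool}

local notation "Δ" => [p, q, r, p1, q1, r1]

local notation "𝒪" => OuterIndex D β p q r p1 q1 r1 e

/-- The Seifert circle in a coherently oriented triangle is dropped, and the points on it are moved to the circles
that pass by. -/
theorem CyclicTriangle.isRotation_drop (h : D.CyclicTriangle p q r p1 q1 r1 β) (he : e = p ∨ e = q ∨ e = r)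
    {ρ : Perm D.Pt} (ρp : ρ p = p1) (ρq : ρ q = q1) (ρr : ρ r = r1) (ρp1 : ρ p1 = D.next q1)
    (ρq1 : ρ q1 = D.next r1) (ρr1 : ρ r1 = D.next p1) (ρo : ∀ z, z ∉ Δ → ρ z = D.seifert z)
    {ω : ℤ} (hr : IsRotation D.seifert (D.NormIndex e) ω) :
    IsRotation ρ 𝒪 (ω - (2 * (if β = true then 1 else 0) - 1)) := by
  obtain ⟨c, hc⟩ : ∃ c, contract p q r p1 q1 r1 = c := ⟨_, rfl⟩
  obtain ⟨⟨c1, c2, c3⟩, c0, ⟨c4, c5, c6⟩, ⟨c7, c8, c9⟩, co⟩ := h.contract_eq hc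
  obtain ⟨mp1, mq1, mr1⟩ := h.mates
  have mo := fun z => h.mate_notMem (w := z)
  have h' := h
  obtain ⟨hnd, np, nq, nr, mp, mq, mr, -, -, -⟩ := h
  have σp : D.seifert p = D.next q1 := by rw [seifert_apply, mp]
  have σq : D.seifert q = D.next r1 := by rw [seifert_apply, mq]
  have σr : D.seifert r = D.next p1 := by rw [seifert_apply, mr]
  have σp1 : D.seifert p1 = r1 := by rw [seifert_apply, mp1, nr]
  have σq1 : D.seifert q1 = p1 := by rw [seifert_apply, mq1, np]
  have σr1 : D.seifert r1 = q1 := by rw [seifert_apply, mr1, nq]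
  refine hr.comap_drop c p1 _ (fun f hf => forall_of_six p q r p1 q1 r1 ?_ ?_ ?_ ?_ ?_ ?_ fun z hm => ?_)
    (fun f hf => ?_) (forall_of_three p1 q1 r1 (.inl (.refl _ _)) (.inl ?_) (.inl ?_)
      fun z e1 e2 e3 => .inr ⟨z, by rw [c0 z e1 e2 e3]⟩)
    (fun f G hf hG => hc ▸ h'.outerIndex he (isCycle_of_seifert hf) hG) (fun f G hf hG ht h0 => ?_)
  · rw [ρp, c1, c4]
  · rw [ρq, c2, c5]
  · rw [ρr, c3, c6]
  · rw [ρp1, c8, c1, ← σp, hf]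
  · rw [ρq1, c9, c2, ← σq, hf]
  · rw [ρr1, c7, c3, ← σr, hf]
  · rw [ρo z hm, seifert_apply, (co _ (mo z hm)).2, (co z hm).1, ← seifert_apply, hf]
  · have fp := hf p
    have fq := hf q
    have fr := hf r
    have fp1 := hf p1
    have fq1 := hf q1
    have fr1 := hf r1
    rw [ρp] at fp
    rw [ρq] at fq
    rw [ρr] at fr
    rw [ρp1] at fp1
    rw [ρq1] at fq1
    rw [ρr1] at fr1
    obtain ⟨f', g1, g2, g3, g4⟩ := exists_eq_on_three hnd f 0 0 0
    obtain ⟨⟨gp, gq, gr⟩, ⟨gP, gQ, gR⟩, gO⟩ := eq_off_three hnd np nq nr g4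
    refine ⟨f', forall_of_six p q r p1 q1 r1 ?_ ?_ ?_ ?_ ?_ ?_ fun z hm => ?_,
      forall_of_three p1 q1 r1 ?_ ?_ ?_ fun z e1 e2 e3 => ?_, g1⟩
    · rw [σp, gQ, gp, fp1, fp]
    · rw [σq, gR, gq, fq1, fq]
    · rw [σr, gP, gr, fr1, fr]
    · rw [σp1, g3, g1]
    · rw [σq1, g1, g2]
    · rw [σr1, g2, g3]
    · have := hf z
      rw [ρo z hm] at this
      rw [seifert_apply] at this ⊢
      rw [(gO z hm).1, (gO _ (mo z hm)).2, this]
    · rw [c1, gp, fp]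
    · rw [c2, gq, fq]
    · rw [c3, gr, fr]
    · rw [c0 z e1 e2 e3, g4 z e1 e2 e3]
  · rw [← σr1, ← σp1]; exact (sameCycle_seifert _).trans (sameCycle_seifert p1)
  · rw [← σp1]; exact sameCycle_seifert p1
  · have hb := (h'.boundary (isCycle_of_seifert hf) hG.1)
    have fp := h0 p
    have fq := h0 q
    have fr := h0 r
    have fp1 := h0 (D.next p1)
    have fq1 := h0 (D.next q1)
    have fr1 := h0 (D.next r1)
    rw [c4] at fp
    rw [c5] at fq
    rw [c6] at fr
    rw [c7] at fp1
    rw [c8] at fq1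
    rw [c9] at fr1
    have ft := hf q1
    rw [σq1] at ft
    have hGe := hG.2
    obtain ⟨hb, -, -, k1, k2⟩ := hb
    have gp : G p = 0 ∧ G r = 0 := by
      rcases hb with ⟨-, hb⟩ | ⟨-, hb⟩ <;> rcases he with rfl | rfl | rfl <;> constructor <;> linarith
    cases β
    · have := k2 rfl
      rw [if_neg (by decide)]; linarith
    · have := k1 rfl
      rw [if_pos rfl]; linarith

theorem OuterIndex.seifert_at {f G : D.Pt → ℤ} (hG : 𝒪 f G) {z : D.Pt}
    (hz : z ∉ Δ) (hz' : D.mate z ∉ Δ)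
    (h2 : f (D.seifert (D.mate z)) = f (D.mate z)) : G (D.seifert z) = G z := by
  rw [seifert_apply] at h2 ⊢
  rw [D.mate_mate] at h2
  by_cases hy : D.mate z = z
  · rw [hy]; exact hG.ordinary z hz hy
  by_cases hl : D.crossedToLeft z = true
  · exact (hG.left z hz hy hl).1
  · obtain ⟨e1, e2, e3⟩ := hG.left (D.mate z) hz' (D.mate_mate_ne hy)
      (by rw [D.crossedToLeft_mate hy]; simpa using hl)
    rw [D.mate_mate] at e1 e2 e3
    linarith

theorem CyclicTriangle.exists_outerIndex (h : D.CyclicTriangle p q r p1 q1 r1 β) (hD : D.IsPlanar)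
    (he : e = p ∨ e = q ∨ e = r) {f : D.Pt → ℤ} {ρ : Perm D.Pt} (hf : ∀ z, f (ρ z) = f z)
    (ρp : ρ p = p1) (ρq : ρ q = q1) (ρr : ρ r = r1) (ρo : ∀ z, z ∉ Δ → ρ z = D.seifert z)
    (hs : f (D.next p1) + f (D.next q1) + f (D.next r1) = f (ρ p1) + f (ρ q1) + f (ρ r1)) :
    ∃ G, 𝒪 f G := by
  have fp := hf p
  have fq := hf q
  have fr := hf r
  rw [ρp] at fp
  rw [ρq] at fq
  rw [ρr] at fr
  rw [hf, hf, hf, fp, fq, fr] at hs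
  obtain ⟨f', hf', rfl⟩ := h.exists_isCycle (fun z hz => by
    have h1 := hf z
    have h2 := hf (D.mate z)
    rw [ρo z hz, seifert_apply] at h1
    rw [ρo _ (h.mate_notMem hz), seifert_apply, D.mate_mate] at h2
    linarith) hs fp fq fr
  obtain ⟨G, hG⟩ := exists_normIndex hD e hf'
  exact ⟨_, h.outerIndex he hf' hG⟩

theorem OuterIndex.inv (h : D.CyclicTriangle p q r p1 q1 r1 β) {f G : D.Pt → ℤ} {ρ : Perm D.Pt}
    (hf : ∀ z, f (ρ z) = f z)
    (ρp : ρ p = p1) (ρq : ρ q = q1) (ρr : ρ r = r1) (ρo : ∀ z, z ∉ Δ → ρ z = D.seifert z)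
    (hG : 𝒪 f G) (h1 : G (ρ p1) = G p) (h2 : G (ρ q1) = G q) (h3 : G (ρ r1) = G r) :
    ∀ z, G (ρ z) = G z := by
  refine forall_of_six p q r p1 q1 r1 ?_ ?_ ?_ ?_ ?_ ?_ fun z hm => ?_
  · rw [ρp, hG.inner_p]
  · rw [ρq, hG.inner_q]
  · rw [ρr, hG.inner_r]
  · rw [h1, hG.inner_p]
  · rw [h2, hG.inner_q]
  · rw [h3, hG.inner_r]
  · rw [ρo z hm]
    exact hG.seifert_at hm (h.mate_notMem hm) (ρo _ (h.mate_notMem hm) ▸ hf (D.mate z))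

theorem CyclicTriangle.slide (h : D.CyclicTriangle p q r p1 q1 r1 β) {π : D.Pt → D.Pt}
    (hπ : ∀ z, π (π z) = z) (πp : π p = p1) (πq : π q = q1) (πr : π r = r1) :
    (D.slide π hπ).CyclicTriangle p r q p1 r1 q1 (!β) := by
  obtain ⟨lp, lq, lr⟩ := h.lefts
  obtain ⟨mp1, mq1, mr1⟩ := h.mates
  have e : ∀ {a b}, π a = b → π b = a := fun h => by rw [← h, hπ]
  have m : ∀ {a a1 b b1}, π a = a1 → D.mate a1 = b1 → π b1 = b → (D.slide π hπ).mate a = b := by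
    rintro a _ _ _ rfl rfl rfl; rfl
  refine ⟨?_, h.next_p, h.next_r, h.next_q, m πp mp1 πr, m πr mr1 πq, m πq mq1 πp, (congrArg _ (e πp)).trans lp,
    (congrArg _ (e πr)).trans lr, (congrArg _ (e πq)).trans lq⟩
  have hnd := h.nodup
  change [p, r, q, p1, r1, q1].Nodup
  simp only [List.nodup_cons, List.mem_cons, List.not_mem_nil, or_false, not_or] at hnd ⊢
  clear e m
  grind

set_option maxHeartbeats 1000000 in
theorem CyclicTriangle.isRotation_slide (h : D.CyclicTriangle p q r p1 q1 r1 β) {π : D.Pt → D.Pt}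
    (hπ : ∀ z, π (π z) = z) (πp : π p = p1) (πq : π q = q1) (πr : π r = r1)
    (πo : ∀ z, z ∉ Δ → π z = z) (hD : D.IsPlanar) (hD' : (D.slide π hπ).IsPlanar)
    (hc : D.IsConnected) (hc' : (D.slide π hπ).IsConnected) (he : e = p ∨ e = q ∨ e = r) {ω : ℤ}
    (hr : IsRotation D.seifert (D.NormIndex e) ω) :
    IsRotation (D.slide π hπ).seifert ((D.slide π hπ).NormIndex e) ω := by
  have hs := h.slide hπ πp πq πr
  obtain ⟨⟨a1, a2, a3, a4, a5⟩, ⟨b2, b3, b4, b5⟩, ⟨c3, c4, c5⟩, ⟨d4, d5⟩, e5⟩ := ne_of_nodup_six h.nodup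
  have so : ∀ z, z ∉ Δ → (D.slide π hπ).mate z = D.mate z := fun z hz => by
    change π (D.mate (π z)) = D.mate z
    rw [πo z hz, πo _ (h.mate_notMem hz)]
  -- the permutation that turns back nowhere along the triangle, and its modification on the interior points
  obtain ⟨ν, ν1, ν2⟩ : ∃ ν : Perm D.Pt, (∀ z, z ∈ Δ → ν z = D.next z) ∧
      ∀ z, z ∉ Δ → ν z = D.seifert z := by
    have hS : ∀ z, D.mate z ∈ {z | z ∈ Δ} ↔ z ∈ {z | z ∈ Δ} := by
      refine fun z => ⟨fun h1 => ?_, fun h1 => ?_⟩ <;> by_contra h2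
      · exact h.mate_notMem h2 h1
      · exact h.mate_notMem h2 (by rwa [D.mate_mate])
    exact ⟨(D.eraseAll _ hS).seifert, fun z hz => congrArg D.next (eraseAll_mate_of_mem (hS := hS) hz),
      fun z hz => congrArg D.next (eraseAll_mate_of_notMem (hS := hS) hz)⟩
  have off : ∀ z, z ∉ Δ → z ≠ p1 ∧ z ≠ q1 ∧ z ≠ r1 := fun z hz => by
    refine ⟨?_, ?_, ?_⟩ <;> rintro rfl <;> simp at hz
  obtain ⟨ρ, hρ⟩ : ∃ ρ : Perm D.Pt, ρ = ν * swap p1 q1 * swap q1 r1 := ⟨_, rfl⟩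
  have sw : ∀ a b z : D.Pt, z ≠ a → z ≠ b → swap a b z = z := fun a b z h1 h2 =>
    swap_apply_of_ne_of_ne h1 h2
  have ρ1 : ∀ z, z ≠ p1 → z ≠ q1 → z ≠ r1 → ρ z = ν z := fun z h1 h2 h3 => by
    rw [hρ, Perm.mul_apply, Perm.mul_apply, sw _ _ z h2 h3, sw _ _ z h1 h2]
  have ρp : ρ p = p1 := by rw [ρ1 p a3 a4 a5, ν1 p (by simp), h.next_p]
  have ρq : ρ q = q1 := by rw [ρ1 q b3 b4 b5, ν1 q (by simp), h.next_q]
  have ρr : ρ r = r1 := by rw [ρ1 r c3 c4 c5, ν1 r (by simp), h.next_r]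
  have ρp1 : ρ p1 = D.next q1 := by simp [hρ, sw _ _ p1 d4 d5, ν1]
  have ρq1 : ρ q1 = D.next r1 := by simp [hρ, sw _ _ r1 d5.symm e5.symm, ν1]
  have ρr1 : ρ r1 = D.next p1 := by simp [hρ, ν1]
  have ρo : ∀ z, z ∉ Δ → ρ z = D.seifert z := fun z hz => by
    obtain ⟨h1, h2, h3⟩ := off z hz
    rw [ρ1 z h1 h2 h3, ν2 z hz]
  obtain ⟨ρ', hρ'⟩ : ∃ ρ' : Perm D.Pt, ρ' = ρ * swap p1 q1 := ⟨_, rfl⟩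
  have ρ1' : ∀ z, z ≠ p1 → z ≠ q1 → ρ' z = ρ z := fun z h1 h2 => by
    rw [hρ', Perm.mul_apply, sw _ _ z h1 h2]
  have ρp' := (ρ1' p a3 a4).trans ρp
  have ρq' := (ρ1' q b3 b4).trans ρq
  have ρr' := (ρ1' r c3 c4).trans ρr
  have ρp1' : ρ' p1 = D.next r1 := by simp [hρ', ρq1]
  have ρq1' : ρ' q1 = D.next q1 := by simp [hρ', ρp1]
  have ρr1' : ρ' r1 = D.next p1 := (ρ1' r1 d5.symm e5.symm).trans ρr1
  have ρo' := fun z hz => (ρ1' z (off z hz).1 (off z hz).2.1).trans (ρo z hz)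
  obtain ⟨τ, hτ⟩ : ∃ τ : Perm D.Pt, τ = ρ' * swap q1 r1 := ⟨_, rfl⟩
  have τ1 : ∀ z, z ≠ q1 → z ≠ r1 → τ z = ρ' z := fun z h1 h2 => by
    rw [hτ, Perm.mul_apply, sw _ _ z h1 h2]
  have τp := (τ1 p a4 a5).trans ρp'
  have τq := (τ1 q b4 b5).trans ρq'
  have τr := (τ1 r c4 c5).trans ρr'
  have τp1 := (τ1 p1 d4 d5).trans ρp1'
  have τq1 : τ q1 = D.next p1 := by simp [hτ, ρr1']
  have τr1 : τ r1 = D.next q1 := by simp [hτ, ρq1']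
  have τo := fun z hz => (τ1 z (off z hz).2.1 (off z hz).2.2).trans (ρo' z hz)
  have hu : ∀ f G G', 𝒪 f G → 𝒪 f G' → G = G' :=
    fun f G G' => h.outerIndex_unique hc
  obtain ⟨δ, hδ⟩ : ∃ δ : ℤ, δ = if β = true then 0 else 1 := ⟨_, rfl⟩
  -- an index of a cycle that follows one of the three permutations is constant along it, and it takes equal values
  -- on both sides of the bands
  have inv : ∀ (κ : Perm D.Pt) (f G : D.Pt → ℤ), κ p = p1 → κ q = q1 → κ r = r1 →
      (∀ z, z ∉ Δ → κ z = D.seifert z) →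
      (κ p1 = D.next q1 ∧ κ q1 = D.next r1 ∧ κ r1 = D.next p1 ∨
        κ p1 = D.next r1 ∧ κ q1 = D.next q1 ∧ κ r1 = D.next p1 ∨
        κ p1 = D.next r1 ∧ κ q1 = D.next p1 ∧ κ r1 = D.next q1) →
      (∀ y, f (κ y) = f y) → 𝒪 f G → (∀ y, G (κ y) = G y) ∧
        (κ q1 = D.next r1 → G p1 - δ * f p1 = G q1 - δ * f q1) ∧
        (κ p1 = D.next r1 → G p1 - (1 - δ) * f p1 = G q1 - (1 - δ) * f q1) ∧
        (κ r1 = D.next p1 → G q1 - δ * f q1 = G r1 - δ * f r1) ∧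
        (κ q1 = D.next p1 → G q1 - (1 - δ) * f q1 = G r1 - (1 - δ) * f r1) := by
    intro κ f G kp kq kr ko hκ hf hG
    have fp := kp ▸ hf p
    have fq := kq ▸ hf q
    have fr := kr ▸ hf r
    have f1 := hf p1
    have f2 := hf q1
    have f3 := hf r1
    have g1 := hG.inner_p
    have g2 := hG.inner_q
    have g3 := hG.inner_r
    refine ⟨hG.inv h hf kp kq kr ko ?_ ?_ ?_, fun e => ?_, fun e => ?_, fun e => ?_, fun e => ?_⟩
    iterate 3
      · rcases hκ with ⟨e1, e2, e3⟩ | ⟨e1, e2, e3⟩ | ⟨e1, e2, e3⟩ <;> rw [e1] at f1 <;> rw [e2] at f2 <;>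
          rw [e3] at f3 <;> simp only [e1, e2, e3] <;> rcases hG.boundary with ⟨_, b⟩ | ⟨_, b⟩ <;> linarith
    all_goals
      simp only [e] at f1 f2 f3
      rcases hG.boundary with ⟨hb, b⟩ | ⟨hb, b⟩ <;> rw [hb] at hδ <;>
        simp only [if_true, Bool.false_eq_true, if_false] at hδ <;> subst hδ <;> linarith
  have i0 := fun f G hf hG => inv ρ f G ρp ρq ρr ρo (.inl ⟨ρp1, ρq1, ρr1⟩) hf hG
  have i1 := fun f G hf hG => inv ρ' f G ρp' ρq' ρr' ρo' (.inr (.inl ⟨ρp1', ρq1', ρr1'⟩)) hf hG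
  have i2 := fun f G hf hG => inv τ f G τp τq τr τo (.inr (.inr ⟨τp1, τq1, τr1⟩)) hf hG
  have key0 := h.isRotation_drop he ρp ρq ρr ρp1 ρq1 ρr1 ρo hr
  have key1 := key0.band d4 δ hu (fun _ _ _ _ => OuterIndex.add)
    (fun f hf => h.exists_outerIndex hD he (hρ' ▸ hf) ρp' ρq' ρr' ρo' (by rw [ρp1', ρq1', ρr1']; ring))
    (fun f G hf hG => ⟨(i0 f G hf hG).1, (i0 f G hf hG).2.1 ρq1⟩)
    (hρ' ▸ fun f G hf hG => ⟨(i1 f G hf hG).1, (i1 f G hf hG).2.2.1 ρp1'⟩)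
  rw [← hρ'] at key1
  have key2 := key1.band e5 δ hu (fun _ _ _ _ => OuterIndex.add)
    (fun f hf => h.exists_outerIndex hD he (hτ ▸ hf) τp τq τr τo (by rw [τp1, τq1, τr1]; ring))
    (fun f G hf hG => ⟨(i1 f G hf hG).1, (i1 f G hf hG).2.2.2.1 ρr1'⟩)
    (hτ ▸ fun f G hf hG => ⟨(i2 f G hf hG).1, (i2 f G hf hG).2.2.2.2 τq1⟩)
  rw [← hτ] at key2
  obtain ⟨J, hJ⟩ : ∃ J : (D.Pt → ℤ) → (D.Pt → ℤ) → Prop, J = (D.slide π hπ).OuterIndex (!β) p r q p1 r1 q1 e :=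
    ⟨_, rfl⟩
  have perm : ∀ z, z ∈ [p, r, q, p1, r1, q1] ↔ z ∈ Δ := by
    intro z; simp only [List.mem_cons, List.not_mem_nil, or_false]; tauto
  have key3 : IsRotation τ J _ := key2.comap id (fun f hf => hf) (fun f hf => ⟨f, hf, fun _ => rfl⟩)
    (fun p => ⟨p, .refl _ _⟩) (fun f G hf hG => by
      subst hJ
      refine ⟨fun (z : D.Pt) hz hm => ?_, fun (z : D.Pt) hz hm hl => ?_, ?_, hG.norm, hG.inner_p, hG.inner_r,
        hG.inner_q⟩
      · exact hG.ordinary z (mt (perm z).2 hz) ((so z (mt (perm z).2 hz)).symm.trans hm)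
      · have hz' := mt (perm z).2 hz
        have e1 : π (D.mate (π z)) = D.mate z := so z hz'
        change D.crossedToLeft (π z) = true at hl
        rw [πo z hz'] at hl
        change G (D.next (π (D.mate (π z)))) = G z ∧ G (π (D.mate (π z))) = G z - f z ∧
          G (D.next z) = G z - f (D.next (π (D.mate (π z))))
        rw [e1]
        exact hG.left z hz' (fun e => hm (e1.trans e)) hl
      · exact hG.boundary.symm.imp (fun ⟨b, b1, b2, b3, b4, b5, b6⟩ => ⟨by rw [b]; rfl, b1, b3, b2, b4, b6, b5⟩)
          fun ⟨b, b1, b2, b3, b4, b5, b6⟩ => ⟨by rw [b]; rfl, b1, b3, b2, b4, b6, b5⟩)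
  obtain ⟨ω', hω'⟩ := exists_isRotation hD' e
  have key4 := CyclicTriangle.isRotation_drop (D := D.slide π hπ) hs (ρ := τ) (e := e)
    (by rcases he with h | h | h; exacts [.inl h, .inr (.inr h), .inr (.inl h)]) τp τr τq τp1 τr1 τq1
    (fun z hz => by
      exact (τo z (mt (perm z).2 hz)).trans (congrArg D.next (so z (mt (perm z).2 hz))).symm) hω'
  subst hJ
  have e0 := key3.unique (I := (D.slide π hπ).OuterIndex (!β) p r q p1 r1 q1 e) (fun f G G' h h' => CyclicTriangle.outerIndex_unique (D := D.slide π hπ) hs hc' h h') key4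
  have e1 : ω = ω' := by
    subst hδ
    cases β <;> simp at e0 <;> linarith
  rwa [e1]

end Cyclic

end GaussDiagram

namespace GaussDiagram

section Slide

variable {D : GaussDiagram}

theorem face_eq {w v : D.Pt} {a b : Bool} (hw : D.mate w ≠ w) (hw' : D.mate (D.next w) ≠ D.next w)
    (h : D.face (w, a) = (v, b)) :
    D.mate (cond a (D.next w) w) = cond b v (D.next v) ∧ D.mate (cond b v (D.next v)) = cond a (D.next w) w ∧
      D.crossedToLeft (cond a (D.next w) w) = (a == b) ∧ D.crossedToLeft (cond b v (D.next v)) = !(a == b) := by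
  have key : D.mate (cond a (D.next w) w) = cond b v (D.next v) ∧
      D.crossedToLeft (cond a (D.next w) w) = (a == b) := by
    cases a
    · simp only [face, hw, if_false] at h
      by_cases hl : D.crossedToLeft w = true
      · rw [if_pos hl, Prod.mk.injEq] at h
        obtain ⟨h1, rfl⟩ := h
        exact ⟨((Equiv.symm_apply_eq _).1 h1), hl⟩
      · rw [if_neg hl, Prod.mk.injEq] at h
        obtain ⟨h1, rfl⟩ := h
        exact ⟨h1, by simpa using hl⟩
    · simp only [face, hw', if_false] at h
      by_cases hl : D.crossedToLeft (D.next w) = true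
      · rw [if_pos hl, Prod.mk.injEq] at h
        obtain ⟨h1, rfl⟩ := h
        exact ⟨h1, hl⟩
      · rw [if_neg hl, Prod.mk.injEq] at h
        obtain ⟨h1, rfl⟩ := h
        exact ⟨((Equiv.symm_apply_eq _).1 h1), by simpa using hl⟩
  have hc : D.mate (cond a (D.next w) w) ≠ cond a (D.next w) w := by cases a <;> assumption
  refine ⟨key.1, by rw [← key.1, D.mate_mate], key.2, ?_⟩
  rw [← key.1, D.crossedToLeft_mate hc, key.2]

theorem perm_three {α : Type*} (x y z : α) : [x, z, y].Perm [x, y, z] ∧ [y, x, z].Perm [x, y, z] ∧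
    [z, x, y].Perm [x, y, z] ∧ [y, z, x].Perm [x, y, z] ∧ [z, y, x].Perm [x, y, z] :=
  have h1 : [x, z, y].Perm [x, y, z] := .cons x (.swap y z [])
  have h2 : [y, x, z].Perm [x, y, z] := .swap x y _
  have h4 : [y, z, x].Perm [x, y, z] := .trans (.cons y (.swap x z [])) h2
  ⟨h1, h2, .trans (.swap x z _) h1, h4, .trans (.swap y z _) h4⟩

theorem perm_next {x y z p q r : D.Pt} (h : [p, q, r].Perm [x, y, z]) :
    [p, q, r, D.next p, D.next q, D.next r].Perm [x, y, z, D.next x, D.next y, D.next z] :=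
  h.append (h.map D.next)

/-- The possible orientations of a triangle. -/
theorem triangle_cases {x y z : D.Pt} (hnd : [x, y, z, D.next x, D.next y, D.next z].Nodup)
    (hcr : ∀ w ∈ [x, y, z, D.next x, D.next y, D.next z], D.mate w ≠ w) {a b c : Bool}
    (h1 : D.face (x, a) = (y, b)) (h2 : D.face (y, b) = (z, c)) (h3 : D.face (z, c) = (x, a)) :
    ∃ β, D.LinearTriangle x y z (D.next x) (D.next y) (D.next z) β ∨
      D.LinearTriangle x z y (D.next x) (D.next z) (D.next y) β ∨
      D.LinearTriangle y x z (D.next y) (D.next x) (D.next z) β ∨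
      D.LinearTriangle z x y (D.next z) (D.next x) (D.next y) β ∨
      D.LinearTriangle y z x (D.next y) (D.next z) (D.next x) β ∨
      D.LinearTriangle z y x (D.next z) (D.next y) (D.next x) β ∨
      D.CyclicTriangle x y z (D.next x) (D.next y) (D.next z) β ∨
      D.CyclicTriangle x z y (D.next x) (D.next z) (D.next y) β := by
  have e1 := face_eq (hcr x (by simp)) (hcr _ (by simp)) h1
  have e2 := face_eq (hcr y (by simp)) (hcr _ (by simp)) h2
  have e3 := face_eq (hcr z (by simp)) (hcr _ (by simp)) h3
  clear h1 h2 h3 hcr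
  obtain ⟨t1, t2, t3, t4, t5⟩ := perm_three x y z
  have n1 := (perm_next t1).nodup_iff.2 hnd
  have n2 := (perm_next t2).nodup_iff.2 hnd
  have n3 := (perm_next t3).nodup_iff.2 hnd
  have n4 := (perm_next t4).nodup_iff.2 hnd
  have n5 := (perm_next t5).nodup_iff.2 hnd
  cases a <;> cases b <;> cases c <;>
    simp only [cond_true, cond_false, beq_self_eq_true, Bool.not_true, Bool.true_beq, Bool.false_beq, Bool.not_false] at e1 e2 e3 <;> obtain ⟨a1, a2, a3, a4⟩ := e1 <;>
    obtain ⟨b1, b2, b3, b4⟩ := e2 <;> obtain ⟨c1, c2, c3, c4⟩ := e3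
  · exact ⟨false, .inr (.inr (.inr (.inr (.inr (.inr (.inl (by constructor <;> first | assumption | rfl)))))))⟩
  · exact ⟨false, .inr (.inr (.inr (.inr (.inl (by constructor <;> first | assumption | rfl)))))⟩
  · exact ⟨false, .inl (by constructor <;> first | assumption | rfl)⟩
  · exact ⟨true, .inr (.inr (.inl (by constructor <;> first | assumption | rfl)))⟩
  · exact ⟨false, .inr (.inr (.inr (.inl (by constructor <;> first | assumption | rfl))))⟩
  · exact ⟨true, .inr (.inr (.inr (.inr (.inr (.inl (by constructor <;> first | assumption | rfl))))))⟩
  · exact ⟨true, .inr (.inl (by constructor <;> first | assumption | rfl))⟩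
  · exact ⟨true, .inr (.inr (.inr (.inr (.inr (.inr (.inr (by constructor <;> first | assumption | rfl)))))))⟩

theorem weight_slide (s : ℝ) {π : D.Pt → D.Pt} (hπ : ∀ z, π (π z) = z) (w : D.Pt) :
    (D.slide π hπ).weight s w = D.weight s (π w) :=
  weight_congr (D := D) (D' := D.slide π hπ) s (y := π w) (y' := w)
    (⟨fun h => by rw [← hπ (D.mate (π w))]; exact congrArg π h, fun h => (congrArg π h).trans (hπ w)⟩)
    fun _ => ⟨rfl, rfl⟩

theorem sign_slide {π : D.Pt → D.Pt} (hπ : ∀ z, π (π z) = z) (w : D.Pt) :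
    (D.slide π hπ).sign w = D.sign (π w) :=
  sign_congr (D := D) (D' := D.slide π hπ) (y := π w) (y' := w)
    (⟨fun h => by rw [← hπ (D.mate (π w))]; exact congrArg π h, fun h => (congrArg π h).trans (hπ w)⟩)
    fun _ => ⟨rfl, rfl⟩

theorem writhe_slide {π : D.Pt → D.Pt} (hπ : ∀ z, π (π z) = z) : (D.slide π hπ).writhe = D.writhe :=
  Fintype.sum_equiv (Function.Involutive.toPerm π hπ) _ _ fun w => sign_slide hπ w

theorem weight_of_mate_top (s : ℝ) {w v : D.Pt} (hv : D.mate v ≠ v) (ho : D.isOver v = true) (hw : D.mate w = v) :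
    D.weight s w = if D.crossedToLeft v = true then s ^ 2 else s⁻¹ ^ 2 := by
  have e : w = D.mate v := by rw [← hw, D.mate_mate]
  rw [e, weight_of_under s (D.mate_mate_ne hv) (by rw [D.isOver_mate v hv, ho]; rfl), D.isPos_mate, crossedToLeft, ho]
  cases D.isPos v <;> rfl

variable {x x1 y y1 z z1 : D.Pt}

local notation "Δ" => [x, x1, y, y1, z, z1]

/-- The walk determinant is invariant under the slide of a strand across a crossing. -/
theorem walkDet_slide {s : ℝ} (hs : 0 < s) (hnd : (Δ).Nodup)
    (hcr : ∀ w ∈ Δ, D.mate w ≠ w) (nx : D.next x = x1) (ny : D.next y = y1) (nz : D.next z = z1)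
    (ox : D.isOver x = true) (ox1 : D.isOver x1 = true)
    (oz : D.isOver z = false) (oz1 : D.isOver z1 = false) {π : D.Pt → D.Pt} (hπ : ∀ z, π (π z) = z) (πx : π x = x1)
    (πy : π y = y1) (πz : π z = z1) (πo : ∀ w, w ∉ Δ → π w = w) (hm : ∀ w, w ∉ Δ → D.mate w ∉ Δ)
    (h : ((D.mate x = y ∧ D.mate x1 = z ∨ D.mate x = z ∧ D.mate x1 = y) ∧ D.mate z1 = y1 ∧
        D.crossedToLeft x1 = D.crossedToLeft x) ∨
      ((D.mate x = y ∧ D.mate x1 = z1 ∨ D.mate x = z1 ∧ D.mate x1 = y) ∧ D.mate z = y1 ∧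
        D.crossedToLeft x1 = !D.crossedToLeft x) ∨
      ((D.mate x = y1 ∧ D.mate x1 = z1 ∨ D.mate x = z1 ∧ D.mate x1 = y1) ∧ D.mate z = y ∧
        D.crossedToLeft x1 = D.crossedToLeft x) ∨
      ((D.mate x = y1 ∧ D.mate x1 = z ∨ D.mate x = z ∧ D.mate x1 = y1) ∧ D.mate z1 = y ∧
        D.crossedToLeft x1 = !D.crossedToLeft x)) :
    walkDet D.next D.mate (D.weight s) x =
      walkDet (D.slide π hπ).next (D.slide π hπ).mate ((D.slide π hπ).weight s) x := by
  have πx1 : π x1 = x := by rw [← πx, hπ]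
  have πy1 : π y1 = y := by rw [← πy, hπ]
  have πz1 : π z1 = z := by rw [← πz, hπ]
  obtain ⟨m', hm'⟩ : ∃ m' : D.Pt → D.Pt, m' = (D.slide π hπ).mate := ⟨_, rfl⟩
  obtain ⟨τ', hτ'⟩ : ∃ τ' : D.Pt → ℝ, τ' = (D.slide π hπ).weight s := ⟨_, rfl⟩
  suffices walkDet D.next D.mate (D.weight s) x = walkDet D.next m' τ' x by subst hm' hτ'; exact this
  have mv : ∀ w, m' w = π (D.mate (π w)) := fun w => by rw [hm']; rfl
  have tv : ∀ w, τ' w = D.weight s (π w) := fun w => by rw [hτ']; exact weight_slide s hπ w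
  have t1 := weight_of_isOver s ox
  have t2 := weight_of_isOver s ox1
  have ho : ∀ i, i ∉ Δ →
      m' i = D.mate i ∧ τ' i = D.weight s i ∧ D.mate i ∉ Δ := fun i hi =>
    ⟨by rw [mv, πo i hi, πo _ (hm i hi)], by rw [tv, πo i hi], hm i hi⟩
  have ho' : ∀ i, i ∉ Δ →
      D.mate i = m' i ∧ D.weight s i = τ' i ∧ m' i ∉ Δ := fun i hi => by
    obtain ⟨h1, h2, h3⟩ := ho i hi
    exact ⟨h1.symm, h2.symm, by rwa [h1]⟩
  -- the middle strand is over where it meets the bottom strand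
  have ov : ∀ {v w}, D.mate v ≠ v → D.mate v = w → D.isOver v = false → D.weight s w = 1 := fun h1 h2 h3 =>
    weight_of_isOver s (by rw [← h2, D.isOver_mate _ h1, h3]; rfl)
  have s0 := hs.ne'
  have top : ∀ a b, (D.mate x = a ∧ D.mate x1 = b ∨ D.mate x = b ∧ D.mate x1 = a) →
      (D.mate a = x ∨ D.mate a = x1) ∧ (D.mate b = x ∨ D.mate b = x1) ∧
      (D.crossedToLeft x1 = D.crossedToLeft x → D.weight s a = D.weight s b) ∧
      (D.crossedToLeft x1 = !D.crossedToLeft x → D.weight s a * D.weight s b = 1) := by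
    intro a b h
    have w1 := fun v hv => weight_of_mate_top s (hcr x (by simp)) ox (mate_eq_symm (w := v) hv)
    have w2 := fun v hv => weight_of_mate_top s (hcr x1 (by simp)) ox1 (mate_eq_symm (w := v) hv)
    rcases h with ⟨h1, h2⟩ | ⟨h1, h2⟩ <;> refine ⟨by simp [mate_eq_symm h1, mate_eq_symm h2],
      by simp [mate_eq_symm h1, mate_eq_symm h2], fun hl => ?_, fun hl => ?_⟩ <;> rw [w1 _ h1, w2 _ h2, hl] <;>
      cases D.crossedToLeft x <;> simp <;> field_simp
  have mx : ∀ {a b}, π a = b → D.mate b = x ∨ D.mate b = x1 → m' a = x ∨ m' a = x1 := fun e h => by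
    rw [mv, e]; rcases h with h | h <;> simp [h, πx, πx1]
  have mo : ∀ {a a1 b b1}, π a = a1 → D.mate a1 = b1 → π b1 = b → m' a = b := fun e1 e2 e3 => by rw [mv, e1, e2, e3]
  have tx : τ' x = 1 := by rw [tv, πx, t2]
  have tx1 : τ' x1 = 1 := by rw [tv, πx1, t1]
  have cz := hcr z (by simp)
  have cz1 := hcr z1 (by simp)
  rcases h with ⟨h, hz, hl⟩ | ⟨h, hz, hl⟩ | ⟨h, hz, hl⟩ | ⟨h, hz, hl⟩ <;>
    obtain ⟨k1, k2, k3, k4⟩ := top _ _ h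
  · have ty := ov cz1 hz oz1
    exact walkDet_triangle D.next.injective hnd nx ny nz t1 t2 tx tx1 ty (by rw [tv, πy, ty]) k1 (mx πy1 k1)
      (.inl ⟨k2, hz, mx πz1 k2, mo πz hz πy1, k3 hl⟩) (by rw [tv, πy1]) (by rw [tv, πz1]) (by rw [tv, πz]) ho
  · have ty := ov cz hz oz
    exact walkDet_triangle D.next.injective hnd nx ny nz t1 t2 tx tx1 ty (by rw [tv, πy, ty]) k1 (mx πy1 k1)
      (.inr ⟨k2, hz, mx πz k2, mo πz1 hz πy1, k4 hl⟩) (by rw [tv, πy1]) (by rw [tv, πz1]) (by rw [tv, πz]) ho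
  · have ty := ov cz hz oz
    exact (walkDet_triangle D.next.injective hnd nx ny nz tx tx1 t1 t2 (by rw [tv, πy1, ty]) ty (mx πy k1) k1
      (.inl ⟨mx πz k2, mo πz1 hz πy, k2, hz, by rw [tv, tv, πy, πz, k3 hl]⟩) (by rw [tv, πy]) (by rw [tv, πz])
      (by rw [tv, πz1]) ho').symm
  · have ty := ov cz1 hz oz1
    exact (walkDet_triangle D.next.injective hnd nx ny nz tx tx1 t1 t2 (by rw [tv, πy1, ty]) ty (mx πy k1) k1
      (.inr ⟨mx πz1 k2, mo πz hz πy, k2, hz, by rw [tv, tv, πy, πz1, k4 hl]⟩) (by rw [tv, πy]) (by rw [tv, πz])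
      (by rw [tv, πz1]) ho').symm

local notation "Λ" => [x, D.next x, y, D.next y, z, D.next z]

theorem hasValue_slide {s : ℝ} (hs : 0 < s) (hD : D.IsPlanar)
    (hnd : (Λ).Nodup) (hcr : ∀ w ∈ Λ, D.IsCrossing w)
    (htop : D.isOver x = true ∧ D.isOver (D.next x) = true)
    (hbot : D.isOver z = false ∧ D.isOver (D.next z) = false)
    (hface : ∃ a b c : Bool,
      (D.face (x, a) = (y, b) ∧ D.face (y, b) = (z, c) ∧ D.face (z, c) = (x, a)) ∨
      (D.face (x, a) = (z, c) ∧ D.face (z, c) = (y, b) ∧ D.face (y, b) = (x, a)))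
    {π : D.Pt → D.Pt} (hπ : ∀ z, π (π z) = z) (πx : π x = D.next x)
    (πy : π y = D.next y) (πz : π z = D.next z)
    (πo : ∀ w, w ∉ Λ → π w = w) (hD' : (D.slide π hπ).IsPlanar) (v : ℝ) :
    HasValue s D v ↔ HasValue s (D.slide π hπ) v := by
  have p0 : [x, y, z, D.next x, D.next y, D.next z].Perm Λ := by
    have h1 : [z, D.next x, D.next y, D.next z].Perm [D.next x, D.next y, z, D.next z] :=
      List.perm_middle (l₁ := [_, _]).symm
    have h2 : [y, D.next x, D.next y, z, D.next z].Perm [D.next x, y, D.next y, z, D.next z] := .swap ..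
    exact .cons _ ((h1.cons _).trans h2)
  obtain ⟨t1, t2, t3, t4, t5⟩ := perm_three x y z
  have hcases : ∃ β, D.LinearTriangle x y z (D.next x) (D.next y) (D.next z) β ∨
      D.LinearTriangle x z y (D.next x) (D.next z) (D.next y) β ∨
      D.LinearTriangle y x z (D.next y) (D.next x) (D.next z) β ∨
      D.LinearTriangle z x y (D.next z) (D.next x) (D.next y) β ∨
      D.LinearTriangle y z x (D.next y) (D.next z) (D.next x) β ∨
      D.LinearTriangle z y x (D.next z) (D.next y) (D.next x) β ∨
      D.CyclicTriangle x y z (D.next x) (D.next y) (D.next z) β ∨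
      D.CyclicTriangle x z y (D.next x) (D.next z) (D.next y) β := by
    obtain ⟨a, b, c, ⟨h1, h2, h3⟩ | ⟨h1, h2, h3⟩⟩ := hface
    · exact triangle_cases (p0.nodup_iff.2 hnd) (fun w hw => hcr w (p0.mem_iff.1 hw)) h1 h2 h3
    · have p1 := (perm_next t1).trans p0
      obtain ⟨β, h⟩ := triangle_cases (p1.nodup_iff.2 hnd) (fun w hw => hcr w (p1.mem_iff.1 hw)) h1 h2 h3
      refine ⟨β, ?_⟩
      rcases h with h | h | h | h | h | h | h | h <;> simp only [h, true_or, or_true]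
  have fin : (∀ w, w ∉ Λ → D.mate w ∉ Λ) →
      (((D.mate x = y ∧ D.mate (D.next x) = z ∨ D.mate x = z ∧ D.mate (D.next x) = y) ∧ D.mate (D.next z) = D.next y ∧
        D.crossedToLeft (D.next x) = D.crossedToLeft x) ∨
      ((D.mate x = y ∧ D.mate (D.next x) = D.next z ∨ D.mate x = D.next z ∧ D.mate (D.next x) = y) ∧
        D.mate z = D.next y ∧ D.crossedToLeft (D.next x) = !D.crossedToLeft x) ∨
      ((D.mate x = D.next y ∧ D.mate (D.next x) = D.next z ∨ D.mate x = D.next z ∧ D.mate (D.next x) = D.next y) ∧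
        D.mate z = y ∧ D.crossedToLeft (D.next x) = D.crossedToLeft x) ∨
      ((D.mate x = D.next y ∧ D.mate (D.next x) = z ∨ D.mate x = z ∧ D.mate (D.next x) = D.next y) ∧
        D.mate (D.next z) = y ∧ D.crossedToLeft (D.next x) = !D.crossedToLeft x)) →
      (D.IsConnected → (D.slide π hπ).IsConnected → ∀ r, IsRotation D.seifert (D.NormIndex x) r →
        IsRotation (D.slide π hπ).seifert ((D.slide π hπ).NormIndex x) r) →
      (HasValue s D v ↔ HasValue s (D.slide π hπ) v) := by
    intro h1 h2 h3
    refine hasValue_iff hs hD hD' x x 0 ?_ (fun k1 k2 r hr => ?_) v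
    · rw [zpow_zero, one_mul]
      exact walkDet_slide hs hnd hcr rfl rfl rfl htop.1 htop.2 hbot.1 hbot.2 hπ πx πy πz πo h1 h2
    · have := h3 k1 k2 r hr
      rwa [writhe_slide, add_zero, sub_add_cancel]
  have sub : ∀ {p q r}, [p, q, r].Perm [x, y, z] →
      (∀ w, w ∉ [p, q, r, D.next p, D.next q, D.next r] → π w = w) ∧
      ((∀ w, w ∉ [p, q, r, D.next p, D.next q, D.next r] → D.mate w ∉ [p, q, r, D.next p, D.next q, D.next r]) →
        ∀ w, w ∉ Λ → D.mate w ∉ Λ) :=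
    fun h => by simp only [((perm_next h).trans p0).mem_iff]; exact ⟨πo, id⟩
  have neg : ∀ {v w b}, D.mate v = w → v ∈ Λ → D.crossedToLeft v = b →
      D.crossedToLeft w = !b := fun e hv hb => by rw [← e, D.crossedToLeft_mate (hcr _ hv), hb]
  obtain ⟨β, h | h | h | h | h | h | h | h⟩ := hcases
  · have hS := sub (.refl _)
    exact fin (hS.2 fun _ => h.mate_notMem) (.inl ⟨.inl ⟨h.mate_p, h.mate_p1⟩, h.mates.2.2, h.left_p1.trans h.left_p.symm⟩)
      fun _ _ _ => h.isRotation_slide hπ πx πy πz hS.1 (by simp)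
  · have hS := sub t1
    exact fin (hS.2 fun _ => h.mate_notMem) (.inl ⟨.inr ⟨h.mate_p, h.mate_p1⟩, h.mate_q1, h.left_p1.trans h.left_p.symm⟩)
      fun _ _ _ => h.isRotation_slide hπ πx πz πy hS.1 (by simp)
  · have hS := sub t2
    exact fin (hS.2 fun _ => h.mate_notMem) (.inr (.inl ⟨.inl ⟨h.mates.1, h.mate_q1⟩, h.mates.2.1,
      by rw [h.left_q1, neg h.mate_p (by simp) h.left_p, Bool.not_not]⟩))
      fun _ _ _ => h.isRotation_slide hπ πy πx πz hS.1 (by simp)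
  · have hS := sub t3
    exact fin (hS.2 fun _ => h.mate_notMem) (.inr (.inr (.inr ⟨.inr ⟨h.mates.1, h.mate_q1⟩, h.mate_p1,
      by rw [h.left_q1, neg h.mate_p (by simp) h.left_p, Bool.not_not]⟩)))
      fun _ _ _ => h.isRotation_slide hπ πz πx πy hS.1 (by simp)
  · have hS := sub t4
    exact fin (hS.2 fun _ => h.mate_notMem) (.inr (.inr (.inl ⟨.inl ⟨h.mates.2.1, h.mates.2.2⟩, h.mates.1,
      (neg h.mate_q1 (by simp) h.left_q1).trans (neg h.mate_p1 (by simp) h.left_p1).symm⟩)))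
      fun _ _ _ => h.isRotation_slide hπ πy πz πx hS.1 (by simp)
  · have hS := sub t5
    exact fin (hS.2 fun _ => h.mate_notMem) (.inr (.inr (.inl ⟨.inr ⟨h.mates.2.1, h.mates.2.2⟩, h.mate_p,
      (neg h.mate_q1 (by simp) h.left_q1).trans (neg h.mate_p1 (by simp) h.left_p1).symm⟩)))
      fun _ _ _ => h.isRotation_slide hπ πz πy πx hS.1 (by simp)
  · have hS := sub (.refl _)
    exact fin (hS.2 fun _ => h.mate_notMem) (.inr (.inr (.inr ⟨.inl ⟨h.mate_p, h.mates.1⟩, h.mates.2.2,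
      by rw [h.left_p1, neg h.mates.2.1 (by simp) h.left_q1, Bool.not_not]⟩)))
      fun k1 k2 _ => h.isRotation_slide hπ πx πy πz hS.1 hD hD' k1 k2 (by simp)
  · have hS := sub t1
    exact fin (hS.2 fun _ => h.mate_notMem) (.inr (.inl ⟨.inr ⟨h.mate_p, h.mates.1⟩, h.mate_q,
      by rw [h.left_p1, neg h.mates.2.1 (by simp) h.left_q1, Bool.not_not]⟩))
      fun k1 k2 _ => h.isRotation_slide hπ πx πz πy hS.1 hD hD' k1 k2 (by simp)

end Slide

end GaussDiagram

/-! ### The Conway polynomial is determined by the diagram -/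

namespace GaussDiagram

section Exchange

variable {D : GaussDiagram} {x y z : D.Pt}

local notation "Λ" => [x, D.next x, y, D.next y, z, D.next z]

theorem hasValue_exchange {s : ℝ} (hs : 0 < s) (hD : D.IsPlanar)
    (hnd : (Λ).Nodup)
    (hcr : ∀ w ∈ Λ, D.IsCrossing w)
    (htop : D.isOver x = true ∧ D.isOver (D.next x) = true)
    (hbot : D.isOver z = false ∧ D.isOver (D.next z) = false)
    (hface : ∃ a b c : Bool,
      (D.face (x, a) = (y, b) ∧ D.face (y, b) = (z, c) ∧ D.face (z, c) = (x, a)) ∨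
      (D.face (x, a) = (z, c) ∧ D.face (z, c) = (y, b) ∧ D.face (y, b) = (x, a)))
    (hD' : (D.exchange x y z).IsPlanar) (v : ℝ) :
    HasValue s D v ↔ HasValue s (D.exchange x y z) v := by
  classical
  obtain ⟨π, hπ⟩ : ∃ π : Perm D.Pt,
      π = swap x (D.next x) * swap y (D.next y) * swap z (D.next z) := ⟨_, rfl⟩
  have hn : (D.exchange x y z).next = π * D.next * π⁻¹ := by
    rw [hπ]
    unfold exchange
    congr!
  obtain ⟨⟨a1, a2, a3, a4, a5⟩, ⟨b2, b3, b4, b5⟩, ⟨c3, c4, c5⟩, ⟨d4, d5⟩, e5⟩ := ne_of_nodup_six hnd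
  have sw : ∀ {a b w : D.Pt}, w ≠ a → w ≠ b → swap a b w = w := swap_apply_of_ne_of_ne
  have πv : ∀ w, π w = swap x (D.next x) (swap y (D.next y) (swap z (D.next z) w)) := fun w => by
    rw [hπ]; rfl
  have πx : π x = D.next x := by rw [πv, sw a4 a5, sw a2 a3, swap_apply_left]
  have πx1 : π (D.next x) = x := by rw [πv, sw b4 b5, sw b2 b3, swap_apply_right]
  have πy : π y = D.next y := by
    rw [πv, sw c4 c5, swap_apply_left, sw a3.symm b3.symm]
  have πy1 : π (D.next y) = y := by
    rw [πv, sw d4 d5, swap_apply_right, sw a2.symm b2.symm]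
  have πz : π z = D.next z := by
    rw [πv, swap_apply_left, sw c5.symm d5.symm, sw a5.symm b5.symm]
  have πz1 : π (D.next z) = z := by
    rw [πv, swap_apply_right, sw c4.symm d4.symm, sw a4.symm b4.symm]
  have πo : ∀ w, w ∉ Λ → π w = w := by
    intro w hw
    simp only [List.mem_cons, List.not_mem_nil, or_false, not_or] at hw
    rw [πv, sw hw.2.2.2.2.1 hw.2.2.2.2.2, sw hw.2.2.1 hw.2.2.2.1, sw hw.1 hw.2.1]
  have hπ2 : ∀ w, π (π w) = w := by
    intro w
    by_cases hw : w ∈ Λ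
    · simp only [List.mem_cons, List.not_mem_nil, or_false] at hw
      rcases hw with e | e | e | e | e | e <;> simp only [e, πx, πx1, πy, πy1, πz, πz1]
    · rw [πo w hw, πo w hw]
  have hinv : ∀ w, π⁻¹ w = π w := fun w => by rw [Perm.inv_eq_iff_eq, hπ2]
  have h1 : ∀ w : D.Pt, (D.slide π hπ2).next (π w) = π ((D.exchange x y z).next w) := fun w => by
    rw [hn]
    change D.next (π w) = π (π (D.next (π⁻¹ w)))
    rw [hπ2, hinv]
  have h2 : ∀ w : D.Pt, (D.slide π hπ2).mate (π w) = π ((D.exchange x y z).mate w) := fun w =>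
    congrArg (fun u => π (D.mate u)) (hπ2 w)
  have h3 : ∀ w : D.Pt, (D.slide π hπ2).isOver (π w) = (D.exchange x y z).isOver w := fun w =>
    congrArg D.isOver (hπ2 w)
  have h4 : ∀ w : D.Pt, (D.slide π hπ2).isPos (π w) = (D.exchange x y z).isPos w := fun w =>
    congrArg D.isPos (hπ2 w)
  have hs' : (D.slide π hπ2).IsPlanar :=
    isPlanar_iso (D := D.exchange x y z) (D' := D.slide π hπ2) π h1 h2 (fun w _ => h3 w) (fun w _ => h4 w) hD'
  rw [hasValue_slide hs hD hnd hcr htop hbot hface hπ2 πx πy πz πo hs' v,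
    hasValue_iso (D := D.exchange x y z) (D' := D.slide π hπ2) π h1 h2 (fun w _ => h3 w) (fun w _ => h4 w) hs hD' v]

end Exchange

theorem PlanarMove.hasValue_iff {D D' : GaussDiagram} (h : PlanarMove D D') {s : ℝ} (hs : 0 < s) (v : ℝ) :
    HasValue s D v ↔ HasValue s D' v := by
  obtain ⟨hD, hD', h⟩ := h
  cases h with
  | iso _ e hnext hmate hover hpos => exact hasValue_iso e hnext hmate hover hpos hs hD v
  | sub a => exact hasValue_subdivide hs hD a v
  | reidI x hx h => exact hasValue_reidI hs hD hx h v
  | reidII x y hx hy hox hoy hpos hxy hm => exact hasValue_reidII hs hD hx hy hox hoy hpos hxy hm v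
  | reidIII x y z hnd hcr htop hbot hface => exact hasValue_exchange hs hD hnd hcr htop hbot hface hD' v

theorem LinkEquiv.hasValue_iff {D D' : GaussDiagram} (h : LinkEquiv D D') {s : ℝ} (hs : 0 < s) (v : ℝ) :
    HasValue s D v ↔ HasValue s D' v := by
  induction h with
  | rel _ _ h => exact h.hasValue_iff hs v
  | refl => rfl
  | symm _ _ _ ih => exact ih.symm
  | trans _ _ _ _ _ ih1 ih2 => exact ih1.trans ih2

theorem HasConwayPolynomial.hasValue {D : GaussDiagram} {q : ℤ[X]} (h : D.HasConwayPolynomial q) {s : ℝ}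
    (hs : 0 < s) (h1 : s ≠ 1) : HasValue s D (aeval (s⁻¹ - s) q) := by
  have hz : s⁻¹ - s ≠ 0 := by
    intro e
    have : s⁻¹ = s := by linarith
    rw [inv_eq_iff_eq_inv] at this
    have h2 : s * s = 1 := by nth_rewrite 1 [this]; exact inv_mul_cancel₀ hs.ne'
    exact h1 (mul_self_eq_one_iff.1 h2 |>.resolve_right (by linarith))
  have key : ∀ {a b c : ℤ[X]}, a - b = X * c → aeval (s⁻¹ - s) a - aeval (s⁻¹ - s) b = (s⁻¹ - s) * aeval (s⁻¹ - s) c :=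
    fun h => by rw [← map_sub, h, map_mul, aeval_X]
  induction h with
  | unknot D h => simpa using hasValue_circle s h
  | equiv D D' h q _ ih => exact (h.hasValue_iff hs _).1 ih
  | skeinPos D hD x hx hpos qp qm qz hq _ _ ihm ihz =>
    obtain ⟨v, hv⟩ := exists_hasValue s hD ⟨x⟩
    rwa [show aeval (s⁻¹ - s) qp = v by linarith [key hq, hasValue_skein hs hD hx hpos hv ihm ihz]]
  | skeinNeg D hD x hx hpos qp qm qz hq _ _ ihp ihz =>
    obtain ⟨v, hv⟩ := exists_hasValue s (D := D.switch x) (isPlanar_switch hD x) ⟨x⟩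
    rwa [show aeval (s⁻¹ - s) qm = v by linarith [key hq, hasValue_skein hs hD hx hpos ihp hv ihz]]
  | skeinZero D hD x hx hpos qp qm qz hq _ _ ihp ihm =>
    obtain ⟨v, hv⟩ := exists_hasValue s (D := D.smooth x) (isPlanar_smooth hD hx) ⟨x⟩
    rwa [mul_left_cancel₀ hz ((key hq).symm.trans (hasValue_skein hs hD hx hpos ihp ihm hv))]

/-- The Conway polynomial is well defined. -/
theorem HasConwayPolynomial.unique {D : GaussDiagram} {q q' : ℤ[X]} (h : D.HasConwayPolynomial q)
    (h' : D.HasConwayPolynomial q') : q = q' := by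
  have key : ∀ s : ℝ, 0 < s → s < 1 → aeval (s⁻¹ - s) (q - q') = 0 := fun s h0 h1 => by
    rw [map_sub, (h.hasValue h0 h1.ne).unique h0 (h'.hasValue h0 h1.ne), sub_self]
  have : (q - q').map (Int.castRingHom ℝ) = 0 := by
    refine Polynomial.eq_zero_of_infinite_isRoot _ (Set.Infinite.mono (s := (fun s : ℝ => s⁻¹ - s) '' Set.Ioo 0 1) ?_ ?_)
    · rintro _ ⟨s, hs, rfl⟩
      have := key s hs.1 hs.2
      rw [aeval_def, ← eval_map] at this
      exact this
    · refine Set.Infinite.image ?_ (Set.Ioo_infinite one_pos)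
      intro a ha b hb e
      have h1 : b⁻¹ - a⁻¹ = b - a := by simp only at e; linarith
      have h2 : b⁻¹ - a⁻¹ = (a - b) * (a⁻¹ * b⁻¹) := by
        have := ha.1.ne'; have := hb.1.ne'; field_simp
      have h3 : 0 < a⁻¹ * b⁻¹ := mul_pos (inv_pos.2 ha.1) (inv_pos.2 hb.1)
      have h4 : (a - b) * (a⁻¹ * b⁻¹ + 1) = 0 := by linarith
      rcases mul_eq_zero.1 h4 with h5 | h5 <;> linarith
  have hinj := Polynomial.map_injective (Int.castRingHom ℝ) Int.cast_injective
  have := hinj (this.trans (Polynomial.map_zero _).symm)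
  exact sub_eq_zero.1 this

end GaussDiagram

/-- The data of a Gauss diagram on a type `P` of marked points, without the laws.  Working with codes keeps the type
of marked points fixed when crossings are erased or smoothed. -/
@[ext] structure Code (P : Type) where
  next : P → P
  mate : P → P
  isOver : P → Bool
  isPos : P → Bool

namespace Code

variable {P Q : Type}

/-- `C` is the code of the Gauss diagram `D`, whose marked points are labelled by `e`. -/
structure Represents (C : Code P) (D : GaussDiagram) (e : P ≃ D.Pt) : Prop where
  next : ∀ x, D.next (e x) = e (C.next x)
  mate : ∀ x, D.mate (e x) = e (C.mate x)
  isOver : ∀ x, C.mate x ≠ x → D.isOver (e x) = C.isOver x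
  isPos : ∀ x, C.mate x ≠ x → D.isPos (e x) = C.isPos x

/-- `C` is the code of a Gauss diagram. -/
def Valid (C : Code P) : Prop := ∃ D e, C.Represents D e

/-- `C` is the code of a planar Gauss diagram. -/
def Planar (C : Code P) : Prop := ∃ D e, C.Represents D e ∧ D.IsPlanar

/-- `C` is the code of a planar Gauss diagram with the Conway polynomial `q`. -/
def Poly (C : Code P) (q : ℤ[X]) : Prop := ∃ D e, C.Represents D e ∧ D.IsPlanar ∧ D.HasConwayPolynomial q

variable {C : Code P} {C' : Code Q} {D D' : GaussDiagram} {e : P ≃ D.Pt} {e' : P ≃ D'.Pt} {q : ℤ[X]}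

theorem Planar.valid (h : C.Planar) : C.Valid :=
  let ⟨D, e, h, _⟩ := h; ⟨D, e, h⟩

theorem Poly.planar (h : C.Poly q) : C.Planar :=
  let ⟨D, e, h, hD, _⟩ := h; ⟨D, e, h, hD⟩

namespace Valid

theorem finite (h : C.Valid) : Finite P := by
  obtain ⟨D, e, h⟩ := h
  have := D.finite
  exact Finite.of_equiv _ e.symm

theorem bijective (h : C.Valid) : Function.Bijective C.next := by
  obtain ⟨D, e, h⟩ := h
  have : C.next = e.symm ∘ D.next ∘ e := by funext x; simp [h.next]
  rw [this]
  exact e.symm.bijective.comp (D.next.bijective.comp e.bijective)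

theorem next_inj (h : C.Valid) {x y : P} (e : C.next x = C.next y) : x = y := h.bijective.1 e

theorem mate_mate (h : C.Valid) (x : P) : C.mate (C.mate x) = x := by
  obtain ⟨D, e, h⟩ := h
  apply e.injective
  rw [← h.mate, ← h.mate, D.mate_mate]

theorem mate_mate_ne (h : C.Valid) {x : P} (hx : C.mate x ≠ x) : C.mate (C.mate x) ≠ C.mate x := by
  rw [h.mate_mate]; exact hx.symm

theorem isOver_mate (h : C.Valid) {x : P} (hx : C.mate x ≠ x) : C.isOver (C.mate x) = !C.isOver x := by
  have hx' := h.mate_mate_ne hx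
  obtain ⟨D, e, h⟩ := h
  rw [← h.isOver x hx, ← h.isOver _ hx', ← h.mate]
  exact D.isOver_mate _ (by rw [h.mate]; exact e.injective.ne hx)

theorem isPos_mate (h : C.Valid) {x : P} (hx : C.mate x ≠ x) : C.isPos (C.mate x) = C.isPos x := by
  have hx' := h.mate_mate_ne hx
  obtain ⟨D, e, h⟩ := h
  rw [← h.isPos x hx, ← h.isPos _ hx', ← h.mate]
  exact D.isPos_mate _

end Valid

theorem Represents.isCrossing (h : C.Represents D e) {x : P}
    (hx : C.mate x ≠ x) : D.mate (e x) ≠ e x := by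
  rw [h.mate]; exact e.injective.ne hx

/-- Codes that agree up to a relabelling, and up to the irrelevant values at ordinary points. -/
theorem Represents.congr (h : C.Represents D e)
    (φ : Q ≃ P) (hn : ∀ x, C.next (φ x) = φ (C'.next x)) (hm : ∀ x, C.mate (φ x) = φ (C'.mate x))
    (ho : ∀ x, C'.mate x ≠ x → C.isOver (φ x) = C'.isOver x ∧ C.isPos (φ x) = C'.isPos x) :
    C'.Represents D (φ.trans e) where
  next x := by simp [h.next, hn]
  mate x := by simp [h.mate, hm]
  isOver x hx := (h.isOver (φ x) (by rw [hm]; exact φ.injective.ne hx)).trans (ho x hx).1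
  isPos x hx := (h.isPos (φ x) (by rw [hm]; exact φ.injective.ne hx)).trans (ho x hx).2

theorem Poly.congr (h : C.Poly q)
    (φ : Q ≃ P) (hn : ∀ x, C.next (φ x) = φ (C'.next x)) (hm : ∀ x, C.mate (φ x) = φ (C'.mate x))
    (ho : ∀ x, C'.mate x ≠ x → C.isOver (φ x) = C'.isOver x ∧ C.isPos (φ x) = C'.isPos x) : C'.Poly q := by
  obtain ⟨D, e, h, hD, hq⟩ := h
  exact ⟨D, _, h.congr φ hn hm ho, hD, hq⟩

theorem Planar.congr (h : C.Planar)
    (φ : Q ≃ P) (hn : ∀ x, C.next (φ x) = φ (C'.next x)) (hm : ∀ x, C.mate (φ x) = φ (C'.mate x))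
    (ho : ∀ x, C'.mate x ≠ x → C.isOver (φ x) = C'.isOver x ∧ C.isPos (φ x) = C'.isPos x) : C'.Planar := by
  obtain ⟨D, e, h, hD⟩ := h
  exact ⟨D, _, h.congr φ hn hm ho, hD⟩

theorem Represents.move (h : C.Represents D e) (h' : C.Represents D' e') :
    D.Move D' ∧ (D.IsPlanar → D'.IsPlanar) := by
  have hn : ∀ x, D'.next ((e.symm.trans e') x) = (e.symm.trans e') (D.next x) := fun x => by
    obtain ⟨x, rfl⟩ := e.surjective x
    simp [h.next, h'.next]
  have hm : ∀ x, D'.mate ((e.symm.trans e') x) = (e.symm.trans e') (D.mate x) := fun x => by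
    obtain ⟨x, rfl⟩ := e.surjective x
    simp [h.mate, h'.mate]
  have hx : ∀ x, D.mate (e x) ≠ e x → C.mate x ≠ x := fun x hx e1 => hx (by rw [h.mate, e1])
  have ho : ∀ x, D.mate x ≠ x → D'.isOver ((e.symm.trans e') x) = D.isOver x := fun x h1 => by
    obtain ⟨x, rfl⟩ := e.surjective x
    simp [h.isOver x (hx x h1), h'.isOver x (hx x h1)]
  have hp : ∀ x, D.mate x ≠ x → D'.isPos ((e.symm.trans e') x) = D.isPos x := fun x h1 => by
    obtain ⟨x, rfl⟩ := e.surjective x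
    simp [h.isPos x (hx x h1), h'.isPos x (hx x h1)]
  exact ⟨GaussDiagram.Move.iso D D' _ hn hm ho hp, GaussDiagram.isPlanar_iso _ hn hm ho hp⟩

theorem Planar.isPlanar (hC : C.Planar) (h : C.Represents D e) :
    D.IsPlanar := by
  obtain ⟨D', e', h', hD'⟩ := hC
  exact (h'.move h).2 hD'

theorem Poly.hasConwayPolynomial (hC : C.Poly q) {D : GaussDiagram} {e : P ≃ D.Pt}
    (h : C.Represents D e) : D.HasConwayPolynomial q := by
  obtain ⟨D', e', h', hD', hq⟩ := hC
  exact .equiv _ _ (.rel _ _ ⟨hD', (h'.move h).2 hD', (h'.move h).1⟩) _ hq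

/-! ### Operations on codes -/

open Classical in
/-- The points of `S` become ordinary. -/
noncomputable def erase (C : Code P) (S : Set P) : Code P :=
  { C with mate := fun y => if y ∈ S then y else C.mate y }

/-- The crossings of `x` and `y` are forgotten. -/
noncomputable abbrev eraseTwo (C : Code P) (x y : P) : Code P := C.erase {x, C.mate x, y, C.mate y}

open Classical in
/-- The crossing change at `x`. -/
noncomputable def switch (C : Code P) (x : P) : Code P :=
  { C with
    isOver := fun y => if y = x ∨ y = C.mate x then !C.isOver y else C.isOver y
    isPos := fun y => if y = x ∨ y = C.mate x then !C.isPos y else C.isPos y }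

open Classical in
/-- The smoothing of the crossing of `x`. -/
noncomputable def smooth (C : Code P) (x : P) : Code P :=
  { C.erase {x, C.mate x} with
    next := fun y => if y = x then C.next (C.mate x) else if y = C.mate x then C.next x else C.next y }

section operations

variable (C) {S : Set P} {x y : P}

@[simp] theorem erase_next : (C.erase S).next = C.next := rfl

theorem erase_mate_of_mem (h : y ∈ S) : (C.erase S).mate y = y := if_pos h
theorem erase_mate_of_notMem (h : y ∉ S) : (C.erase S).mate y = C.mate y := if_neg h

theorem erase_mate_of_eq (h : C.mate y = y) : (C.erase S).mate y = y := by
  by_cases hS : y ∈ S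
  · exact C.erase_mate_of_mem hS
  · rw [C.erase_mate_of_notMem hS, h]

theorem smooth_mate : (C.smooth x).mate = (C.erase {x, C.mate x}).mate := rfl

theorem smooth_next_self : (C.smooth x).next x = C.next (C.mate x) := if_pos rfl

theorem smooth_next_mate : (C.smooth x).next (C.mate x) = C.next x := by
  by_cases h : C.mate x = x
  · rw [h, smooth_next_self, h]
  · exact (if_neg h).trans (if_pos rfl)

theorem smooth_next_of_ne (h1 : y ≠ x) (h2 : y ≠ C.mate x) : (C.smooth x).next y = C.next y :=
  (if_neg h1).trans (if_neg h2)

variable {C}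

theorem switch_of_erase (hS : x ∈ S) (hS' : C.mate x ∈ S) (hy : (C.erase S).mate y ≠ y) :
    (C.switch x).isOver y = C.isOver y ∧ (C.switch x).isPos y = C.isPos y := by
  have : ¬ (y = x ∨ y = C.mate x) := fun h => hy (C.erase_mate_of_mem (by rcases h with rfl | rfl <;> assumption))
  simp [switch, this]

theorem Poly.of_erase_switch (h : (C.erase S).Poly q) (hS : x ∈ S) (hS' : C.mate x ∈ S) :
    ((C.switch x).erase S).Poly q :=
  h.congr (.refl P) (fun _ => rfl) (fun _ => rfl) fun _ hy => (switch_of_erase hS hS' hy).imp Eq.symm Eq.symm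

theorem Planar.of_erase_switch (h : ((C.switch x).erase S).Planar) (hS : x ∈ S) (hS' : C.mate x ∈ S) :
    (C.erase S).Planar :=
  h.congr (.refl P) (fun _ => rfl) (fun _ => rfl) fun _ hy => switch_of_erase hS hS' hy

theorem Represents.sameCrossing (h : C.Represents D e) :
    D.SameCrossing (e x) (e y) ↔ y = x ∨ y = C.mate x := by
  unfold GaussDiagram.SameCrossing
  rw [h.mate, e.injective.eq_iff, e.injective.eq_iff]

open Classical in
theorem Represents.switch (h : C.Represents D e) (x : P) :
    (C.switch x).Represents (D.switch (e x)) e where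
  next := h.next
  mate := h.mate
  isOver y hy := by
    change (if D.SameCrossing (e x) (e y) then !D.isOver (e y) else D.isOver (e y)) = _
    simp only [h.isOver y hy, h.sameCrossing, Code.switch]
  isPos y hy := by
    change (if D.SameCrossing (e x) (e y) then !D.isPos (e y) else D.isPos (e y)) = _
    simp only [h.isPos y hy, h.sameCrossing, Code.switch]

theorem Represents.smooth (h : C.Represents D e) (x : P) :
    (C.smooth x).Represents (D.smooth (e x)) e where
  next y := by
    by_cases h1 : y = x
    · subst h1
      rw [smooth_next_self]
      exact (D.smooth_next_self (e y)).trans ((congrArg D.next (h.mate y)).trans (h.next _))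
    · by_cases h2 : y = C.mate x
      · subst h2
        rw [smooth_next_mate]
        exact (congrArg (D.smooth (e x)).next (h.mate x).symm).trans ((D.smooth_next_mate (e x)).trans (h.next x))
      · rw [smooth_next_of_ne _ h1 h2]
        exact (D.smooth_next_of_not_same (mt h.sameCrossing.1 (not_or.2 ⟨h1, h2⟩))).trans (h.next y)
  mate y := by
    by_cases h1 : y = x ∨ y = C.mate x
    · rw [C.smooth_mate, C.erase_mate_of_mem h1]
      exact D.smooth_mate_of_same (h.sameCrossing.2 h1)
    · rw [C.smooth_mate, C.erase_mate_of_notMem h1]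
      exact (D.smooth_mate_of_not_same (mt h.sameCrossing.1 h1)).trans (h.mate y)
  isOver y hy := h.isOver y fun e => hy (C.erase_mate_of_eq e)
  isPos y hy := h.isPos y fun e => hy (C.erase_mate_of_eq e)

theorem Valid.smooth (h : C.Valid) (x : P) : (C.smooth x).Valid := by
  obtain ⟨D, e, h⟩ := h
  exact ⟨D.smooth (e x), e, h.smooth x⟩

theorem Planar.smooth (h : C.Planar) (hx : C.mate x ≠ x) : (C.smooth x).Planar := by
  obtain ⟨D, e, h, hD⟩ := h
  exact ⟨D.smooth (e x), e, h.smooth x, GaussDiagram.isPlanar_smooth hD (h.isCrossing hx)⟩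

theorem Planar.switch (h : C.Planar) (x : P) : (C.switch x).Planar := by
  obtain ⟨D, e, h, hD⟩ := h
  exact ⟨D.switch (e x), e, h.switch x, GaussDiagram.isPlanar_switch hD _⟩

/-- The sign of a crossing. -/
noncomputable def sign (C : Code P) (x : P) : ℤ[X] := if C.isPos x then 1 else -1

theorem switch_switch (C : Code P) (x : P) : (C.switch x).switch x = C := by
  refine Code.ext rfl rfl (funext fun y => ?_) (funext fun y => ?_) <;>
  · by_cases h : y = x ∨ y = C.mate x <;> simp [Code.switch, h]

/-- The skein relation, solved for the polynomial of `C`. -/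
theorem Planar.poly_of_switch_of_smooth (h : C.Planar) (hx : C.mate x ≠ x) {q₁ q₂ : ℤ[X]} (h₁ : (C.switch x).Poly q₁)
    (h₂ : (C.smooth x).Poly q₂) : C.Poly (q₁ + C.sign x * X * q₂) := by
  obtain ⟨D, e, h, hD⟩ := h
  have hx' := h.isCrossing hx
  cases hp : C.isPos x
  · refine ⟨(D.switch (e x)).switch (e x), e, C.switch_switch x ▸ (h.switch x).switch x, GaussDiagram.isPlanar_switch
      (GaussDiagram.isPlanar_switch hD _) _, ?_⟩
    have hs : (C.smooth x).Represents ((D.switch (e x)).smooth (e x)) e :=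
      ((h.switch x).smooth x).congr (.refl P) (fun _ => rfl) (fun _ => rfl) fun _ hy =>
        switch_of_erase (.inl rfl) (.inr rfl) hy
    refine .skeinNeg (D.switch (e x)) (GaussDiagram.isPlanar_switch hD _) (e x) hx' ?_ q₁ _ q₂ ?_
      (h₁.hasConwayPolynomial (h.switch x)) (h₂.hasConwayPolynomial hs)
    · exact ((h.switch x).isPos x hx).trans (by simp [Code.switch, hp])
    · simp [sign, hp]
  · refine ⟨D, e, h, hD, .skeinPos D hD (e x) hx' ((h.isPos x hx).trans hp) _ q₁ q₂ ?_
      (h₁.hasConwayPolynomial (h.switch x)) (h₂.hasConwayPolynomial (h.smooth x))⟩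
    simp [sign, hp]

/-- A crossing whose change does not matter has a smoothing of vanishing polynomial. -/
theorem Planar.poly_smooth_zero (h : C.Planar) (hx : C.mate x ≠ x) (h₁ : C.Poly q)
    (h₂ : (C.switch x).Poly q) : (C.smooth x).Poly 0 := by
  wlog hp : C.isPos x = true generalizing C
  · have := this (C := C.switch x) (h.switch x) hx h₂ (by rwa [switch_switch])
      (by simpa [Code.switch] using hp)
    exact this.congr (.refl P) (fun _ => rfl) (fun _ => rfl) fun _ hy => switch_of_erase (.inl rfl) (.inr rfl) hy
  obtain ⟨D, e, h, hD⟩ := h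
  exact ⟨D.smooth (e x), e, h.smooth x, GaussDiagram.isPlanar_smooth hD (h.isCrossing hx),
    .skeinZero D hD (e x) (h.isCrossing hx) ((h.isPos x hx).trans hp) q q 0 (by simp)
      (h₁.hasConwayPolynomial h) (h₂.hasConwayPolynomial (h.switch x))⟩

end operations

end Code

namespace GaussDiagram

theorem isPlanar_of_subdivide {D : GaussDiagram} {a : D.Pt} (hD : (D.subdivide a).IsPlanar) : D.IsPlanar := by
  rw [isPlanar_iff] at *
  intro f hf
  have key : ∀ y, (f ∘ D.subdivideEdge a) ((D.subdivide a).next (some y)) = f (D.next y) := fun y =>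
    congrArg f (D.subdivideEdge_next_some a y)
  obtain ⟨G, hG⟩ := hD (f ∘ D.subdivideEdge a) fun (y : Option D.Pt) => by
    rcases y with _ | y
    · have e : (f ∘ D.subdivideEdge a) ((D.subdivide a).next none) = (f ∘ D.subdivideEdge a) none :=
        Eq.trans (congrArg (f ∘ D.subdivideEdge a) (D.subdivide_next_none a)) rfl
      exact congrArg₂ (· + ·) e e
    · exact (congrArg₂ (· + ·) (key y) (key (D.mate y))).trans (hf y)
  have hn : ∀ y : D.Pt, G ((D.subdivide a).next (some y)) = G (some (D.next y)) := by
    intro y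
    by_cases h : y = a
    · subst h
      have := hG.ordinary none rfl
      rw [subdivide_next_none] at this
      rw [subdivide_next_some_self]
      exact this.symm
    · rw [subdivide_next_some _ _ h]
  refine ⟨fun y => G (some y), fun y hy => ?_, fun y hy hl => ?_⟩
  · exact (hn y).symm.trans (hG.ordinary (some y) (congrArg some hy))
  · obtain ⟨h1, h2, h3⟩ := hG.left (some y) (fun e => hy (Option.some.inj e)) hl
    exact ⟨(hn (D.mate y)).symm.trans h1, h2, (hn y).symm.trans (h3.trans (congrArg (G (some y) - ·) (key (D.mate y))))⟩

end GaussDiagram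

namespace Code

variable {P : Type}

/-! ### Ordinary points -/

/-- Starting from `x`, the curve arrives at `y` after passing only through ordinary points. -/
inductive Thru (C : Code P) : P → P → Prop
  | single (x : P) : Thru C x (C.next x)
  | step {x y : P} (h : C.mate (C.next x) = C.next x) (hy : Thru C (C.next x) y) : Thru C x y

variable {C : Code P} {x y z : P} {S : Set P}

theorem Thru.of_eq (h : C.next x = y) : C.Thru x y := h ▸ .single x

theorem Thru.trans (h : C.Thru x y) (hy : C.mate y = y) (h' : C.Thru y z) : C.Thru x z := by
  induction h with
  | single x => exact .step hy h'
  | step h1 _ ih => exact .step h1 (ih hy h')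

theorem Thru.erase (h : C.Thru x y) (S : Set P) : (C.erase S).Thru x y := by
  induction h with
  | single x => exact .single (C := C.erase S) x
  | step h1 _ ih => exact .step (C := C.erase S) (C.erase_mate_of_eq h1) ih

/-- The first step of a path; it is the only step, unless it leads to an ordinary point. -/
theorem Thru.cases (h : C.Thru x y) : C.next x = y ∨ (C.mate (C.next x) = C.next x ∧ C.Thru (C.next x) y) := by
  cases h with
  | single => exact .inl rfl
  | step h1 h2 => exact .inr ⟨h1, h2⟩

theorem Valid.mate_ne {o : P} (hC : C.Valid) (ho : C.mate o = o) (hx : x ≠ o) : C.mate x ≠ o := fun e =>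
  hx (by rw [← hC.mate_mate x, e, ho])

theorem ne_of_ordinary (hx : C.mate x ≠ x) (hxx : C.mate (C.mate x) = x) (hz : C.mate z = z) :
    z ≠ x ∧ z ≠ C.mate x :=
  ⟨fun e => hx (e ▸ hz), fun e => hx (by rw [e, hxx] at hz; exact hz.symm)⟩

/-- A path that does not start at the crossing of `x` survives the smoothing of this crossing. -/
theorem Thru.smooth_of_ne (h : C.Thru y z) (hx : C.mate x ≠ x) (hxx : C.mate (C.mate x) = x) (h1 : y ≠ x)
    (h2 : y ≠ C.mate x) : (C.smooth x).Thru y z := by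
  induction h with
  | single y => exact .of_eq (C.smooth_next_of_ne h1 h2)
  | @step y z h3 _ ih =>
    refine .step ?_ ?_ <;> rw [C.smooth_next_of_ne h1 h2]
    · exact C.erase_mate_of_eq h3
    · exact ih (ne_of_ordinary hx hxx h3).1 (ne_of_ordinary hx hxx h3).2

theorem Thru.smooth_of_ordinary (h : C.Thru y z) (hx : C.mate x ≠ x) (hxx : C.mate (C.mate x) = x)
    (hy : C.mate y = y) : (C.smooth x).Thru y z :=
  h.smooth_of_ne hx hxx (ne_of_ordinary hx hxx hy).1 (ne_of_ordinary hx hxx hy).2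

theorem Thru.smooth_mate (h : C.Thru x z) (hx : C.mate x ≠ x) (hxx : C.mate (C.mate x) = x) :
    (C.smooth x).Thru (C.mate x) z := by
  rcases h.cases with e | ⟨e, h⟩
  · exact .of_eq (C.smooth_next_mate.trans e)
  · refine .step ?_ ?_ <;> rw [C.smooth_next_mate]
    · exact C.erase_mate_of_eq e
    · exact h.smooth_of_ordinary hx hxx e

theorem Thru.smooth_self (h : C.Thru (C.mate x) z) (hx : C.mate x ≠ x) (hxx : C.mate (C.mate x) = x) :
    (C.smooth x).Thru x z := by
  rcases h.cases with e | ⟨e, h⟩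
  · exact .of_eq (C.smooth_next_self.trans e)
  · refine .step ?_ ?_ <;> rw [C.smooth_next_self]
    · exact C.erase_mate_of_eq e
    · exact h.smooth_of_ordinary hx hxx e

open Classical in
/-- Forget the ordinary point `o`. -/
noncomputable def remove (C : Code P) (o : P) (h : C.next o ≠ o) : Code {y // y ≠ o} where
  next y := if h' : C.next y = o then ⟨C.next o, h⟩ else ⟨C.next y, h'⟩
  mate y := if h' : C.mate y = o then y else ⟨C.mate y, h'⟩
  isOver y := C.isOver y
  isPos y := C.isPos y

section remove

variable {o : P} {h : C.next o ≠ o}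

theorem remove_next_of_eq {y : {y // y ≠ o}} (h' : C.next y = o) : ((C.remove o h).next y : P) = C.next o :=
  congrArg Subtype.val (dif_pos h')

theorem remove_next_of_ne {y : {y // y ≠ o}} (h' : C.next y ≠ o) : ((C.remove o h).next y : P) = C.next y :=
  congrArg Subtype.val (dif_neg h')

theorem remove_mate (ho : C.mate o = o) (hC : C.Valid) (y : {y // y ≠ o}) :
    ((C.remove o h).mate y : P) = C.mate y := congrArg Subtype.val (dif_neg (hC.mate_ne ho y.2))

theorem Valid.exists_subdivide (hC : C.Valid) (ho : C.mate o = o) : ∃ D e, (C.remove o h).Represents D e ∧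
    ∃ (a : D.Pt) (e' : P ≃ (D.subdivide a).Pt), C.Represents (D.subdivide a) e' := by
  classical
  have hfin := hC.finite
  have hm := remove_mate (h := h) ho hC
  have hinj : Function.Injective (C.remove o h).next := by
    intro y z e
    have e := congrArg Subtype.val e
    by_cases hy : C.next y = o <;> by_cases hz : C.next z = o
    · exact Subtype.ext (hC.next_inj (hy.trans hz.symm))
    · rw [remove_next_of_eq hy, remove_next_of_ne hz] at e
      exact absurd (hC.next_inj e).symm z.2
    · rw [remove_next_of_ne hy, remove_next_of_eq hz] at e
      exact absurd (hC.next_inj e) y.2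
    · rw [remove_next_of_ne hy, remove_next_of_ne hz] at e
      exact Subtype.ext (hC.next_inj e)
  have hne : ∀ y : {y // y ≠ o}, (C.remove o h).mate y ≠ y → C.mate y ≠ y := fun y hy e =>
    hy (Subtype.ext ((hm y).trans e))
  let D : GaussDiagram :=
    { Pt := {y // y ≠ o}
      finite := inferInstance
      next := Equiv.ofBijective _ (Finite.injective_iff_bijective.1 hinj)
      mate := (C.remove o h).mate
      mate_mate := fun y => Subtype.ext (by rw [hm, hm, hC.mate_mate])
      isOver := fun y => C.isOver y
      isOver_mate := fun y hy => by rw [hm]; exact hC.isOver_mate (hne y hy)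
      isPos := fun y => C.isPos y
      isPos_mate := fun y => by
        by_cases hy : (C.remove o h).mate y = y
        · rw [hy]
        · rw [hm]; exact hC.isPos_mate (hne y hy) }
  obtain ⟨a, ha⟩ := hC.bijective.2 o
  have hao : a ≠ o := fun e => h (e ▸ ha)
  refine ⟨D, Equiv.refl _, ⟨fun _ => rfl, fun _ => rfl, fun _ _ => rfl, fun _ _ => rfl⟩, ⟨a, hao⟩,
    (Equiv.optionSubtypeNe o).symm, ?_⟩
  have hsome : ∀ (y : P) (hy : y ≠ o), (Equiv.optionSubtypeNe o).symm y = some ⟨y, hy⟩ := fun y hy =>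
    Equiv.optionSubtypeNe_symm_of_ne hy
  have hnone : (Equiv.optionSubtypeNe o).symm o = none := Equiv.optionSubtypeNe_symm_self o
  refine ⟨fun x => ?_, fun x => ?_, fun x hx => ?_, fun x hx => ?_⟩
  · by_cases hx : x = o
    · subst hx
      exact (congrArg (D.subdivide _).next hnone).trans ((D.subdivide_next_none _).trans
        ((congrArg some (Subtype.ext (remove_next_of_eq (y := ⟨a, hao⟩) ha))).trans (hsome _ h).symm))
    · refine (congrArg (D.subdivide _).next (hsome x hx)).trans ?_
      by_cases hxa : x = a
      · subst hxa
        exact (D.subdivide_next_some_self _).trans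
          (hnone.symm.trans (congrArg (Equiv.optionSubtypeNe o).symm ha.symm))
      · have hxo : C.next x ≠ o := fun e => hxa (hC.next_inj (e.trans ha.symm))
        refine (D.subdivide_next_some (a := ⟨a, hao⟩) (y := ⟨x, hx⟩) (fun e => hxa (congrArg Subtype.val e))).trans ?_
        exact (congrArg some (Subtype.ext (remove_next_of_ne (y := ⟨x, hx⟩) hxo))).trans (hsome _ hxo).symm
  · by_cases hx : x = o
    · subst hx
      exact (congrArg (D.subdivide _).mate hnone).trans
        (hnone.symm.trans (congrArg (Equiv.optionSubtypeNe _).symm ho.symm))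
    · exact (congrArg (D.subdivide _).mate (hsome x hx)).trans
        ((congrArg some (Subtype.ext (hm ⟨x, hx⟩))).trans (hsome _ (hC.mate_ne ho hx)).symm)
  · exact congrArg (D.subdivide _).isOver (hsome x fun e => hx (e ▸ ho))
  · exact congrArg (D.subdivide _).isPos (hsome x fun e => hx (e ▸ ho))

theorem planar_remove_iff (hC : C.Valid) (ho : C.mate o = o) : (C.remove o h).Planar ↔ C.Planar := by
  obtain ⟨D, e, hD, a, e', hD'⟩ := hC.exists_subdivide (h := h) ho
  exact ⟨fun h => ⟨_, e', hD', GaussDiagram.isPlanar_subdivide (h.isPlanar hD) a⟩,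
    fun h => ⟨D, e, hD, GaussDiagram.isPlanar_of_subdivide (h.isPlanar hD')⟩⟩

theorem poly_remove_iff (hC : C.Valid) (ho : C.mate o = o) {q : ℤ[X]} : (C.remove o h).Poly q ↔ C.Poly q := by
  have hp := planar_remove_iff (h := h) hC ho
  obtain ⟨D, e, hD, a, e', hD'⟩ := hC.exists_subdivide (h := h) ho
  refine ⟨fun h => ?_, fun h => ?_⟩
  · have h1 := h.planar.isPlanar hD
    have h2 := GaussDiagram.isPlanar_subdivide h1 a
    exact ⟨_, e', hD', h2, .equiv _ _ (.rel _ _ ⟨h1, h2, .sub D a⟩) _ (h.hasConwayPolynomial hD)⟩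
  · have h1 := (hp.2 h.planar).isPlanar hD
    have h2 := GaussDiagram.isPlanar_subdivide h1 a
    exact ⟨D, e, hD, h1, .equiv _ _ (.symm _ _ (.rel _ _ ⟨h1, h2, .sub D a⟩)) _ (h.hasConwayPolynomial hD')⟩

theorem remove_erase (S : Set P) : (C.erase S).remove o h = (C.remove o h).erase (Subtype.val ⁻¹' S) := by
  refine Code.ext rfl (funext fun y => ?_) rfl rfl
  by_cases hy : (y : P) ∈ S
  · have hyo : (C.erase S).mate y ≠ o := by rw [C.erase_mate_of_mem hy]; exact y.2
    rw [erase_mate_of_mem _ (show y ∈ Subtype.val ⁻¹' S from hy)]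
    exact (dif_neg hyo).trans (Subtype.ext (C.erase_mate_of_mem hy))
  · rw [erase_mate_of_notMem _ (show y ∉ Subtype.val ⁻¹' S from hy)]
    have e := C.erase_mate_of_notMem hy
    by_cases h' : C.mate y = o
    · exact (dif_pos (e.trans h')).trans (dif_pos h' : (C.remove o h).mate y = y).symm
    · exact (dif_neg (by rwa [e])).trans ((Subtype.ext e).trans (dif_neg h' : (C.remove o h).mate y = ⟨_, h'⟩).symm)

theorem Thru.remove (hxy : C.Thru x y) (hC : C.Valid) (ho : C.mate o = o) (hx : x ≠ o) (hy : y ≠ o) :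
    (C.remove o h).Thru ⟨x, hx⟩ ⟨y, hy⟩ := by
  suffices (∀ hx : x ≠ o, (C.remove o h).Thru ⟨x, hx⟩ ⟨y, hy⟩) ∧
      ∀ w : {y // y ≠ o}, x = o → C.next w = o → (C.remove o h).Thru w ⟨y, hy⟩ from this.1 hx
  clear hx
  have hm : ∀ z : {y // y ≠ o}, C.mate z = z → (C.remove o h).mate z = z := fun z hz =>
    Subtype.ext ((remove_mate ho hC z).trans hz)
  induction hxy with
  | single x =>
    refine ⟨fun hx => .of_eq (Subtype.ext (remove_next_of_ne hy)), ?_⟩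
    rintro w rfl hw
    exact .of_eq (Subtype.ext (remove_next_of_eq hw))
  | @step x y h1 _ ih =>
    specialize ih hy
    refine ⟨fun hx => ?_, ?_⟩
    · by_cases hxo : C.next x = o
      · exact ih.2 ⟨x, hx⟩ hxo hxo
      · have e : (C.remove o h).next ⟨x, hx⟩ = ⟨C.next x, hxo⟩ := Subtype.ext (remove_next_of_ne hxo)
        refine .step ?_ ?_ <;> rw [e]
        · exact hm _ h1
        · exact ih.1 hxo
    · rintro w rfl hw
      have e : (C.remove x h).next w = ⟨C.next x, h⟩ := Subtype.ext (remove_next_of_eq hw)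
      refine .step ?_ ?_ <;> rw [e]
      · exact hm _ h1
      · exact ih.1 h

end remove

end Code

namespace Code

variable {P : Type} {C : Code P} {x y z : P} {S : Set P}

/-! ### Reidemeister moves in the presence of ordinary points -/

theorem Represents.erase_pair {D : GaussDiagram} {e : P ≃ D.Pt} (h : C.Represents D e) (x : P) :
    (C.erase {x, C.mate x}).Represents (D.erase (e x)) e :=
  ⟨h.next, (h.smooth x).mate, (h.smooth x).isOver, (h.smooth x).isPos⟩

theorem Represents.erase_erase {D : GaussDiagram} {e : P ≃ D.Pt} (h : C.Represents D e) (x y : P) :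
    (C.eraseTwo x y).Represents ((D.erase (e x)).erase (e y)) e where
  next := h.next
  mate z := by
    refine (congrFun (D.erase_erase_mate (e x) (e y)) (e z)).trans ?_
    by_cases hz : z ∈ ({x, C.mate x, y, C.mate y} : Set P)
    · rw [C.erase_mate_of_mem hz]
      refine GaussDiagram.eraseAll_mate_of_mem (D := D) (y := e z) ?_
      change D.SameCrossing (e x) (e z) ∨ D.SameCrossing (e y) (e z)
      rw [h.sameCrossing, h.sameCrossing]
      simpa [or_assoc] using hz
    · rw [C.erase_mate_of_notMem hz]
      refine (GaussDiagram.eraseAll_mate_of_notMem (D := D) (y := e z) ?_).trans (h.mate z)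
      change ¬ (D.SameCrossing (e x) (e z) ∨ D.SameCrossing (e y) (e z))
      rw [h.sameCrossing, h.sameCrossing]
      simpa [or_assoc] using hz
  isOver z hz := h.isOver z fun e => hz (C.erase_mate_of_eq e)
  isPos z hz := h.isPos z fun e => hz (C.erase_mate_of_eq e)

theorem Valid.erase_pair (h : C.Valid) (x : P) : (C.erase {x, C.mate x}).Valid := by
  obtain ⟨D, e, h⟩ := h
  exact ⟨D.erase (e x), e, h.erase_pair x⟩

theorem Valid.erase_erase (h : C.Valid) (x y : P) : (C.eraseTwo x y).Valid := by
  obtain ⟨D, e, h⟩ := h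
  exact ⟨(D.erase (e x)).erase (e y), e, h.erase_erase x y⟩

theorem Valid.ne_of_thru (hC : C.Valid) (hx : C.mate x ≠ x) (ho : C.mate (C.next x) = C.next x) :
    C.next (C.next x) ≠ C.next x := fun e => hx (by rw [hC.next_inj e] at ho; exact ho)

/-- A curl is removed, ordinary points on it being allowed. -/
theorem Planar.reidI (hC : C.Planar) (hx : C.mate x ≠ x) (h : C.Thru x (C.mate x)) :
    (C.erase {x, C.mate x}).Planar ∧ ∀ q, (C.erase {x, C.mate x}).Poly q → C.Poly q := by
  induction hn : Nat.card P using Nat.strong_induction_on generalizing P with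
  | _ n ih =>
  have hV := hC.valid
  have hfin := hV.finite
  rcases h.cases with h1 | ⟨ho, h1⟩
  · obtain ⟨D, e, hD, hp⟩ := hC
    have h2 : D.next (e x) = D.mate (e x) := by rw [hD.next, hD.mate, h1]
    have hp' := GaussDiagram.isPlanar_reidI hp (hD.isCrossing hx) h2
    refine ⟨⟨D.erase (e x), e, hD.erase_pair x, hp'⟩, fun q hq => ⟨D, e, hD, hp, ?_⟩⟩
    exact .equiv _ _ (.symm _ _ (.rel _ _ ⟨hp, hp', .reidI D (e x) (hD.isCrossing hx) h2⟩)) _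
      (hq.hasConwayPolynomial (hD.erase_pair x))
  · have hno := hV.ne_of_thru hx ho
    set o := C.next x with hodef
    have hxo : x ≠ o := fun e => hx (e ▸ ho)
    have hmo := hV.mate_ne ho hxo
    have hm : (C.remove o hno).mate ⟨x, hxo⟩ = ⟨C.mate x, hmo⟩ := Subtype.ext (remove_mate ho hV _)
    have hset : ({⟨x, hxo⟩, (C.remove o hno).mate ⟨x, hxo⟩} : Set {y // y ≠ o}) =
        Subtype.val ⁻¹' {x, C.mate x} := by
      rw [hm]; ext ⟨z, hz⟩; simp
    have key := ih (Nat.card {y // y ≠ o}) (hn ▸ Finite.card_subtype_lt (p := fun y => y ≠ o) (x := o) (by simp))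
      (C := C.remove o hno) (x := ⟨x, hxo⟩) ((planar_remove_iff hV ho).2 hC)
      (by rw [hm]; exact fun e => hx (congrArg Subtype.val e))
      (by rw [hm]; exact h.remove hV ho hxo hmo) rfl
    rw [hset, ← remove_erase (h := hno)] at key
    have hV' := hV.erase_pair x
    have ho' := C.erase_mate_of_eq (S := {x, C.mate x}) ho
    exact ⟨(planar_remove_iff hV' ho').1 key.1, fun q hq =>
      (poly_remove_iff hV ho).1 (key.2 q ((poly_remove_iff (C := C.erase {x, C.mate x}) (h := hno) hV' ho').2 hq))⟩

/-- The two strands of a bigon, both running from the crossing of `x` to that of `y`, or antiparallel. -/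
structure Bigon (C : Code P) (x y : P) (par : Bool) : Prop where
  left : C.mate x ≠ x
  right : C.mate y ≠ y
  ne : y ≠ x
  ne_mate : y ≠ C.mate x
  thru : C.Thru x y
  thru_mate : if par then C.Thru (C.mate x) (C.mate y) else C.Thru (C.mate y) (C.mate x)

/-- Ordinary points on the sides of a bigon are irrelevant for properties of codes that do not depend on
ordinary points. -/
theorem Bigon.induction {par : Bool} (hC : C.Planar) (h : C.Bigon x y par)
    (p : ∀ {Q : Type}, Code Q → Q → Q → Prop)
    (base : ∀ {Q : Type} {C : Code Q} {x y : Q}, C.Planar → C.Bigon x y par → C.next x = y →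
      (if par then C.next (C.mate x) = C.mate y else C.next (C.mate y) = C.mate x) → p C x y)
    (step : ∀ {Q : Type} {C : Code Q} {x y o : Q} (_ : C.mate o = o) (h : C.next o ≠ o) (hx : x ≠ o) (hy : y ≠ o),
      C.Planar → C.Bigon x y par → p (C.remove o h) ⟨x, hx⟩ ⟨y, hy⟩ → p C x y) : p C x y := by
  induction hn : Nat.card P using Nat.strong_induction_on generalizing P with
  | _ n ih =>
  have hV := hC.valid
  have hfin := hV.finite
  have red : ∀ {o : P} (ho : C.mate o = o) (hno : C.next o ≠ o), p C x y := by
    intro o ho hno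
    have hne : ∀ {x}, C.mate x ≠ x → x ≠ o := fun hx e => hx (e ▸ ho)
    have hm : ∀ {x} (hx : C.mate x ≠ x), (C.remove o hno).mate ⟨x, hne hx⟩ = ⟨C.mate x, hne (hV.mate_mate_ne hx)⟩ :=
      fun hx => Subtype.ext (remove_mate ho hV _)
    refine step ho hno (hne h.left) (hne h.right) hC h (ih (Nat.card {y // y ≠ o})
      (hn ▸ Finite.card_subtype_lt (p := fun y => y ≠ o) (x := o) (by simp)) ((planar_remove_iff hV ho).2 hC) ?_ rfl)
    refine ⟨?_, ?_, fun e => h.ne (congrArg Subtype.val e), ?_, h.thru.remove hV ho _ _, ?_⟩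
    · rw [hm h.left]; exact fun e => h.left (congrArg Subtype.val e)
    · rw [hm h.right]; exact fun e => h.right (congrArg Subtype.val e)
    · rw [hm h.left]; exact fun e => h.ne_mate (congrArg Subtype.val e)
    · rw [hm h.left, hm h.right]
      cases par <;> exact Thru.remove h.thru_mate hV ho _ _
  rcases h.thru.cases with h1 | ⟨ho, -⟩
  · have h2 := h.thru_mate
    cases par <;> rcases Thru.cases h2 with h3 | ⟨ho, -⟩
    · exact base hC h h1 h3
    · exact red ho (hV.ne_of_thru (hV.mate_mate_ne h.right) ho)
    · exact base hC h h1 h3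
    · exact red ho (hV.ne_of_thru (hV.mate_mate_ne h.left) ho)
  · exact red ho (hV.ne_of_thru h.left ho)

theorem remove_eraseTwo {o : P} (hV : C.Valid) (ho : C.mate o = o) (h : C.next o ≠ o) (hx : x ≠ o) (hy : y ≠ o) :
    (C.eraseTwo x y).remove o h = (C.remove o h).eraseTwo ⟨x, hx⟩ ⟨y, hy⟩ := by
  rw [remove_erase]
  congr 1
  ext z
  simp only [Set.mem_preimage, Set.mem_insert_iff, Set.mem_singleton_iff, Subtype.ext_iff, remove_mate ho hV]

theorem eraseTwo_comm (C : Code P) (x y : P) : C.eraseTwo x y = C.eraseTwo y x := by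
  unfold eraseTwo; congr 1; ext z; simp only [Set.mem_insert_iff, Set.mem_singleton_iff]; tauto

theorem Valid.eraseTwo_mate (hV : C.Valid) (x y : P) : C.eraseTwo (C.mate x) (C.mate y) = C.eraseTwo x y := by
  unfold eraseTwo; congr 1; ext z; simp only [hV.mate_mate, Set.mem_insert_iff, Set.mem_singleton_iff]; tauto

/-- A bigon between an over-strand and an under-strand is removed. -/
theorem Bigon.reidII {par : Bool} (hC : C.Planar) (h : C.Bigon x y par) (ho : C.isOver x = C.isOver y)
    (hp : C.isPos x ≠ C.isPos y) :
    (C.eraseTwo x y).Planar ∧ ∀ q, (C.eraseTwo x y).Poly q → C.Poly q := by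
  refine Bigon.induction hC h (fun C x y => C.isOver x = C.isOver y → C.isPos x ≠ C.isPos y →
    (C.eraseTwo x y).Planar ∧ ∀ q, (C.eraseTwo x y).Poly q → C.Poly q)
    ?_ ?_ ho hp
  · intro Q C x y hC h h1 h2 ho hp
    have hV := hC.valid
    obtain ⟨D, e, hD, hpl⟩ := hC
    -- the case of an over-strand through `x` and `y`
    have main : ∀ x y : Q, C.mate x ≠ x → C.mate y ≠ y → C.isOver x = true → C.isOver y = true → C.isPos x ≠ C.isPos y →
        C.next x = y → (C.next (C.mate x) = C.mate y ∨ C.next (C.mate y) = C.mate x) →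
        (C.eraseTwo x y).Planar ∧
          ∀ q, (C.eraseTwo x y).Poly q → C.Poly q := by
      intro x y hx hy hox hoy hp h1 h2
      have a3 := (hD.isOver x hx).trans hox
      have a4 := (hD.isOver y hy).trans hoy
      have a5 : D.isPos (e x) ≠ D.isPos (e y) := by rwa [hD.isPos x hx, hD.isPos y hy]
      have a6 : D.next (e x) = e y := by rw [hD.next, h1]
      have a7 : D.next (D.mate (e x)) = D.mate (e y) ∨ D.next (D.mate (e y)) = D.mate (e x) := by
        simpa only [hD.mate, hD.next, e.injective.eq_iff] using h2
      have hp' := GaussDiagram.isPlanar_reidII hpl (hD.isCrossing hx) (hD.isCrossing hy) a3 a4 a5 a6 a7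
      refine ⟨⟨(D.erase (e x)).erase (e y), e, hD.erase_erase x y, hp'⟩, fun q hq => ⟨D, e, hD, hpl, ?_⟩⟩
      exact .equiv _ _ (.symm _ _ (.rel _ _ ⟨hpl, hp', .reidII D _ _ (hD.isCrossing hx) (hD.isCrossing hy) a3 a4 a5 a6 a7⟩)) _
        (hq.hasConwayPolynomial (hD.erase_erase x y))
    have hx' := hV.mate_mate_ne h.left
    have hy' := hV.mate_mate_ne h.right
    by_cases hox : C.isOver x = true
    · refine main x y h.left h.right hox (ho ▸ hox) hp h1 ?_
      cases par
      · exact .inr h2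
      · exact .inl h2
    · have hox' : C.isOver (C.mate x) = true := by rw [hV.isOver_mate h.left]; simpa using hox
      have hoy' : C.isOver (C.mate y) = true := by rw [hV.isOver_mate h.right, ← ho]; simpa using hox
      have hp' : C.isPos (C.mate x) ≠ C.isPos (C.mate y) := by rwa [hV.isPos_mate h.left, hV.isPos_mate h.right]
      cases par
      · have := main (C.mate y) (C.mate x) hy' hx' hoy' hox' hp'.symm h2
          (.inr (by rw [hV.mate_mate, hV.mate_mate]; exact h1))
        rwa [hV.eraseTwo_mate, eraseTwo_comm] at this
      · have := main (C.mate x) (C.mate y) hx' hy' hox' hoy' hp' h2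
          (.inl (by rw [hV.mate_mate, hV.mate_mate]; exact h1))
        rwa [hV.eraseTwo_mate] at this
  · intro Q C x y o ho hno hx hy hC h ih h1 h2
    have key := ih h1 h2
    have hV := hC.valid
    have hV' := hV.erase_erase x y
    have ho' : (C.eraseTwo x y).mate o = o := C.erase_mate_of_eq ho
    rw [← remove_eraseTwo hV ho hno hx hy] at key
    exact ⟨(planar_remove_iff hV' ho').1 key.1, fun q hq =>
      (poly_remove_iff hV ho).1 (key.2 q ((poly_remove_iff (C := C.eraseTwo x y) (h := hno) hV' ho').2 hq))⟩

theorem smooth_remove {o : P} (hV : C.Valid) (ho : C.mate o = o) (h : C.next o ≠ o) (hx : x ≠ o)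
    (h' : (C.smooth x).next o ≠ o) : (C.smooth x).remove o h' = (C.remove o h).smooth ⟨x, hx⟩ := by
  have hmx := hV.mate_ne ho hx
  have hm : (C.remove o h).mate ⟨x, hx⟩ = ⟨C.mate x, hmx⟩ := Subtype.ext (remove_mate ho hV _)
  have hso : (C.smooth x).next o = C.next o := C.smooth_next_of_ne hx.symm hmx.symm
  have hset : ({⟨x, hx⟩, (C.remove o h).mate ⟨x, hx⟩} : Set {y // y ≠ o}) = Subtype.val ⁻¹' {x, C.mate x} := by
    rw [hm]; ext ⟨z, hz⟩; simp
  have hnext : ∀ (D : Code P) (h1 : D.next o ≠ o) (z : {y // y ≠ o}) (w : P), D.next z = C.next w →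
      D.next o = C.next o → ∀ (hw : w ≠ o), (D.remove o h1).next z = (C.remove o h).next ⟨w, hw⟩ := by
    intro D h1 z w e1 e2 hw
    apply Subtype.ext
    by_cases hz : C.next w = o
    · rw [remove_next_of_eq (e1.trans hz), remove_next_of_eq (y := ⟨w, hw⟩) hz, e2]
    · rw [remove_next_of_ne (by rwa [e1]), remove_next_of_ne (y := ⟨w, hw⟩) hz, e1]
  refine Code.ext (funext fun z => ?_) ?_ rfl rfl
  · by_cases h1 : z = ⟨x, hx⟩
    · subst h1
      rw [smooth_next_self, hm]
      exact hnext _ _ _ _ C.smooth_next_self hso _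
    · by_cases h2 : z = (C.remove o h).mate ⟨x, hx⟩
      · rw [h2, smooth_next_mate, hm]
        exact hnext _ _ _ _ C.smooth_next_mate hso _
      · rw [smooth_next_of_ne _ h1 h2]
        rw [hm] at h2
        exact hnext _ _ _ _ (C.smooth_next_of_ne (fun e => h1 (Subtype.ext e)) (fun e => h2 (Subtype.ext e))) hso _
  · have e1 : ((C.smooth x).remove o h').mate = ((C.erase {x, C.mate x}).remove o h).mate := rfl
    rw [e1, remove_erase, smooth_mate, hset]

/-- Smoothing both crossings of a bigon with parallel sides amounts to forgetting them. -/
theorem Bigon.poly_of_smooth_smooth (hC : C.Planar) (h : C.Bigon x y true) {q : ℤ[X]}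
    (hq : ((C.smooth x).smooth y).Poly q) : (C.eraseTwo x y).Poly q := by
  classical
  refine Bigon.induction hC h (fun C x y => ((C.smooth x).smooth y).Poly q →
    (C.eraseTwo x y).Poly q) ?_ ?_ hq
  · intro Q C x y hC h h1 h2 hq
    have h2 : C.next (C.mate x) = C.mate y := h2
    have hV := hC.valid
    have hx := h.left
    have hy := h.right
    have hyx := h.ne
    have hymx := h.ne_mate
    have hmyx : C.mate y ≠ x := fun e => hymx (by rw [← e, hV.mate_mate])
    have hmyx' : C.mate y ≠ C.mate x := fun e => hyx (by rw [← hV.mate_mate y, e, hV.mate_mate])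
    have hmy : (C.smooth x).mate y = C.mate y := C.erase_mate_of_notMem (by simp [hyx, hymx])
    have s1 := (C.smooth x).smooth_next_self (x := y)
    have s2 := (C.smooth x).smooth_next_mate (x := y)
    rw [hmy] at s1 s2
    rw [C.smooth_next_of_ne hmyx hmyx'] at s1
    rw [C.smooth_next_of_ne hyx hymx] at s2
    have s3 : ∀ z, z ≠ y → z ≠ C.mate y → ((C.smooth x).smooth y).next z = (C.smooth x).next z := fun z a b =>
      smooth_next_of_ne _ a (by rwa [hmy])
    have sw := fun z => swap_apply_of_ne_of_ne (a := y) (b := C.mate y) (x := z)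
    have n1 : ∀ z, z ≠ x → C.next z ≠ y := fun z hz e => hz (hV.next_inj (e.trans h1.symm))
    have n2 : ∀ z, z ≠ C.mate x → C.next z ≠ C.mate y := fun z hz e => hz (hV.next_inj (e.trans h2.symm))
    refine hq.congr (swap y (C.mate y)) (fun z => ?_) (fun z => ?_) (fun z hz => ?_)
    · rw [erase_next]
      by_cases z1 : z = y
      · subst z1
        rw [swap_apply_left, s2, sw _ (n1 _ hyx) (n2 _ hymx)]
      by_cases z2 : z = C.mate y
      · subst z2
        rw [swap_apply_right, s1, sw _ (n1 _ hmyx) (n2 _ hmyx')]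
      rw [sw _ z1 z2, s3 z z1 z2]
      by_cases z3 : z = x
      · subst z3
        rw [C.smooth_next_self, h1, h2, swap_apply_left]
      by_cases z4 : z = C.mate x
      · subst z4
        rw [C.smooth_next_mate, h1, h2, swap_apply_right]
      rw [C.smooth_next_of_ne z3 z4, sw _ (n1 z z3) (n2 z z4)]
    · by_cases z1 : z = y ∨ z = C.mate y
      · rw [C.erase_mate_of_mem (by rcases z1 with rfl | rfl <;> simp)]
        refine erase_mate_of_mem _ ?_
        rcases z1 with rfl | rfl <;> simp [hmy]
      · rw [not_or] at z1
        rw [sw _ z1.1 z1.2]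
        by_cases z2 : z = x ∨ z = C.mate x
        · rw [C.erase_mate_of_mem (by rcases z2 with rfl | rfl <;> simp), sw _ z1.1 z1.2]
          exact erase_mate_of_eq _ (C.erase_mate_of_mem z2)
        · rw [not_or] at z2
          rw [C.erase_mate_of_notMem (by simp [z1, z2]), smooth_mate, hmy,
            erase_mate_of_notMem _ (by simp [z1]), smooth_mate, erase_mate_of_notMem _ (by simp [z2]),
            sw _]
          · exact fun e => z1.2 (by rw [← e, hV.mate_mate])
          · exact fun e => z1.1 (by rw [← hV.mate_mate y, ← e, hV.mate_mate])
    · have hz' : z ∉ ({x, C.mate x, y, C.mate y} : Set Q) := fun e => hz (C.erase_mate_of_mem e)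
      simp only [Set.mem_insert_iff, Set.mem_singleton_iff, not_or] at hz'
      rw [sw _ hz'.2.2.1 hz'.2.2.2]
      exact ⟨rfl, rfl⟩
  · intro Q C x y o ho hno hx hy hC h ih hq
    have hV := hC.valid
    have hmx := hV.mate_ne ho hx
    have hso : (C.smooth x).next o ≠ o := by rwa [C.smooth_next_of_ne hx.symm hmx.symm]
    have ho1 : (C.smooth x).mate o = o := C.erase_mate_of_eq ho
    have hV1 := hV.smooth x
    have hmy := hV1.mate_ne ho1 hy
    have hso2 : ((C.smooth x).smooth y).next o ≠ o := by rwa [smooth_next_of_ne _ hy.symm hmy.symm]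
    have ho2 : ((C.smooth x).smooth y).mate o = o := erase_mate_of_eq _ ho1
    have e := smooth_remove (C := C.smooth x) (x := y) hV1 ho1 hso hy hso2
    rw [smooth_remove hV ho hno hx hso] at e
    rw [← remove_eraseTwo hV ho hno hx hy, ← e] at ih
    exact (poly_remove_iff (hV.erase_erase x y) (C.erase_mate_of_eq ho)).1
      (ih ((poly_remove_iff (hV1.smooth y) ho2).2 hq))

end Code

namespace Code

variable {P : Type} {C C' : Code P} {x y z : P} {S : Set P}

theorem Thru.congr (h : C.Thru x y) (hn : C'.next = C.next) (hm : C'.mate = C.mate) : C'.Thru x y := by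
  induction h with
  | single x => exact .of_eq (by rw [hn])
  | step h1 _ ih => exact .step (by rw [hn, hm]; exact h1) (by rw [hn]; exact ih)

/-- Two paths with a common ordinary point, or sharing an end, are joined to the ends of a path. -/
theorem Thru.extend {x' y' : P} (h : C.Thru x y) (h1 : x' = x ∨ C.mate x = x ∧ C.Thru x' x)
    (h2 : y = y' ∨ C.mate y = y ∧ C.Thru y y') : C.Thru x' y' := by
  have : C.Thru x y' := by
    rcases h2 with rfl | ⟨h2, h3⟩
    · exact h
    · exact h.trans h2 h3
  rcases h1 with rfl | ⟨h4, h5⟩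
  · exact this
  · exact h5.trans h4 this

theorem erase_erase_eq (C : Code P) (S T : Set P) : (C.erase S).erase T = C.erase (S ∪ T) := by
  refine Code.ext rfl (funext fun y => ?_) rfl rfl
  by_cases hT : y ∈ T
  · rw [erase_mate_of_mem _ hT, erase_mate_of_mem _ (Set.mem_union_right S hT)]
  · rw [erase_mate_of_notMem _ hT]
    by_cases hS : y ∈ S
    · rw [erase_mate_of_mem _ hS, erase_mate_of_mem _ (Set.mem_union_left T hS)]
    · rw [erase_mate_of_notMem _ hS, erase_mate_of_notMem _ (by simp [hS, hT])]

theorem Planar.reidI' (hC : C.Planar) (hx : C.mate x ≠ x) (h : C.Thru (C.mate x) x) :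
    (C.erase {x, C.mate x}).Planar ∧ ∀ q, (C.erase {x, C.mate x}).Poly q → C.Poly q := by
  have hm := hC.valid.mate_mate x
  have := hC.reidI (hC.valid.mate_mate_ne hx) (by rwa [hm])
  rwa [hm, Set.pair_comm] at this

/-- The skein relation at a clasp or a full twist: a crossing change turns it into a removable bigon. -/
theorem Bigon.skein {par : Bool} (hC : C.Planar) (h : C.Bigon x y par) (ho : C.isOver x ≠ C.isOver y)
    (hp : C.isPos x = C.isPos y) (hz : z = x ∨ z = y) :
    (C.eraseTwo x y).Planar ∧ ∀ q₁ q₂, (C.eraseTwo x y).Poly q₁ →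
      (C.smooth z).Poly q₂ → C.Poly (q₁ + C.sign z * X * q₂) := by
  have hV := hC.valid
  have hxy := h.ne
  have hymx := h.ne_mate
  have hxmy : x ≠ C.mate y := fun e => hymx (by rw [e, hV.mate_mate])
  have hz' : C.mate z ≠ z := by
    rcases hz with rfl | rfl
    · exact h.left
    · exact h.right
  have hb : (C.switch z).Bigon x y par := by
    refine ⟨h.left, h.right, hxy, hymx, h.thru.congr rfl rfl, ?_⟩
    have := h.thru_mate
    cases par <;> exact Thru.congr this rfl rfl
  have hov : (C.switch z).isOver x = (C.switch z).isOver y ∧ (C.switch z).isPos x ≠ (C.switch z).isPos y := by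
    rcases hz with rfl | rfl
    · simp only [switch, true_or, if_true, hxy, hymx, or_self, if_false, hp]
      exact ⟨by revert ho; cases C.isOver z <;> cases C.isOver y <;> simp, by simp⟩
    · simp only [switch, true_or, if_true, hxy.symm, hxmy, or_self, if_false, hp]
      exact ⟨by revert ho; cases C.isOver x <;> cases C.isOver z <;> simp, by simp⟩
  have hzS : z ∈ ({x, C.mate x, y, C.mate y} : Set P) := by rcases hz with rfl | rfl <;> simp
  have hzS' : C.mate z ∈ ({x, C.mate x, y, C.mate y} : Set P) := by rcases hz with rfl | rfl <;> simp
  have key := hb.reidII (hC.switch z) hov.1 hov.2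
  exact ⟨Planar.of_erase_switch key.1 hzS hzS', fun q₁ q₂ h1 h2 =>
    hC.poly_of_switch_of_smooth hz' (key.2 q₁ (h1.of_erase_switch hzS hzS')) h2⟩

/-- Forgetting the crossings of a bigon with parallel sides leaves a split link, if after the smoothing
of one of them the other one becomes the crossing of a curl. -/
theorem Bigon.poly_zero (hC : C.Planar) (h : C.Bigon x y true)
    (hy : (C.smooth x).Thru y (C.mate y) ∨ (C.smooth x).Thru (C.mate y) y) {q : ℤ[X]}
    (hq : (((C.smooth x).erase {y, C.mate y}).Planar → ((C.smooth x).erase {y, C.mate y}).Poly q)) :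
    (C.eraseTwo x y).Poly 0 := by
  have h1 := hC.smooth h.left
  have hm : (C.smooth x).mate y = C.mate y := C.erase_mate_of_notMem (by simp [h.ne, h.ne_mate])
  have hy' : (C.smooth x).mate y ≠ y := by rw [hm]; exact h.right
  have hyy : ∀ z ∈ ({y, C.mate y} : Set P), z = y ∨ z = (C.smooth x).mate y := fun z hz => by rwa [hm]
  have k1 : ((C.smooth x).erase {y, C.mate y}).Planar ∧
      ∀ q, ((C.smooth x).erase {y, C.mate y}).Poly q → (C.smooth x).Poly q := by
    rcases hy with hy | hy
    · rw [← hm] at hy ⊢; exact h1.reidI hy' hy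
    · rw [← hm] at hy ⊢; exact h1.reidI' hy' hy
  have k2 : ∀ q, (((C.smooth x).switch y).erase {y, C.mate y}).Poly q → ((C.smooth x).switch y).Poly q := by
    rcases hy with hy | hy
    · rw [← hm] at hy ⊢; exact ((h1.switch y).reidI hy' (hy.congr rfl rfl)).2
    · rw [← hm] at hy ⊢; exact ((h1.switch y).reidI' hy' (hy.congr rfl rfl)).2
  refine h.poly_of_smooth_smooth hC (h1.poly_smooth_zero hy' (k1.2 q (hq k1.1)) (k2 q ((hq k1.1).of_erase_switch ?_ ?_)))
  · simp
  · rw [hm]; simp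

/-- A single curve without crossings. -/
theorem Valid.poly_circle (hC : C.Valid) (hm : ∀ y, C.mate y = y) (hx : ∀ y, y = x ∨ C.Thru y x) : C.Poly 1 := by
  obtain ⟨D, e, h⟩ := hC
  have hD : ∀ y, D.mate y = y := fun y => by
    obtain ⟨y, rfl⟩ := e.surjective y
    rw [h.mate, hm]
  have hs : ∀ y z, C.Thru y z → D.next.SameCycle (e y) (e z) := by
    intro y z hyz
    induction hyz with
    | single y =>
      rw [← h.next]
      exact Perm.sameCycle_apply_right.2 (.refl _ _)
    | step h1 _ ih =>
      rw [← h.next] at ih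
      exact Perm.sameCycle_apply_left.1 ih
  have hs' : ∀ y, D.next.SameCycle y (e x) := fun y => by
    obtain ⟨y, rfl⟩ := e.surjective y
    rcases hx y with rfl | h
    · exact .refl _ _
    · exact hs _ _ h
  exact ⟨D, e, h, GaussDiagram.isPlanar_of_crossingless hD, .unknot D ⟨⟨e x⟩, hD, fun y z => (hs' y).trans (hs' z).symm⟩⟩

/-- A twist between two antiparallel strands that are joined at one end is unravelled. -/
theorem Planar.unravel (hC : C.Planar) (a b : ℕ → P) (r : ℕ) (hm : ∀ i < r, C.mate (b i) = a i ∧ a i ≠ b i)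
    (hd : ∀ i j, i < j → j < r → b j ≠ b i ∧ b j ≠ a i) (h0 : 0 < r → C.Thru (b 0) (a 0))
    (hb : ∀ i, i + 1 < r → C.Thru (b (i + 1)) (b i)) (ha : ∀ i, i + 1 < r → C.Thru (a i) (a (i + 1))) :
    (C.erase {z | ∃ i < r, z = a i ∨ z = b i}).Planar ∧
      (∀ q, (C.erase {z | ∃ i < r, z = a i ∨ z = b i}).Poly q → C.Poly q) ∧
      ∀ i < r, (C.erase {z | ∃ i < r, z = a i ∨ z = b i}).Thru (b i) (a i) := by
  induction r with
  | zero =>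
    have : C.erase {z | ∃ i < 0, z = a i ∨ z = b i} = C :=
      Code.ext rfl (funext fun y => C.erase_mate_of_notMem (by simp)) rfl rfl
    rw [this]
    exact ⟨hC, fun _ h => h, by simp⟩
  | succ r ih =>
    obtain ⟨i1, i2, i3⟩ := ih (fun i hi => hm i (by omega)) (fun i j hi hj => hd i j hi (by omega)) (fun h => h0 (by omega))
      (fun i hi => hb i (by omega)) (fun i hi => ha i (by omega))
    have hV := hC.valid
    set S : Set P := {z | ∃ i < r, z = a i ∨ z = b i}
    have hbS : b r ∉ S := by
      rintro ⟨i, hi, h | h⟩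
      · exact (hd i r hi (by omega)).2 h
      · exact (hd i r hi (by omega)).1 h
    have hmr : (C.erase S).mate (b r) = a r := (C.erase_mate_of_notMem hbS).trans (hm r (by omega)).1
    have hS : C.erase {z | ∃ i < r + 1, z = a i ∨ z = b i} = (C.erase S).erase {b r, (C.erase S).mate (b r)} := by
      rw [hmr, erase_erase_eq]
      congr 1
      ext z
      simp only [Set.mem_union, Set.mem_insert_iff, Set.mem_singleton_iff]
      constructor
      · rintro ⟨i, hi, h⟩
        rcases Nat.lt_succ_iff_lt_or_eq.1 hi with hi | rfl
        · exact .inl ⟨i, hi, h⟩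
        · exact .inr h.symm
      · rintro (⟨i, hi, h⟩ | h)
        · exact ⟨i, by omega, h⟩
        · exact ⟨r, by omega, h.symm⟩
    have hthru : (C.erase S).Thru (b r) (a r) := by
      rcases Nat.eq_zero_or_pos r with rfl | hr
      · exact (h0 (by omega)).erase _
      · obtain ⟨k, rfl⟩ : ∃ k, r = k + 1 := ⟨r - 1, by omega⟩
        refine (i3 k (by omega)).extend (.inr ⟨?_, (hb k (by omega)).erase _⟩) (.inr ⟨?_, (ha k (by omega)).erase _⟩)
        · exact erase_mate_of_mem _ ⟨k, by omega, .inr rfl⟩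
        · exact erase_mate_of_mem _ ⟨k, by omega, .inl rfl⟩
    have key := i1.reidI (x := b r) (by rw [hmr]; exact (hm r (by omega)).2) (by rwa [hmr])
    rw [hS]
    refine ⟨key.1, fun q hq => i2 q (key.2 q hq), fun i hi => ?_⟩
    rcases Nat.lt_succ_iff_lt_or_eq.1 hi with hi | rfl
    · exact (i3 i hi).erase _
    · exact hthru.erase _

/-! ### Labelled crossings -/

/-- The crossings `(c, i)` with `c < u` and `i < m c`, arranged in columns, have the passages
`pt c i true` and `pt c i false`. -/
structure Labels (C : Code P) (u : ℕ) (m : ℕ → ℕ) (ov : ℕ → ℕ → Bool) (ps : ℕ → Bool) (pt : ℕ → ℕ → Bool → P) :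
    Prop where
  mate (c i : ℕ) (s : Bool) (hc : c < u := by omega) (hi : i < m c := by omega) : C.mate (pt c i s) = pt c i (!s)
  inj {c i : ℕ} {s : Bool} {c' i' : ℕ} {s' : Bool} (e : pt c i s = pt c' i' s') (hc : c < u := by omega)
    (hi : i < m c := by omega) (hc' : c' < u := by omega) (hi' : i' < m c' := by omega) : c = c' ∧ i = i' ∧ s = s'
  isOver (c i : ℕ) (hc : c < u := by omega) (hi : i < m c := by omega) : C.isOver (pt c i true) = ov c i
  isPos (c i : ℕ) (s : Bool) (hc : c < u := by omega) (hi : i < m c := by omega) : C.isPos (pt c i s) = ps c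

/-- The passages of the labelled crossings. -/
def labelSet (u : ℕ) (m : ℕ → ℕ) (pt : ℕ → ℕ → Bool → P) : Set P := {z | ∃ c < u, ∃ i < m c, ∃ s, z = pt c i s}

/-- All the crossings have their passages in `L`, and each curve meets `L`. -/
def Covers (C : Code P) (L : Set P) : Prop := ∀ y, y ∈ L ∨ C.mate y = y ∧ ∃ z ∈ L, C.Thru y z

theorem Covers.mono {L L' : Set P} (h : C.Covers L)
    (h1 : ∀ y, C.mate y = y → C'.mate y = y ∧ ∀ z, C.Thru y z → C'.Thru y z)
    (h2 : ∀ z ∈ L, z ∈ L' ∨ C'.mate z = z ∧ ∃ w ∈ L', C'.Thru z w) : C'.Covers L' := by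
  intro y
  rcases h y with hy | ⟨hy, z, hz, hyz⟩
  · exact h2 y hy
  · obtain ⟨a1, a2⟩ := h1 y hy
    refine .inr ⟨a1, ?_⟩
    rcases h2 z hz with hz' | ⟨hz', w, hw, hzw⟩
    · exact ⟨z, hz', a2 z hyz⟩
    · exact ⟨w, hw, (a2 z hyz).trans hz' hzw⟩

variable {u u' : ℕ} {m m' : ℕ → ℕ} {ov ov' : ℕ → ℕ → Bool} {ps ps' : ℕ → Bool} {pt pt' : ℕ → ℕ → Bool → P} {c i c' i' : ℕ}

/-- Labels of a part of the crossings. -/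
theorem Labels.reindex (h : C.Labels u m ov ps pt) (jc : ℕ → ℕ) (ji : ℕ → ℕ → ℕ)
    (hpt : ∀ c i s, pt' c i s = pt (jc c) (ji c i) s)
    (hv : ∀ c i, c < u' → i < m' c → jc c < u ∧ ji c i < m (jc c))
    (hinj : ∀ c i c' i', c < u' → i < m' c → c' < u' → i' < m' c' → jc c = jc c' → ji c i = ji c' i' → c = c' ∧ i = i')
    (hov : ∀ c i, c < u' → i < m' c → ov (jc c) (ji c i) = ov' c i) (hps : ∀ c, c < u' → ps (jc c) = ps' c)
    (hm : ∀ c i s, c < u' → i < m' c → C'.mate (pt' c i s) = C.mate (pt' c i s))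
    (ho : C'.isOver = C.isOver) (hp : C'.isPos = C.isPos) : C'.Labels u' m' ov' ps' pt' where
  mate c i s hc hi := by
    rw [hm c i s hc hi, hpt, hpt]
    exact h.mate _ _ _ (hv c i hc hi).1 (hv c i hc hi).2
  inj e hc hi hc' hi' := by
    rw [hpt, hpt] at e
    obtain ⟨e1, e2, e3⟩ := h.inj e (hv _ _ hc hi).1 (hv _ _ hc hi).2 (hv _ _ hc' hi').1 (hv _ _ hc' hi').2
    obtain ⟨e4, e5⟩ := hinj _ _ _ _ hc hi hc' hi' e1 e2
    exact ⟨e4, e5, e3⟩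
  isOver c i hc hi := by
    rw [ho, hpt, h.isOver _ _ (hv c i hc hi).1 (hv c i hc hi).2, hov c i hc hi]
  isPos c i s hc hi := by
    rw [hp, hpt, h.isPos _ _ _ (hv c i hc hi).1 (hv c i hc hi).2, hps c hc]

theorem _root_.Nat.exists_lt_two_iff {p : ℕ → Prop} : (∃ i < 2, p i) ↔ p 0 ∨ p 1 :=
  ⟨by rintro ⟨i, hi, h⟩; interval_cases i <;> tauto, by rintro (h | h); exacts [⟨0, two_pos, h⟩, ⟨1, one_lt_two, h⟩]⟩

namespace Labels

theorem mate_ne (h : C.Labels u m ov ps pt) (s : Bool) (hc : c < u := by omega) (hi : i < m c := by omega) :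
    C.mate (pt c i s) ≠ pt c i s := fun e => by simpa using (h.inj ((h.mate c i s).symm.trans e)).2.2

theorem isOver_false (h : C.Labels u m ov ps pt) (hC : C.Valid) (c i : ℕ) (hc : c < u := by omega)
    (hi : i < m c := by omega) : C.isOver (pt c i false) = !ov c i := by
  have := hC.isOver_mate (h.mate_ne (i := i) true hc)
  rwa [h.mate c i true, h.isOver c i] at this

theorem bigon (h : C.Labels u m ov ps pt) {s s' par : Bool} (hne : c ≠ c' ∨ i ≠ i')
    (h1 : C.Thru (pt c i s) (pt c' i' s'))
    (h2 : if par then C.Thru (pt c i !s) (pt c' i' !s') else C.Thru (pt c' i' !s') (pt c i !s))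
    (hc : c < u := by omega) (hi : i < m c := by omega) (hc' : c' < u := by omega) (hi' : i' < m c' := by omega) :
    C.Bigon (pt c i s) (pt c' i' s') par where
  left := h.mate_ne s
  right := h.mate_ne s'
  ne e := by have := h.inj e; omega
  ne_mate e := by
    rw [h.mate c i s] at e
    have := h.inj e; omega
  thru := h1
  thru_mate := by rwa [h.mate c i s, h.mate c' i' s']

theorem mem_eraseTwo (h : C.Labels u m ov ps pt) {s s' : Bool} {z : P} (hc : c < u := by omega) (hi : i < m c := by omega)
    (hc' : c' < u := by omega) (hi' : i' < m c' := by omega) :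
    z ∈ ({pt c i s, C.mate (pt c i s), pt c' i' s', C.mate (pt c' i' s')} : Set P) ↔
      (∃ t, z = pt c i t) ∨ ∃ t, z = pt c' i' t := by
  rw [h.mate c i s, h.mate c' i' s']
  cases s <;> cases s' <;> simp only [Set.mem_insert_iff, Set.mem_singleton_iff, Bool.exists_bool, Bool.not_true,
    Bool.not_false] <;> tauto

end Labels

end Code

/-- The column that cyclically follows the column `c` of `u` columns. -/
def cyc (u c : ℕ) : ℕ := if c + 1 = u then 0 else c + 1

theorem cyc_lt {u c : ℕ} (h : c < u) : cyc u c < u := by unfold cyc; split_ifs <;> omega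

theorem cyc_last (d : ℕ) : cyc (d + 1) d = 0 := if_pos rfl

theorem cyc_of_lt {u c : ℕ} (h : c + 1 < u) : cyc u c = c + 1 := if_neg (by omega)

theorem cyc_inj {u c c' : ℕ} (h : cyc u c = cyc u c') : c = c' := by
  unfold cyc at h; split_ifs at h <;> omega

theorem exists_cyc {u c : ℕ} (h : c < u) : ∃ c' < u, cyc u c' = c := by
  rcases Nat.eq_zero_or_pos c with rfl | hc
  · exact ⟨u - 1, by omega, if_pos (by omega)⟩
  · exact ⟨c - 1, by omega, by unfold cyc; rw [if_neg (by omega)]; omega⟩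

theorem prod_range_cyc {M : Type*} [CommMonoid M] (u : ℕ) (f : ℕ → M) :
    ∏ c ∈ range u, f (cyc u c) = ∏ c ∈ range u, f c := by
  cases u with
  | zero => rfl
  | succ d =>
    rw [prod_range_succ, Finset.prod_range_succ', cyc_last]
    congr 1
    exact prod_congr rfl fun c hc => by rw [cyc_of_lt (by simpa using hc)]

theorem sum_range_cyc (u : ℕ) (f : ℕ → ℕ) : ∑ c ∈ range u, f (cyc u c) = ∑ c ∈ range u, f c :=
  prod_range_cyc (M := Multiplicative ℕ) u f

namespace Code

variable {P : Type} {C : Code P} {u d : ℕ} {m : ℕ → ℕ} {ov : ℕ → ℕ → Bool} {ps ε : ℕ → Bool} {pt : ℕ → ℕ → Bool → P}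

theorem labelSet_cyc : labelSet u (fun c => m (cyc u c)) (fun c => pt (cyc u c)) = labelSet u m pt := by
  ext z
  constructor
  · rintro ⟨c, hc, h⟩
    exact ⟨cyc u c, cyc_lt hc, h⟩
  · rintro ⟨c, hc, h⟩
    obtain ⟨c', hc', rfl⟩ := exists_cyc hc
    exact ⟨c', hc', h⟩

theorem Labels.cyc (h : C.Labels u m ov ps pt) : C.Labels u (fun c => m (cyc u c)) (fun c => ov (cyc u c))
    (fun c => ps (cyc u c)) (fun c => pt (_root_.cyc u c)) :=
  h.reindex (_root_.cyc u) (fun _ i => i) (fun _ _ _ => rfl) (fun _ _ hc hi => ⟨cyc_lt hc, hi⟩)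
    (fun _ _ _ _ _ _ _ _ e1 e2 => ⟨cyc_inj e1, e2⟩) (fun _ _ _ _ => rfl) (fun _ _ => rfl) (fun _ _ _ _ _ => rfl) rfl rfl

/-- The labels that remain when the first `t` crossings of the column `d` are dropped. -/
def dropPt (d t : ℕ) (pt : ℕ → ℕ → Bool → P) (c i : ℕ) : Bool → P := pt c (if c = d then i + t else i)

/-- The lengths of the columns when the first `t` crossings of the column `d` are dropped. -/
def dropLen (d t : ℕ) (m : ℕ → ℕ) (c : ℕ) : ℕ := if c = d then m c - t else m c

theorem dropLen_self (d t : ℕ) (m : ℕ → ℕ) : dropLen d t m d = m d - t := if_pos rfl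

theorem dropLen_of_ne {d t c : ℕ} (m : ℕ → ℕ) (h : c ≠ d) : dropLen d t m c = m c := if_neg h

theorem dropPt_self (d t i : ℕ) (pt : ℕ → ℕ → Bool → P) : dropPt d t pt d i = pt d (i + t) := by simp [dropPt]

theorem dropPt_of_ne {d t c : ℕ} (i : ℕ) (pt : ℕ → ℕ → Bool → P) (h : c ≠ d) : dropPt d t pt c i = pt c i := by
  simp [dropPt, h]

theorem dropPt_last {d t c : ℕ} (pt : ℕ → ℕ → Bool → P) (h : t < m d) :
    dropPt d t pt c (dropLen d t m c - 1) = pt c (m c - 1) := by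
  unfold dropPt dropLen
  by_cases hc : c = d
  · subst hc; rw [if_pos rfl, if_pos rfl]; congr 1; omega
  · rw [if_neg hc, if_neg hc]

theorem dropLen_pos {d t c : ℕ} (ht : t < m d) (h : 0 < m c) : 0 < dropLen d t m c := by
  unfold dropLen; split_ifs with e
  · subst e; omega
  · exact h

theorem dropPt_step {T : (Bool → P) → (Bool → P) → Prop} {d t c i : ℕ} (hi : i + 1 < dropLen d t m c)
    (h : ∀ i, (c = d → t ≤ i) → i + 1 < m c → T (pt c i) (pt c (i + 1))) :
    T (dropPt d t pt c i) (dropPt d t pt c (i + 1)) := by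
  by_cases e : c = d
  · subst e
    rw [dropLen_self] at hi
    rw [dropPt_self, dropPt_self, Nat.add_right_comm]
    exact h _ (by omega) (by omega)
  · rw [dropLen_of_ne _ e] at hi
    rw [dropPt_of_ne _ _ e, dropPt_of_ne _ _ e]
    exact h _ (by tauto) hi

theorem Labels.drop {S : Set P} {t : ℕ} {ov' : ℕ → ℕ → Bool} (h : C.Labels u m ov ps pt) (hd : d < u) (ht : t ≤ m d)
    (hS : ∀ z ∈ S, ∃ i < t, ∃ s, z = pt d i s)
    (hov : ∀ c i, ov c (if c = d then i + t else i) = ov' c i) {C' : Code P} (hm : C'.mate = (C.erase S).mate)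
    (ho : C'.isOver = C.isOver) (hp : C'.isPos = C.isPos) :
    C'.Labels u (dropLen d t m) ov' ps (dropPt d t pt) := by
  have hv : ∀ c i, c < u → i < dropLen d t m c → c < u ∧ (if c = d then i + t else i) < m c := fun c i hc hi => by
    unfold dropLen at hi
    split_ifs at hi ⊢ with e
    · subst e; omega
    · omega
  refine h.reindex (fun c => c) (fun c i => if c = d then i + t else i) (fun _ _ _ => rfl)
    hv (fun c i c' i' _ _ _ _ e1 e2 => ?_) (fun c i _ _ => hov c i) (fun _ _ => rfl) (fun c i s hc hi => ?_) ho hp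
  · subst e1
    split_ifs at e2 <;> exact ⟨rfl, by omega⟩
  · rw [hm]
    refine C.erase_mate_of_notMem fun hz => ?_
    obtain ⟨j, hj, s', e⟩ := hS _ hz
    obtain ⟨e1, e2, -⟩ := h.inj e hc (hv c i hc hi).2
    rw [if_pos e1] at e2
    omega

/-- Labels of the first columns, the crossings of the other columns being erased. -/
theorem Labels.init {S : Set P} {u' : ℕ} (h : C.Labels u m ov ps pt) (hu : u' ≤ u)
    (hS : ∀ z ∈ S, ∃ c, u' ≤ c ∧ c < u ∧ ∃ i < m c, ∃ s, z = pt c i s) {C' : Code P} (hm : C'.mate = (C.erase S).mate)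
    (ho : C'.isOver = C.isOver) (hp : C'.isPos = C.isPos) : C'.Labels u' m ov ps pt := by
  refine h.reindex (fun c => c) (fun _ i => i) (fun _ _ _ => rfl) (fun _ _ hc hi => ⟨by omega, hi⟩)
    (fun _ _ _ _ _ _ _ _ e1 e2 => ⟨e1, e2⟩) (fun c i _ _ => rfl) (fun _ _ => rfl) (fun c i s hc hi => ?_) ho hp
  rw [hm]
  refine C.erase_mate_of_notMem fun hz => ?_
  obtain ⟨j, hj, hj', i', hi', s', e⟩ := hS _ hz
  have := (h.inj e).1
  omega

/-! ### Columns with antiparallel strands -/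

/-- Up to ordinary points, `C` is the code of the oriented pretzel diagram with `u` columns, whose strands are
antiparallel; the column `c` has `m c` crossings, right-handed if `ε c` and left-handed otherwise.
The passage `pt c i true` belongs to the strand that runs downwards. -/
structure IsAntiparallel (C : Code P) (u : ℕ) (m : ℕ → ℕ) (ε : ℕ → Bool) (pt : ℕ → ℕ → Bool → P) : Prop where
  labels : C.Labels u m (fun c i => decide (i % 2 = 1) == ε c) (fun c => !ε c) pt
  pos (c : ℕ) (hc : c < u := by omega) : 0 < m c
  down (c i : ℕ) (hc : c < u := by omega) (hi : i + 1 < m c := by omega) : C.Thru (pt c i true) (pt c (i + 1) true)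
  up (c i : ℕ) (hc : c < u := by omega) (hi : i + 1 < m c := by omega) : C.Thru (pt c (i + 1) false) (pt c i false)
  top (c : ℕ) (hc : c < u := by omega) : C.Thru (pt c 0 false) (pt (cyc u c) 0 true)
  bot (c : ℕ) (hc : c < u := by omega) : C.Thru (pt c (m c - 1) true) (pt (cyc u c) (m (cyc u c) - 1) false)
  covers : C.Covers (labelSet u m pt)

namespace IsAntiparallel

theorem rotate (h : C.IsAntiparallel u m ε pt) :
    C.IsAntiparallel u (fun c => m (cyc u c)) (fun c => ε (cyc u c)) (fun c => pt (cyc u c)) where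
  labels := h.labels.cyc
  pos c hc := h.pos _ (cyc_lt hc)
  down c i hc hi := h.down _ i (cyc_lt hc)
  up c i hc hi := h.up _ i (cyc_lt hc)
  top c hc := h.top _ (cyc_lt hc)
  bot c hc := h.bot _ (cyc_lt hc)
  covers := by
    have := labelSet_cyc (u := u) (m := m) (pt := pt)
    exact this.symm ▸ h.covers

/-- The two top crossings of the last column are erased. -/
theorem shrink (h : C.IsAntiparallel (d + 1) m ε pt) (hd : 2 < m d) {S : Set P}
    (hS : ∀ z, z ∈ S ↔ ∃ i < 2, ∃ s, z = pt d i s) :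
    (C.erase S).IsAntiparallel (d + 1) (dropLen d 2 m) ε (dropPt d 2 pt) := by
  have ho : ∀ i s, i < 2 → (C.erase S).mate (pt d i s) = pt d i s := fun i s hi =>
    C.erase_mate_of_mem ((hS _).2 ⟨i, hi, s, rfl⟩)
  have hdu : d < d + 1 := by omega
  -- the new labels at the top of the columns are reached from the old ones
  have hin : ∀ c, pt c 0 true = dropPt d 2 pt c 0 true ∨
      (C.erase S).mate (pt c 0 true) = pt c 0 true ∧ (C.erase S).Thru (pt c 0 true) (dropPt d 2 pt c 0 true) := by
    intro c
    by_cases hc : c = d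
    · subst hc
      rw [dropPt_self]
      exact .inr ⟨ho _ _ (by omega), ((h.down c 0).erase S).trans (ho _ _ (by omega))
        ((h.down c 1).erase S)⟩
    · exact .inl (by rw [dropPt_of_ne _ _ hc])
  have hout : ∀ c, dropPt d 2 pt c 0 false = pt c 0 false ∨
      (C.erase S).mate (pt c 0 false) = pt c 0 false ∧ (C.erase S).Thru (dropPt d 2 pt c 0 false) (pt c 0 false) := by
    intro c
    by_cases hc : c = d
    · subst hc
      rw [dropPt_self]
      exact .inr ⟨ho _ _ (by omega), ((h.up c 1).erase S).trans (ho _ _ (by omega))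
        ((h.up c 0).erase S)⟩
    · exact .inl (by rw [dropPt_of_ne _ _ hc])
  have hpos : ∀ c < d + 1, 0 < dropLen d 2 m c := fun c hc => dropLen_pos hd (h.pos c)
  have hnew : ∀ c < d + 1, ∀ i < dropLen d 2 m c, ∀ s, dropPt d 2 pt c i s ∈ labelSet (d + 1) (dropLen d 2 m) (dropPt d 2 pt) :=
    fun c hc i hi s => ⟨c, hc, i, hi, s, rfl⟩
  have htop : ∀ c < d + 1, (C.erase S).Thru (pt c 0 false) (dropPt d 2 pt (cyc (d + 1) c) 0 true) := fun c hc =>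
    ((h.top c).erase S).extend (.inl rfl) (hin _)
  refine ⟨h.labels.drop hdu hd.le (fun z hz => (hS z).1 hz) (fun c i => ?_) rfl rfl rfl, hpos,
    fun c i hc hi => dropPt_step (T := fun a b => (C.erase S).Thru (a true) (b true)) hi fun i _ _ => (h.down c i).erase S,
    fun c i hc hi => dropPt_step (T := fun a b => (C.erase S).Thru (b false) (a false)) hi fun i _ _ => (h.up c i).erase S,
    fun c hc => ((h.top c).erase S).extend (hout c) (hin _), fun c hc => ?_,
    h.covers.mono (fun y hy => ⟨C.erase_mate_of_eq hy, fun z hz => hz.erase S⟩) ?_⟩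
  · split_ifs <;> simp
  · rw [dropPt_last _ hd, dropPt_last _ hd]
    exact (h.bot c).erase S
  · rintro _ ⟨c, hc, i, hi, s, rfl⟩
    by_cases e : c = d ∧ i < 2
    · obtain ⟨rfl, hi2⟩ := e
      refine .inr ⟨ho i s hi2, ?_⟩
      have t1 := (h.down c 0).erase S
      have t2 := (h.down c 1).erase S
      have t3 := (h.up c 0).erase S
      have hT : pt c 2 true ∈ labelSet (c + 1) (dropLen c 2 m) (dropPt c 2 pt) := by
        have := hnew c hc 0 (hpos c hc) true
        rwa [dropPt_self] at this
      have hF := hnew _ (cyc_lt hc) 0 (hpos _ (cyc_lt hc)) true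
      obtain rfl | rfl : i = 0 ∨ i = 1 := by omega
      · cases s
        · exact ⟨_, hF, htop c hc⟩
        · exact ⟨_, hT, t1.trans (ho _ _ (by omega)) t2⟩
      · cases s
        · exact ⟨_, hF, t3.trans (ho _ _ (by omega)) (htop c hc)⟩
        · exact ⟨_, hT, t2⟩
    · left
      by_cases e' : c = d
      · subst e'
        refine ⟨c, hc, i - 2, by rw [dropLen_self]; omega, s, ?_⟩
        rw [dropPt_self, Nat.sub_add_cancel (by omega)]
      · exact ⟨c, hc, i, by rwa [dropLen_of_ne _ e'], s, by rw [dropPt_of_ne _ _ e']⟩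

/-- The top crossing of the last column is smoothed; then the rest of this column is unravelled. -/
theorem delete (hC : C.Planar) (h : C.IsAntiparallel (d + 2) m ε pt) : ∃ S : Set P,
    ((C.smooth (pt (d + 1) 0 true)).erase S).Planar ∧
    (∀ q, ((C.smooth (pt (d + 1) 0 true)).erase S).Poly q → (C.smooth (pt (d + 1) 0 true)).Poly q) ∧
    ((C.smooth (pt (d + 1) 0 true)).erase S).IsAntiparallel (d + 1) m ε pt := by
  have hdu : d + 1 < d + 2 := by omega
  have hmd := h.pos _
  have hV := hC.valid
  have hx : C.mate (pt (d + 1) 0 true) = pt (d + 1) 0 false := h.labels.mate _ _ _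
  have hxx : C.mate (C.mate (pt (d + 1) 0 true)) = pt (d + 1) 0 true := hV.mate_mate _
  have hx' : C.mate (pt (d + 1) 0 true) ≠ pt (d + 1) 0 true := h.labels.mate_ne true
  set x := pt (d + 1) 0 true with hxdef
  have hne : ∀ c < d + 2, ∀ i < m c, ∀ s, (c ≠ d + 1 ∨ i ≠ 0) → pt c i s ≠ x ∧ pt c i s ≠ C.mate x := by
    intro c hc i hi s hci
    rw [hx]
    constructor <;>
    · intro e
      obtain ⟨e1, e2, -⟩ := h.labels.inj e
      tauto
  have hs : ∀ {c i s z} (hz : C.Thru (pt c i s) z) (hc : c < d + 2 := by omega) (hi : i < m c := by omega)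
      (hci : c ≠ d + 1 ∨ i ≠ 0 := by omega), (C.smooth x).Thru (pt c i s) z := fun hz hc hi hci =>
    hz.smooth_of_ne hx' hxx (hne _ hc _ hi _ hci).1 (hne _ hc _ hi _ hci).2
  have hordx : ∀ s, (C.smooth x).mate (pt (d + 1) 0 s) = pt (d + 1) 0 s := fun s => by
    refine C.erase_mate_of_mem ?_
    rw [hx]; cases s <;> simp [hxdef]
  have hmate : ∀ c < d + 2, ∀ i < m c, ∀ s, (c ≠ d + 1 ∨ i ≠ 0) → (C.smooth x).mate (pt c i s) = pt c i !s := by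
    intro c hc i hi s hci
    refine (C.erase_mate_of_notMem ?_).trans (h.labels.mate c i s)
    have := hne c hc i hi s hci
    simp [this.1, this.2]
  have hmx : ∀ {z}, C.Thru x z → (C.smooth x).Thru (pt (d + 1) 0 false) z := fun hz => hx ▸ hz.smooth_mate hx' hxx
  have hsx : ∀ {z}, C.Thru (pt (d + 1) 0 false) z → (C.smooth x).Thru x z := fun hz =>
    Thru.smooth_self (by rwa [hx]) hx' hxx
  obtain ⟨hP, hQ, hT⟩ := (hC.smooth hx').unravel (fun i => pt (d + 1) (i + 1) true) (fun i => pt (d + 1) (i + 1) false)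
    (m (d + 1) - 1)
    (fun i hi => ⟨hmate _ hdu _ (by omega) _ (.inr (by omega)), fun e => by
      simpa using (h.labels.inj e).2.2⟩)
    (fun i j hij hj => ⟨fun e => by have := (h.labels.inj e).2.1; omega,
      fun e => by have := (h.labels.inj e).2.1; omega⟩)
    (fun h0 => (hs (h.up _ 0)).trans (hordx false)
      (hmx (h.down _ 0)))
    (fun i hi => hs (h.up _ (i + 1)))
    (fun i hi => hs (h.down _ (i + 1)))
  set S : Set P := {z | ∃ i < m (d + 1) - 1, z = pt (d + 1) (i + 1) true ∨ z = pt (d + 1) (i + 1) false} with hSdef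
  refine ⟨S, hP, hQ, ?_⟩
  have hord : ∀ i s (hi : i < m (d + 1) := by omega), ((C.smooth x).erase S).mate (pt (d + 1) i s) = pt (d + 1) i s := by
    intro i s hi
    rcases Nat.eq_zero_or_pos i with rfl | hi0
    · exact erase_mate_of_eq _ (hordx s)
    · refine erase_mate_of_mem _ ⟨i - 1, by omega, ?_⟩
      rw [Nat.sub_add_cancel hi0]
      cases s <;> simp
  have c1 : cyc (d + 2) (d + 1) = 0 := cyc_last _
  have c2 : cyc (d + 2) d = d + 1 := cyc_of_lt (by omega)
  have c3 : ∀ {c}, c < d → cyc (d + 2) c = cyc (d + 1) c := fun hc => by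
    rw [cyc_of_lt (by omega), cyc_of_lt (by omega)]
  -- the way through the former last column
  have ttop : ((C.smooth x).erase S).Thru x (pt 0 0 true) := by
    have := h.top _
    rw [c1] at this
    exact (hsx this).erase S
  have tfalse : ∀ i, i + 1 < m (d + 1) → ((C.smooth x).erase S).Thru (pt (d + 1) (i + 1) false) (pt (d + 1) (i + 1) true) :=
    fun i hi => hT i (by omega)
  have tbot : ((C.smooth x).erase S).Thru (pt (d + 1) (m (d + 1) - 1) false) (pt 0 (m 0 - 1) false) := by
    have hb := h.bot _
    rw [c1] at hb
    rcases Nat.lt_or_ge 1 (m (d + 1)) with h1 | h1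
    · obtain ⟨i, hi⟩ : ∃ i, m (d + 1) - 1 = i + 1 := ⟨m (d + 1) - 2, by omega⟩
      rw [hi] at hb ⊢
      exact (tfalse i (by omega)).trans (hord _ _) ((hs hb).erase S)
    · have : m (d + 1) - 1 = 0 := by omega
      rw [this] at hb ⊢
      exact (hmx hb).erase S
  have hkeep : ∀ c < d + 1, ∀ i < m c, ∀ s, pt c i s ∈ labelSet (d + 1) m pt := fun c hc i hi s => ⟨c, hc, i, hi, s, rfl⟩
  have ttrue : ∀ k i, i + 1 + k = m (d + 1) → 0 < i →
      ∃ w ∈ labelSet (d + 1) m pt, ((C.smooth x).erase S).Thru (pt (d + 1) i true) w := by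
    intro k
    induction k with
    | zero =>
      intro i hi hi0
      have hb := h.bot _
      rw [c1, show m (d + 1) - 1 = i by omega] at hb
      exact ⟨_, hkeep 0 (by omega) (m 0 - 1) (by have := h.pos 0; omega) false,
        (hs hb).erase S⟩
    | succ k ih =>
      intro i hi hi0
      obtain ⟨w, hw, hiw⟩ := ih (i + 1) (by omega) (by omega)
      exact ⟨w, hw, ((hs (h.down _ i)).erase S).trans
        (hord _ _) hiw⟩
  refine ⟨h.labels.init (S := {x, C.mate x} ∪ S) (by omega) ?_ ?_ rfl rfl, fun c hc => h.pos c,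
    fun c i hc hi => (hs (h.down c i)).erase S,
    fun c i hc hi => (hs (h.up c i)).erase S,
    fun c hc => ?_, fun c hc => ?_, h.covers.mono (fun y hy => ⟨erase_mate_of_eq _ (C.erase_mate_of_eq hy), fun z hz => ?_⟩) ?_⟩
  · rintro z ((rfl | rfl) | ⟨i, hi, rfl | rfl⟩)
    · exact ⟨d + 1, by omega, by omega, 0, hmd, true, rfl⟩
    · exact ⟨d + 1, by omega, by omega, 0, hmd, false, hx⟩
    · exact ⟨d + 1, by omega, by omega, i + 1, by omega, true, rfl⟩
    · exact ⟨d + 1, by omega, by omega, i + 1, by omega, false, rfl⟩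
  · rw [← erase_erase_eq]; rfl
  · have ht := (hs (h.top c) (hi := h.pos c)).erase S
    rcases Nat.lt_succ_iff_lt_or_eq.1 hc with hc' | rfl
    · rwa [c3 hc'] at ht
    · rw [c2] at ht
      rw [cyc_last]
      exact ht.trans (hord _ _) ttop
  · have hm1 := h.pos c
    have ht := (hs (h.bot c)).erase S
    rcases Nat.lt_succ_iff_lt_or_eq.1 hc with hc' | rfl
    · rwa [c3 hc'] at ht
    · rw [c2] at ht
      rw [cyc_last]
      exact ht.trans (hord _ _) tbot
  · exact (hz.smooth_of_ordinary hx' hxx hy).erase S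
  · rintro _ ⟨c, hc, i, hi, s, rfl⟩
    by_cases e : c = d + 1
    · subst e
      refine .inr ⟨hord i s, ?_⟩
      rcases Nat.eq_zero_or_pos i with rfl | hi0
      · cases s
        · rcases Nat.lt_or_ge 1 (m (d + 1)) with h1 | h1
          · obtain ⟨w, hw, hiw⟩ := ttrue (m (d + 1) - 2) 1 (by omega) (by omega)
            exact ⟨w, hw, ((hmx (h.down _ 0)).erase S).trans (hord _ _) hiw⟩
          · have e1 : m (d + 1) - 1 = 0 := by omega
            rw [e1] at tbot
            exact ⟨_, hkeep 0 (by omega) (m 0 - 1) (by have := h.pos 0; omega) false, tbot⟩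
        · exact ⟨_, hkeep 0 (by omega) 0 (h.pos 0) true, ttop⟩
      · obtain ⟨w, hw, hiw⟩ := ttrue (m (d + 1) - 1 - i) i (by omega) hi0
        cases s
        · obtain ⟨j, rfl⟩ : ∃ j, i = j + 1 := ⟨i - 1, by omega⟩
          exact ⟨w, hw, (tfalse j hi).trans (hord _ _) hiw⟩
        · exact ⟨w, hw, hiw⟩
    · exact .inl ⟨c, by omega, i, hi, s, rfl⟩

end IsAntiparallel

end Code

/-! ### The Conway polynomial of antiparallel pretzel diagrams -/

/-- The quadratic algebra over `ℤ[X]` generated by `ω` with `ω ^ 2 = 1 - X * ω`. -/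
abbrev QuadRing : Type := QuadraticAlgebra ℤ[X] 1 (-X)

/-- The contribution `ω - p X` of a column with `2 p + 1` half-twists to the Conway polynomial, where
`2 p + 1` is `k` or `-k`, according to `ε`. -/
noncomputable def antiparallelFactor (ε : Bool) (k : ℕ) : QuadRing :=
  ⟨if ε then -(((k / 2 : ℕ) : ℤ[X]) * X) else (((k + 1) / 2 : ℕ) : ℤ[X]) * X, 1⟩

open QuadraticAlgebra (im_mul re_mul)

theorem antiparallelFactor_add_two (ε : Bool) (k : ℕ) (A : QuadRing) :
    (A * antiparallelFactor ε (k + 2)).im =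
      (A * antiparallelFactor ε k).im + (if !ε then 1 else -1) * X * A.im := by
  have h1 : (k + 2) / 2 = k / 2 + 1 := by omega
  have h2 : (k + 2 + 1) / 2 = (k + 1) / 2 + 1 := by omega
  cases ε <;> simp [antiparallelFactor, im_mul, h1, h2] <;> ring

theorem antiparallelFactor_one_mul (ε : Bool) (A : QuadRing) :
    (A * antiparallelFactor ε 1 * antiparallelFactor ε 1).im =
      A.im + (if !ε then 1 else -1) * X * (A * antiparallelFactor ε 1).im := by
  cases ε <;> simp [antiparallelFactor, im_mul, re_mul] <;> ring

theorem antiparallelFactor_one_mul_not (ε : Bool) (A : QuadRing) :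
    A * antiparallelFactor (!ε) 1 * antiparallelFactor ε 1 = A := by
  cases ε <;> apply QuadraticAlgebra.ext <;>
    simp [antiparallelFactor, im_mul, re_mul] <;> ring

namespace Code

variable {P : Type} {C : Code P} {u d : ℕ} {m : ℕ → ℕ} {ε : ℕ → Bool} {pt : ℕ → ℕ → Bool → P}

/-- If the crossings of a link that consists of two bigons are forgotten, two split circles are left. -/
theorem Bigon.poly_two_circles {x y : P} (hC : C.Planar) (h : C.Bigon x y true) (h1 : C.Thru y x)
    (h2 : C.Thru (C.mate y) (C.mate x)) (hcov : C.Covers {x, C.mate x, y, C.mate y}) :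
    (C.eraseTwo x y).Poly 0 := by
  have hV := hC.valid
  have hxx : C.mate (C.mate x) = x := hV.mate_mate _
  have h3 := h.thru
  have h4 : C.Thru (C.mate x) (C.mate y) := h.thru_mate
  have hmyx : C.mate y ≠ x := fun e => h.ne_mate (by rw [← e, hV.mate_mate])
  have hmyx' : C.mate y ≠ C.mate x := fun e => h.ne (by rw [← hV.mate_mate y, e, hxx])
  have s1 := h2.smooth_of_ne h.left hxx hmyx hmyx'
  have s2 := h1.smooth_of_ne h.left hxx h.ne h.ne_mate
  have s3 := h4.smooth_self h.left hxx
  have s4 := h3.smooth_mate h.left hxx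
  have ho1 : (C.smooth x).mate x = x := C.erase_mate_of_mem (by simp)
  have ho2 : (C.smooth x).mate (C.mate x) = C.mate x := C.erase_mate_of_mem (by simp)
  refine h.poly_zero hC (.inl (s2.trans ho1 s3)) (q := 1) fun hP => ?_
  set C' := (C.smooth x).erase {y, C.mate y}
  have hall : ∀ z ∈ ({x, C.mate x, y, C.mate y} : Set P), C'.mate z = z ∧ C'.Thru z y := by
    have o1 : C'.mate x = x := erase_mate_of_eq _ ho1
    have o2 : C'.mate (C.mate x) = C.mate x := erase_mate_of_eq _ ho2
    have o3 : C'.mate y = y := erase_mate_of_mem _ (by simp)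
    have o4 : C'.mate (C.mate y) = C.mate y := erase_mate_of_mem _ (by simp)
    have r1 : C'.Thru (C.mate x) y := s4.erase _
    have r2 : C'.Thru (C.mate y) y := (s1.erase _).trans o2 r1
    have r3 : C'.Thru x y := (s3.erase _).trans o4 r2
    have r4 : C'.Thru y y := (s2.erase _).trans o1 r3
    rintro z (rfl | rfl | rfl | rfl)
    exacts [⟨o1, r3⟩, ⟨o2, r1⟩, ⟨o3, r4⟩, ⟨o4, r2⟩]
  refine hP.valid.poly_circle (x := y) (fun w => ?_) fun w => .inr ?_
  · rcases hcov w with hw | ⟨hw, -⟩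
    · exact (hall w hw).1
    · exact erase_mate_of_eq _ (C.erase_mate_of_eq hw)
  · rcases hcov w with hw | ⟨hw, z, hz, hwz⟩
    · exact (hall w hw).2
    · exact ((hwz.smooth_of_ordinary h.left hxx hw).erase _).trans (hall z hz).1 (hall z hz).2

namespace IsAntiparallel

theorem bigon_column (h : C.IsAntiparallel (d + 1) m ε pt) (hd : 1 < m d) : C.Bigon (pt d 0 true) (pt d 1 true) false :=
  h.labels.bigon (by omega) (h.down d 0) (h.up d 0)

theorem bigon_row (h : C.IsAntiparallel (d + 2) m ε pt) (hd : m d = 1) (hd' : m (d + 1) = 1) :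
    C.Bigon (pt d 0 false) (pt (d + 1) 0 true) true := by
  have h1 := h.top d
  have h2 := h.bot d
  rw [cyc_of_lt (by omega)] at h1 h2
  rw [hd, hd'] at h2
  exact h.labels.bigon (by omega) h1 h2

/-- The single crossings of the last two columns are erased. -/
theorem cancel (h : C.IsAntiparallel (d + 3) m ε pt) (hd : m (d + 1) = 1) (hd' : m (d + 2) = 1) {S : Set P}
    (hS : ∀ z, z ∈ S ↔ ∃ c, (c = d + 1 ∨ c = d + 2) ∧ ∃ s, z = pt c 0 s) : (C.erase S).IsAntiparallel (d + 1) m ε pt := by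
  have ho : ∀ c s, (c = d + 1 ∨ c = d + 2) → (C.erase S).mate (pt c 0 s) = pt c 0 s := fun c s hc =>
    C.erase_mate_of_mem ((hS _).2 ⟨c, hc, s, rfl⟩)
  have c1 : cyc (d + 3) (d + 2) = 0 := cyc_last _
  have c2 : cyc (d + 3) (d + 1) = d + 2 := cyc_of_lt (by omega)
  have c3 : cyc (d + 3) d = d + 1 := cyc_of_lt (by omega)
  have c4 : ∀ {c}, c < d → cyc (d + 3) c = cyc (d + 1) c := fun hc => by
    rw [cyc_of_lt (by omega), cyc_of_lt (by omega)]
  have t1 := (h.top (d + 1)).erase S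
  have t2 := (h.top (d + 2)).erase S
  have b1 := (h.bot (d + 1)).erase S
  have b2 := (h.bot (d + 2)).erase S
  rw [c2] at t1 b1
  rw [c1] at t2 b2
  rw [hd, hd'] at b1
  rw [hd'] at b2
  have t3 : (C.erase S).Thru (pt (d + 1) 0 true) (pt 0 0 true) := b1.trans (ho _ _ (.inr rfl)) t2
  have b3 : (C.erase S).Thru (pt (d + 1) 0 false) (pt 0 (m 0 - 1) false) := t1.trans (ho _ _ (.inr rfl)) b2
  have hT : pt 0 0 true ∈ labelSet (d + 1) m pt := ⟨0, by omega, 0, h.pos 0, true, rfl⟩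
  have hB : pt 0 (m 0 - 1) false ∈ labelSet (d + 1) m pt :=
    ⟨0, by omega, m 0 - 1, by have := h.pos 0; omega, false, rfl⟩
  refine ⟨h.labels.init (S := S) (by omega) ?_ rfl rfl rfl, fun c hc => h.pos c,
    fun c i hc hi => (h.down c i).erase S, fun c i hc hi => (h.up c i).erase S,
    fun c hc => ?_, fun c hc => ?_, h.covers.mono (fun y hy => ⟨C.erase_mate_of_eq hy, fun z hz => hz.erase S⟩) ?_⟩
  · intro z hz
    obtain ⟨c, hc, s, rfl⟩ := (hS z).1 hz
    exact ⟨c, by omega, by omega, 0, h.pos c, s, rfl⟩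
  · have ht := (h.top c).erase S
    rcases Nat.lt_succ_iff_lt_or_eq.1 hc with hc' | rfl
    · rwa [c4 hc'] at ht
    · rw [c3] at ht
      rw [cyc_last]
      exact ht.trans (ho _ _ (.inl rfl)) t3
  · have ht := (h.bot c).erase S
    rcases Nat.lt_succ_iff_lt_or_eq.1 hc with hc' | rfl
    · rwa [c4 hc'] at ht
    · rw [c3, hd] at ht
      rw [cyc_last]
      exact ht.trans (ho _ _ (.inl rfl)) b3
  · rintro _ ⟨c, hc, i, hi, s, rfl⟩
    rcases Nat.lt_or_ge c (d + 1) with e | e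
    · exact .inl ⟨c, e, i, hi, s, rfl⟩
    · right
      obtain rfl | rfl : c = d + 1 ∨ c = d + 2 := by omega
      · obtain rfl : i = 0 := by omega
        refine ⟨ho _ _ (.inl rfl), ?_⟩
        cases s
        · exact ⟨_, hB, b3⟩
        · exact ⟨_, hT, t3⟩
      · obtain rfl : i = 0 := by omega
        refine ⟨ho _ _ (.inr rfl), ?_⟩
        cases s
        · exact ⟨_, hT, t2⟩
        · exact ⟨_, hB, b2⟩

/-- A single column is an unknot. -/
theorem poly_one (hC : C.Planar) (h : C.IsAntiparallel 1 m ε pt) : C.Poly 1 := by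
  have h0 := h.pos 0
  have hV := hC.valid
  have htop := h.top 0
  have hbot := h.bot 0
  rw [show cyc 1 0 = 0 from rfl] at htop hbot
  obtain ⟨hP, hQ, hT⟩ := hC.unravel (fun i => pt 0 i true) (fun i => pt 0 i false) (m 0)
    (fun i hi => ⟨h.labels.mate _ _ _, fun e => by
      simpa using (h.labels.inj e).2.2⟩)
    (fun i j hij hj => ⟨fun e => by have := (h.labels.inj e).2.1; omega,
      fun e => by have := (h.labels.inj e).2.1; omega⟩)
    (fun _ => htop) (fun i hi => h.up 0 i) (fun i hi => h.down 0 i)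
  set S : Set P := {z | ∃ i < m 0, z = pt 0 i true ∨ z = pt 0 i false}
  have hord : ∀ i < m 0, ∀ s, (C.erase S).mate (pt 0 i s) = pt 0 i s := fun i hi s =>
    C.erase_mate_of_mem ⟨i, hi, by cases s <;> simp⟩
  have htrue : ∀ k i, i + 1 + k = m 0 → (C.erase S).Thru (pt 0 i true) (pt 0 (m 0 - 1) false) := by
    intro k
    induction k with
    | zero =>
      intro i hi
      have := hbot.erase S
      rwa [show pt 0 (m 0 - 1) true = pt 0 i true by congr; omega] at this
    | succ k ih =>
      intro i hi
      exact ((h.down 0 i).erase S).trans (hord _ (by omega) _) (ih (i + 1) (by omega))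
  have hall : ∀ z ∈ labelSet 1 m pt, (C.erase S).mate z = z ∧ (C.erase S).Thru z (pt 0 (m 0 - 1) false) := by
    rintro _ ⟨c, hc, i, hi, s, rfl⟩
    obtain rfl : c = 0 := by omega
    refine ⟨hord i hi s, ?_⟩
    have := htrue (m 0 - 1 - i) i (by omega)
    cases s
    · exact (hT i hi).trans (hord i hi _) this
    · exact this
  refine hQ 1 (hP.valid.poly_circle (x := pt 0 (m 0 - 1) false) (fun y => ?_) fun y => .inr ?_)
  · rcases h.covers y with hy | ⟨hy, -⟩
    · exact (hall y hy).1
    · exact C.erase_mate_of_eq hy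
  · rcases h.covers y with hy | ⟨hy, z, hz, hyz⟩
    · exact (hall y hy).2
    · exact (hyz.erase S).trans (hall z hz).1 (hall z hz).2

theorem poly_zero (hC : C.Planar) (h : C.IsAntiparallel 2 m ε pt) (h0 : m 0 = 1) (h1 : m 1 = 1) :
    (C.eraseTwo (pt 0 0 false) (pt 1 0 true)).Poly 0 := by
  have mx : C.mate (pt 0 0 false) = pt 0 0 true := h.labels.mate _ _ _
  have my : C.mate (pt 1 0 true) = pt 1 0 false := h.labels.mate _ _ _
  have t1 := h.top 1
  have b1 := h.bot 1
  rw [show cyc 2 1 = 0 from rfl] at t1 b1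
  simp only [h0, h1, Nat.sub_self] at b1
  refine (h.bigon_row (d := 0) h0 h1).poly_two_circles hC b1 (by rwa [mx, my])
    (h.covers.mono (fun y hy => ⟨hy, fun _ => id⟩) ?_)
  rintro _ ⟨c, hc, i, hi, s, rfl⟩
  rw [mx, my]
  obtain rfl | rfl : c = 0 ∨ c = 1 := by omega
  all_goals
    obtain rfl : i = 0 := by omega
    cases s <;> simp

theorem poly (hC : C.Planar) (h : C.IsAntiparallel (d + 1) m ε pt) (hm : ∀ c < d + 1, m c % 2 = 1) :
    C.Poly (∏ c ∈ range (d + 1), antiparallelFactor (ε c) (m c)).im := by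
  induction hN : ∑ c ∈ range (d + 1), m c using Nat.strong_induction_on generalizing C d m ε pt with
  | _ N ih =>
  have hcol : ∀ (m : ℕ → ℕ) (ε : ℕ → Bool) (pt : ℕ → ℕ → Bool → P), C.IsAntiparallel (d + 1) m ε pt →
      (∀ c < d + 1, m c % 2 = 1) → ∑ c ∈ range (d + 1), m c = N → 2 < m d →
      C.Poly (∏ c ∈ range (d + 1), antiparallelFactor (ε c) (m c)).im := by
    intro m ε pt h hm hN hd
    have hb := h.bigon_column (by omega)
    obtain ⟨k1, k2⟩ := hb.skein hC (by
        rw [h.labels.isOver d 0, h.labels.isOver d 1]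
        cases ε d <;> decide) (by
        rw [h.labels.isPos d 0 true, h.labels.isPos d 1 true]) (.inl rfl)
    have hpos : C.isPos (pt d 0 true) = !ε d := h.labels.isPos d 0 true
    obtain ⟨k, hk⟩ : ∃ k, m d = k + 2 := ⟨m d - 2, by omega⟩
    have i1 := ih (∑ c ∈ range (d + 1), dropLen d 2 m c) (by
        rw [← hN, sum_range_succ, sum_range_succ, dropLen_self]
        have : ∑ c ∈ range d, dropLen d 2 m c = ∑ c ∈ range d, m c :=
          sum_congr rfl fun c hc => dropLen_of_ne m (by simp at hc; omega)
        omega) k1 (h.shrink hd fun z => h.labels.mem_eraseTwo.trans (by rw [Nat.exists_lt_two_iff])) (fun c hc => by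
          have := hm c hc
          unfold dropLen; split_ifs with e
          · subst e; omega
          · omega) rfl
    rw [prod_range_succ, dropLen_self, prod_congr rfl (fun c hc => by
      rw [dropLen_of_ne m (by simp at hc; omega)] : ∀ c ∈ range d, antiparallelFactor (ε c) (dropLen d 2 m c) =
        antiparallelFactor (ε c) (m c)), hk, Nat.add_sub_cancel] at i1
    rw [prod_range_succ, hk, antiparallelFactor_add_two]
    cases d with
    | zero =>
      -- a single column is an unknot, whatever its length
      have := h.poly_one hC
      have e : (∏ c ∈ range 0, antiparallelFactor (ε c) (m c)).im = 0 := rfl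
      rw [e]
      simpa [antiparallelFactor] using this
    | succ d =>
      obtain ⟨T, l1, l2, l3⟩ := h.delete hC
      have i2 := ih (∑ c ∈ range (d + 1), m c) (by
        rw [← hN, sum_range_succ _ (d + 1)]; omega) l1 l3 (fun c hc => hm c (by omega)) rfl
      have := k2 _ _ i1 (l2 _ i2)
      rwa [sign, hpos] at this
  by_cases hbig : ∃ c < d + 1, 2 < m c
  · -- rotate until the long column is the last one
    obtain ⟨c, hc, hbig⟩ := hbig
    clear ih
    induction c generalizing m ε pt with
    | zero =>
      rw [← prod_range_cyc]
      exact hcol _ _ _ h.rotate (fun c hc => hm _ (cyc_lt hc)) ((sum_range_cyc _ _).trans hN) (by rwa [cyc_last])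
    | succ c ihc =>
      rw [← prod_range_cyc]
      exact ihc h.rotate (fun c hc => hm _ (cyc_lt hc)) ((sum_range_cyc _ _).trans hN) (by omega) (by rwa [cyc_of_lt hc])
  · have hone : ∀ c < d + 1, m c = 1 := fun c hc => by
      have := hm c hc
      have : ¬ 2 < m c := fun h => hbig ⟨c, hc, h⟩
      omega
    cases d with
    | zero =>
      have := h.poly_one hC
      simpa [antiparallelFactor] using this
    | succ d =>
      have m1 := hone d (by omega)
      have m2 := hone (d + 1) (by omega)
      have hb := h.bigon_row m1 m2
      have o1 := h.labels.isOver_false hC.valid d 0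
      have o2 := h.labels.isOver (d + 1) 0
      have p1 := h.labels.isPos d 0 false
      have p2 := h.labels.isPos (d + 1) 0 true
      have hE : (C.eraseTwo (pt d 0 false) (pt (d + 1) 0 true)).Planar →
          (C.eraseTwo (pt d 0 false) (pt (d + 1) 0 true)).Poly
            (∏ c ∈ range d, antiparallelFactor (ε c) (m c)).im := by
        intro hP
        cases d with
        | zero => exact h.poly_zero hC m1 m2
        | succ d =>
          refine ih (∑ c ∈ range (d + 1), m c) (by
            rw [← hN, sum_range_succ _ (d + 2), sum_range_succ _ (d + 1)]; omega) hP
            (h.cancel m1 m2 fun z => h.labels.mem_eraseTwo.trans (by simp [or_and_right, exists_or]))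
            (fun c hc => hm c (by omega)) rfl
      rw [prod_range_succ, prod_range_succ, m1, m2]
      by_cases hε : ε d = ε (d + 1)
      · obtain ⟨k1, k2⟩ := hb.skein hC (by rw [o1, o2, hε]; cases ε (d + 1) <;> decide) (by rw [p1, p2, hε]) (.inr rfl)
        obtain ⟨T, l1, l2, l3⟩ := h.delete hC
        have i2 := ih (∑ c ∈ range (d + 1), m c) (by
          rw [← hN, sum_range_succ _ (d + 1)]; omega) l1 l3 (fun c hc => hm c (by omega)) rfl
        have := k2 _ _ (hE k1) (l2 _ i2)
        rw [hε, antiparallelFactor_one_mul]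
        rwa [sign, p2, prod_range_succ, m1, hε] at this
      · have hε' : ε d = !ε (d + 1) := by revert hε; cases ε d <;> cases ε (d + 1) <;> simp
        obtain ⟨k1, k2⟩ := hb.reidII hC (by rw [o1, o2, hε']; cases ε (d + 1) <;> decide) (by rw [p1, p2, hε']; simp)
        rw [hε', antiparallelFactor_one_mul_not]
        exact k2 _ (hE k1)

end IsAntiparallel

end Code

/-! ### Columns with parallel strands -/

namespace Code

variable {P : Type} {C C' : Code P} {u d t : ℕ} {m : ℕ → ℕ} {ω ε : ℕ → Bool} {pt : ℕ → ℕ → Bool → P} {r : P} {S : Set P}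

/-- Columns with parallel strands.  The passage `pt c i true` enters the `i`-th crossing of the column `c`, in the
direction of travel, from the left side of the column. -/
structure IsColumns (C : Code P) (u : ℕ) (m : ℕ → ℕ) (ω ε : ℕ → Bool) (pt : ℕ → ℕ → Bool → P) : Prop where
  labels : C.Labels u m (fun c _ => ω c) ε pt
  pos (c : ℕ) (hc : c < u := by omega) : 0 < m c
  step (c i : ℕ) (s : Bool) (hc : c < u := by omega) (hi : i + 1 < m c := by omega) : C.Thru (pt c i s) (pt c (i + 1) !s)

/-- Up to ordinary points, `C` is the code of the oriented pretzel diagram with `u` columns, whose strands are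
parallel; the column `c` has `m c` crossings, right-handed if `ε c` and left-handed otherwise.  The odd columns run
upwards or downwards, according to `φ`, and the even ones in the opposite direction. -/
structure IsParallel (C : Code P) (u : ℕ) (m : ℕ → ℕ) (ε : ℕ → Bool) (φ : Bool) (pt : ℕ → ℕ → Bool → P) : Prop
    extends C.IsColumns u m (fun c => ε c == (decide (c % 2 = 0) ^^ φ)) ε pt where
  right (c : ℕ) (hc : c < u := by omega) : C.Thru (pt c (m c - 1) true) (pt (cyc u c) 0 true)
  left (c : ℕ) (hc : c < u := by omega) : C.Thru (pt (cyc u c) (m (cyc u c) - 1) false) (pt c 0 false)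
  covers : C.Covers (labelSet u m pt)

/-- Columns with parallel strands that are connected to a linear chain, beginning and ending at the ordinary
point `r`: a connected sum of closed two-strand twists. -/
structure IsChain (C : Code P) (u : ℕ) (m : ℕ → ℕ) (ω ε : ℕ → Bool) (pt : ℕ → ℕ → Bool → P) (r : P) : Prop
    extends C.IsColumns u m ω ε pt where
  mate_root : C.mate r = r
  right (c : ℕ) (hc : c + 1 < u := by omega) : C.Thru (pt c (m c - 1) true) (pt (c + 1) 0 true)
  left (c : ℕ) (hc : c + 1 < u := by omega) : C.Thru (pt (c + 1) (m (c + 1) - 1) false) (pt c 0 false)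
  start (hu : 0 < u := by omega) : C.Thru r (pt 0 0 true)
  turn (c : ℕ) (hc : c + 1 = u := by omega) : C.Thru (pt c (m c - 1) true) (pt c 0 false)
  finish (hu : 0 < u := by omega) : C.Thru (pt 0 (m 0 - 1) false) r
  covers : C.Covers (labelSet u m pt ∪ {r})

/-- `C'` arises from `C` by making the first `t` crossings of the column `d` ordinary, in such a way that they are
still passed straight on. -/
structure Drops (C C' : Code P) (d t : ℕ) (pt : ℕ → ℕ → Bool → P) (S : Set P) : Prop where
  mem : ∀ z, z ∈ S ↔ ∃ i < t, ∃ s, z = pt d i s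
  mate : C'.mate = (C.erase S).mate
  isOver : C'.isOver = C.isOver
  isPos : C'.isPos = C.isPos
  thru : ∀ y z, y ∉ S → C.Thru y z → C'.Thru y z

namespace Drops

theorem mate_pt (h : Drops C C' d t pt S) {i : ℕ} (hi : i < t) (s : Bool) : C'.mate (pt d i s) = pt d i s := by
  rw [h.mate]; exact C.erase_mate_of_mem ((h.mem _).2 ⟨i, hi, s, rfl⟩)

theorem mate_of_eq (h : Drops C C' d t pt S) {y : P} (hy : C.mate y = y) : C'.mate y = y := by
  rw [h.mate]; exact C.erase_mate_of_eq hy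

theorem notMem (h : Drops C C' d t pt S) (hc : C.IsColumns u m ω ε pt) (hd : d < u) (ht : t ≤ m d) {c i : ℕ} {s : Bool}
    (hcu : c < u) (hi : i < m c) (hci : c = d → t ≤ i) : pt c i s ∉ S := by
  rw [h.mem]
  rintro ⟨j, hj, s', e⟩
  obtain ⟨e1, e2, -⟩ := hc.labels.inj e
  have := hci e1
  omega

theorem notMem_of_mate_eq (h : Drops C C' d t pt S) (hc : C.IsColumns u m ω ε pt) (hd : d < u) (ht : t ≤ m d) {y : P}
    (hy : C.mate y = y) : y ∉ S := by
  rw [h.mem]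
  rintro ⟨i, hi, s, rfl⟩
  exact hc.labels.mate_ne s hd (by omega) hy

theorem isColumns (h : Drops C C' d t pt S) (hc : C.IsColumns u m ω ε pt) (hd : d < u) (ht : t < m d) :
    C'.IsColumns u (dropLen d t m) ω ε (dropPt d t pt) where
  labels := hc.labels.drop hd ht.le (fun z hz => (h.mem z).1 hz) (fun _ _ => rfl) h.mate h.isOver h.isPos
  pos c hcu := dropLen_pos ht (hc.pos c)
  step c i s hcu hi := dropPt_step (T := fun a b => C'.Thru (a s) (b !s)) hi fun i hi' hi =>
    h.thru _ _ (h.notMem hc hd ht.le hcu (by omega) hi') (hc.step c i s)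

/-- A path between columns that leads to the top of a column is continued to the first remaining crossing. -/
theorem enter (h : Drops C C' d t pt S) (hent : ∀ s, C'.Thru (pt d 0 s) (pt d t s)) (h0 : 0 < t) {y : P} (hy : y ∉ S)
    {c : ℕ} {s : Bool} (hz : C.Thru y (pt c 0 s)) : C'.Thru y (dropPt d t pt c 0 s) := by
  refine (h.thru _ _ hy hz).extend (.inl rfl) ?_
  by_cases e : c = d
  · subst e
    rw [dropPt_self, Nat.zero_add]
    exact .inr ⟨h.mate_pt h0 s, hent s⟩
  · exact .inl (by rw [dropPt_of_ne _ _ e])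

theorem exit_notMem (h : Drops C C' d t pt S) (hc : C.IsColumns u m ω ε pt) (hd : d < u) (ht : t < m d) {c : ℕ} (s : Bool)
    (hcu : c < u) : pt c (m c - 1) s ∉ S :=
  h.notMem hc hd ht.le hcu (by have := hc.pos c; omega) (by rintro rfl; omega)

theorem covers (h : Drops C C' d t pt S) (hc : C.IsColumns u m ω ε pt) (hd : d < u) (ht : t < m d)
    (hdrop : ∀ i < t, ∀ s, ∃ s', C'.Thru (pt d i s) (pt d t s')) {R : Set P}
    (hcov : C.Covers (labelSet u m pt ∪ R)) : C'.Covers (labelSet u (dropLen d t m) (dropPt d t pt) ∪ R) := by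
  refine hcov.mono (fun y hy => ⟨h.mate_of_eq hy, fun z hz => h.thru y z (h.notMem_of_mate_eq hc hd ht.le hy) hz⟩) ?_
  rintro z (⟨c, hcu, i, hi, s, rfl⟩ | hz)
  · by_cases e : c = d
    · subst e
      rcases Nat.lt_or_ge i t with hit | hit
      · obtain ⟨s', hs'⟩ := hdrop i hit s
        refine .inr ⟨h.mate_pt hit s, _, .inl ⟨c, hcu, 0, by rw [dropLen_self]; omega, s', rfl⟩, ?_⟩
        rwa [dropPt_self, Nat.zero_add]
      · refine .inl (.inl ⟨c, hcu, i - t, by rw [dropLen_self]; omega, s, ?_⟩)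
        rw [dropPt_self, Nat.sub_add_cancel hit]
    · exact .inl (.inl ⟨c, hcu, i, by rwa [dropLen_of_ne _ e], s, by rw [dropPt_of_ne _ _ e]⟩)
  · exact .inl (.inr hz)

theorem isParallel {φ : Bool} (h : Drops C C' d t pt S) (hc : C.IsParallel u m ε φ pt) (hd : d < u) (ht : t < m d) (h0 : 0 < t)
    (hent : ∀ s, C'.Thru (pt d 0 s) (pt d t s)) (hdrop : ∀ i < t, ∀ s, ∃ s', C'.Thru (pt d i s) (pt d t s')) :
    C'.IsParallel u (dropLen d t m) ε φ (dropPt d t pt) where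
  toIsColumns := h.isColumns hc.toIsColumns hd ht
  right c hcu := by
    rw [dropPt_last _ ht]
    exact h.enter hent h0 (h.exit_notMem hc.toIsColumns hd ht _ hcu) (hc.right c)
  left c hcu := by
    rw [dropPt_last _ ht]
    exact h.enter hent h0 (h.exit_notMem hc.toIsColumns hd ht _ (cyc_lt hcu)) (hc.left c)
  covers := by
    have := h.covers hc.toIsColumns hd ht hdrop (R := ∅) (by simpa using hc.covers)
    simpa using this

theorem isChain (h : Drops C C' d t pt S) (hc : C.IsChain u m ω ε pt r) (hd : d < u) (ht : t < m d) (h0 : 0 < t)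
    (hent : ∀ s, C'.Thru (pt d 0 s) (pt d t s)) (hdrop : ∀ i < t, ∀ s, ∃ s', C'.Thru (pt d i s) (pt d t s')) :
    C'.IsChain u (dropLen d t m) ω ε (dropPt d t pt) r where
  toIsColumns := h.isColumns hc.toIsColumns hd ht
  mate_root := h.mate_of_eq hc.mate_root
  right c hcu := by
    rw [dropPt_last _ ht]
    exact h.enter hent h0 (h.exit_notMem hc.toIsColumns hd ht _ (by omega)) (hc.right c)
  left c hcu := by
    rw [dropPt_last _ ht]
    exact h.enter hent h0 (h.exit_notMem hc.toIsColumns hd ht _ (by omega)) (hc.left c)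
  start hu := h.enter hent h0 (h.notMem_of_mate_eq hc.toIsColumns hd ht.le hc.mate_root) (hc.start hu)
  turn c hcu := by
    rw [dropPt_last _ ht]
    exact h.enter hent h0 (h.exit_notMem hc.toIsColumns hd ht _ (by omega)) (hc.turn c hcu)
  finish hu := by
    rw [dropPt_last _ ht]
    exact h.thru _ _ (h.exit_notMem hc.toIsColumns hd ht _ hu) (hc.finish hu)
  covers := h.covers hc.toIsColumns hd ht hdrop hc.covers

/-- If a whole column of a cyclic arrangement is dropped, the other columns form a chain. -/
theorem isChain_of_isParallel {φ : Bool} (h : Drops C C' (d + 1) (m (d + 1)) pt S) (hc : C.IsParallel (d + 2) m ε φ pt)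
    (h1 : C'.Thru (pt (d + 1) 0 true) (pt d 0 false)) (h2 : C'.Thru (pt (d + 1) 0 false) (pt 0 0 true))
    (hdrop : ∀ i < m (d + 1), ∀ s, ∃ c < d + 1, ∃ s', C'.Thru (pt (d + 1) i s) (pt c 0 s')) :
    C'.IsChain (d + 1) m (fun c => ε c == (decide (c % 2 = 0) ^^ φ)) ε pt (pt (d + 1) 0 false) := by
  have hcol := hc.toIsColumns
  have hdu : d + 1 < d + 2 := by omega
  have hpos := hc.pos _
  have hex : ∀ c s, c < d + 1 → pt c (m c - 1) s ∉ S := fun c s hcu =>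
    h.notMem hcol hdu le_rfl (by omega) (by have := hc.pos c; omega) (by omega)
  have c1 : ∀ c, c < d + 1 → cyc (d + 2) c = c + 1 := fun c hcu => cyc_of_lt (by omega)
  refine ⟨⟨hc.labels.init (by omega) (fun z hz => ?_) h.mate h.isOver h.isPos, fun c hcu => hc.pos c,
    fun c i s hcu hi => h.thru _ _ (h.notMem hcol hdu le_rfl (by omega) (by omega) (by omega))
      (hc.step c i s)⟩, h.mate_pt hpos _, fun c hcu => ?_, fun c hcu => ?_, fun _ => h2,
    fun c hcu => ?_, fun _ => ?_, hc.covers.mono (fun y hy =>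
      ⟨h.mate_of_eq hy, fun z hz => h.thru y z (h.notMem_of_mate_eq hcol hdu le_rfl hy) hz⟩) ?_⟩
  · obtain ⟨i, hi, s, rfl⟩ := (h.mem z).1 hz
    exact ⟨d + 1, by omega, by omega, i, hi, s, rfl⟩
  · have := hc.right c
    rw [c1 c (by omega)] at this
    exact h.thru _ _ (hex c _ (by omega)) this
  · have := hc.left c
    rw [c1 c (by omega)] at this
    exact h.thru _ _ (hex _ _ (by omega)) this
  · obtain rfl : c = d := by omega
    have := hc.right c
    rw [c1 c (by omega)] at this
    exact (h.thru _ _ (hex c _ (by omega)) this).trans (h.mate_pt hpos _) h1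
  · have := hc.left (d + 1)
    rw [cyc_last] at this
    exact h.thru _ _ (hex 0 _ (by omega)) this
  · rintro _ ⟨c, hcu, i, hi, s, rfl⟩
    by_cases e : c = d + 1
    · subst e
      obtain ⟨c, hc', s', ht⟩ := hdrop i hi s
      exact .inr ⟨h.mate_pt hi s, _, .inl ⟨c, hc', 0, hc.pos c, s', rfl⟩, ht⟩
    · exact .inl (.inl ⟨c, by omega, i, hi, s, rfl⟩)

end Drops

namespace IsColumns

theorem bigon (h : C.IsColumns u m ω ε pt) (hd : d < u) (hm : 1 < m d) : C.Bigon (pt d 0 true) (pt d 1 false) true :=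
  h.labels.bigon (by omega) (h.step d 0 true) (h.step d 0 false)

/-- The skein relation at the beginning of a column. -/
theorem skein (hC : C.Planar) (h : C.IsColumns u m ω ε pt) (hd : d < u) (hm : 1 < m d) :
    (C.eraseTwo (pt d 0 true) (pt d 1 false)).Planar ∧
    ∀ q₁ q₂, (C.eraseTwo (pt d 0 true) (pt d 1 false)).Poly q₁ →
      (C.smooth (pt d 0 true)).Poly q₂ → C.Poly (q₁ + (if ε d then 1 else -1) * X * q₂) := by
  have o1 := h.labels.isOver d 0
  have o2 := h.labels.isOver_false hC.valid d 1
  have p1 := h.labels.isPos d 0 true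
  have p2 := h.labels.isPos d 1 false
  have := (h.bigon hd hm).skein hC (by rw [o1, o2]; cases ω d <;> decide) (by rw [p1, p2]) (.inl rfl)
  rwa [sign, p1] at this

theorem drops_erase (h : C.IsColumns u m ω ε pt) (hd : d < u) (hm : 1 < m d) :
    Drops C (C.eraseTwo (pt d 0 true) (pt d 1 false)) d 2 pt
      {pt d 0 true, C.mate (pt d 0 true), pt d 1 false, C.mate (pt d 1 false)} where
  mem z := h.labels.mem_eraseTwo.trans (by rw [Nat.exists_lt_two_iff])
  mate := rfl
  isOver := rfl
  isPos := rfl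
  thru _ _ _ h := h.erase _

theorem drops_smooth (hV : C.Valid) (h : C.IsColumns u m ω ε pt) (hd : d < u) :
    Drops C (C.smooth (pt d 0 true)) d 1 pt {pt d 0 true, C.mate (pt d 0 true)} where
  mem z := by
    rw [h.labels.mate _ _ _ hd (h.pos d)]
    simp only [Set.mem_insert_iff, Set.mem_singleton_iff, Bool.exists_bool, Bool.not_true, Nat.lt_one_iff,
      exists_eq_left]
    exact or_comm
  mate := rfl
  isOver := rfl
  isPos := rfl
  thru y z hy hz := by
    simp only [Set.mem_insert_iff, Set.mem_singleton_iff, not_or] at hy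
    exact hz.smooth_of_ne (h.labels.mate_ne _ hd (h.pos d)) (hV.mate_mate _) hy.1 hy.2

theorem thru_smooth (hV : C.Valid) (h : C.IsColumns u m ω ε pt) (hd : d < u) {s : Bool} {z : P}
    (hz : C.Thru (pt d 0 !s) z) : (C.smooth (pt d 0 true)).Thru (pt d 0 s) z := by
  have e := h.labels.mate d 0 true hd (h.pos d)
  have hx := h.labels.mate_ne true hd (h.pos d)
  cases s
  · have := Thru.smooth_mate (x := pt d 0 true) hz hx (hV.mate_mate _)
    rwa [e] at this
  · exact Thru.smooth_self (by rwa [e]) hx (hV.mate_mate _)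

theorem enter_erase (h : C.IsColumns u m ω ε pt) (hd : d < u) (hm : 2 < m d) (s : Bool) :
    (C.eraseTwo (pt d 0 true) (pt d 1 false)).Thru (pt d 0 s) (pt d 2 s) ∧
    (C.eraseTwo (pt d 0 true) (pt d 1 false)).Thru (pt d 1 s) (pt d 2 !s) := by
  have h1 := fun s => (h.step d 1 s).erase
    {pt d 0 true, C.mate (pt d 0 true), pt d 1 false, C.mate (pt d 1 false)}
  have h2 := ((h.step d 0 s).erase _).trans ((h.drops_erase hd (by omega)).mate_pt (by omega) _) (h1 !s)
  rw [Bool.not_not] at h2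
  exact ⟨h2, h1 s⟩

theorem enter_smooth (hV : C.Valid) (h : C.IsColumns u m ω ε pt) (hd : d < u) (hm : 1 < m d) (s : Bool) :
    (C.smooth (pt d 0 true)).Thru (pt d 0 s) (pt d 1 s) := by
  have := h.step d 0 (!s)
  rw [Bool.not_not] at this
  exact h.thru_smooth hV hd this

end IsColumns

end Code

/-! ### The Conway polynomial of parallel pretzel diagrams -/

/-- The dual numbers over `ℤ[X]`. -/
abbrev DualRing : Type := QuadraticAlgebra ℤ[X] 0 0

/-- The contribution of a column with `k` crossings and parallel strands: `re` is the coefficient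
of a single crossing without twist (the Conway polynomial of the closed two-strand twist), `im` that of two vertical
strands. -/
noncomputable def twistFactor (ε : Bool) : ℕ → DualRing
  | 0 => ⟨0, 1⟩
  | 1 => ⟨1, if ε then 0 else -X⟩
  | k + 2 => twistFactor ε k + (if ε then 1 else -1) * QuadraticAlgebra.C X * twistFactor ε (k + 1)

/-- The Conway polynomial of a parallel pretzel diagram with `2 n` columns whose contributions multiply to `A`. -/
noncomputable def parallelValue (n : ℕ) (A : DualRing) : ℤ[X] := (n : ℤ[X]) * X * A.re + A.im

open QuadraticAlgebra (im_mul re_mul)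

theorem twistFactor_add_two_re (ε : Bool) (k : ℕ) (A : DualRing) : (A * twistFactor ε (k + 2)).re =
    (A * twistFactor ε k).re + (if ε then 1 else -1) * X * (A * twistFactor ε (k + 1)).re := by
  cases ε <;> simp [twistFactor, re_mul] <;> ring

theorem parallelValue_add_two (n : ℕ) (ε : Bool) (k : ℕ) (A : DualRing) : parallelValue n (A * twistFactor ε (k + 2)) =
    parallelValue n (A * twistFactor ε k) + (if ε then 1 else -1) * X * parallelValue n (A * twistFactor ε (k + 1)) := by
  cases ε <;> simp [parallelValue, twistFactor, re_mul, im_mul] <;> ring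

theorem parallelValue_zero (n : ℕ) (ε : Bool) (A : DualRing) : parallelValue n (A * twistFactor ε 0) = A.re := by
  simp [parallelValue, twistFactor, re_mul, im_mul]

theorem twistFactor_zero_re (ε : Bool) (A : DualRing) : (A * twistFactor ε 0).re = 0 := by
  simp [twistFactor, re_mul]

theorem twistFactor_one_re (ε : Bool) (A : DualRing) : (A * twistFactor ε 1).re = A.re := by
  simp [twistFactor, re_mul]

theorem parallelValue_one_mul (n : ℕ) (ε : Bool) (A : DualRing) :
    parallelValue (n + 1) (A * twistFactor ε 1 * twistFactor ε 1) =
      parallelValue n A + (if ε then 1 else -1) * X * (A * twistFactor ε 1).re := by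
  cases ε <;> simp [parallelValue, twistFactor, re_mul, im_mul] <;> ring

theorem parallelValue_one_mul_not (n : ℕ) (ε : Bool) (A : DualRing) :
    parallelValue (n + 1) (A * twistFactor (!ε) 1 * twistFactor ε 1) = parallelValue n A := by
  cases ε <;> simp [parallelValue, twistFactor, re_mul, im_mul] <;> ring

namespace Code

variable {P : Type} {C C' : Code P} {u d t n : ℕ} {m : ℕ → ℕ} {ω ε : ℕ → Bool} {φ : Bool} {pt : ℕ → ℕ → Bool → P} {r : P} {S : Set P}

theorem sum_range_dropLen {d t : ℕ} (m : ℕ → ℕ) (h : t ≤ m d) :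
    ∑ c ∈ range (d + 1), dropLen d t m c + t = ∑ c ∈ range (d + 1), m c := by
  rw [sum_range_succ, sum_range_succ, dropLen_self,
    sum_congr rfl fun c hc => dropLen_of_ne m (ne_of_lt (mem_range.1 hc))]
  omega

theorem prod_range_dropLen {M : Type*} [CommMonoid M] {d t : ℕ} (m : ℕ → ℕ) (f : ℕ → ℕ → M) :
    ∏ c ∈ range (d + 1), f c (dropLen d t m c) = (∏ c ∈ range d, f c (m c)) * f d (m d - t) := by
  rw [prod_range_succ, dropLen_self,
    prod_congr rfl fun c hc => by rw [dropLen_of_ne m (ne_of_lt (mem_range.1 hc))]]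

namespace IsChain

/-- The last column, if it has a single crossing, is a curl. -/
theorem curl (h : C.IsChain (d + 1) m ω ε pt r) (hd : m d = 1) : C.Thru (pt d 0 true) (pt d 0 false) := by
  have := h.turn d rfl
  rwa [hd] at this

theorem erase_last (h : C.IsChain (d + 1) m ω ε pt r) (hd : m d = 1) (hS : ∀ z, z ∈ S ↔ ∃ s, z = pt d 0 s) :
    (C.erase S).IsChain d m ω ε pt r := by
  have ho : ∀ s, (C.erase S).mate (pt d 0 s) = pt d 0 s := fun s => C.erase_mate_of_mem ((hS _).2 ⟨s, rfl⟩)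
  have hcurl := (h.curl hd).erase S
  have hback : (C.erase S).Thru (pt d 0 false) (if d = 0 then r else pt (d - 1) 0 false) := by
    split_ifs with e
    · subst e
      have := h.finish.erase S
      rwa [hd] at this
    · obtain ⟨c, rfl⟩ : ∃ c, d = c + 1 := ⟨d - 1, by omega⟩
      have := (h.left c).erase S
      rwa [hd] at this
  refine ⟨⟨h.labels.init (S := S) (by omega) (fun z hz => ?_) rfl rfl rfl, fun c hc => h.pos c,
    fun c i s hc hi => (h.step c i s).erase S⟩, C.erase_mate_of_eq h.mate_root,
    fun c hc => (h.right c).erase S, fun c hc => (h.left c).erase S,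
    fun hu => h.start.erase S, ?_, fun hu => h.finish.erase S,
    h.covers.mono (fun y hy => ⟨C.erase_mate_of_eq hy, fun z hz => hz.erase S⟩) ?_⟩
  · obtain ⟨s, rfl⟩ := (hS z).1 hz
    exact ⟨d, le_rfl, by omega, 0, by omega, s, rfl⟩
  · rintro c rfl
    exact (((h.right c).erase S).trans (ho _) hcurl).trans (ho _) hback
  · rintro z (⟨c, hc, i, hi, s, rfl⟩ | hz)
    · by_cases e : c = d
      · subst e
        obtain rfl : i = 0 := by omega
        refine .inr ⟨ho s, (if c = 0 then r else pt (c - 1) 0 false), ?_, ?_⟩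
        · split_ifs with e
          · exact .inr rfl
          · exact .inl ⟨c - 1, by omega, 0, h.pos _, false, rfl⟩
        · cases s
          · exact hback
          · exact hcurl.trans (ho _) hback
      · exact .inl (.inl ⟨c, by omega, i, hi, s, rfl⟩)
    · exact .inl (.inr hz)

theorem poly (hC : C.Planar) (h : C.IsChain u m ω ε pt r) :
    C.Poly (∏ c ∈ range u, twistFactor (ε c) (m c)).re := by
  induction hN : ∑ c ∈ range u, m c using Nat.strong_induction_on generalizing C u m pt with
  | _ N ih =>
  cases u with
  | zero =>
    refine hC.valid.poly_circle (x := r) (fun y => ?_) (fun y => ?_)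
    · rcases h.covers y with (⟨c, hc, -⟩ | rfl) | ⟨hy, -⟩
      · omega
      · exact h.mate_root
      · exact hy
    · rcases h.covers y with (⟨c, hc, -⟩ | rfl) | ⟨hy, z, ⟨c, hc, -⟩ | rfl, hyz⟩
      · omega
      · exact .inl rfl
      · omega
      · exact .inr hyz
  | succ d =>
    have hdu : d < d + 1 := by omega
    have hpos := h.pos d
    -- a single crossing in the last column is a curl
    have hone : ∀ {C : Code P} {m : ℕ → ℕ} {pt : ℕ → ℕ → Bool → P} {S : Set P}, (C.erase S).Planar →
        C.IsChain (d + 1) m ω ε pt r → m d = 1 → ∑ c ∈ range (d + 1), m c ≤ N →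
        (∀ z, z ∈ S ↔ ∃ s, z = pt d 0 s) →
        (C.erase S).Poly (∏ c ∈ range d, twistFactor (ε c) (m c)).re := fun hP h hd hN hS =>
      ih _ (by rw [sum_range_succ, hd] at hN; omega) hP (h.erase_last hd hS) rfl
    rcases Nat.lt_or_ge 1 (m d) with hm | hm
    · obtain ⟨k1, k2⟩ := h.toIsColumns.skein hC hdu hm
      have hds := h.drops_smooth hC.valid hdu
      have hde := h.drops_erase hdu hm
      have hent := h.enter_smooth hC.valid hdu hm
      have hsm := hds.isChain h hdu hm one_pos hent (fun i hi s => ⟨s, by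
        obtain rfl : i = 0 := by omega
        exact hent s⟩)
      have hsum := sum_range_dropLen (t := 1) m hpos
      have hP := hC.smooth (h.labels.mate_ne true hdu hpos)
      have i2 := ih _ (by omega) hP hsm rfl
      obtain ⟨k, hk⟩ : ∃ k, m d = k + 2 := ⟨m d - 2, by omega⟩
      rw [prod_range_dropLen, hk] at i2
      rw [prod_range_succ, hk, twistFactor_add_two_re]
      refine k2 _ _ ?_ i2
      rcases Nat.eq_zero_or_pos k with rfl | hk0
      · -- the column disappears, which leaves a split circle
        rw [twistFactor_zero_re]
        have e0 := h.labels.mate d 1 false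
        have e1 : m d - 1 = 1 := by omega
        have hcurl := hsm.curl (by rw [dropLen_self]; exact e1)
        rw [dropPt_self, zero_add] at hcurl
        refine (h.bigon hdu hm).poly_zero hC (.inr (by rwa [e0])) fun hP' => hone hP' hsm
          (by rw [dropLen_self]; exact e1) (by omega) fun z => ?_
        rw [e0, dropPt_self, zero_add]
        simp
      · have hent2 := h.enter_erase hdu (by omega)
        have hsum2 := sum_range_dropLen (t := 2) m hm
        have i1 := ih _ (by omega) k1 (hde.isChain h hdu (by omega) two_pos (fun s => (hent2 s).1) fun i hi s => by
          obtain rfl | rfl : i = 0 ∨ i = 1 := by omega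
          · exact ⟨s, (hent2 s).1⟩
          · exact ⟨_, (hent2 s).2⟩) rfl
        rwa [prod_range_dropLen, hk] at i1
    · have hm1 : m d = 1 := by omega
      have hx := h.labels.mate d 0 true
      obtain ⟨k1, k2⟩ := hC.reidI (h.labels.mate_ne true) (by rw [hx]; exact h.curl hm1)
      rw [prod_range_succ, hm1, twistFactor_one_re]
      refine k2 _ (hone k1 h hm1 hN.le fun z => ?_)
      rw [hx]
      simp [or_comm]

end IsChain

namespace IsParallel

theorem rotate (h : C.IsParallel (2 * n + 2) m ε φ pt) : C.IsParallel (2 * n + 2) (fun c => m (cyc (2 * n + 2) c))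
    (fun c => ε (cyc (2 * n + 2) c)) (!φ) (fun c => pt (cyc (2 * n + 2) c)) where
  labels := by
    refine h.labels.reindex (cyc (2 * n + 2)) (fun _ i => i) (fun _ _ _ => rfl) (fun _ _ hc hi => ⟨cyc_lt hc, hi⟩)
      (fun _ _ _ _ _ _ _ _ e1 e2 => ⟨cyc_inj e1, e2⟩) (fun c i hc _ => ?_) (fun _ _ => rfl) (fun _ _ _ _ _ => rfl) rfl rfl
    have : decide (cyc (2 * n + 2) c % 2 = 0) = !decide (c % 2 = 0) := by
      rw [← decide_not, decide_eq_decide]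
      unfold cyc
      split_ifs <;> omega
    rw [this]
    cases decide (c % 2 = 0) <;> cases φ <;> rfl
  pos c hc := h.pos _ (cyc_lt hc)
  step c i s hc hi := h.step _ i s (cyc_lt hc)
  right c hc := h.right _ (cyc_lt hc)
  left c hc := h.left _ (cyc_lt hc)
  covers := by
    have := labelSet_cyc (u := 2 * n + 2) (m := m) (pt := pt)
    exact this.symm ▸ h.covers

/-- The single crossings of the last two columns are erased. -/
theorem cancel (h : C.IsParallel (d + 3) m ε φ pt) (hd : m (d + 1) = 1) (hd' : m (d + 2) = 1)
    (hS : ∀ z, z ∈ S ↔ ∃ c, (c = d + 1 ∨ c = d + 2) ∧ ∃ s, z = pt c 0 s) : (C.erase S).IsParallel (d + 1) m ε φ pt := by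
  have ho : ∀ c s, (c = d + 1 ∨ c = d + 2) → (C.erase S).mate (pt c 0 s) = pt c 0 s := fun c s hc =>
    C.erase_mate_of_mem ((hS _).2 ⟨c, hc, s, rfl⟩)
  have c1 : cyc (d + 3) (d + 2) = 0 := cyc_last _
  have c2 : cyc (d + 3) (d + 1) = d + 2 := cyc_of_lt (by omega)
  have c3 : cyc (d + 3) d = d + 1 := cyc_of_lt (by omega)
  have c4 : ∀ {c}, c < d → cyc (d + 3) c = cyc (d + 1) c := fun hc => by
    rw [cyc_of_lt (by omega), cyc_of_lt (by omega)]
  have r1 := (h.right (d + 1)).erase S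
  have r2 := (h.right (d + 2)).erase S
  have l0 := (h.left d).erase S
  have l1 := (h.left (d + 1)).erase S
  rw [c2, hd] at r1
  rw [c1, hd'] at r2
  rw [c3, hd] at l0
  rw [c2, hd'] at l1
  have r3 : (C.erase S).Thru (pt (d + 1) 0 true) (pt 0 0 true) := r1.trans (ho _ _ (.inr rfl)) r2
  have l2 : (C.erase S).Thru (pt (d + 2) 0 false) (pt d 0 false) := l1.trans (ho _ _ (.inl rfl)) l0
  have hR : pt 0 0 true ∈ labelSet (d + 1) m pt := ⟨0, by omega, 0, h.pos 0, true, rfl⟩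
  have hL : pt d 0 false ∈ labelSet (d + 1) m pt := ⟨d, by omega, 0, h.pos d, false, rfl⟩
  refine ⟨⟨h.labels.init (S := S) (by omega) ?_ rfl rfl rfl, fun c hc => h.pos c,
    fun c i s hc hi => (h.step c i s).erase S⟩,
    fun c hc => ?_, fun c hc => ?_, h.covers.mono (fun y hy => ⟨C.erase_mate_of_eq hy, fun z hz => hz.erase S⟩) ?_⟩
  · intro z hz
    obtain ⟨c, hc, s, rfl⟩ := (hS z).1 hz
    exact ⟨c, by omega, by omega, 0, h.pos c, s, rfl⟩
  · have ht := (h.right c).erase S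
    rcases Nat.lt_succ_iff_lt_or_eq.1 hc with hc' | rfl
    · rwa [c4 hc'] at ht
    · rw [c3] at ht
      rw [cyc_last]
      exact ht.trans (ho _ _ (.inl rfl)) r3
  · rcases Nat.lt_succ_iff_lt_or_eq.1 hc with hc' | rfl
    · have ht := (h.left c).erase S
      rwa [c4 hc'] at ht
    · have ht := (h.left (c + 2)).erase S
      rw [c1] at ht
      rw [cyc_last]
      exact ht.trans (ho _ _ (.inr rfl)) l2
  · rintro _ ⟨c, hc, i, hi, s, rfl⟩
    rcases Nat.lt_or_ge c (d + 1) with e | e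
    · exact .inl ⟨c, e, i, hi, s, rfl⟩
    · right
      obtain rfl | rfl : c = d + 1 ∨ c = d + 2 := by omega
      · obtain rfl : i = 0 := by omega
        refine ⟨ho _ _ (.inl rfl), ?_⟩
        cases s
        · exact ⟨_, hL, l0⟩
        · exact ⟨_, hR, r3⟩
      · obtain rfl : i = 0 := by omega
        refine ⟨ho _ _ (.inr rfl), ?_⟩
        cases s
        · exact ⟨_, hL, l2⟩
        · exact ⟨_, hR, r2⟩

theorem poly_zero (hC : C.Planar) (h : C.IsParallel 2 m ε φ pt) (h0 : m 0 = 1) (h1 : m 1 = 1) :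
    (C.eraseTwo (pt 0 0 true) (pt 1 0 true)).Poly 0 := by
  have mx : C.mate (pt 0 0 true) = pt 0 0 false := h.labels.mate _ _ _
  have my : C.mate (pt 1 0 true) = pt 1 0 false := h.labels.mate _ _ _
  have r0 := h.right 0
  have r1 := h.right 1
  have l0 := h.left 0
  have l1 := h.left 1
  rw [show cyc 2 0 = 1 from rfl] at r0 l0
  rw [show cyc 2 1 = 0 from rfl] at r1 l1
  simp only [h0, h1, Nat.sub_self] at r0 r1 l0 l1
  have hb : C.Bigon (pt 0 0 true) (pt 1 0 true) true := h.labels.bigon (by omega) r0 l1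
  refine hb.poly_two_circles hC r1 (by rwa [mx, my]) (h.covers.mono (fun y hy => ⟨hy, fun _ => id⟩) ?_)
  rintro _ ⟨c, hc, i, hi, s, rfl⟩
  rw [mx, my]
  obtain rfl | rfl : c = 0 ∨ c = 1 := by omega
  all_goals
    obtain rfl : i = 0 := by omega
    cases s <;> simp

theorem bigon_row (h : C.IsParallel (d + 2) m ε φ pt) (hd : m d = 1) (hd' : m (d + 1) = 1) :
    C.Bigon (pt d 0 true) (pt (d + 1) 0 true) false := by
  have h1 := h.right d
  have h2 := h.left d
  rw [cyc_of_lt (by omega)] at h1 h2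
  rw [hd] at h1
  rw [hd'] at h2
  exact h.labels.bigon (by omega) h1 h2

/-- If the last column has two crossings, erasing them leaves a chain. -/
theorem chain_of_erase (h : C.IsParallel (d + 2) m ε φ pt) (hd : m (d + 1) = 2) :
    (C.eraseTwo (pt (d + 1) 0 true) (pt (d + 1) 1 false)).IsChain
      (d + 1) m (fun c => ε c == (decide (c % 2 = 0) ^^ φ)) ε pt (pt (d + 1) 0 false) := by
  have hdu : d + 1 < d + 2 := by omega
  have hde := h.drops_erase hdu (by omega)
  have hR := h.right (d + 1)
  have hL := h.left d
  rw [cyc_last, hd] at hR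
  rw [cyc_of_lt hdu, hd] at hL
  have l1 : ∀ T, (C.erase T).Thru (pt (d + 1) 1 false) (pt d 0 false) := fun T => hL.erase T
  have r1 : ∀ T, (C.erase T).Thru (pt (d + 1) 1 true) (pt 0 0 true) := fun T => hR.erase T
  have l0 := ((h.step (d + 1) 0 true).erase _).trans (hde.mate_pt (by omega) _) (l1 _)
  have r0 := ((h.step (d + 1) 0 false).erase _).trans (hde.mate_pt (by omega) _) (r1 _)
  refine Drops.isChain_of_isParallel (hd ▸ hde) h l0 r0 fun i hi s => ?_
  obtain rfl | rfl : i = 0 ∨ i = 1 := by omega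
  · cases s
    · exact ⟨0, by omega, _, r0⟩
    · exact ⟨d, by omega, _, l0⟩
  · cases s
    · exact ⟨d, by omega, _, l1 _⟩
    · exact ⟨0, by omega, _, r1 _⟩

/-- If the last column has a single crossing, smoothing it leaves a chain. -/
theorem chain_of_smooth (hV : C.Valid) (h : C.IsParallel (d + 2) m ε φ pt) (hd : m (d + 1) = 1) :
    (C.smooth (pt (d + 1) 0 true)).IsChain
      (d + 1) m (fun c => ε c == (decide (c % 2 = 0) ^^ φ)) ε pt (pt (d + 1) 0 false) := by
  have hdu : d + 1 < d + 2 := by omega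
  have hR := h.right (d + 1)
  have hL := h.left d
  have hds : ∀ k, k = 1 → Drops C (C.smooth (pt (d + 1) 0 true)) (d + 1) k pt
      {pt (d + 1) 0 true, C.mate (pt (d + 1) 0 true)} := by
    rintro _ rfl
    exact h.drops_smooth hV hdu
  rw [cyc_last, hd] at hR
  rw [cyc_of_lt hdu, hd] at hL
  have l0 := h.thru_smooth hV hdu (s := true) hL
  have r0 := h.thru_smooth hV hdu (s := false) hR
  refine Drops.isChain_of_isParallel (hds _ hd) h l0 r0 fun i hi s => ?_
  obtain rfl : i = 0 := by omega
  cases s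
  · exact ⟨0, by omega, _, r0⟩
  · exact ⟨d, by omega, _, l0⟩

theorem poly (hC : C.Planar) (h : C.IsParallel (2 * n + 2) m ε φ pt) :
    C.Poly (parallelValue (n + 1) (∏ c ∈ range (2 * n + 2), twistFactor (ε c) (m c))) := by
  induction hN : ∑ c ∈ range (2 * n + 2), m c using Nat.strong_induction_on generalizing C n m ε φ pt with
  | _ N ih =>
  have hcol : ∀ (m : ℕ → ℕ) (ε : ℕ → Bool) (φ : Bool) (pt : ℕ → ℕ → Bool → P), C.IsParallel (2 * n + 2) m ε φ pt →
      ∑ c ∈ range (2 * n + 2), m c = N → 1 < m (2 * n + 1) →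
      C.Poly (parallelValue (n + 1) (∏ c ∈ range (2 * n + 2), twistFactor (ε c) (m c))) := by
    intro m ε φ pt h hN hm
    have hdu : 2 * n + 1 < 2 * n + 2 := by omega
    have hpos := h.pos _
    obtain ⟨k1, k2⟩ := h.toIsColumns.skein hC hdu hm
    have hds := h.drops_smooth hC.valid hdu
    have hde := h.drops_erase hdu hm
    have hent := h.enter_smooth hC.valid hdu hm
    have hsm := hds.isParallel h hdu hm one_pos hent (fun i hi s => ⟨s, by
      obtain rfl : i = 0 := by omega
      exact hent s⟩)
    have hsum : ∑ c ∈ range (2 * n + 2), dropLen (2 * n + 1) 1 m c + 1 = N :=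
      (sum_range_dropLen m hpos).trans hN
    have i2 := ih _ (by omega) (hC.smooth (h.labels.mate_ne true)) hsm rfl
    obtain ⟨k, hk⟩ : ∃ k, m (2 * n + 1) = k + 2 := ⟨m (2 * n + 1) - 2, by omega⟩
    rw [prod_range_dropLen (d := 2 * n + 1), hk] at i2
    rw [prod_range_succ, hk, parallelValue_add_two]
    refine k2 _ _ ?_ i2
    rcases Nat.eq_zero_or_pos k with rfl | hk0
    · rw [parallelValue_zero]
      exact (h.chain_of_erase hk).poly k1
    · have hent2 := h.enter_erase hdu (by omega)
      have hsum2 : ∑ c ∈ range (2 * n + 2), dropLen (2 * n + 1) 2 m c + 2 = N :=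
        (sum_range_dropLen m hm).trans hN
      have i1 := ih _ (by omega) k1 (hde.isParallel h hdu (by omega) two_pos (fun s => (hent2 s).1) fun i hi s => by
        obtain rfl | rfl : i = 0 ∨ i = 1 := by omega
        · exact ⟨s, (hent2 s).1⟩
        · exact ⟨_, (hent2 s).2⟩) rfl
      rwa [prod_range_dropLen (d := 2 * n + 1), hk] at i1
  by_cases hbig : ∃ c < 2 * n + 2, 1 < m c
  · -- rotate until the long column is the last one
    obtain ⟨c, hc, hbig⟩ := hbig
    clear ih
    induction c generalizing m ε φ pt with
    | zero =>
      rw [← prod_range_cyc]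
      exact hcol _ _ _ _ h.rotate ((sum_range_cyc _ _).trans hN) (by rwa [cyc_last])
    | succ c ihc =>
      rw [← prod_range_cyc]
      exact ihc h.rotate ((sum_range_cyc _ _).trans hN) (by omega) (by rwa [cyc_of_lt (by omega)])
  · have hone : ∀ c < 2 * n + 2, m c = 1 := fun c hc => by
      have := h.pos c
      have : ¬ 1 < m c := fun h => hbig ⟨c, hc, h⟩
      omega
    have m1 := hone (2 * n) (by omega)
    have m2 := hone (2 * n + 1) (by omega)
    have hb := h.bigon_row m1 m2
    have o1 := h.labels.isOver (2 * n) 0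
    have o2 := h.labels.isOver (2 * n + 1) 0
    have p1 := h.labels.isPos (2 * n) 0 true
    have p2 := h.labels.isPos (2 * n + 1) 0 true
    have q1 : decide (2 * n % 2 = 0) = true := by simp
    have q2 : decide ((2 * n + 1) % 2 = 0) = false := by simp
    rw [q1] at o1
    rw [q2] at o2
    set C' := C.eraseTwo (pt (2 * n) 0 true) (pt (2 * n + 1) 0 true)
    have hE : C'.Planar → C'.Poly (parallelValue n (∏ c ∈ range (2 * n), twistFactor (ε c) (m c))) := by
      intro hP
      cases n with
      | zero =>
        have e : parallelValue 0 (∏ c ∈ range (2 * 0), twistFactor (ε c) (m c)) = 0 := by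
          change ((0 : ℕ) : ℤ[X]) * X * 1 + 0 = 0
          simp
        rw [e]
        exact h.poly_zero hC m1 m2
      | succ n =>
        refine ih (∑ c ∈ range (2 * n + 2), m c) (by
          rw [← hN, show 2 * (n + 1) + 2 = 2 * n + 2 + 1 + 1 by ring, sum_range_succ _ (2 * n + 2 + 1),
            sum_range_succ _ (2 * n + 2)]
          have := hone (2 * n + 2) (by omega)
          omega) hP (IsParallel.cancel (d := 2 * n + 1) h m1 m2 fun z =>
            h.labels.mem_eraseTwo.trans (by
              rw [show 2 * (n + 1) = 2 * n + 1 + 1 by ring]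
              simp [or_and_right, exists_or])) rfl
    rw [prod_range_succ, prod_range_succ, m1, m2]
    by_cases hε : ε (2 * n) = ε (2 * n + 1)
    · obtain ⟨k1, k2⟩ := hb.skein hC (by rw [o1, o2, hε]; cases ε (2 * n + 1) <;> cases φ <;> decide) (by rw [p1, p2, hε])
        (.inr rfl)
      have i2 := (h.chain_of_smooth hC.valid m2).poly (hC.smooth (h.labels.mate_ne true))
      have := k2 _ _ (hE k1) i2
      rw [hε, parallelValue_one_mul]
      rwa [sign, p2, prod_range_succ, m1, hε] at this
    · have hε' : ε (2 * n) = !ε (2 * n + 1) := by revert hε; cases ε (2 * n) <;> cases ε (2 * n + 1) <;> simp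
      obtain ⟨k1, k2⟩ := hb.reidII hC (by rw [o1, o2, hε']; cases ε (2 * n + 1) <;> cases φ <;> decide)
        (by rw [p1, p2, hε']; simp)
      rw [hε', parallelValue_one_mul_not]
      exact k2 _ (hE k1)

end IsParallel

end Code

/-! ### Labels of the pretzel diagrams -/

namespace GaussDiagram

/-- The code of a Gauss diagram. -/
def code (D : GaussDiagram) : Code D.Pt := ⟨D.next, D.mate, D.isOver, D.isPos⟩

theorem represents_code (D : GaussDiagram) : D.code.Represents D (Equiv.refl _) :=
  ⟨fun _ => rfl, fun _ => rfl, fun _ _ => rfl, fun _ _ => rfl⟩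

theorem covers_code (D : GaussDiagram) {L : Set D.Pt} (h : ∀ x, x ∈ L) : D.code.Covers L := fun x => .inl (h x)

end GaussDiagram

namespace Pretzel

variable {u : ℕ}

theorem finRotate_eq_cyc (j : Fin u) : (finRotate u j).1 = cyc u j.1 := by
  cases u with
  | zero => exact j.elim0
  | succ d => rw [coe_finRotate]; simp [cyc, Fin.ext_iff]

theorem cross_ext {k : Fin u → ℤ} {x y : Cross k} (h : x.1.1 = y.1.1) (h' : x.2.1 = y.2.1) : x = y := by
  obtain ⟨⟨j, hj⟩, i, hi⟩ := x
  obtain ⟨⟨j', hj'⟩, i', hi'⟩ := y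
  obtain rfl : j = j' := h
  obtain rfl : i = i' := h'
  rfl

theorem join_symm {k : Fin u → ℤ} {hk : ∀ j, k j ≠ 0} {x y : Cross k × Corner} (h : join k hk x = y) : join k hk y = x := by
  rw [← h, join_join]

/-- A strand that leaves a crossing at a corner enters the next one at the other end of the arc. -/
theorem Orientation.next_eq {k : Fin u → ℤ} {hk : ∀ j, k j ≠ 0} (o : Orientation k hk) {x y : Cross k} {a b : Corner} (h : join k hk (x, a) = (y, b))
    (ha : o.inward (x, a) = false) : o.diagram.next (x, a.rising) = (y, b.rising) :=
  (congrArg (fun d => strand (join k hk d)) (o.exit_strand (x, a) ha)).trans (congrArg strand h)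

variable [NeZero u]

/-- The length of the column `c`. -/
def len (k : Fin u → ℤ) (c : ℕ) : ℕ := (k (Fin.ofNat u c)).natAbs

/-- The `i`-th crossing, from the top, of the column `c`. -/
def cross (k : Fin u → ℤ) (hk : ∀ j, k j ≠ 0) (c i : ℕ) : Cross k :=
  ⟨Fin.ofNat u c, ⟨i % len k c, Nat.mod_lt _ (Int.natAbs_pos.2 (hk _))⟩⟩

variable {k : Fin u → ℤ} (hk : ∀ j, k j ≠ 0) {c i : ℕ}

theorem len_pos (hk : ∀ j, k j ≠ 0) (c : ℕ) : 0 < len k c := Int.natAbs_pos.2 (hk _)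

theorem cross_fst (hc : c < u) : (cross k hk c i).1.1 = c := Nat.mod_eq_of_lt hc

theorem cross_snd (hi : i < len k c) : (cross k hk c i).2.1 = i := Nat.mod_eq_of_lt hi

theorem len_val (j : Fin u) : len k j.1 = (k j).natAbs := by
  unfold len; congr; exact Fin.ext (Nat.mod_eq_of_lt j.2)

theorem exists_eq_cross (x : Cross k) : ∃ c < u, ∃ i < len k c, x = cross k hk c i := by
  have hi : x.2.1 < len k x.1.1 := by rw [len_val]; exact x.2.2
  exact ⟨x.1.1, x.1.2, x.2.1, hi, cross_ext (cross_fst hk x.1.2).symm (cross_snd hk hi).symm⟩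

theorem cross_inj {c' i' : ℕ} (hc : c < u) (hi : i < len k c) (hc' : c' < u) (hi' : i' < len k c')
    (h : cross k hk c i = cross k hk c' i') : c = c' ∧ i = i' := by
  have h1 := congrArg (fun x => x.1.1) h
  have h2 := congrArg (fun x => x.2.1) h
  simp only [cross_fst hk hc, cross_fst hk hc', cross_snd hk hi, cross_snd hk hi'] at h1 h2
  exact ⟨h1, h2⟩

theorem top_eq (hc : c < u) {j : Fin u} (hj : j.1 = c) : top k hk j = cross k hk c 0 :=
  cross_ext (hj.trans (cross_fst hk hc).symm) (cross_snd hk (len_pos hk c)).symm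

theorem bot_eq (hc : c < u) {j : Fin u} (hj : j.1 = c) : bot k hk j = cross k hk c (len k c - 1) := by
  subst hj
  refine cross_ext (cross_fst hk hc).symm ?_
  rw [cross_snd hk (by have := len_pos hk j.1; omega), len_val]
  rfl

theorem join_sw (hi : i + 1 < len k c) : join k hk (cross k hk c i, .sw) = (cross k hk c (i + 1), .nw) := by
  have e : (cross k hk c i).2.1 = i := cross_snd hk (by omega)
  refine (dif_pos (show (cross k hk c i).2.1 + 1 < len k c by rw [e]; exact hi)).trans (Prod.ext (cross_ext rfl ?_) rfl)
  rw [cross_snd hk hi]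
  exact congrArg (· + 1) e

theorem join_se (hi : i + 1 < len k c) : join k hk (cross k hk c i, .se) = (cross k hk c (i + 1), .ne) := by
  have e : (cross k hk c i).2.1 = i := cross_snd hk (by omega)
  refine (dif_pos (show (cross k hk c i).2.1 + 1 < len k c by rw [e]; exact hi)).trans (Prod.ext (cross_ext rfl ?_) rfl)
  rw [cross_snd hk hi]
  exact congrArg (· + 1) e

theorem join_top (hc : c < u) : join k hk (cross k hk c 0, .ne) = (cross k hk (cyc u c) 0, .nw) := by
  have e : join k hk (cross k hk c 0, .ne) = (top k hk (finRotate u (Fin.ofNat u c)), .nw) :=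
    if_pos (e := (⟨_, (cross k hk c 0).2.1 - 1, (Nat.sub_le _ _).trans_lt (cross k hk c 0).2.2⟩, .se)) (cross_snd hk (len_pos hk c))
  refine e.trans (congrArg (·, Corner.nw) (top_eq hk (cyc_lt hc) ?_))
  rw [finRotate_eq_cyc]
  exact congrArg (cyc u) (Nat.mod_eq_of_lt hc)

theorem join_bot (hc : c < u) : join k hk (cross k hk c (len k c - 1), .se) =
    (cross k hk (cyc u c) (len k (cyc u c) - 1), .sw) := by
  have hp := len_pos hk c
  have e : (cross k hk c (len k c - 1)).2.1 = len k c - 1 := cross_snd hk (by omega)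
  refine (dif_neg (show ¬ (cross k hk c (len k c - 1)).2.1 + 1 < len k c by rw [e]; omega)).trans (congrArg (·, Corner.sw) (bot_eq hk (cyc_lt hc) ?_))
  rw [finRotate_eq_cyc]
  exact congrArg (cyc u) (Nat.mod_eq_of_lt hc)

variable {hk}

/-- The labels of the passages, `pt c i s` being the passage through the crossing `pos c i` of the column `c`, on the
rising strand if `s = b c i`. -/
theorem Orientation.labels (o : Orientation k hk) {pos : ℕ → ℕ → ℕ} {b : ℕ → ℕ → Bool} {ps : ℕ → Bool}
    (hpos : ∀ c i, i < len k c → pos c i < len k c)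
    (hinj : ∀ c i i', i < len k c → i' < len k c → pos c i = pos c i' → i = i')
    (hps : ∀ c i, c < u → i < len k c → o.diagram.isPos (cross k hk c i, true) = ps c) :
    o.diagram.code.Labels u (len k) (fun c i => b c i == decide (0 < k (Fin.ofNat u c))) ps
      fun c i s => (cross k hk c (pos c i), s == b c i) where
  mate c i s _ _ := by
    refine Prod.ext rfl ?_
    change (!(s == b c i)) = ((!s) == b c i)
    cases s <;> cases b c i <;> rfl
  inj := @fun c i s c' i' s' e hc hi hc' hi' => by
    obtain ⟨e1, e2⟩ := Prod.ext_iff.1 e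
    obtain ⟨rfl, e4⟩ := cross_inj hk hc (hpos _ _ hi) hc' (hpos _ _ hi') e1
    obtain rfl := hinj _ _ _ hi hi' e4
    refine ⟨rfl, rfl, ?_⟩
    revert e2
    cases s <;> cases s' <;> cases b c i <;> simp
  isOver c i _ _ := by
    change ((true == b c i) == _) = _
    rw [Bool.true_beq]
    rfl
  isPos c i s hc hi := hps c _ hc (hpos _ _ hi)

theorem Orientation.covers (o : Orientation k hk) {pos : ℕ → ℕ → ℕ} {b : ℕ → ℕ → Bool}
    (hpos : ∀ c i, i < len k c → pos c i < len k c ∧ pos c (pos c i) = i) (x : o.diagram.Pt) :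
    x ∈ Code.labelSet u (len k) (fun c i s => ((cross k hk c (pos c i), s == b c i) : o.diagram.Pt)) := by
  obtain ⟨c, hc, i, hi, e⟩ := exists_eq_cross hk x.1
  refine ⟨c, hc, pos c i, (hpos c i hi).1, x.2 == b c (pos c i), Prod.ext (e.trans ?_) ?_⟩
  · change _ = cross k hk c (pos c (pos c i))
    rw [(hpos c i hi).2]
  · change x.2 = ((x.2 == b c (pos c i)) == b c (pos c i))
    cases x.2 <;> cases b c (pos c i) <;> rfl

end Pretzel

/-! ### The antiparallel pretzel diagrams -/

namespace Pretzel

variable {u : ℕ} [NeZero u] (p : Fin u → ℤ)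

/-- The `i`-th crossing, from the top, of the column `c`, passed downwards if `s` is true and upwards otherwise. -/
def antiparallelPt (c i : ℕ) (s : Bool) : (antiparallel p).diagram.Pt :=
  (cross (oddParam p) (oddParam_ne_zero p) c i, s == decide (i % 2 = 1))

variable {p} {c i : ℕ}

local notation "𝓐" => Orientation.diagram (antiparallel p)

local notation "ℓ" => len (oddParam p)

local notation "h₀" => oddParam_ne_zero p

local notation "τ" => antiparallelPt p

theorem len_odd (c : ℕ) : ℓ c % 2 = 1 := natAbs_oddParam p _

theorem antiparallel_inward (a : Corner) (hi : i < ℓ c) :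
    (antiparallel p).inward (cross _ h₀ c i, a) = (a.west == decide (i % 2 = 0)) := by
  change (a.west == decide ((cross _ h₀ c i).2.1 % 2 = 0)) = _
  rw [cross_snd _ hi]

theorem antiparallel_down (hi : i + 1 < ℓ c) :
    (𝓐).next (τ c i true) = τ c (i + 1) true := by
  unfold antiparallelPt
  rcases Nat.mod_two_eq_zero_or_one i with e | e
  · have e' : (i + 1) % 2 = 1 := by omega
    rw [e, e']
    exact (antiparallel p).next_eq (join_se _ hi) (by rw [antiparallel_inward _ (by omega), e]; rfl)
  · have e' : (i + 1) % 2 = 0 := by omega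
    rw [e, e']
    exact (antiparallel p).next_eq (join_sw _ hi) (by rw [antiparallel_inward _ (by omega), e]; rfl)

theorem antiparallel_up (hi : i + 1 < ℓ c) :
    (𝓐).next (τ c (i + 1) false) = τ c i false := by
  unfold antiparallelPt
  rcases Nat.mod_two_eq_zero_or_one i with e | e
  · have e' : (i + 1) % 2 = 1 := by omega
    rw [e, e']
    exact (antiparallel p).next_eq (join_symm (join_sw _ hi)) (by rw [antiparallel_inward _ hi, e']; rfl)
  · have e' : (i + 1) % 2 = 0 := by omega
    rw [e, e']
    exact (antiparallel p).next_eq (join_symm (join_se _ hi)) (by rw [antiparallel_inward _ hi, e']; rfl)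

theorem antiparallel_top (hc : c < u) : (𝓐).next (τ c 0 false) = τ (cyc u c) 0 true :=
  (antiparallel p).next_eq (join_top _ hc) (antiparallel_inward _ (len_pos h₀ _))

theorem antiparallel_bot (hc : c < u) : (𝓐).next (τ c (ℓ c - 1) true) =
    τ (cyc u c) (ℓ (cyc u c) - 1) false := by
  have h1 := len_odd (p := p) c
  have h2 := len_odd (p := p) (cyc u c)
  have e1 : (ℓ c - 1) % 2 = 0 := by omega
  have e2 : (ℓ (cyc u c) - 1) % 2 = 0 := by omega
  unfold antiparallelPt
  rw [e1, e2]
  exact (antiparallel p).next_eq (join_bot _ hc) (by rw [antiparallel_inward _ (by omega), e1]; rfl)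

variable (p) in
theorem antiparallel_mem (x : (𝓐).Pt) : x ∈ Code.labelSet u ℓ τ :=
  (antiparallel p).covers (pos := fun _ i => i) (b := fun _ i => decide (i % 2 = 1)) (fun _ _ h => ⟨h, rfl⟩) x

variable (p) in
theorem isAntiparallel : (𝓐).code.IsAntiparallel u ℓ (fun c => decide (0 < oddParam p (Fin.ofNat u c)))
    τ where
  labels := (antiparallel p).labels (pos := fun _ i => i) (b := fun _ i => decide (i % 2 = 1)) (fun _ _ h => h)
    (fun _ _ _ _ _ h => h) fun c i _ hi => by
      refine (congrArg₂ (fun a b => (a == b) == decide (0 < oddParam p (Fin.ofNat u c)))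
        (antiparallel_inward .sw hi) (antiparallel_inward .se hi)).trans ?_
      cases decide (i % 2 = 0) <;> cases decide (0 < oddParam p (Fin.ofNat u c)) <;> rfl
  pos c _ := len_pos h₀ c
  down c i _ hi := .of_eq (antiparallel_down hi)
  up c i _ hi := .of_eq (antiparallel_up hi)
  top c hc := .of_eq (antiparallel_top hc)
  bot c hc := .of_eq (antiparallel_bot hc)
  covers := (𝓐).covers_code (antiparallel_mem p)

theorem antiparallel_mate (s : Bool) : (𝓐).mate (τ c i s) = τ c i !s := by
  refine Prod.ext rfl ?_
  change (!(s == decide (i % 2 = 1))) = ((!s) == decide (i % 2 = 1))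
  cases s <;> cases decide (i % 2 = 1) <;> rfl

/-- The flow of a cycle down a column is constant. -/
theorem antiparallel_flow {f : (𝓐).Pt → ℤ} (hf : (𝓐).IsCycle f) (hc : c < u) (hi : i + 1 < ℓ c) :
    f (τ c (i + 1) true) - f (τ c i false) =
      f (τ c 0 true) - f (τ (cyc u c) 0 true) := by
  have h := hf (τ c i true)
  rw [antiparallel_mate, antiparallel_down hi, Bool.not_true] at h
  induction i with
  | zero =>
    rw [antiparallel_top hc] at h
    linarith
  | succ i ih =>
    rw [antiparallel_up (by omega)] at h
    have := ih (by omega) (by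
      have := hf (τ c i true)
      rwa [antiparallel_mate, antiparallel_down (by omega), Bool.not_true] at this)
    linarith

variable (p) in
theorem antiparallel_isPlanar : (𝓐).IsPlanar := by
  rw [GaussDiagram.isPlanar_iff]
  intro f hf
  let t : ℕ → ℤ := fun c => f (τ c 0 true)
  let w : ℕ → ℕ → ℤ := fun c i => if i % 2 = 0 then t c else t (cyc u c)
  let G : (𝓐).Pt → ℤ := fun x => (if x.2 then 0 else f x) - w x.1.1.1 x.1.2.1
  have hG : ∀ {c i} s, c < u → i < ℓ c → G (τ c i s) =
      (if s == decide (i % 2 = 1) then 0 else f (τ c i s)) - if i % 2 = 0 then t c else t (cyc u c) := by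
    intro c i s hc hi
    change _ - w (cross _ h₀ c i).1.1 (cross _ h₀ c i).2.1 = _
    rw [cross_fst _ hc, cross_snd _ hi]
    rfl
  refine ⟨G, fun x hx => absurd hx ?_, fun x _ hl => ?_⟩
  · obtain ⟨c, hc, i, hi, s, rfl⟩ := antiparallel_mem p x
    exact (isAntiparallel p).labels.mate_ne s hc hi
  · obtain ⟨c, hc, i, hi, s, rfl⟩ := antiparallel_mem p x
    have hf' := fun i => antiparallel_flow (i := i) hf hc
    have hm := len_odd (p := p) c
    have hc' := cyc_lt hc
    have hb : (s == decide (i % 2 = 1)) = false := by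
      have hp : (𝓐).isPos (τ c i s) = _ := (isAntiparallel p).labels.isPos c i s hc hi
      have hl' : ((s == decide (i % 2 = 1)) == decide (0 < oddParam p (Fin.ofNat u c))) =
        (𝓐).isPos (τ c i s) := eq_of_beq hl
      rw [hp] at hl'
      revert hl'
      generalize decide (0 < oddParam p (Fin.ofNat u c)) = b
      cases (s == decide (i % 2 = 1)) <;> cases b <;> simp
    rcases Nat.mod_two_eq_zero_or_one i with e | e
    · obtain rfl : s = true := by simpa [e] using hb
      have hup : f ((𝓐).next (τ c i false)) =
            f (τ c i true) - t c + t (cyc u c) ∧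
          G ((𝓐).next (τ c i false)) = f (τ c i true) - t c := by
        cases i with
        | zero =>
          rw [antiparallel_top hc, hG _ hc' (len_pos h₀ _)]
          simp [t]
        | succ i =>
          have := hf' _ hi
          have e' : i % 2 = 1 := by omega
          rw [antiparallel_up hi, hG _ hc (by omega)]
          simp [t, e']
          constructor <;> linarith
      have hdown : G ((𝓐).next (τ c i true)) = -t (cyc u c) := by
        by_cases hi' : i + 1 < ℓ c
        · rw [antiparallel_down hi', hG _ hc hi']
          simp [show (i + 1) % 2 = 1 by omega]
        · have := len_odd (p := p) (cyc u c)
          obtain rfl : i = ℓ c - 1 := by omega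
          rw [antiparallel_bot hc, hG _ hc' (by omega)]
          simp [show (ℓ (cyc u c) - 1) % 2 = 0 by omega]
      rw [antiparallel_mate, Bool.not_true, hup.1, hup.2, hdown, hG _ hc hi, hG _ hc hi]
      simp [e]
    · obtain rfl : s = false := by simpa [e] using hb
      obtain ⟨i, rfl⟩ : ∃ j, i = j + 1 := ⟨i - 1, by omega⟩
      have e' : i % 2 = 0 := by omega
      have e2 : (i + 1 + 1) % 2 = 0 := by omega
      have hi' : i + 1 + 1 < ℓ c := by omega
      have := hf' _ hi'
      rw [antiparallel_mate, Bool.not_false, antiparallel_down hi', antiparallel_up hi, hG _ hc hi, hG _ hc hi,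
        hG _ hc hi', hG _ hc (show i < _ by omega)]
      simp [t, e, e', e2]
      refine ⟨?_, ?_⟩ <;> linarith

end Pretzel

/-! ### The parallel pretzel diagrams -/

namespace Pretzel

theorem cyc_mod_two {n c : ℕ} : cyc (2 * n) c % 2 = 1 - c % 2 := by
  unfold cyc; split_ifs <;> omega

variable {n : ℕ} [NeZero (2 * n)] (p : Fin (2 * n) → ℤ)

/-- The position, counted from the top, of the `i`-th crossing in the direction of travel of a column of length `m`. -/
def travelPos (m c i : ℕ) : ℕ := if c % 2 = 0 then m - 1 - i else i

/-- The `i`-th crossing in the direction of travel of the column `c`, entered from the left side of the column if `s`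
is true and from the right side otherwise. -/
def parallelPt (c i : ℕ) (s : Bool) : (parallel p).diagram.Pt :=
  (cross (oddParam p) (oddParam_ne_zero p) c (travelPos (len (oddParam p) c) c i), s == decide (c % 2 = 0))

variable {p} {c i : ℕ}

local notation "𝓑" => Orientation.diagram (parallel p)

local notation "ℓ" => len (oddParam p)

local notation "h₀" => oddParam_ne_zero p

local notation "τ" => parallelPt p

theorem parallel_inward (a : Corner) (hc : c < 2 * n) :
    (parallel p).inward (cross _ h₀ c i, a) = (a.south == decide (c % 2 = 0)) := by
  change (a.south == decide ((cross _ h₀ c i).1.1 % 2 = 0)) = _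
  rw [cross_fst _ hc]

theorem parallel_step (hc : c < 2 * n) (hi : i + 1 < ℓ c) (s : Bool) :
    (𝓑).next (τ c i s) = τ c (i + 1) !s := by
  unfold parallelPt travelPos
  rcases Nat.mod_two_eq_zero_or_one c with e | e
  · have h : ℓ c - 1 - i = ℓ c - 1 - (i + 1) + 1 := by omega
    simp only [e, if_true, decide_true]
    rw [h]
    cases s
    · exact (parallel p).next_eq (join_symm (join_sw _ (by omega))) (by rw [parallel_inward _ hc, e]; rfl)
    · exact (parallel p).next_eq (join_symm (join_se _ (by omega))) (by rw [parallel_inward _ hc, e]; rfl)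
  · simp only [e, one_ne_zero, if_false, decide_false]
    cases s
    · exact (parallel p).next_eq (join_sw _ hi) (by rw [parallel_inward _ hc, e]; rfl)
    · exact (parallel p).next_eq (join_se _ hi) (by rw [parallel_inward _ hc, e]; rfl)

theorem parallel_right (hc : c < 2 * n) :
    (𝓑).next (τ c (ℓ c - 1) true) = τ (cyc (2 * n) c) 0 true := by
  have h := cyc_mod_two (n := n) (c := c)
  unfold parallelPt travelPos
  rcases Nat.mod_two_eq_zero_or_one c with e | e <;>
    simp only [h, e, if_true, Nat.sub_self, Nat.sub_zero, one_ne_zero, if_false, decide_true, decide_false]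
  · exact (parallel p).next_eq (join_top _ hc) (by rw [parallel_inward _ hc, e]; rfl)
  · exact (parallel p).next_eq (join_bot _ hc) (by rw [parallel_inward _ hc, e]; rfl)

theorem parallel_left (hc : c < 2 * n) : (𝓑).next
    (τ (cyc (2 * n) c) (ℓ (cyc (2 * n) c) - 1) false) = τ c 0 false := by
  have h := cyc_mod_two (n := n) (c := c)
  unfold parallelPt travelPos
  rcases Nat.mod_two_eq_zero_or_one c with e | e <;>
    simp only [h, e, if_true, Nat.sub_self, Nat.sub_zero, one_ne_zero, if_false, decide_true, decide_false]
  · exact (parallel p).next_eq (join_symm (join_bot _ hc)) (by rw [parallel_inward _ (cyc_lt hc), h, e]; rfl)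
  · exact (parallel p).next_eq (join_symm (join_top _ hc)) (by rw [parallel_inward _ (cyc_lt hc), h, e]; rfl)

theorem travelPos_lt {m : ℕ} (hi : i < m) : travelPos m c i < m := by
  unfold travelPos; split_ifs <;> omega

theorem travelPos_travelPos {m : ℕ} (hi : i < m) : travelPos m c (travelPos m c i) = i := by
  unfold travelPos; split_ifs <;> omega

variable (p) in
theorem parallel_mem (x : (𝓑).Pt) : x ∈ Code.labelSet (2 * n) ℓ τ :=
  (parallel p).covers (pos := fun c => travelPos (ℓ c) c) (b := fun c _ => decide (c % 2 = 0))
    (fun _ _ h => ⟨travelPos_lt h, travelPos_travelPos h⟩) x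

variable (p) in
theorem isParallel : (𝓑).code.IsParallel (2 * n) ℓ
    (fun c => decide (0 < oddParam p (Fin.ofNat (2 * n) c))) false τ where
  labels := by
    have := (parallel p).labels (pos := fun c => travelPos (ℓ c) c) (b := fun c _ => decide (c % 2 = 0))
      (fun _ _ h => travelPos_lt h) (fun c i i' h h' e => by
        rw [← travelPos_travelPos (c := c) h, e, travelPos_travelPos h'])
      (ps := fun c => decide (0 < oddParam p (Fin.ofNat (2 * n) c))) fun c i hc _ => by
        refine (congrArg₂ (fun a b => (a == b) == decide (0 < oddParam p (Fin.ofNat (2 * n) c)))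
          (parallel_inward .sw hc) (parallel_inward .se hc)).trans ?_
        cases decide (c % 2 = 0) <;> cases decide (0 < oddParam p (Fin.ofNat (2 * n) c)) <;> rfl
    have e : ∀ a b : Bool, (a == (b ^^ false)) = (b == a) := by decide
    simp only [e]
    exact this
  pos c _ := len_pos h₀ c
  step c i s hc hi := .of_eq (parallel_step hc hi s)
  right c hc := .of_eq (parallel_right hc)
  left c hc := .of_eq (parallel_left hc)
  covers := (𝓑).covers_code (parallel_mem p)

theorem parallel_mate (s : Bool) : (𝓑).mate (τ c i s) = τ c i !s := by
  refine Prod.ext rfl ?_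
  change (!(s == decide (c % 2 = 0))) = ((!s) == decide (c % 2 = 0))
  cases s <;> cases decide (c % 2 = 0) <;> rfl

/-- The flow of a cycle along a column is constant. -/
theorem parallel_flow {f : (𝓑).Pt → ℤ} (hf : (𝓑).IsCycle f) (hc : c < 2 * n)
    (hi : i < ℓ c) : f (τ c i true) + f (τ c i false) =
      f (τ c 0 true) + f (τ c 0 false) := by
  induction i with
  | zero => rfl
  | succ i ih =>
    have h := hf (τ c i true)
    rw [parallel_mate, parallel_step hc hi, parallel_step hc hi] at h
    have := ih (by omega)
    simp only [Bool.not_true, Bool.not_false] at h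
    linarith

/-- The flow of a cycle out of a column. -/
theorem parallel_flow_cyc {f : (𝓑).Pt → ℤ} (hf : (𝓑).IsCycle f) (hc : c < 2 * n) :
    f (τ (cyc (2 * n) (cyc (2 * n) c)) 0 true) + f (τ c 0 false) =
      f (τ (cyc (2 * n) c) 0 true) + f (τ (cyc (2 * n) c) 0 false) := by
  have hp := len_pos h₀ (cyc (2 * n) c)
  rw [← parallel_flow hf (cyc_lt hc) (i := ℓ (cyc (2 * n) c) - 1) (by omega)]
  have h := hf (τ (cyc (2 * n) c) (ℓ (cyc (2 * n) c) - 1) true)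
  rwa [parallel_mate, parallel_right (cyc_lt hc), Bool.not_true, parallel_left hc] at h

variable (p) in
theorem parallel_isPlanar : (𝓑).IsPlanar := by
  rw [GaussDiagram.isPlanar_iff]
  intro f hf
  let t : ℕ → ℤ := fun c => f (τ c 0 false)
  let A : ℕ → ℤ := fun c => if c % 2 = 0 then t (if c = 0 then 2 * n - 1 else c - 1) else t c
  have hA : ∀ {c}, c < 2 * n → c % 2 = 1 → A (cyc (2 * n) c) = t c := by
    intro c hc h
    have e := cyc_mod_two (n := n) (c := c)
    rw [h] at e
    refine (if_pos e).trans (congrArg t ?_)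
    unfold cyc
    by_cases h : c + 1 = 2 * n
    · rw [if_pos h, if_pos rfl]; omega
    · rw [if_neg h, if_neg (by omega)]; omega
  let G : (𝓑).Pt → ℤ := fun x => A x.1.1.1 - if x.2 then 0 else f ((𝓑).mate x)
  have hG : ∀ {c} i s, c < 2 * n → G (τ c i s) =
      A c - if s == decide (c % 2 = 0) then 0 else f (τ c i !s) := by
    intro c i s hc
    rw [← parallel_mate]
    exact congrArg (A · - _) (cross_fst h₀ hc)
  refine ⟨G, fun x hx => absurd hx ?_, fun x _ hl => ?_⟩
  · obtain ⟨c, hc, i, hi, s, rfl⟩ := parallel_mem p x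
    exact (isParallel p).labels.mate_ne s hc hi
  · obtain ⟨c, hc, i, hi, s, rfl⟩ := parallel_mem p x
    have hb : (s == decide (c % 2 = 0)) = true := by
      have hp : (𝓑).isPos (τ c i s) = _ := (isParallel p).labels.isPos c i s hc hi
      have hl' : ((s == decide (c % 2 = 0)) == decide (0 < oddParam p (Fin.ofNat (2 * n) c))) =
        (𝓑).isPos (τ c i s) := eq_of_beq hl
      rw [hp] at hl'
      revert hl'
      generalize decide (0 < oddParam p (Fin.ofNat (2 * n) c)) = b
      cases (s == decide (c % 2 = 0)) <;> cases b <;> simp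
    obtain ⟨b, hb', rfl⟩ := exists_cyc hc
    have e1 := cyc_mod_two (n := n) (c := b)
    have e2 := cyc_mod_two (n := n) (c := cyc (2 * n) b)
    have hc' := cyc_lt hc
    rw [parallel_mate]
    rcases Nat.mod_two_eq_zero_or_one b with e | e
    · replace e1 : cyc (2 * n) b % 2 = 1 := by omega
      replace e2 : cyc (2 * n) (cyc (2 * n) b) % 2 = 0 := by omega
      obtain rfl : s = false := by simpa [e1] using hb
      by_cases hi' : i + 1 < ℓ (cyc (2 * n) b)
      · rw [Bool.not_false, parallel_step hc hi', parallel_step hc hi', hG _ _ hc, hG _ _ hc, hG _ _ hc, hG _ _ hc]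
        simp [e1]
      · obtain rfl : i = ℓ (cyc (2 * n) b) - 1 := by omega
        rw [Bool.not_false, parallel_right hc, parallel_left hb', hG _ _ hc, hG _ _ hc, hG _ _ hc', hG _ _ hb',
          hA hc e1]
        obtain ⟨a, ha, rfl⟩ := exists_cyc hb'
        have e3 := cyc_mod_two (n := n) (c := a)
        have h1 := parallel_flow_cyc hf ha
        have h2 := parallel_flow_cyc hf hb'
        rw [hA ha (by omega)]
        simp [e, e1, e2, t, A]
        linarith
    · replace e1 : cyc (2 * n) b % 2 = 0 := by omega
      replace e2 : cyc (2 * n) (cyc (2 * n) b) % 2 = 1 := by omega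
      obtain rfl : s = true := by simpa [e1] using hb
      by_cases hi' : i + 1 < ℓ (cyc (2 * n) b)
      · rw [Bool.not_true, parallel_step hc hi', parallel_step hc hi', hG _ _ hc, hG _ _ hc, hG _ _ hc, hG _ _ hc]
        simp [e1]
      · obtain rfl : i = ℓ (cyc (2 * n) b) - 1 := by omega
        rw [Bool.not_true, parallel_right hc, parallel_left hb', hG _ _ hc, hG _ _ hc, hG _ _ hc', hG _ _ hb',
          hA hb' e]
        simp [e, e1, e2, t, A]

end Pretzel

/-! ### Low coefficients of the two products -/

theorem sum_Ioi_eq_sum_range {u : ℕ} (f : ℕ → ℕ → ℚ) :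
    ∑ i : Fin u, ∑ j ∈ Ioi i, f i j = ∑ j ∈ range u, ∑ i ∈ range j, f i j := by
  have h : ∀ j : Fin u, ∑ i ∈ Iio j, f i j = ∑ i ∈ range j, f i j := fun j => by
    rw [← Nat.Iio_eq_range, ← Fin.map_valEmbedding_Iio, sum_map]; rfl
  rw [sum_range, sum_comm' (s' := fun j => Iio j) (t' := univ) (by simp)]
  exact sum_congr rfl fun j _ => h j

theorem sum_Ioi_Ioi_eq_sum_range {u : ℕ} (p : ℕ → ℚ) :
    ∑ i : Fin u, ∑ j ∈ Ioi i, ∑ k ∈ Ioi j, p i * p j * p k =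
      ∑ k ∈ range u, ∑ j ∈ range k, ∑ i ∈ range j, p i * p j * p k := by
  rw [← sum_Ioi_eq_sum_range (fun j k => ∑ i ∈ range j, p i * p j * p k),
    sum_comm' (s' := fun j => Iio j) (t' := univ) (by simp)]
  refine sum_congr rfl fun j _ => ?_
  rw [sum_comm]
  refine sum_congr rfl fun k _ => ?_
  rw [← Nat.Iio_eq_range, ← Fin.map_valEmbedding_Iio, sum_map]; rfl

theorem antiparallelFactor_eq (p : ℤ) :
    antiparallelFactor (decide (0 < 2 * p + 1)) (2 * p + 1).natAbs = ⟨-((p : ℤ[X]) * X), 1⟩ := by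
  have hcast : ∀ {k : ℕ} {a : ℤ}, (k : ℤ) = a → ((k : ℕ) : ℤ[X]) = (a : ℤ[X]) := by
    rintro k _ rfl
    simp
  unfold antiparallelFactor
  by_cases h : 0 < 2 * p + 1
  · rw [if_pos (by simpa using h), hcast (a := p) (by omega)]
  · rw [if_neg (by simpa using h), hcast (a := -p) (by omega)]
    simp

/-- Coefficients of the product of the elements `ω - p X`, in terms of the elementary symmetric functions of the `p`. -/
theorem antiparallel_coeff (p : ℕ → ℤ) (n : ℕ) :
    let A : QuadRing := ∏ c ∈ range (2 * n), ⟨-((p c : ℤ[X]) * X), 1⟩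
    let e₁ : ℚ := ∑ i ∈ range (2 * n), (p i : ℚ)
    let e₂ : ℚ := ∑ j ∈ range (2 * n), ∑ i ∈ range j, (p i : ℚ) * p j
    let e₃ : ℚ := ∑ k ∈ range (2 * n), ∑ j ∈ range k, ∑ i ∈ range j, (p i : ℚ) * p j * p k
    A.re.coeff 0 = 1 ∧ (A.re.coeff 2 : ℚ) = n * (n - 1) / 2 + (n - 1) * e₁ + e₂ ∧ (A.im.coeff 1 : ℚ) = -n - e₁ ∧
      (A.im.coeff 3 : ℚ) = -(n * ((n : ℚ) ^ 2 - 1) / 6 + n * (n - 1) / 2 * e₁ + (n - 1) * e₂ + e₃) := by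
  induction n with
  | zero => simp [QuadraticAlgebra.re_one, QuadraticAlgebra.im_one, coeff_one]
  | succ n ih =>
    obtain ⟨h0, h2, h1, h3⟩ := ih
    have hre : ∀ (A : QuadRing) (r : ℤ), (A * ⟨-((r : ℤ[X]) * X), 1⟩).re = A.im - C r * (A.re * X) := fun A r => by
      simp [QuadraticAlgebra.re_mul]; ring
    have him : ∀ (A : QuadRing) (r : ℤ), (A * ⟨-((r : ℤ[X]) * X), 1⟩).im = A.re - C (r + 1) * (A.im * X) := fun A r => by
      simp [QuadraticAlgebra.im_mul]; ring
    rw [show 2 * (n + 1) = 2 * n + 1 + 1 by ring]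
    simp only [prod_range_succ, sum_range_succ, ← sum_mul] at *
    generalize (∏ c ∈ range (2 * n), (⟨-((p c : ℤ[X]) * X), 1⟩ : QuadRing)) = A at *
    simp only [hre, him, coeff_sub, coeff_C_mul, coeff_mul_X, coeff_mul_X_zero]
    refine ⟨by simp [h0], ?_, ?_, ?_⟩ <;> push_cast <;> simp only [h0, h1, h2, h3] <;> push_cast <;> ring

/-- The lowest coefficients of an element of the dual numbers: `1 + T X ^ 2` and `S X + U X ^ 3` up to terms of higher
order. -/
structure DualRing.HasLow (A : DualRing) (S T U : ℚ) : Prop where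
  re_zero : A.re.coeff 0 = 1
  re_one : A.re.coeff 1 = 0
  re_two : (A.re.coeff 2 : ℚ) = T
  im_zero : A.im.coeff 0 = 0
  im_one : (A.im.coeff 1 : ℚ) = S
  im_two : A.im.coeff 2 = 0
  im_three : (A.im.coeff 3 : ℚ) = U

theorem DualRing.HasLow.mul {A B : DualRing} {S T U S' T' U' : ℚ} (h : HasLow A S T U) (h' : HasLow B S' T' U') :
    HasLow (A * B) (S + S') (T + T') (U + U' + S * T' + T * S') := by
  obtain ⟨a0, a1, a2, b0, b1, b2, b3⟩ := h
  obtain ⟨a0', a1', a2', b0', b1', b2', b3'⟩ := h'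
  constructor <;>
    simp [QuadraticAlgebra.re_mul, QuadraticAlgebra.im_mul, coeff_mul, Finset.Nat.antidiagonal_succ, *] <;> ring

theorem twistFactor_re_coeff (ε : Bool) (k : ℕ) :
    ((twistFactor ε (2 * k)).re.coeff 0 = 0 ∧ (twistFactor ε (2 * k)).re.coeff 2 = 0 ∧
      (twistFactor ε (2 * k)).re.coeff 1 = (if ε then 1 else -1) * (k : ℤ) ∧
      ((twistFactor ε (2 * k)).re.coeff 3 : ℚ) = (if ε then 1 else -1) * ((k : ℚ) * (k + 1) * (k - 1) / 6)) ∧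
    (twistFactor ε (2 * k + 1)).re.coeff 0 = 1 ∧ (twistFactor ε (2 * k + 1)).re.coeff 1 = 0 ∧
      ((twistFactor ε (2 * k + 1)).re.coeff 2 : ℚ) = (k : ℚ) * (k + 1) / 2 := by
  have hre : ∀ m, (twistFactor ε (m + 2)).re =
      (twistFactor ε m).re + Polynomial.C (if ε then 1 else -1 : ℤ) * ((twistFactor ε (m + 1)).re * X) := fun m => by
    have := twistFactor_add_two_re ε m 1
    rw [one_mul, one_mul, one_mul] at this
    rw [this]
    cases ε <;> simp <;> ring
  induction k with
  | zero => simp [twistFactor, coeff_one]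
  | succ k ih =>
    obtain ⟨⟨h0, h2, h1, h3⟩, h0', h1', h2'⟩ := ih
    have e1 := hre (2 * k)
    have e2 := hre (2 * k + 1)
    rw [show 2 * (k + 1) = 2 * k + 2 by ring, show 2 * k + 2 + 1 = 2 * k + 1 + 2 by ring]
    rw [show 2 * k + 1 + 1 = 2 * k + 2 by ring, e1] at e2
    rw [e1, e2]
    simp only [coeff_add, coeff_C_mul, coeff_mul_X, coeff_mul_X_zero, h0, h1, h2, h0', h1']
    refine ⟨⟨by simp, by simp, by push_cast; ring, ?_⟩, by simp, by simp, ?_⟩ <;> push_cast <;> simp only [h3, h2'] <;>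
      cases ε <;> simp <;> ring

theorem twistFactor_true_im (m : ℕ) : (twistFactor true (m + 1)).im = (twistFactor true m).re ∧
    (twistFactor true (m + 2)).im = (twistFactor true (m + 1)).re := by
  have h : ∀ m, twistFactor true (m + 2) = twistFactor true m + 1 * QuadraticAlgebra.C X * twistFactor true (m + 1) :=
    fun _ => rfl
  induction m with
  | zero => simp [twistFactor, QuadraticAlgebra.im_mul]
  | succ m ih =>
    refine ⟨ih.2, ?_⟩
    have e2 := ih.2
    rw [h m] at e2
    rw [h (m + 1), h m]
    simp [QuadraticAlgebra.im_mul, QuadraticAlgebra.re_mul, ih.1] at e2 ⊢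
    linear_combination e2

theorem twistFactor_false_im (m : ℕ) : (twistFactor false m).im = (twistFactor false (m + 1)).re ∧
    (twistFactor false (m + 1)).im = (twistFactor false (m + 2)).re := by
  have h : ∀ m, twistFactor false (m + 2) = twistFactor false m + -1 * QuadraticAlgebra.C X * twistFactor false (m + 1) :=
    fun _ => rfl
  induction m with
  | zero => simp [twistFactor, QuadraticAlgebra.re_mul]
  | succ m ih =>
    refine ⟨ih.2, ?_⟩
    rw [h m, h (m + 1)]
    simp [QuadraticAlgebra.im_mul, QuadraticAlgebra.re_mul, ih.1, ih.2]

theorem twistFactor_hasLow (p : ℤ) : DualRing.HasLow (twistFactor (decide (0 < 2 * p + 1)) (2 * p + 1).natAbs)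
    p (p * (p + 1) / 2) (p * (p + 1) * (p - 1) / 6) := by
  by_cases h : 0 < 2 * p + 1
  · obtain ⟨k, rfl⟩ : ∃ k : ℕ, p = k := ⟨p.toNat, by omega⟩
    rw [decide_eq_true h, show (2 * (k : ℤ) + 1).natAbs = 2 * k + 1 by omega]
    obtain ⟨⟨h0, h2, h1, h3⟩, h0', h1', h2'⟩ := twistFactor_re_coeff true k
    have e := (twistFactor_true_im (2 * k)).1
    exact ⟨h0', h1', by simpa using h2', by rw [e, h0], by rw [e, h1]; simp, by rw [e, h2], by rw [e, h3]; simp⟩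
  · obtain ⟨k, rfl⟩ : ∃ k : ℕ, p = -(k + 1 : ℤ) := ⟨(-p - 1).toNat, by omega⟩
    rw [decide_eq_false h, show (2 * -((k : ℤ) + 1) + 1).natAbs = 2 * k + 1 by omega]
    obtain ⟨-, h0', h1', h2'⟩ := twistFactor_re_coeff false k
    obtain ⟨⟨h0, h2, h1, h3⟩, -⟩ := twistFactor_re_coeff false (k + 1)
    have e : _ = (twistFactor false (2 * (k + 1))).re := (twistFactor_false_im (2 * k + 1)).1
    refine ⟨h0', h1', ?_, by rw [e, h0], by rw [e, h1]; simp, by rw [e, h2], ?_⟩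
    · rw [h2']; push_cast; ring
    · rw [e, h3]; push_cast; simp; ring

theorem twistFactor_prod_hasLow (p : ℕ → ℤ) (u : ℕ) :
    DualRing.HasLow (∏ c ∈ range u, twistFactor (decide (0 < 2 * p c + 1)) (2 * p c + 1).natAbs)
      (∑ c ∈ range u, (p c : ℚ)) (∑ c ∈ range u, (p c : ℚ) * (p c + 1) / 2)
      ((∑ c ∈ range u, (p c : ℚ)) * (∑ c ∈ range u, (p c : ℚ) * (p c + 1) / 2) -
        ∑ c ∈ range u, (p c : ℚ) * (p c + 1) * (2 * p c + 1) / 6) := by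
  induction u with
  | zero => constructor <;> simp [QuadraticAlgebra.re_one, QuadraticAlgebra.im_one, coeff_one]
  | succ u ih =>
    simp only [prod_range_succ, sum_range_succ]
    convert ih.mul (twistFactor_hasLow (p u)) using 1
    ring

/-! ### The coefficients of the Conway polynomials -/

namespace Pretzel

variable {u : ℕ} [NeZero u]

theorem antiparallel_hasConwayPolynomial (p : Fin u → ℤ) : (antiparallel p).diagram.HasConwayPolynomial
    (∏ c ∈ range u, (⟨-((p (Fin.ofNat u c) : ℤ[X]) * X), 1⟩ : QuadRing)).im := by
  obtain ⟨d, rfl⟩ : ∃ d, u = d + 1 := ⟨u - 1, by have := NeZero.pos u; omega⟩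
  have hC : (antiparallel p).diagram.code.Planar := ⟨_, _, GaussDiagram.represents_code _, antiparallel_isPlanar p⟩
  have := (isAntiparallel p).poly hC fun c _ => len_odd c
  have e : ∀ c, antiparallelFactor (decide (0 < oddParam p (Fin.ofNat (d + 1) c))) (len (oddParam p) c) =
    ⟨-((p (Fin.ofNat (d + 1) c) : ℤ[X]) * X), 1⟩ := fun c => antiparallelFactor_eq _
  simp only [e] at this
  exact this.hasConwayPolynomial (GaussDiagram.represents_code _)

theorem parallel_hasConwayPolynomial {n : ℕ} [NeZero (2 * n)] (p : Fin (2 * n) → ℤ) :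
    (parallel p).diagram.HasConwayPolynomial (parallelValue n (∏ c ∈ range (2 * n),
      twistFactor (decide (0 < 2 * p (Fin.ofNat (2 * n) c) + 1)) (2 * p (Fin.ofNat (2 * n) c) + 1).natAbs)) := by
  obtain ⟨d, rfl⟩ : ∃ d, n = d + 1 := ⟨n - 1, by have := NeZero.pos (2 * n); omega⟩
  have hC : (parallel p).diagram.code.Planar := ⟨_, _, GaussDiagram.represents_code _, parallel_isPlanar p⟩
  exact (Code.IsParallel.poly hC (isParallel p)).hasConwayPolynomial (GaussDiagram.represents_code _)

end Pretzel

theorem GaussDiagram.LinkEquiv.hasConwayPolynomial_iff {L D : GaussDiagram} (h : L.LinkEquiv D) {q : ℤ[X]}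
    (hD : D.HasConwayPolynomial q) (q' : ℤ[X]) : L.HasConwayPolynomial q' ↔ q' = q := by
  have hL : L.HasConwayPolynomial q := .equiv D L (h.symm _ _) q hD
  exact ⟨fun h' => h'.unique hL, fun e => e ▸ hL⟩

theorem mainTheorem4 (n : ℕ) (hn : 0 < n) (p : Fin (2 * n) → ℤ) :
    (∀ L : GaussDiagram, GaussDiagram.LinkEquiv L (Pretzel.antiparallel p).diagram →
      (∃ q : ℤ[X], L.HasConwayPolynomial q) ∧
      ∀ q : ℤ[X], L.HasConwayPolynomial q →
        (q.coeff 1 : ℚ) = -n - ∑ j, (p j : ℚ) ∧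
        (q.coeff 3 : ℚ) =
          -((n : ℚ) * ((n : ℚ) ^ 2 - 1) / 6 + (n : ℚ) * ((n : ℚ) - 1) / 2 * ∑ i, (p i : ℚ)
            + ((n : ℚ) - 1) * ∑ i, ∑ j ∈ Finset.Ioi i, (p i : ℚ) * p j
            + ∑ i, ∑ j ∈ Finset.Ioi i, ∑ k ∈ Finset.Ioi j, (p i : ℚ) * p j * p k) ∧
        (q.coeff 3 : ℚ) =
          1 / 2 * (q.coeff 1 : ℚ) * n * ((n : ℚ) - 1)
            + 1 / 6 * n * ((n : ℚ) - 1) * (2 * (n : ℚ) - 1)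
            - ((n : ℚ) - 1) * ∑ i, ∑ j ∈ Finset.Ioi i, (p i : ℚ) * p j
            - ∑ i, ∑ j ∈ Finset.Ioi i, ∑ k ∈ Finset.Ioi j, (p i : ℚ) * p j * p k) ∧
    (∀ L : GaussDiagram, GaussDiagram.LinkEquiv L (Pretzel.parallel p).diagram →
      (∃ q : ℤ[X], L.HasConwayPolynomial q) ∧
      ∀ q : ℤ[X], L.HasConwayPolynomial q →
        (q.coeff 1 : ℚ) = n + ∑ j, (p j : ℚ) ∧
        (q.coeff 3 : ℚ) =
          1 / 2 * (q.coeff 1 : ℚ) * ∑ j, (p j : ℚ) * ((p j : ℚ) + 1)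
            - 1 / 6 * ∑ j, (p j : ℚ) * ((p j : ℚ) + 1) * (2 * (p j : ℚ) + 1)) := by
  have : NeZero (2 * n) := ⟨by omega⟩
  obtain ⟨P, hP, hp⟩ : ∃ P : ℕ → ℤ, P = (fun c => p (Fin.ofNat (2 * n) c)) ∧ ∀ j : Fin (2 * n), p j = P j.1 :=
    ⟨_, rfl, fun j => congrArg p (Fin.ext (Nat.mod_eq_of_lt j.2).symm)⟩
  refine ⟨fun L hL => ?_, fun L hL => ?_⟩
  · have hq := hL.hasConwayPolynomial_iff (hP ▸ Pretzel.antiparallel_hasConwayPolynomial p :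
      GaussDiagram.HasConwayPolynomial _ (∏ c ∈ range (2 * n), (⟨-((P c : ℤ[X]) * X), 1⟩ : QuadRing)).im)
    refine ⟨⟨_, (hq _).2 rfl⟩, fun q h => ?_⟩
    obtain ⟨-, -, h1, h3⟩ := antiparallel_coeff P n
    rw [(hq q).1 h]
    simp only [hp]
    rw [sum_Ioi_eq_sum_range (fun i j => ((P i : ℚ) * P j)),
      sum_Ioi_Ioi_eq_sum_range (fun i => (P i : ℚ)),
      ← Finset.sum_range fun j => (P j : ℚ)]
    refine ⟨h1, h3, ?_⟩
    rw [h3, h1]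
    ring
  · have hq := hL.hasConwayPolynomial_iff (hP ▸ Pretzel.parallel_hasConwayPolynomial p :
      GaussDiagram.HasConwayPolynomial _ (parallelValue n (∏ c ∈ range (2 * n), twistFactor (decide (0 < 2 * P c + 1)) (2 * P c + 1).natAbs)))
    refine ⟨⟨_, (hq _).2 rfl⟩, fun q h => ?_⟩
    have hA := twistFactor_prod_hasLow P (2 * n)
    rw [(hq q).1 h]
    simp only [hp]
    rw [← Finset.sum_range fun j => (P j : ℚ),
      ← Finset.sum_range fun j => (P j : ℚ) * (P j + 1),
      ← Finset.sum_range fun j => (P j : ℚ) * (P j + 1) *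
        (2 * P j + 1)]
    simp only [← sum_div] at hA
    generalize (∏ c ∈ range (2 * n), _ : DualRing) = A at hA
    have hv : ∀ k, (parallelValue n A).coeff (k + 1) = n * A.re.coeff k + A.im.coeff (k + 1) := fun k => by
      rw [parallelValue, coeff_add, mul_assoc, ← C_eq_natCast, coeff_C_mul, coeff_X_mul]
    have h1 : ((parallelValue n A).coeff 1 : ℚ) = n + ∑ c ∈ range (2 * n), (P c : ℚ) := by
      rw [hv 0, hA.re_zero]
      push_cast
      rw [hA.im_one]
      ring
    refine ⟨h1, ?_⟩
    rw [h1, hv 2]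
    push_cast
    rw [hA.re_two, hA.im_three]
    ring
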